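/- **Setting.** Let $n\in\{2,3\}$, $N\in\mathbb N$, $T>0$, let $\Omega\subset\mathbb R^n$ be bounded and open, and let $H^1_0=H^1_0(\Omega;\mathbb C^N)$ with dual (conjugate-linear functionals) $H^{-1}$, $(f,g)_{L^2}=\int_\Omega\sum_j f_j\overline{g_j}\,dx$, $X=L^2(0,T;H^1_0)$, $X^*=L^2(0,T;H^{-1})$, $W=\{\Psi\in X:\Psi'\in X^*\}\subset C([0,T];L^2(\Omega;\mathbb C^N))$. For $\Psi\in\mathbb C^N$ write $(\Psi,\Lambda)_{\mathbb C}=\sum_j\psi_j\overline{\lambda_j}$ and $\rho=|\Psi|^2$. Let $V_0,V_u\in L^\infty(\Omega;\mathbb R)$, $V_{ext}(x,t,u)=u(t)V_u(x)+V_0(x)$, and $$V_{Hxc}(\Psi)(x)=\int_\Omega\frac{\rho(y)}{|x-y|}\,dy+V_{xc}(\rho(x)),\qquad V_{xc}=V_x+V_c .$$ Here $V_x(\rho)=\alpha_n\rho^{1/n}$ for $0\le\rho\le R$, $V_x(\rho)=\alpha_n p(\rho)$ for $R<\rho<2R$, $V_x(\rho)=\alpha_n p(2R)$ for $\rho\ge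 2R$, where $R>0$, $\alpha_2=-\sqrt{8/\pi}$, $\alpha_3=-\sqrt[3]{3/\pi}$, and $$p(\rho)=\tfrac{(n+1)R^{1/n-4}}{4n^2}\rho^4-\tfrac{(4n+5)R^{1/n-3}}{3n^2}\rho^3+\tfrac{2(n+2)R^{1/n-2}}{n^2}\rho^2-\tfrac{4R^{1/n-1}}{n^2}\rho+\tfrac{(12n^2-11n+17)R^{1/n}}{12n^2}.$$ The function $V_c:[0,\infty)\to\mathbb R$ is continuous and bounded, and $z\mapsto V_c(|z|^2)z$ is continuously real-Fréchet differentiable on $\mathbb C^N$ with bounded derivative. Let $\Psi^0\in H^1_0$, $A\subset\mathbb R^n$ measurable, $\rho_d\in L^2(0,T;L^2(\Omega;\mathbb R))$, $\beta,\eta\ge0$, $\beta+\eta>0$, $\nu>0$, and if $\beta\neq0$ assume in addition $\Psi^0\in H^2(\Omega;\mathbb C^N)$. Put $$J(\Psi,u)=\frac\beta2\int_0^T\!\!\int_\Omega(\rho-\rho_d)^2\,dx\,dt+\frac\eta2\int_\Omega\chi_A(x)\rho(x,T)\,dx+\frac\nu2\|u\|^2_{H^1(0,T)},\qquad \|u\|_{H^1(0,T)}^2=\|u\|_{L^2}^2+\|u'\|_{L^2}^2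 .$$ **Theorem.** (i) For every $u\in H^1(0,T;\mathbb R)$ the TDKS equation has a unique weak solution $\Psi=\Psi(u)\in W$: $\Psi(0)=\Psi^0$ and, for a.e. $t\in(0,T)$ and all $\Phi\in H^1_0$, $$i\langle\Psi'(t),\Phi\rangle=(\nabla\Psi,\nabla\Phi)_{L^2}+(V_{ext}(\cdot,t,u)\Psi,\Phi)_{L^2}+(V_{Hxc}(\Psi)\Psi,\Phi)_{L^2}.$$ (ii) For every $u\in H^1(0,T;\mathbb R)$, with $\Psi=\Psi(u)$, there is a unique $\Lambda\in C([0,T];L^2(\Omega;\mathbb C^N))$ with $i\Lambda(T)=\eta\chi_A\Psi(T)$ that solves the linear adjoint equation $a(\Psi,u,\Lambda)=0$, $$a(\Psi,u,\Lambda)=i\Lambda'-\bigl(-\nabla^2+V_{ext}+V_{Hxc}(\Psi)\bigr)\Lambda-\frac{\partial V_{xc}}{\partial\rho}2\,\mathrm{Re}(\Psi,\Lambda)_{\mathbb C}\Psi-\int_\Omega\frac{2\,\mathrm{Re}(\Psi,\Lambda)_{\mathbb C}}{|x-y|}\,dy\,\Psi+2\beta(\rho-\rho_d)\Psi ,$$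 in the sense that, writing $a(\Psi,u,\Lambda)=i\Lambda'+\nabla^2\Lambda-F(\Lambda)$, for all $\Phi\in H^1_0$ with $\nabla^2\Phi\in L^2(\Omega;\mathbb C^N)$ and all $t\in[0,T]$ $$i(\Lambda(T),\Phi)_{L^2}-i(\Lambda(t),\Phi)_{L^2}=\int_t^T\bigl[(\Lambda,-\nabla^2\Phi)_{L^2}+(F(\Lambda),\Phi)_{L^2}\bigr]ds .$$ Every $\tilde\Lambda\in W$ that satisfies the adjoint equation weakly (tested with all $\Phi\in H^1_0$ for a.e. $t$, as in (i)) and the terminal condition coincides with this $\Lambda$. (iii) The function $t\mapsto-\mathrm{Re}(\Lambda(t),V_u\Psi(t))_{L^2}$ is in $L^2(0,T)$, the linear functional $\delta u\mapsto\int_0^T-\mathrm{Re}(\Lambda(t),V_u\Psi(t))_{L^2}\,\delta u(t)\,dt$ is continuous on $H^1(0,T;\mathbb R)$, and, with $\mu\in H^1(0,T;\mathbb R)$ its $H^1$-Riesz representative, the reduced cost $\hat J(u)=J(\Psi(u),u)$ is Fréchet differentiable at every $u\in H^1(0,T;\mathbb R)$ with $H^1$-gradient $$\nabla\hat J(u)=\nu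 u+\mu .$$ -/

import Mathlib

open MeasureTheory Set
open scoped ContDiff InnerProductSpace

namespace TDKS

noncomputable section

/-! ### Function spaces -/

/-- Physical space `ℝⁿ`. -/
abbrev Sp (n : ℕ) : Type := EuclideanSpace ℝ (Fin n)

/-- Values of the orbitals: `ℂᴺ` with its Hermitian norm. -/
abbrev Orb (N : ℕ) : Type := EuclideanSpace ℂ (Fin N)

/-- Lebesgue measure on the time interval `(0,T)`. -/
abbrev timeMeasure (T : ℝ) : Measure ℝ := volume.restrict (Ioo 0 T)

/-- Smooth functions with compact support in the open set `U`. -/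
def IsTestFun {E F : Type*} [NormedAddCommGroup E] [NormedSpace ℝ E]
    [NormedAddCommGroup F] [NormedSpace ℝ F] (U : Set E) (f : E → F) : Prop :=
  ContDiff ℝ ∞ f ∧ HasCompactSupport f ∧ tsupport f ⊆ U

/-- `L²(0,T;ℝ) × L²(0,T;ℝ)` with the Hilbert norm. -/
abbrev TimePair (T : ℝ) : Type :=
  WithLp 2 (Lp ℝ 2 (timeMeasure T) × Lp ℝ 2 (timeMeasure T))

/-- The Sobolev space `H¹(0,T;ℝ)`, realised as the space of pairs `(u, u')` in `L² × L²` such that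
`u'` is the weak derivative of `u`, i.e. `∫ u φ' + ∫ u' φ = 0` for all test functions `φ`
(see `mem_H1_iff`). Its norm is `‖u‖² = ‖u‖²_{L²} + ‖u'‖²_{L²}`. -/
def H1 (T : ℝ) : Submodule ℝ (TimePair T) :=
  (Submodule.span ℝ {w : TimePair T | ∃ φ : ℝ → ℝ, IsTestFun (Ioo 0 T) φ ∧
    w.fst =ᵐ[timeMeasure T] deriv φ ∧ w.snd =ᵐ[timeMeasure T] φ})ᗮ

instance (T : ℝ) : CompleteSpace (H1 T) := by
  unfold H1; infer_instance

theorem mem_H1_iff {T : ℝ} (w : TimePair T) :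
    w ∈ H1 T ↔ ∀ φ : ℝ → ℝ, IsTestFun (Ioo 0 T) φ →
      (∫ t in Ioo 0 T, w.fst t * deriv φ t) = - ∫ t in Ioo 0 T, w.snd t * φ t := by
  have key : ∀ (v : TimePair T) (φ : ℝ → ℝ), v.fst =ᵐ[timeMeasure T] deriv φ →
      v.snd =ᵐ[timeMeasure T] φ →
      inner ℝ v w = (∫ t in Ioo 0 T, w.fst t * deriv φ t) + ∫ t in Ioo 0 T, w.snd t * φ t := by
    intro v φ h1 h2
    rw [WithLp.prod_inner_apply, L2.inner_def, L2.inner_def]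
    congr 1
    · refine integral_congr_ae ?_
      filter_upwards [h1] with t ht
      simp [ht]
    · refine integral_congr_ae ?_
      filter_upwards [h2] with t ht
      simp [ht]
  unfold H1
  rw [Submodule.mem_orthogonal]
  constructor
  · intro h φ hφ
    have m1 : MemLp (deriv φ) 2 (timeMeasure T) :=
      ((hφ.1.continuous_deriv (by simp)).memLp_of_hasCompactSupport hφ.2.1.deriv).restrict _
    have m2 : MemLp φ 2 (timeMeasure T) :=
      (hφ.1.continuous.memLp_of_hasCompactSupport hφ.2.1).restrict _
    have := h (WithLp.toLp 2 (m1.toLp _, m2.toLp _))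
      (Submodule.subset_span ⟨φ, hφ, m1.coeFn_toLp, m2.coeFn_toLp⟩)
    rw [key (WithLp.toLp 2 (m1.toLp _, m2.toLp _)) φ m1.coeFn_toLp m2.coeFn_toLp] at this
    linarith
  · intro h v hv
    induction hv using Submodule.span_induction with
    | mem x hx =>
      obtain ⟨φ, hφ, h1, h2⟩ := hx
      rw [key x φ h1 h2, h φ hφ]; ring
    | zero => simp
    | add x y _ _ hx hy => rw [inner_add_left, hx, hy, add_zero]
    | smul a x _ hx => rw [inner_smul_left, hx, mul_zero]

/-- The value of (a representative of) a control at time `t`. -/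
def H1.ev {T : ℝ} (u : H1 T) (t : ℝ) : ℝ := (u : TimePair T).fst t

/-- `L²(Ω;ℂᴺ)`. -/
abbrev L2 {n : ℕ} (Ω : Set (Sp n)) (N : ℕ) : Type := Lp (Orb N) 2 (volume.restrict Ω)

/-- `L²(Ω;ℂᴺ) × L²(Ω;ℂᴺ)ⁿ` with the Hilbert norm, containing the pairs `(ψ, ∇ψ)`. -/
abbrev SpacePair {n : ℕ} (Ω : Set (Sp n)) (N : ℕ) : Type :=
  WithLp 2 (L2 Ω N × PiLp 2 (fun _ : Fin n => L2 Ω N))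

/-- The Sobolev space `H¹₀(Ω;ℂᴺ)`: the closure of the test functions in the norm
`‖ψ‖² = ‖ψ‖²_{L²} + ‖∇ψ‖²_{L²}`; its elements are the pairs `(ψ, ∇ψ)`. -/
def H10 {n : ℕ} (Ω : Set (Sp n)) (N : ℕ) : Submodule ℂ (SpacePair Ω N) :=
  (Submodule.span ℂ {w : SpacePair Ω N | ∃ φ : Sp n → Orb N, IsTestFun Ω φ ∧
    w.fst =ᵐ[volume.restrict Ω] φ ∧
    ∀ i : Fin n, w.snd i =ᵐ[volume.restrict Ω]
      fun x => fderiv ℝ φ x (EuclideanSpace.single i 1)}).topologicalClosure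

instance {n : ℕ} (Ω : Set (Sp n)) (N : ℕ) : CompleteSpace (H10 Ω N) := by
  unfold H10; infer_instance

/-- The function underlying an element of `H¹₀`. -/
def H10.fn {n N : ℕ} {Ω : Set (Sp n)} (w : H10 Ω N) : L2 Ω N := (w : SpacePair Ω N).fst

/-- The gradient of an element of `H¹₀`. -/
def H10.grad {n N : ℕ} {Ω : Set (Sp n)} (w : H10 Ω N) : PiLp 2 (fun _ : Fin n => L2 Ω N) :=
  (w : SpacePair Ω N).snd

/-- `w ∈ H²(Ω;ℂᴺ)`: every first derivative has weak first derivatives in `L²`. -/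
def H10.MemH2 {n N : ℕ} {Ω : Set (Sp n)} (w : H10 Ω N) : Prop :=
  ∀ i j : Fin n, ∃ d : L2 Ω N, ∀ φ : Sp n → ℝ, IsTestFun Ω φ →
    (∫ x in Ω, fderiv ℝ φ x (EuclideanSpace.single j 1) • H10.grad w i x)
      = - ∫ x in Ω, φ x • d x

/-- `-Δ w = g` with `g ∈ L²(Ω;ℂᴺ)` (and zero boundary values, as `w ∈ H¹₀`). -/
def H10.IsNegLaplacian {n N : ℕ} {Ω : Set (Sp n)} (w : H10 Ω N) (g : L2 Ω N) : Prop :=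
  ∀ ξ : H10 Ω N, inner ℂ (H10.grad ξ) (H10.grad w) = inner ℂ (H10.fn ξ) g

/-- `H⁻¹(Ω;ℂᴺ)`: the bounded conjugate-linear functionals on `H¹₀(Ω;ℂᴺ)`. A function `f ∈ L²`
acts by `Φ ↦ (f, Φ)_{L²} = ∫ f · conj Φ`, which is `inner ℂ Φ f` in Lean's convention. -/
abbrev Hm1 {n : ℕ} (Ω : Set (Sp n)) (N : ℕ) : Type := H10 Ω N →L⋆[ℂ] ℂ

/-- `X = L²(0,T;H¹₀(Ω;ℂᴺ))`. -/
abbrev X {n : ℕ} (Ω : Set (Sp n)) (N : ℕ) (T : ℝ) : Type := Lp (H10 Ω N) 2 (timeMeasure T)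

/-- `X* = L²(0,T;H⁻¹(Ω;ℂᴺ))`. -/
abbrev XDual {n : ℕ} (Ω : Set (Sp n)) (N : ℕ) (T : ℝ) : Type := Lp (Hm1 Ω N) 2 (timeMeasure T)

section Time

variable {n N : ℕ} {Ω : Set (Sp n)} {T : ℝ}

/-- `Ψ' = G` in the sense of distributions on `(0,T)` with values in `H⁻¹`; the space `W` consists
of the `Ψ ∈ X` for which such a `G ∈ X*` exists. -/
def IsTimeDeriv (Ψ : X Ω N T) (G : XDual Ω N T) : Prop :=
  ∀ (Φ : H10 Ω N) (φ : ℝ → ℝ), IsTestFun (Ioo 0 T) φ →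
    (∫ t in Ioo 0 T, ((deriv φ t : ℝ) : ℂ) * inner ℂ (H10.fn Φ) (H10.fn (Ψ t)))
      = - ∫ t in Ioo 0 T, ((φ t : ℝ) : ℂ) * G t Φ

/-- The representative of `Ψ` that is continuous on `[0,T]` with values in `L²(Ω;ℂᴺ)` has the value
`f` at time `t`. -/
def HasTimeTrace (Ψ : X Ω N T) (t : ℝ) (f : L2 Ω N) : Prop :=
  ∃ v : ℝ → L2 Ω N, ContinuousOn v (Icc 0 T) ∧
    (∀ᵐ s ∂(timeMeasure T), v s = H10.fn (Ψ s)) ∧ v t = f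

open Classical in
/-- The value `Ψ(t) ∈ L²(Ω;ℂᴺ)` of the continuous representative. -/
def timeTrace (Ψ : X Ω N T) (t : ℝ) : L2 Ω N :=
  if h : ∃ f, HasTimeTrace Ψ t f then h.choose else 0

end Time

/-! ### The Kohn-Sham potentials -/

/-- The constants `α₂ = -√(8/π)` and `α₃ = -∛(3/π)`. -/
def exchangeConst (n : ℕ) : ℝ :=
  if n = 2 then -Real.sqrt (8 / Real.pi) else -((3 / Real.pi) ^ (1 / 3 : ℝ))

/-- The polynomial that joins `ρ ^ (1/n)` on `[0,R]` to a constant on `[2R,∞)`. -/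
def cutoffPoly (n : ℕ) (R ρ : ℝ) : ℝ :=
  ((n + 1) * R ^ (1 / n - 4 : ℝ)) / (4 * n ^ 2) * ρ ^ 4
    - ((4 * n + 5) * R ^ (1 / n - 3 : ℝ)) / (3 * n ^ 2) * ρ ^ 3
    + (2 * (n + 2) * R ^ (1 / n - 2 : ℝ)) / n ^ 2 * ρ ^ 2
    - (4 * R ^ (1 / n - 1 : ℝ)) / n ^ 2 * ρ
    + ((12 * n ^ 2 - 11 * n + 17) * R ^ (1 / n : ℝ)) / (12 * n ^ 2)

/-- The exchange potential `V_x(ρ)`, `ρ ≥ 0`, in the local density approximation, cut off at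
densities above `R`. -/
def exchange (n : ℕ) (R ρ : ℝ) : ℝ :=
  exchangeConst n *
    (if ρ ≤ R then ρ ^ (1 / n : ℝ)
      else if ρ < 2 * R then cutoffPoly n R ρ
      else cutoffPoly n R (2 * R))

/-- The Coulomb potential `∫_Ω g(y) / |x - y| dy`. -/
def coulomb {n : ℕ} (Ω : Set (Sp n)) (g : Sp n → ℝ) (x : Sp n) : ℝ :=
  ∫ y in Ω, g y / ‖x - y‖

/-- The data of a TDKS optimal control problem with `N` orbitals in `n` space dimensions. -/
structure Problem (n N : ℕ) where
  /-- the spatial domain -/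
  Ω : Set (Sp n)
  /-- the final time -/
  T : ℝ
  T_pos : 0 < T
  /-- the confining potential -/
  V0 : Lp ℝ ⊤ (volume.restrict Ω)
  /-- the spatial profile of the control potential -/
  Vu : Lp ℝ ⊤ (volume.restrict Ω)
  /-- the cut-off density of the exchange potential -/
  R : ℝ
  /-- the correlation potential, as a function of the density; only its values on `[0,∞)` matter -/
  Vc : ℝ → ℝ
  /-- the initial state -/
  Ψ0 : H10 Ω N
  /-- the weights of the three terms of the cost functional -/
  β : ℝ
  η : ℝ
  ν : ℝ
  /-- the region in which the final density is penalised -/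
  A : Set (Sp n)
  /-- the target density -/
  ρd : Lp (Lp ℝ 2 (volume.restrict Ω)) 2 (timeMeasure T)

namespace Problem

variable {n N : ℕ} (P : Problem n N)

/-- `V_xc(ρ) = V_x(ρ) + V_c(ρ)`. -/
def Vxc (ρ : ℝ) : ℝ := exchange n P.R ρ + P.Vc ρ

/-- `V_Hxc(ψ)(x)`, the sum of Hartree, exchange and correlation potential for the density
`ρ = |ψ|²`. -/
def VHxc (ψ : Sp n → Orb N) (x : Sp n) : ℝ :=
  coulomb P.Ω (fun y => ‖ψ y‖ ^ 2) x + P.Vxc (‖ψ x‖ ^ 2)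

/-- The external potential `V_ext = a V_u + V_0` at control value `a`. -/
def Vext (a : ℝ) (x : Sp n) : ℝ := a * P.Vu x + P.V0 x

/-- The pairing `(f, g)_{L²} = ∫_Ω f · conj g`, linear in `f`. -/
def pairing (f g : Sp n → Orb N) : ℂ := ∫ x in P.Ω, inner ℂ (g x) (f x)

/-- `Ψ ∈ W` is a weak solution of the TDKS equation
`i Ψ' = (-Δ + V_ext(u) + V_Hxc(Ψ)) Ψ`, `Ψ(0) = Ψ⁰`. -/
def IsState (u : H1 P.T) (Ψ : X P.Ω N P.T) : Prop :=
  HasTimeTrace Ψ 0 (H10.fn P.Ψ0) ∧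
  ∃ G : XDual P.Ω N P.T, IsTimeDeriv Ψ G ∧
    ∀ᵐ t ∂(timeMeasure P.T), ∀ Φ : H10 P.Ω N,
      Complex.I * G t Φ =
        inner ℂ (H10.grad Φ) (H10.grad (Ψ t))
          + P.pairing (fun x => P.Vext (H1.ev u t) x • H10.fn (Ψ t) x) (H10.fn Φ)
          + P.pairing (fun x => P.VHxc (H10.fn (Ψ t)) x • H10.fn (Ψ t) x) (H10.fn Φ)

/-- The terms of order zero of the adjoint equation
`i Λ' = -ΔΛ + V_ext Λ + V_Hxc(ψ) Λ + V_xc'(ρ) 2 Re(ψ,Λ) ψ + (∫_Ω 2 Re(ψ,Λ) / |x-y| dy) ψ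
  - 2β (ρ - ρ_d) ψ`, `ρ = |ψ|²`,
at a fixed time, for the control value `a`, the state `ψ`, the adjoint `l` and the target `r`.
(Where `ψ x = 0` the term with `V_xc'` vanishes whatever value `deriv` takes at `0`.) -/
def adjointTerms (a : ℝ) (ψ l : Sp n → Orb N) (r : Sp n → ℝ) (x : Sp n) : Orb N :=
  P.Vext a x • l x + P.VHxc ψ x • l x
    + (deriv P.Vxc (‖ψ x‖ ^ 2) * (2 * (inner ℂ (ψ x) (l x)).re)) • ψ x
    + coulomb P.Ω (fun y => 2 * (inner ℂ (ψ y) (l y)).re) x • ψ x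
    - (2 * P.β * (‖ψ x‖ ^ 2 - r x)) • ψ x

/-- The terminal condition `i f = η χ_A Ψ(T)`. -/
def IsTerminalValue (Ψ : X P.Ω N P.T) (f : L2 P.Ω N) : Prop :=
  ∀ᵐ x ∂(volume.restrict P.Ω),
    Complex.I • f x = (P.η * P.A.indicator (fun _ => (1 : ℝ)) x) • timeTrace Ψ P.T x

/-- A continuous curve `[0,T] → L²(Ω;ℂᴺ)`, extended to `ℝ` by constants. -/
def extend (Λ : C(Icc (0 : ℝ) P.T, L2 P.Ω N)) (t : ℝ) : L2 P.Ω N :=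
  IccExtend P.T_pos.le Λ t

/-- `Λ ∈ C([0,T];L²(Ω;ℂᴺ))` solves the adjoint equation `a(Ψ,u,Λ) = 0` with
`i Λ(T) = η χ_A Ψ(T)`: for all `Φ ∈ H¹₀` with `ΔΦ ∈ L²` and all `t ∈ [0,T]`,
`i (Λ(T),Φ) - i (Λ(t),Φ) = ∫_t^T (Λ,-ΔΦ) + (zero-order terms,Φ) ds`. -/
def IsAdjoint (u : H1 P.T) (Ψ : X P.Ω N P.T) (Λ : C(Icc (0 : ℝ) P.T, L2 P.Ω N)) : Prop :=
  P.IsTerminalValue Ψ (P.extend Λ P.T) ∧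
  ∀ (Φ : H10 P.Ω N) (g : L2 P.Ω N), H10.IsNegLaplacian Φ g → ∀ t ∈ Icc (0 : ℝ) P.T,
    Complex.I * inner ℂ (H10.fn Φ) (P.extend Λ P.T)
        - Complex.I * inner ℂ (H10.fn Φ) (P.extend Λ t) =
      ∫ s in t..P.T, (inner ℂ g (P.extend Λ s)
        + P.pairing (P.adjointTerms (H1.ev u s) (H10.fn (Ψ s)) (P.extend Λ s) (P.ρd s)) (H10.fn Φ))

/-- `Λ ∈ W` is a weak solution, in the same sense as for the state equation, of the adjoint
equation `a(Ψ,u,Λ) = 0` with `i Λ(T) = η χ_A Ψ(T)`. -/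
def IsAdjointW (u : H1 P.T) (Ψ Λ : X P.Ω N P.T) : Prop :=
  (∃ f : L2 P.Ω N, HasTimeTrace Λ P.T f ∧ P.IsTerminalValue Ψ f) ∧
  ∃ G : XDual P.Ω N P.T, IsTimeDeriv Λ G ∧
    ∀ᵐ t ∂(timeMeasure P.T), ∀ Φ : H10 P.Ω N,
      Complex.I * G t Φ =
        inner ℂ (H10.grad Φ) (H10.grad (Λ t))
          + P.pairing (P.adjointTerms (H1.ev u t) (H10.fn (Ψ t)) (H10.fn (Λ t)) (P.ρd t)) (H10.fn Φ)

/-- The cost functional `J(Ψ,u) = β/2 ∫∫ (ρ - ρ_d)² + η/2 ∫ χ_A ρ(T) + ν/2 ‖u‖²_{H¹}`. -/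
def cost (Ψ : X P.Ω N P.T) (u : H1 P.T) : ℝ :=
  P.β / 2 * (∫ t in Ioo 0 P.T, ∫ x in P.Ω, (‖H10.fn (Ψ t) x‖ ^ 2 - P.ρd t x) ^ 2)
    + P.η / 2 * (∫ x in P.Ω, P.A.indicator (fun _ => (1 : ℝ)) x * ‖timeTrace Ψ P.T x‖ ^ 2)
    + P.ν / 2 * ‖u‖ ^ 2

open Classical in
/-- The control-to-state map `u ↦ Ψ(u)`. -/
def state (u : H1 P.T) : X P.Ω N P.T :=
  if h : ∃ Ψ, P.IsState u Ψ then h.choose else 0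

/-- The reduced cost functional `Ĵ(u) = J(Ψ(u),u)`. -/
def reducedCost (u : H1 P.T) : ℝ := P.cost (P.state u) u

/-- The function `t ↦ -Re (Λ(t), V_u Ψ(t))_{L²(Ω;ℂᴺ)}`. -/
def gradDensity (Ψ : X P.Ω N P.T) (Λ : C(Icc (0 : ℝ) P.T, L2 P.Ω N)) (t : ℝ) : ℝ :=
  -(P.pairing (P.extend Λ t) (fun x => P.Vu x • H10.fn (Ψ t) x)).re

/-- The assumptions on the correlation potential: it is bounded, and the correlation term
`z ↦ V_c(|z|²) z` is continuously real-Fréchet differentiable with bounded derivative. -/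
structure CorrelationAssumption : Prop where
  continuousOn : ContinuousOn P.Vc (Ici 0)
  bounded : ∃ K : ℝ, ∀ ρ : ℝ, 0 ≤ ρ → |P.Vc ρ| ≤ K
  contDiff : ContDiff ℝ 1 (fun z : Orb N => P.Vc (‖z‖ ^ 2) • z)
  bounded_fderiv : ∃ L : ℝ, ∀ z : Orb N, ‖fderiv ℝ (fun z : Orb N => P.Vc (‖z‖ ^ 2) • z) z‖ ≤ L

end Problem

end

end TDKS

/-!
The embedding `ι : H¹₀ → L²` is treated as an abstract Gelfand pair `V → H`. The inverse `ι ι*` of the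
form operator `1 - Δ` is a bounded self-adjoint operator, and its functional calculus gives the
unitary group `grp`, without unbounded operators. Each equation is read as a mild (Duhamel)
equation for this group. Mild is the same as very weak (`IsMild.isVeryWeak`, `IsVeryWeak.isMild`),
and weak solutions are mild (`IsMild.of_weakDeriv`).

State equation. Hardy's inequality `∫ |w|² / |x - y| ≤ C ‖w‖ ‖w‖_{H¹}` (`hardy`) makes the Hartree
term trilinear and bounded, and the exchange-correlation map is globally Lipschitz. So the
nonlinearity is Lipschitz for the `L²` norm on balls of `H¹₀`, and it is the gradient of an energy
(`isNonlin`). Smoothed by resolvents, the equation is an ODE with a Lipschitz right-hand side. Its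
solutions conserve the `L²` norm, and the energy identity bounds them in `H¹₀` (`regular_bound`),
the control entering through an integration by parts in time. They are Cauchy in `L²`
(`regular_cauchy`), which gives a solution bounded in `H¹₀` (`exists_mild_solution`). Grönwall's
inequality gives uniqueness and Lipschitz dependence on the control.

Boundedness. The tracking term is quartic in `Ψ`, so for `β ≠ 0` a bound of `Ψ` in `L^∞` is needed.
If `Ψ⁰ ∈ H²`, then `Ψ` is Lipschitz in time with values in `L²` (`IsMild.lipschitz`), hence in the
domain of `Δ` with bounds (`IsMild.exists_res_eq`). Functions with `Δ w ∈ L²` are bounded in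
dimension at most three: Kato's inequality, tested with a regularised fundamental solution, bounds
the averages of `|w|` over small balls (`exists_bound_of_isNegLaplacian`). No regularity of the
boundary of `Ω` is used.

Adjoint equation and derivative. The lower-order part of the adjoint equation is real-linear and
bounded on `L²`, so the backward mild equation has a unique solution (`exists_isMild_final`). It is
the transpose of the linearised state equation. Pairing it with the difference of two states
(`IsTraj.duality`) expresses the increment of the reduced cost through `Λ` and first-order
remainders. These are not quadratic, as the exchange-correlation map is only `C¹`, but they are
`o(1)` times the increment along every sequence of controls, by dominated convergence
(`tendsto_reducedCost`).
-/

namespace TDKS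

noncomputable section

set_option linter.unusedSectionVars false

open Complex (I coe_smul add_re sub_re re_ofReal_mul reCLM conj_ofReal)
open Real (norm_eq_abs norm_of_nonneg)
open ENNReal (ofReal)
open EuclideanSpace (single)
open intervalIntegral (integral_interval_sub_left integral_of_le integral_same integral_mono_on)

local notation "vol" => Measure.restrict volume

variable {V H : Type*} [NormedAddCommGroup V] [InnerProductSpace ℂ V] [CompleteSpace V]
  [NormedAddCommGroup H] [InnerProductSpace ℂ H] [CompleteSpace H]
  {n N : ℕ} {Ω : Set (Sp n)} {P : Problem n N} {L M : ℝ}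

/-! ### Elementary inequalities -/

lemma mul_le_left {a b c : ℝ} (h : b ≤ c) (ha : 0 ≤ a := by positivity) : a * b ≤ a * c :=
  mul_le_mul_of_nonneg_left h ha

lemma mul_le_right {a b c : ℝ} (h : b ≤ c) (ha : 0 ≤ a := by positivity) : b * a ≤ c * a :=
  mul_le_mul_of_nonneg_right h ha

lemma norm_coe (r : ℝ) : ‖(r : ℂ)‖ = |r| := Complex.norm_real r

/-! ### The unitary group of a form operator -/

section Group

open ContinuousLinearMap Filter Topology

/-- `ι` is an injective contraction with dense range, so that `V ⊂ H ⊂ V*` is a Gelfand triple. -/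
structure IsGelfand (ι : V →L[ℂ] H) : Prop where
  inj : Function.Injective ι
  dense : DenseRange ι
  norm_le : ∀ v, ‖ι v‖ ≤ ‖v‖

/-- The resolvent `M⁻¹ : H → H` of the positive operator `M` whose form is the inner product of
`V`. -/
def res (ι : V →L[ℂ] H) : H →L[ℂ] H := ι ∘L adjoint ι

variable {ι : V →L[ℂ] H}

lemma mul_app {E : Type*} [NormedAddCommGroup E] [NormedSpace ℂ E] (f g : E →L[ℂ] E) (x : E) :
    (f * g) x = f (g x) := rfl

lemma res_apply (x : H) : res ι x = ι (adjoint ι x) := rfl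

lemma inner_res_left (x y : H) : inner ℂ (res ι x) y = inner ℂ (adjoint ι x) (adjoint ι y) := by
  rw [res_apply, ← adjoint_inner_right]

lemma inner_res_right (x y : H) : inner ℂ x (res ι y) = inner ℂ (adjoint ι x) (adjoint ι y) := by
  rw [res_apply, ← adjoint_inner_left]

lemma inner_res_comm (x y : H) : inner ℂ (res ι x) y = inner ℂ x (res ι y) := by
  rw [inner_res_left, inner_res_right]

lemma res_isSelfAdjoint : IsSelfAdjoint (res ι) :=
  (ContinuousLinearMap.isSelfAdjoint_iff_isSymmetric).2 fun x y => inner_res_comm x y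

lemma res_isPositive : (res ι).IsPositive := by
  unfold res
  exact ContinuousLinearMap.isPositive_self_comp_adjoint ι

namespace IsGelfand

variable (h : IsGelfand ι)
include h

lemma adjoint_inj : Function.Injective (adjoint ι) := by
  refine (injective_iff_map_eq_zero _).2 fun x hx => (inner_self_eq_zero (𝕜 := ℂ)).1 ?_
  refine h.dense.induction_on (p := fun y => inner ℂ x y = 0) x
    (isClosed_eq (by fun_prop) continuous_const) fun v => ?_
  rw [← adjoint_inner_left, hx, inner_zero_left]

lemma res_inj : Function.Injective (res ι) := h.inj.comp h.adjoint_inj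

lemma adjoint_dense : DenseRange (adjoint ι) := by
  have h1 : (LinearMap.range (adjoint ι).toLinearMap)ᗮ = ⊥ := by
    refine eq_bot_iff.2 fun v hv => ?_
    have : ι v = 0 := by
      refine (inner_self_eq_zero (𝕜 := ℂ)).1 ?_
      rw [← adjoint_inner_left]
      exact hv _ ⟨_, rfl⟩
    simpa using h.inj (this.trans (map_zero ι).symm)
  exact fun x => (Submodule.topologicalClosure_eq_top_iff.2 h1).ge trivial

lemma res_dense : DenseRange (res ι) := h.dense.comp h.adjoint_dense ι.continuous

open scoped ComplexOrder in
lemma spectrum_re {z : ℂ} (hz : z ∈ spectrum ℂ (res ι)) : 0 ≤ z.re ∧ z = (z.re : ℂ) := by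
  have h1 : (0 : H →L[ℂ] H) ≤ res ι := by
    rw [ContinuousLinearMap.nonneg_iff_isPositive]; exact res_isPositive
  have := spectrum_nonneg_of_nonneg (𝕜 := ℂ) h1 hz
  rw [Complex.nonneg_iff] at this
  exact ⟨this.1, Complex.ext rfl (by simp [← this.2])⟩

end IsGelfand

/-- The function `z ↦ z exp (-it/z)`, continuous on `[0,∞)`. -/
def expFun (t : ℝ) (z : ℂ) : ℂ := z * Complex.exp (-(I * t / z))

lemma norm_exp_aux (t b : ℝ) : ‖Complex.exp (-(I * t / (b : ℂ)))‖ = 1 := by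
  rw [show -(I * t / (b : ℂ)) = ((-(t / b) : ℝ) : ℂ) * I by push_cast; ring]
  exact Complex.norm_exp_ofReal_mul_I _

lemma norm_expFun (t b : ℝ) : ‖expFun t b‖ = |b| := by
  rw [expFun, norm_mul, norm_exp_aux, mul_one, norm_coe]

lemma continuousOn_expFun (t : ℝ) {s : Set ℂ} (hs : ∀ z ∈ s, 0 ≤ z.re ∧ z = (z.re : ℂ)) :
    ContinuousOn (expFun t) s := by
  intro z hz
  by_cases h0 : z = 0
  · subst h0
    have h2 : expFun t 0 = 0 := by simp [expFun]
    rw [ContinuousWithinAt, h2]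
    refine squeeze_zero_norm' ?_ (tendsto_norm_zero.mono_left nhdsWithin_le_nhds)
    filter_upwards [self_mem_nhdsWithin] with w hw
    rw [(hs w hw).2, norm_expFun]; simp
  · refine ContinuousAt.continuousWithinAt ?_
    unfold expFun
    fun_prop (disch := assumption)

lemma IsGelfand.continuousOn_expFun (h : IsGelfand ι) (t : ℝ) :
    ContinuousOn (expFun t) (spectrum ℂ (res ι)) :=
  TDKS.continuousOn_expFun t fun _ hz => h.spectrum_re hz

lemma norm_exp_I_sub_le (a b : ℝ) :
    ‖Complex.exp (-(I * a)) - Complex.exp (-(I * b))‖ ≤ |a - b| := by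
  have : Complex.exp (-(I * a)) - Complex.exp (-(I * b))
      = Complex.exp (-(I * b)) * (Complex.exp (I * ((b - a : ℝ) : ℂ)) - 1) := by
    rw [mul_sub, ← Complex.exp_add]; congr 1
    · congr 1; push_cast; ring
    · ring
  rw [this, norm_mul]
  have h1 := norm_exp_aux b 1
  simp only [Complex.ofReal_one, div_one] at h1
  rw [h1, one_mul, abs_sub_comm]
  exact Real.norm_exp_I_mul_ofReal_sub_one_le

/-- `M⁻¹ exp (-itM)`. -/
def resExp (ι : V →L[ℂ] H) (t : ℝ) : H →L[ℂ] H := cfc (expFun t) (res ι)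

instance : IsStarNormal (res ι) := res_isSelfAdjoint.isStarNormal

lemma resExp_zero : resExp ι 0 = res ι := by
  rw [resExp]
  conv_rhs => rw [← cfc_id ℂ (res ι)]
  refine cfc_congr fun z _ => by simp [expFun]

lemma resExp_mul (h : IsGelfand ι) (s t : ℝ) :
    resExp ι s * resExp ι t = res ι * resExp ι (s + t) := by
  have hc := h.continuousOn_expFun
  have : res ι * resExp ι (s + t) = cfc (fun z => z * expFun (s + t) z) (res ι) := by
    rw [cfc_mul (fun z => z) (expFun (s + t)) (res ι) (by fun_prop) (hc _), cfc_id' ℂ (res ι)]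
    rfl
  rw [this, resExp, resExp, ← cfc_mul _ _ _ (hc _) (hc _)]
  refine cfc_congr fun z _ => ?_
  simp only [expFun]
  rw [show -(I * ((s + t : ℝ) : ℂ) / z) = -(I * s / z) + -(I * t / z) by
    push_cast; ring, Complex.exp_add]
  ring

lemma star_resExp (h : IsGelfand ι) (t : ℝ) : star (resExp ι t) = resExp ι (-t) := by
  rw [resExp, ← cfc_star, resExp]
  refine cfc_congr fun z hz => ?_
  obtain ⟨-, hz⟩ := h.spectrum_re hz
  rw [hz]
  simp only [expFun, star_mul, Complex.star_def, conj_ofReal, ← Complex.exp_conj]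
  simp [mul_comm]

lemma norm_resExp_apply (h : IsGelfand ι) (t : ℝ) (x : H) : ‖resExp ι t x‖ = ‖res ι x‖ := by
  have h1 : inner ℂ (resExp ι t x) (resExp ι t x) = inner ℂ (res ι x) (res ι x) := by
    rw [← adjoint_inner_right, ← star_eq_adjoint, star_resExp h, ← mul_app, resExp_mul h,
      neg_add_cancel, resExp_zero, mul_app, ← inner_res_comm]
  rw [@norm_eq_sqrt_re_inner ℂ, h1, ← @norm_eq_sqrt_re_inner ℂ]

lemma norm_resExp_sub_le (h : IsGelfand ι) (s t : ℝ) : ‖resExp ι s - resExp ι t‖ ≤ |s - t| := by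
  have hc := h.continuousOn_expFun
  rw [resExp, resExp, ← cfc_sub _ _ _ (hc _) (hc _)]
  refine norm_cfc_le (abs_nonneg _) fun z hz => ?_
  obtain ⟨h0, hz⟩ := h.spectrum_re hz
  rw [hz]
  simp only [expFun]
  rcases h0.eq_or_lt with h0 | h0
  · simp [← h0]
  rw [← mul_sub, norm_mul]
  have := norm_exp_I_sub_le (s / z.re) (t / z.re)
  rw [norm_coe, abs_of_pos h0]
  calc z.re * _ ≤ z.re * |s / z.re - t / z.re| := by
        gcongr
        have e : ∀ r : ℝ, I * r / (z.re : ℂ) = I * ((r / z.re : ℝ) : ℂ) :=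
          fun r => by push_cast; ring
        rw [e, e]; exact this
    _ = |s - t| := by
        rw [← sub_div, abs_div, abs_of_pos h0]; field_simp

/-- The unitary group `S(t) = exp (-itM)`. -/
def grp (ι : V →L[ℂ] H) (t : ℝ) : H →L[ℂ] H :=
  (resExp ι t).toLinearMap.extendOfNorm (res ι).toLinearMap

/-- A strongly continuous family of isometries is jointly continuous; strong continuity need only
be checked on a dense range. -/
lemma continuous_of_isometry_of_dense {E α : Type*} [NormedAddCommGroup E] [NormedSpace ℂ E]
    {U : ℝ → E →L[ℂ] E} (hU : ∀ t x, ‖U t x‖ = ‖x‖) {f : α → E} (hf : DenseRange f)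
    (hc : ∀ a, Continuous fun t => U t (f a)) : Continuous fun p : ℝ × E => U p.1 p.2 := by
  refine continuous_iff_continuousAt.2 fun ⟨t, x⟩ => Metric.continuousAt_iff'.2 fun ε hε => ?_
  obtain ⟨_, ⟨a, rfl⟩, ha⟩ := Metric.mem_closure_iff.1 (hf x) (ε / 4) (by positivity)
  rw [dist_eq_norm] at ha
  filter_upwards [Metric.continuousAt_iff'.1 (((hc a).comp continuous_fst).continuousAt
    (x := (t, x))) (ε / 4) (by positivity), Metric.continuousAt_iff'.1
    (continuous_snd.continuousAt (x := (t, x))) (ε / 4) (by positivity)] with p hp1 hp2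
  simp only [dist_eq_norm, Function.comp] at hp1 hp2 ⊢
  have h3 : U p.1 p.2 - U t x = U p.1 (p.2 - x) + U p.1 (x - f a)
      + (U p.1 (f a) - U t (f a)) - U t (x - f a) := by
    simp only [map_sub]; abel
  rw [h3]
  refine (norm_sub_le _ _).trans_lt ?_
  have e1 := norm_add_le (U p.1 (p.2 - x) + U p.1 (x - f a)) (U p.1 (f a) - U t (f a))
  have e2 := norm_add_le (U p.1 (p.2 - x)) (U p.1 (x - f a))
  simp only [hU] at e1 e2 ⊢
  linarith

section grp

variable (h : IsGelfand ι)
include h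

lemma grp_res (t : ℝ) (x : H) : grp ι t (res ι x) = resExp ι t x :=
  LinearMap.extendOfNorm_eq (f := (resExp ι t).toLinearMap) (e := (res ι).toLinearMap) h.res_dense
    ⟨1, fun x => by simp [norm_resExp_apply h]⟩ x

lemma norm_grp (t : ℝ) (x : H) : ‖grp ι t x‖ = ‖x‖ := by
  refine h.res_dense.induction_on (p := fun x => ‖grp ι t x‖ = ‖x‖) x
    (isClosed_eq (by fun_prop) (by fun_prop)) fun x => ?_
  rw [grp_res h, norm_resExp_apply h]

lemma res_resExp (t : ℝ) (x : H) : res ι (resExp ι t x) = resExp ι t (res ι x) := by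
  have := resExp_mul h 0 t
  rw [resExp_zero, zero_add] at this
  have h2 := resExp_mul h t 0
  rw [resExp_zero, add_zero] at h2
  rw [← mul_app, ← mul_app, h2]

lemma res_grp (t : ℝ) (x : H) : res ι (grp ι t x) = grp ι t (res ι x) := by
  refine h.res_dense.induction_on (p := fun x => res ι (grp ι t x) = grp ι t (res ι x)) x
    (isClosed_eq (by fun_prop) (by fun_prop)) fun x => ?_
  rw [grp_res h, grp_res h, res_resExp h]

lemma grp_zero (x : H) : grp ι 0 x = x := by
  apply h.res_inj
  rw [res_grp h, grp_res h, resExp_zero]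

lemma grp_grp (s t : ℝ) (x : H) : grp ι s (grp ι t x) = grp ι (s + t) x := by
  apply h.res_inj
  apply h.res_inj
  rw [res_grp h, res_grp h, res_grp h, res_grp h, res_grp h, res_grp h, grp_res h,
    ← res_resExp h, grp_res h, ← mul_app, resExp_mul h, mul_app, res_resExp h, grp_res h]

lemma grp_neg_grp (t : ℝ) (x : H) : grp ι (-t) (grp ι t x) = x := by
  rw [grp_grp h, neg_add_cancel, grp_zero h]

lemma grp_grp_neg (t : ℝ) (x : H) : grp ι t (grp ι (-t) x) = x := by
  rw [grp_grp h, add_neg_cancel, grp_zero h]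

lemma inner_grp_grp (t : ℝ) (x y : H) : inner ℂ (grp ι t x) (grp ι t y) = inner ℂ x y :=
  (LinearMap.norm_map_iff_inner_map_map (𝕜 := ℂ) (grp ι t)).1 (norm_grp h t) x y

lemma inner_grp_left (t : ℝ) (x y : H) : inner ℂ (grp ι t x) y = inner ℂ x (grp ι (-t) y) := by
  conv_lhs => rw [← grp_grp_neg h t y]
  exact inner_grp_grp h t _ _

lemma continuous_grp : Continuous fun p : ℝ × H => grp ι p.1 p.2 := by
  refine continuous_of_isometry_of_dense (norm_grp h) h.res_dense fun x => ?_
  simp only [grp_res h]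
  refine ((LipschitzWith.of_dist_le_mul (K := 1) fun s t => ?_ :
    LipschitzWith 1 (resExp ι)).continuous.clm_apply continuous_const)
  simpa [dist_eq_norm] using norm_resExp_sub_le h s t

lemma continuous_grp_apply (x : H) : Continuous fun t => grp ι t x := by
  have h2 := (continuous_grp h).comp (by fun_prop : Continuous fun t : ℝ => (t, x))
  simp only [Function.comp_def] at h2
  exact h2

lemma norm_grp_res_sub_le (t : ℝ) (z : H) : ‖grp ι t (res ι z) - res ι z‖ ≤ |t| * ‖z‖ := by
  have := le_of_opNorm_le _ (norm_resExp_sub_le h t 0) z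
  rwa [sub_apply, resExp_zero, sub_zero, ← grp_res h] at this

lemma hasDerivAt_resExp (t : ℝ) : HasDerivAt (fun t => resExp ι t * res ι) (-I • resExp ι t) t := by
  have hc := h.continuousOn_expFun
  rw [hasDerivAt_iff_isLittleO]
  have key : ∀ s : ℝ, ‖resExp ι s * res ι - resExp ι t * res ι
      - (s - t) • (-I • resExp ι t)‖ ≤ 3 * |s - t| ^ 2 := by
    intro s
    have e1 : ∀ r : ℝ, resExp ι r * res ι = cfc (fun z => expFun r z * z) (res ι) := by
      intro r
      rw [cfc_mul (expFun r) (fun z => z) (res ι) (hc _) (by fun_prop), cfc_id' ℂ (res ι)]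
      rfl
    have e2 : (s - t) • (-I • resExp ι t)
        = cfc (fun z => (-(I * ((s - t : ℝ) : ℂ))) * expFun t z) (res ι) := by
      rw [cfc_const_mul _ _ _ (hc _), resExp, ← coe_smul (s - t), smul_smul]
      congr 1; ring
    have hc' : ∀ r : ℝ, ContinuousOn (fun z => expFun r z * z) (spectrum ℂ (res ι)) :=
      fun r => (hc r).mul continuousOn_id
    have hc2 : ContinuousOn (fun z => expFun s z * z - expFun t z * z) (spectrum ℂ (res ι)) :=
      (hc' s).sub (hc' t)
    rw [e1, e1, e2, ← cfc_sub _ _ _ (hc' _) (hc' _),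
      ← cfc_sub _ (fun z => _ * expFun t z) _ hc2 (continuousOn_const.mul (hc t))]
    refine norm_cfc_le (by positivity) fun z hz => ?_
    obtain ⟨h0, hz⟩ := h.spectrum_re hz
    rw [hz]
    generalize z.re = b at h0
    rcases h0.eq_or_lt with h0 | h0
    · subst h0; simp [expFun]; positivity
    have hb : (b : ℂ) ≠ 0 := by exact_mod_cast h0.ne'
    set θ : ℝ := -((s - t) / b) with hθ
    have e3 : expFun s b * b - expFun t b * b - -(I * ((s - t : ℝ) : ℂ)) * expFun t b
        = (b : ℂ) ^ 2 * Complex.exp (-(I * t / b)) * (Complex.exp (θ * I) - 1 - θ * I) := by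
      have : Complex.exp (-(I * s / b)) = Complex.exp (-(I * t / b)) * Complex.exp (θ * I) := by
        rw [← Complex.exp_add]; congr 1; rw [hθ]; push_cast; field_simp; ring
      simp only [expFun]
      rw [this, hθ]; push_cast; field_simp
    have e4 : ‖Complex.exp (θ * I) - 1 - θ * I‖ ≤ 3 * |θ| ^ 2 := by
      have hn : ‖(θ : ℂ) * I‖ = |θ| := by simp
      rcases le_or_gt |θ| 1 with h1 | h1
      · have := Complex.norm_exp_sub_one_sub_id_le (x := θ * I) (by rw [hn]; exact h1)
        rw [hn] at this
        nlinarith [sq_nonneg |θ|]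
      · have h2 := norm_sub_le (Complex.exp (θ * I) - 1) (θ * I)
        have h3 := norm_sub_le (Complex.exp (θ * I)) 1
        rw [Complex.norm_exp_ofReal_mul_I, norm_one] at h3
        rw [hn] at h2
        nlinarith
    rw [e3, norm_mul, norm_mul, norm_exp_aux, mul_one, norm_pow, Complex.norm_real,
      norm_eq_abs, abs_of_pos h0]
    calc b ^ 2 * _ ≤ b ^ 2 * (3 * |θ| ^ 2) := by gcongr
      _ = 3 * |s - t| ^ 2 := by
        rw [hθ, abs_neg, abs_div, abs_of_pos h0]; field_simp
  refine Asymptotics.IsLittleO.of_bound fun c hcpos => ?_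
  filter_upwards [Metric.ball_mem_nhds t (show 0 < c / 3 by positivity)] with s hs
  refine (key s).trans ?_
  rw [Metric.mem_ball, Real.dist_eq] at hs
  rw [norm_eq_abs]
  nlinarith [abs_nonneg (s - t)]

lemma norm_adjoint_grp (t : ℝ) (x : H) : ‖adjoint ι (grp ι t x)‖ = ‖adjoint ι x‖ := by
  have h1 : inner ℂ (adjoint ι (grp ι t x)) (adjoint ι (grp ι t x))
      = inner ℂ (adjoint ι x) (adjoint ι x) := by
    rw [← inner_res_left, res_grp h, inner_grp_grp h, inner_res_left]
  rw [@norm_eq_sqrt_re_inner ℂ, h1, ← @norm_eq_sqrt_re_inner ℂ]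

end grp

/-- The restriction of the unitary group to `V`. -/
def grpV (ι : V →L[ℂ] H) (t : ℝ) : V →L[ℂ] V :=
  (adjoint ι ∘L grp ι t).toLinearMap.extendOfNorm (adjoint ι).toLinearMap

section grpV

variable (h : IsGelfand ι)
include h

lemma grpV_adjoint (t : ℝ) (x : H) : grpV ι t (adjoint ι x) = adjoint ι (grp ι t x) :=
  LinearMap.extendOfNorm_eq (f := (adjoint ι ∘L grp ι t).toLinearMap)
    (e := (adjoint ι).toLinearMap) h.adjoint_dense ⟨1, fun x => by simp [norm_adjoint_grp h]⟩ x

lemma norm_grpV (t : ℝ) (v : V) : ‖grpV ι t v‖ = ‖v‖ := by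
  refine h.adjoint_dense.induction_on (p := fun x => ‖grpV ι t x‖ = ‖x‖) v
    (isClosed_eq (by fun_prop) (by fun_prop)) fun x => ?_
  rw [grpV_adjoint h, norm_adjoint_grp h]

lemma apply_grpV (t : ℝ) (v : V) : ι (grpV ι t v) = grp ι t (ι v) := by
  refine h.adjoint_dense.induction_on (p := fun v => ι (grpV ι t v) = grp ι t (ι v)) v
    (isClosed_eq (by fun_prop) (by fun_prop)) fun x => ?_
  rw [grpV_adjoint h, ← res_apply, ← res_apply, res_grp h]

lemma continuous_grpV : Continuous fun p : ℝ × V => grpV ι p.1 p.2 := by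
  refine continuous_of_isometry_of_dense (norm_grpV h) h.adjoint_dense fun x => ?_
  simp only [grpV_adjoint h]
  exact (adjoint ι).continuous.comp (continuous_grp_apply h x)

lemma grpV_grpV_neg (t : ℝ) (v : V) : grpV ι t (grpV ι (-t) v) = v := by
  apply h.inj
  rw [apply_grpV h, apply_grpV h, grp_grp_neg h]

lemma inner_grpV_left (t : ℝ) (v w : V) : inner ℂ (grpV ι t v) w = inner ℂ v (grpV ι (-t) w) := by
  conv_lhs => rw [← grpV_grpV_neg h t w]
  exact (LinearMap.norm_map_iff_inner_map_map (𝕜 := ℂ) (grpV ι t)).1 (norm_grpV h t) v _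

end grpV

/-! ### Regularisation -/

/-- The bounded operator `(M⁻¹ + ε)⁻¹`. -/
def regInv (ι : V →L[ℂ] H) (ε : ℝ) : H →L[ℂ] H := cfc (fun z : ℂ => (z + ε)⁻¹) (res ι)

section reg

variable (h : IsGelfand ι) {ε : ℝ} (hε : 0 < ε)
include h hε

lemma continuousOn_regInv : ContinuousOn (fun z : ℂ => (z + ε)⁻¹) (spectrum ℂ (res ι)) := by
  refine ContinuousOn.inv₀ (by fun_prop) fun z hz h0 => ?_
  have := congrArg Complex.re h0
  simp at this
  linarith [(h.spectrum_re hz).1]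

lemma res_regInv_add (x : H) : res ι (regInv ι ε x) + (ε : ℂ) • regInv ι ε x = x := by
  have h1 : cfc (fun z : ℂ => (z + ε) * (z + ε)⁻¹) (res ι) = 1 := by
    rw [← cfc_const_one ℂ (res ι)]
    refine cfc_congr fun z hz => mul_inv_cancel₀ fun h0 => ?_
    have := congrArg Complex.re h0
    simp at this
    linarith [(h.spectrum_re hz).1]
  rw [cfc_mul _ _ _ (by fun_prop) (continuousOn_regInv h hε),
    cfc_add_const _ _ _ (by fun_prop), cfc_id' ℂ (res ι)] at h1
  have := congrArg (fun T : H →L[ℂ] H => T x) h1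
  simpa [regInv, mul_app, add_mul, Algebra.algebraMap_eq_smul_one] using this

omit h hε in
lemma res_regInv_comm (x : H) : res ι (regInv ι ε x) = regInv ι ε (res ι x) := by
  have : Commute (cfc (fun z : ℂ => z) (res ι)) (regInv ι ε) := cfc_commute_cfc _ _ _
  rw [cfc_id' ℂ (res ι)] at this
  exact congrArg (fun T : H →L[ℂ] H => T x) this.eq

lemma inner_regInv_left (x y : H) : inner ℂ (regInv ι ε x) y = inner ℂ x (regInv ι ε y) := by
  have h1 : star (regInv ι ε) = regInv ι ε := by
    rw [regInv, ← cfc_star]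
    refine cfc_congr fun z hz => ?_
    rw [(h.spectrum_re hz).2]
    simp
  rw [← adjoint_inner_right, ← star_eq_adjoint, h1]

/-- `M⁻¹ (M⁻¹ + ε)⁻¹` is a contraction of `V`, at distance `O(√ε)` from the identity. -/
lemma norm_regV_le (v : V) : ‖adjoint ι (regInv ι ε (ι v))‖ ≤ ‖v‖ ∧
    ‖ι v - res ι (regInv ι ε (ι v))‖ ≤ √(2 * ε) * ‖v‖ := by
  set x := regInv ι ε (ι v) with hx
  set w := adjoint ι x with hw
  have h1 : ι (v - w) = (ε : ℂ) • x := by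
    have := res_regInv_add h hε (ι v)
    rw [map_sub, hw, ← res_apply]
    exact sub_eq_of_eq_add' this.symm
  have h2 : inner ℂ (v - w) w = ((ε * ‖x‖ ^ 2 : ℝ) : ℂ) := by
    rw [hw, adjoint_inner_right, h1, inner_smul_left, inner_self_eq_norm_sq_to_K]
    simp
  have h3 : ‖w‖ ≤ ‖v‖ := by
    have h4 := congrArg Complex.re h2
    rw [inner_sub_left, sub_re, Complex.ofReal_re,
      show (inner ℂ w w : ℂ).re = ‖w‖ ^ 2 from inner_self_eq_norm_sq (𝕜 := ℂ) w] at h4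
    have h5 : (inner ℂ v w).re ≤ ‖v‖ * ‖w‖ := re_inner_le_norm (𝕜 := ℂ) v w
    by_contra! hlt
    nlinarith [norm_nonneg v, norm_nonneg w, mul_nonneg hε.le (sq_nonneg ‖x‖)]
  refine ⟨h3, ?_⟩
  rw [show ι v - res ι x = ι (v - w) by rw [map_sub, hw, res_apply]]
  refine abs_le_of_sq_le_sq' ?_ (by positivity) |>.2
  rw [mul_pow, Real.sq_sqrt (by positivity)]
  have h5 : ‖ι (v - w)‖ ^ 2 = ε * (ε * ‖x‖ ^ 2) := by
    rw [h1, norm_smul, norm_coe, abs_of_pos hε]; ring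
  have h6 : ε * ‖x‖ ^ 2 ≤ ‖v - w‖ * ‖w‖ := by
    have := re_inner_le_norm (𝕜 := ℂ) (v - w) w
    rw [h2] at this
    simpa only [RCLike.re_to_complex, Complex.ofReal_re] using this
  have h7 := norm_sub_le v w
  rw [h5]
  have h8 : ‖v - w‖ * ‖w‖ ≤ (2 * ‖v‖) * ‖v‖ := by gcongr; linarith
  nlinarith [norm_nonneg v]

lemma norm_res_regInv_le (x : H) : ‖res ι (regInv ι ε x)‖ ≤ ‖x‖ := by
  set y := regInv ι ε x with hy
  have h1 := res_regInv_add h hε x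
  rw [← hy] at h1
  have h2 : ‖x‖ ^ 2 = ‖res ι y‖ ^ 2 + 2 * (ε * ‖adjoint ι y‖ ^ 2) + ‖(ε : ℂ) • y‖ ^ 2 := by
    conv_lhs => rw [← h1]
    rw [@norm_add_sq ℂ, inner_smul_right, inner_res_left, inner_self_eq_norm_sq_to_K]
    congr 2
    norm_cast
    rw [RCLike.re_to_complex]
    change 2 * ((ε : ℂ) * ((‖adjoint ι y‖ ^ 2 : ℝ) : ℂ)).re = _
    rw [← Complex.ofReal_mul, Complex.ofReal_re]
  nlinarith [norm_nonneg x, norm_nonneg (res ι y), mul_nonneg hε.le (sq_nonneg ‖adjoint ι y‖),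
    sq_nonneg ‖(ε : ℂ) • y‖]

end reg

/-- `(M⁻¹ (M⁻¹ + ε)⁻¹)³`, a regularisation of the identity of `H`. -/
def smooth (ι : V →L[ℂ] H) (ε : ℝ) : H →L[ℂ] H := (res ι * regInv ι ε) ^ 3

/-- `smooth` as a map into `V`. -/
def smoothV (ι : V →L[ℂ] H) (ε : ℝ) : H →L[ℂ] V :=
  adjoint ι ∘L (regInv ι ε * (res ι * regInv ι ε) ^ 2)

lemma apply_smoothV (ε : ℝ) (x : H) : ι (smoothV ι ε x) = smooth ι ε x := rfl

section smooth

variable (h : IsGelfand ι) {ε : ℝ} (hε : 0 < ε)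
include h hε

lemma norm_smooth_le (x : H) : ‖smooth ι ε x‖ ≤ ‖x‖ :=
  (norm_res_regInv_le h hε _).trans ((norm_res_regInv_le h hε _).trans (norm_res_regInv_le h hε _))

lemma inner_smooth_left (x y : H) : inner ℂ (smooth ι ε x) y = inner ℂ x (smooth ι ε y) := by
  simp only [smooth, pow_succ, pow_zero, one_mul, mul_app, inner_res_comm,
    inner_regInv_left h hε, res_regInv_comm]

lemma norm_smoothV_le (v : V) : ‖smoothV ι ε (ι v)‖ ≤ ‖v‖ :=
  ((norm_regV_le h hε (adjoint ι (regInv ι ε (adjoint ι (regInv ι ε (ι v)) |> ι)))).1).trans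
    ((norm_regV_le h hε _).1.trans (norm_regV_le h hε _).1)

lemma norm_sub_smooth_le (v : V) : ‖ι v - smooth ι ε (ι v)‖ ≤ 3 * √(2 * ε) * ‖v‖ := by
  set v1 := adjoint ι (regInv ι ε (ι v)) with hv1
  set v2 := adjoint ι (regInv ι ε (ι v1)) with hv2
  have h0 := norm_regV_le h hε v
  have h1 := norm_regV_le h hε v1
  have h2 := norm_regV_le h hε v2
  have e : ι v - smooth ι ε (ι v) = (ι v - res ι (regInv ι ε (ι v)))
      + (ι v1 - res ι (regInv ι ε (ι v1))) + (ι v2 - res ι (regInv ι ε (ι v2))) := by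
    have e1 : ι v1 = res ι (regInv ι ε (ι v)) := rfl
    have e2 : ι v2 = res ι (regInv ι ε (ι v1)) := rfl
    have e3 : smooth ι ε (ι v) = res ι (regInv ι ε (ι v2)) := rfl
    rw [← e1, ← e2, e3]; abel
  rw [e]
  refine (norm_add₃_le).trans ?_
  have h3 : √(2 * ε) * ‖v1‖ ≤ √(2 * ε) * ‖v‖ := by gcongr; exact h0.1
  have h4 : √(2 * ε) * ‖v2‖ ≤ √(2 * ε) * ‖v‖ := by gcongr; exact h1.1.trans h0.1
  linarith [h0.2, h1.2, h2.2]

end smooth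

/-- A family of contractions that tends to the identity on a dense range does so everywhere. -/
lemma tendsto_of_contraction_of_dense {E α β : Type*} [NormedAddCommGroup E] [NormedSpace ℂ E]
    {l : Filter β} {U : β → E →L[ℂ] E} (hU : ∀ᶠ b in l, ∀ x, ‖U b x‖ ≤ ‖x‖) {f : α → E}
    (hf : DenseRange f) (hc : ∀ a, Tendsto (fun b => U b (f a)) l (𝓝 (f a))) (x : E) :
    Tendsto (fun b => U b x) l (𝓝 x) := by
  refine Metric.tendsto_nhds.2 fun ε hε => ?_
  obtain ⟨_, ⟨a, rfl⟩, ha⟩ := Metric.mem_closure_iff.1 (hf x) (ε / 3) (by positivity)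
  filter_upwards [hU, Metric.tendsto_nhds.1 (hc a) (ε / 3) (by positivity)] with b hb1 hb2
  rw [dist_eq_norm] at *
  have : U b x - x = U b (x - f a) + (U b (f a) - f a) - (x - f a) := by simp only [map_sub]; abel
  rw [this]
  have e1 := norm_sub_le (U b (x - f a) + (U b (f a) - f a)) (x - f a)
  have e2 := norm_add_le (U b (x - f a)) (U b (f a) - f a)
  linarith [hb1 (x - f a)]

section approx

variable (h : IsGelfand ι)
include h

lemma tendsto_res_regInv (x : H) : Tendsto (fun ε => res ι (regInv ι ε x)) (𝓝[>] 0) (𝓝 x) := by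
  refine tendsto_of_contraction_of_dense (U := fun ε => res ι ∘L regInv ι ε) ?_ h.res_dense
    (fun z => ?_) x
  · filter_upwards [self_mem_nhdsWithin] with ε hε x
    exact norm_res_regInv_le h hε x
  · refine tendsto_iff_norm_sub_tendsto_zero.2 ?_
    have h1 : Tendsto (fun ε : ℝ => ε * ‖z‖) (𝓝[>] 0) (𝓝 0) :=
      (Continuous.tendsto' (by fun_prop) 0 0 (by simp)).mono_left nhdsWithin_le_nhds
    refine squeeze_zero' (.of_forall fun _ => norm_nonneg _) ?_ h1
    filter_upwards [self_mem_nhdsWithin] with ε hε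
    have h2 := res_regInv_add h hε (res ι z)
    have h3 : res ι (regInv ι ε (res ι z)) - res ι z = -((ε : ℂ) • regInv ι ε (res ι z)) := by
      rw [eq_neg_iff_add_eq_zero, sub_add_eq_add_sub, h2, sub_self]
    show ‖res ι (regInv ι ε (res ι z)) - res ι z‖ ≤ _
    rw [h3, norm_neg, norm_smul, norm_coe, abs_of_pos (show (0 : ℝ) < ε from hε), ← res_regInv_comm]
    gcongr
    · exact le_of_lt hε
    · exact norm_res_regInv_le h hε z

lemma tendsto_regV (v : V) : Tendsto (fun ε => adjoint ι (regInv ι ε (ι v))) (𝓝[>] 0) (𝓝 v) := by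
  refine tendsto_of_contraction_of_dense (U := fun ε => adjoint ι ∘L regInv ι ε ∘L ι) ?_
    h.adjoint_dense (fun z => ?_) v
  · filter_upwards [self_mem_nhdsWithin] with ε hε x
    exact (norm_regV_le h hε x).1
  · have := ((adjoint ι).continuous.tendsto z).comp (tendsto_res_regInv h z)
    refine this.congr fun ε => ?_
    simp only [Function.comp, coe_comp, ← res_apply, res_regInv_comm]

lemma tendsto_smooth (x : H) : Tendsto (fun ε => smooth ι ε x) (𝓝[>] 0) (𝓝 x) := by
  refine tendsto_of_contraction_of_dense (U := fun ε => smooth ι ε) ?_ h.dense (fun v => ?_) x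
  · filter_upwards [self_mem_nhdsWithin] with ε hε x
    exact norm_smooth_le h hε x
  · refine tendsto_iff_norm_sub_tendsto_zero.2 ?_
    have h1 : Tendsto (fun ε : ℝ => 3 * √(2 * ε) * ‖v‖) (𝓝[>] 0) (𝓝 0) :=
      (Continuous.tendsto' (by fun_prop) 0 0 (by simp)).mono_left nhdsWithin_le_nhds
    refine squeeze_zero' (.of_forall fun _ => norm_nonneg _) ?_ h1
    filter_upwards [self_mem_nhdsWithin] with ε hε
    rw [norm_sub_rev]
    exact norm_sub_smooth_le h hε v

end approx

/-- A vector whose pairing with every `z` is bounded by `C ‖T z‖` lies in the image of the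
ball of radius `C` under the adjoint of `T`. -/
lemma exists_adjoint_eq_of_bound {E F : Type*} [NormedAddCommGroup E] [InnerProductSpace ℂ E]
    [CompleteSpace E] [NormedAddCommGroup F] [InnerProductSpace ℂ F] [CompleteSpace F]
    (T : E →L[ℂ] F) (hT : DenseRange T) (v : E) {C : ℝ} (hC : 0 ≤ C)
    (hv : ∀ z, ‖inner ℂ v z‖ ≤ C * ‖T z‖) : ∃ x : F, ‖x‖ ≤ C ∧ adjoint T x = v := by
  set g : F →L[ℂ] ℂ := (innerSL ℂ v).toLinearMap.extendOfNorm T.toLinearMap with hg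
  have h1 : ∀ z, g (T z) = inner ℂ v z := fun z =>
    LinearMap.extendOfNorm_eq (f := (innerSL ℂ v).toLinearMap) (e := T.toLinearMap) hT
      ⟨C, fun z => hv z⟩ z
  refine ⟨(InnerProductSpace.toDual ℂ F).symm g, ?_, ?_⟩
  · rw [LinearIsometryEquiv.norm_map]
    exact LinearMap.opNorm_extendOfNorm_le hT hC fun z => hv z
  · refine ext_inner_right ℂ fun z => ?_
    rw [adjoint_inner_left, InnerProductSpace.toDual_symm_apply, h1]

end Group

/-! ### Calculus of vector-valued functions of time -/

section TimeCalculus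

variable {E E₁ E₂ E₃ : Type*} [NormedAddCommGroup E] [NormedSpace ℝ E]
  [NormedAddCommGroup E₁] [NormedSpace ℝ E₁] [CompleteSpace E₁]
  [NormedAddCommGroup E₂] [NormedSpace ℝ E₂] [CompleteSpace E₂]
  [NormedAddCommGroup E₃] [NormedSpace ℝ E₃] [CompleteSpace E₃]

lemma continuousOn_primitive' {f : ℝ → E} {T : ℝ} (hT : 0 ≤ T)
    (hf : IntervalIntegrable f volume 0 T) :
    ContinuousOn (fun t => ∫ s in 0..t, f s) (Icc 0 T) := by
  have := intervalIntegral.continuousOn_primitive_interval' hf left_mem_uIcc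
  rwa [uIcc_of_le hT] at this

lemma intervalIntegrable_bilin (M : E₁ →L[ℝ] E₂ →L[ℝ] E₃) {p : ℝ → E₁} {q : ℝ → E₂} {t : ℝ}
    (ht : 0 ≤ t) (hp : IntervalIntegrable p volume 0 t) (hq : ContinuousOn q (Icc 0 t)) :
    IntervalIntegrable (fun s => M (p s) (q s)) volume 0 t := by
  obtain ⟨C, hC⟩ := isCompact_Icc.exists_bound_of_continuousOn hq
  rw [intervalIntegrable_iff_integrableOn_Ioc_of_le ht] at hp ⊢
  have hqm : AEStronglyMeasurable q (vol (Ioc 0 t)) :=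
    (hq.mono Ioc_subset_Icc_self).aestronglyMeasurable measurableSet_Ioc
  refine Integrable.mono' (g := fun s => ‖M‖ * ‖p s‖ * C) ((hp.norm.const_mul _).mul_const _)
    (M.continuous₂.comp_aestronglyMeasurable₂ hp.1 hqm) ?_
  filter_upwards [ae_restrict_mem measurableSet_Ioc] with s hs
  refine (M.le_opNorm₂ _ _).trans ?_
  gcongr
  exact hC s (Ioc_subset_Icc_self hs)

lemma intervalIntegrable_sub {f : ℝ → E} {T t : ℝ} (hf : IntervalIntegrable f volume 0 T)
    (ht : t ∈ Icc 0 T) : IntervalIntegrable f volume 0 t :=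
  hf.mono_set (by rw [uIcc_of_le ht.1, uIcc_of_le (ht.1.trans ht.2)]; exact Icc_subset_Icc_right ht.2)

lemma absolutelyContinuous_of_norm_sub_le {h : ℝ → E} {p : ℝ → ℝ} {t : ℝ}
    (hp : IntervalIntegrable p volume 0 t)
    (H : ∀ x ∈ uIcc 0 t, ∀ y ∈ uIcc 0 t, ‖h x - h y‖ ≤ |∫ r in y..x, p r|) :
    AbsolutelyContinuousOnInterval h 0 t := by
  have hi : ∀ x ∈ uIcc 0 t, IntervalIntegrable p volume 0 x := fun x hx =>
    hp.mono_set (uIcc_subset_uIcc_left hx)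
  have h1 := hp.absolutelyContinuousOnInterval_intervalIntegral left_mem_uIcc
  rw [absolutelyContinuousOnInterval_iff] at h1 ⊢
  refine fun ε hε => (h1 ε hε).imp fun δ hδ => ⟨hδ.1, fun I hI h2 => lt_of_le_of_lt
    (Finset.sum_le_sum fun i hi' => ?_) (hδ.2 I hI h2)⟩
  obtain ⟨hx, hy⟩ := hI.1 i hi'
  rw [dist_eq_norm, Real.dist_eq, integral_interval_sub_left (hi _ hx) (hi _ hy)]
  exact H _ hx _ hy

lemma primitive_sub {f F : ℝ → E} {t x y : ℝ} (hf : IntervalIntegrable f volume 0 t)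
    (hF : ∀ s ∈ Icc 0 t, F s = F 0 + ∫ r in 0..s, f r) (hx : x ∈ Icc 0 t) (hy : y ∈ Icc 0 t) :
    IntervalIntegrable f volume y x ∧ F x - F y = ∫ r in y..x, f r := by
  have h1 := intervalIntegrable_sub hf hx
  have h2 := intervalIntegrable_sub hf hy
  rw [hF x hx, hF y hy, add_sub_add_left_eq_sub, integral_interval_sub_left h1 h2]
  exact ⟨h2.symm.trans h1, rfl⟩

lemma intervalIntegrable_clm {𝕜 E F : Type*} [NontriviallyNormedField 𝕜] [NormedAddCommGroup E]
    [NormedSpace 𝕜 E] [NormedAddCommGroup F] [NormedSpace 𝕜 F] (L : E →L[𝕜] F) {a b : ℝ}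
    {f : ℝ → E} (hf : IntervalIntegrable f volume a b) :
    IntervalIntegrable (fun s => L (f s)) volume a b :=
  ⟨L.integrable_comp hf.1, L.integrable_comp hf.2⟩

lemma absolutelyContinuous_primitive {f F : ℝ → E} {t : ℝ} (ht : 0 ≤ t)
    (hf : IntervalIntegrable f volume 0 t)
    (hF : ∀ s ∈ Icc 0 t, F s = F 0 + ∫ r in 0..s, f r) :
    AbsolutelyContinuousOnInterval F 0 t :=
  absolutelyContinuous_of_norm_sub_le hf.norm fun x hx y hy => by
    rw [uIcc_of_le ht] at hx hy
    rw [(primitive_sub hf hF hx hy).2]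
    exact intervalIntegral.norm_integral_le_abs_integral_norm

lemma ae_hasDerivAt_of_primitive {f F : ℝ → E₁} {t : ℝ} (ht : 0 ≤ t)
    (hf : IntervalIntegrable f volume 0 t) (hF : ∀ s ∈ Icc 0 t, F s = F 0 + ∫ r in 0..s, f r) :
    ∀ᵐ x, x ∈ uIcc 0 t → HasDerivAt F (f x) x := by
  filter_upwards [hf.ae_hasDerivAt_integral, Measure.ae_ne volume 0, Measure.ae_ne volume t]
    with x h1 h2 h3 hx
  refine ((h1 hx 0 left_mem_uIcc).const_add (F 0)).congr_of_eventuallyEq ?_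
  rw [uIcc_of_le ht] at hx
  filter_upwards [Icc_mem_nhds (hx.1.lt_of_ne' h2) (hx.2.lt_of_ne h3)] with s hs using hF s hs

lemma abs_re_inner_le {E : Type*} [NormedAddCommGroup E] [InnerProductSpace ℂ E] (v w : E) :
    |(inner ℂ v w).re| ≤ ‖v‖ * ‖w‖ :=
  (Complex.abs_re_le_norm _).trans (norm_inner_le_norm v w)

lemma hasDerivAt_re_inner {E : Type*} [NormedAddCommGroup E] [InnerProductSpace ℂ E]
    {f g : ℝ → E} {f' g' : E} {t : ℝ} (hf : HasDerivAt f f' t) (hg : HasDerivAt g g' t) :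
    HasDerivAt (fun s => (inner ℂ (f s) (g s)).re)
      ((inner ℂ (f t) g').re + (inner ℂ f' (g t)).re) t := by
  have := reCLM.hasFDerivAt.comp_hasDerivAt t (hf.inner ℂ hg)
  exact this.congr_deriv (by simp)

lemma inner_re_symm' {E : Type*} [NormedAddCommGroup E] [InnerProductSpace ℂ E] (x y : E) :
    (inner ℂ x y).re = (inner ℂ y x).re := inner_re_symm (𝕜 := ℂ) x y

lemma hasDerivAt_norm_sq {E : Type*} [NormedAddCommGroup E] [InnerProductSpace ℂ E]
    {f : ℝ → E} {f' : E} {t : ℝ} (hf : HasDerivAt f f' t) :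
    HasDerivAt (fun s => ‖f s‖ ^ 2) (2 * (inner ℂ (f t) f').re) t := by
  have h := hasDerivAt_re_inner hf hf
  rw [inner_re_symm' f', ← two_mul] at h
  exact h.congr_of_eventuallyEq (.of_forall fun s => (inner_self_eq_norm_sq (𝕜 := ℂ) _).symm)

lemma eq_add_integral_of_hasDerivAt {f f' : ℝ → E₁} {T t : ℝ}
    (hd : ∀ s ∈ Icc 0 T, HasDerivAt f (f' s) s) (hc : Continuous f') (ht : t ∈ Icc 0 T) :
    f t = f 0 + ∫ s in 0..t, f' s := by
  rw [intervalIntegral.integral_eq_sub_of_hasDerivAt (fun s hs => ?_) (hc.intervalIntegrable _ _),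
    add_sub_cancel]
  rw [uIcc_of_le ht.1] at hs
  exact hd s ⟨hs.1, hs.2.trans ht.2⟩

/-- Product rule for primitives of integrable functions. -/
lemma integral_bilin_primitive (L : E₁ →L[ℝ] E₂ →L[ℝ] E₃) {f : ℝ → E₁} {g : ℝ → E₂} {t : ℝ}
    (ht : 0 ≤ t) (hf : IntervalIntegrable f volume 0 t) (hg : IntervalIntegrable g volume 0 t)
    {F : ℝ → E₁} {G : ℝ → E₂} (hF : ∀ s ∈ Icc 0 t, F s = F 0 + ∫ r in 0..s, f r)
    (hG : ∀ s ∈ Icc 0 t, G s = G 0 + ∫ r in 0..s, g r) :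
    IntervalIntegrable (fun s => L (f s) (G s)) volume 0 t ∧
    IntervalIntegrable (fun s => L (F s) (g s)) volume 0 t ∧
    L (F t) (G t) = L (F 0) (G 0) + ((∫ s in 0..t, L (f s) (G s))
        + ∫ s in 0..t, L (F s) (g s)) := by
  have cF : ContinuousOn F (Icc 0 t) :=
    (continuousOn_const.add (continuousOn_primitive' ht hf)).congr hF
  have cG : ContinuousOn G (Icc 0 t) :=
    (continuousOn_const.add (continuousOn_primitive' ht hg)).congr hG
  have i1 := intervalIntegrable_bilin L ht hf cG
  have i2 : IntervalIntegrable (fun s => L (F s) (g s)) volume 0 t :=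
    intervalIntegrable_bilin L.flip ht hg cF
  refine ⟨i1, i2, ?_⟩
  obtain ⟨A, hA⟩ := isCompact_Icc.exists_bound_of_continuousOn cF
  obtain ⟨B, hB⟩ := isCompact_Icc.exists_bound_of_continuousOn cG
  have h1 : AbsolutelyContinuousOnInterval (fun s => L (F s) (G s)) 0 t := by
    refine absolutelyContinuous_of_norm_sub_le (p := fun r => ‖L‖ * ‖f r‖ * B + ‖L‖ * A * ‖g r‖)
      (((hf.norm.const_mul _).mul_const _).add (hg.norm.const_mul _)) fun x hx y hy => ?_
    rw [uIcc_of_le ht] at hx hy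
    obtain ⟨h1, h2⟩ := primitive_sub hf hF hx hy
    obtain ⟨h3, h4⟩ := primitive_sub hg hG hx hy
    have e : L (F x) (G x) - L (F y) (G y) = L.flip (G x) (F x - F y) + L (F y) (G x - G y) := by
      simp
    rw [e, h2, h4, ← ContinuousLinearMap.intervalIntegral_comp_comm _ h1,
      ← ContinuousLinearMap.intervalIntegral_comp_comm _ h3, ← intervalIntegral.integral_add
        (intervalIntegrable_clm _ h1) (intervalIntegrable_clm _ h3)]
    refine intervalIntegral.norm_integral_le_abs_of_norm_le (.of_forall fun r => ?_)
      (((h1.norm.const_mul _).mul_const _).add (h3.norm.const_mul _))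
    refine (norm_add_le _ _).trans (add_le_add ((L.le_opNorm₂ _ _).trans ?_)
      ((L.le_opNorm₂ _ _).trans ?_))
    · exact mul_le_left (hB x hx)
    · gcongr; exact hA y hy
  have h2 := absolutelyContinuous_primitive ht (i1.add i2) (F := fun s => ∫ r in 0..s,
    (L (f r) (G r) + L (F r) (g r))) fun s _ => by simp
  obtain ⟨C, hC⟩ := (h1.sub h2).const_of_ae_hasDerivAt_zero (by
    filter_upwards [ae_hasDerivAt_of_primitive ht hf hF, ae_hasDerivAt_of_primitive ht hg hG,
      (i1.add i2).ae_hasDerivAt_integral] with x h3 h4 h5 hx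
    have h6 := ((L.hasFDerivAt.comp_hasDerivAt x (h3 hx)).clm_apply (h4 hx)).sub
      (h5 hx 0 left_mem_uIcc)
    exact h6.congr_deriv (sub_self _))
  have h3 := (hC t right_mem_uIcc).trans (hC 0 left_mem_uIcc).symm
  simp only [Pi.sub_apply, integral_same, sub_zero] at h3
  rw [← intervalIntegral.integral_add i1 i2, ← h3, sub_add_cancel]

/-- Grönwall's inequality in integral form with an integrable coefficient. -/
lemma gronwall_integral {c g : ℝ → ℝ} {T a : ℝ} (hc : IntervalIntegrable c volume 0 T)
    (hc0 : ∀ s ∈ Icc 0 T, 0 ≤ c s) (hg : ContinuousOn g (Icc 0 T))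
    (h : ∀ t ∈ Icc 0 T, g t ≤ a + ∫ s in 0..t, c s * g s) :
    ∀ t ∈ Icc 0 T, g t ≤ a * Real.exp (∫ s in 0..t, c s) := by
  intro t ht
  replace hc := intervalIntegrable_sub hc ht
  have hs : ∀ {s}, s ∈ Icc 0 t → s ∈ Icc 0 T := fun hs => ⟨hs.1, hs.2.trans ht.2⟩
  have hi : IntervalIntegrable (fun s => c s * g s) volume 0 t :=
    hc.mul_continuousOn (by rw [uIcc_of_le ht.1]; exact hg.mono fun s => hs)
  have hC : ∀ s ∈ Icc 0 t, (fun s => ∫ r in 0..s, c r) s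
    = (fun s => ∫ r in 0..s, c r) 0 + ∫ r in 0..s, c r := fun s _ => by simp
  have hY : ∀ s ∈ Icc 0 t, (fun s => a + ∫ r in 0..s, c r * g r) s
    = (fun s => a + ∫ r in 0..s, c r * g r) 0 + ∫ r in 0..s, c r * g r :=
    fun s _ => by simp
  have hE : AbsolutelyContinuousOnInterval (fun x => Real.exp (-∫ s in 0..x, c s)) 0 t := by
    refine absolutelyContinuous_of_norm_sub_le hc fun x hx y hy => ?_
    rw [uIcc_of_le ht.1] at hx hy
    have h0 : ∀ x ∈ Icc 0 t, -∫ s in 0..x, c s ∈ Iic 0 := fun x hx =>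
      neg_nonpos.mpr (intervalIntegral.integral_nonneg hx.1
        fun s h => hc0 s (hs ⟨h.1, h.2.trans hx.2⟩))
    have h1 := (convex_Iic (0 : ℝ)).norm_image_sub_le_of_norm_hasDerivWithin_le (f := Real.exp)
      (f' := Real.exp) (C := 1) (fun z _ => (Real.hasDerivAt_exp z).hasDerivWithinAt)
      (fun z hz => by rw [norm_of_nonneg (Real.exp_nonneg z)]; exact Real.exp_le_one_iff.mpr hz)
      (h0 x hx) (h0 y hy)
    rw [one_mul, neg_sub_neg, norm_sub_rev (Real.exp _), (primitive_sub hc hC hx hy).2] at h1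
    exact h1
  have h1 := ((absolutelyContinuous_primitive ht.1 hi hY).fun_mul hE).integral_deriv_eq_sub
  have h2 := intervalIntegral.integral_nonneg_of_ae_restrict (μ := volume) (f := fun x => -deriv
    (fun x => (a + ∫ s in 0..x, c s * g s) * Real.exp (-∫ s in 0..x, c s)) x) ht.1 (by
      rw [Filter.EventuallyLE, ae_restrict_iff' measurableSet_Icc]
      filter_upwards [ae_hasDerivAt_of_primitive ht.1 hc hC, ae_hasDerivAt_of_primitive ht.1 hi hY]
        with x h1 h2 hx
      rw [← uIcc_of_le ht.1] at hx
      have h3 := ((h2 hx).mul (h1 hx).neg.exp).deriv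
      rw [uIcc_of_le ht.1] at hx
      have h4 := mul_nonneg (hc0 x (hs hx)) (sub_nonneg.mpr (h x (hs hx)))
      have h5 := mul_nonneg h4 (Real.exp_nonneg (-∫ s in 0..x, c s))
      rw [Pi.zero_apply, neg_nonneg]
      refine h3.trans_le ?_
      rw [Pi.neg_apply]
      linarith)
  rw [intervalIntegral.integral_neg, neg_nonneg] at h2
  have h3 : (a + ∫ s in 0..t, c s * g s) * Real.exp (-∫ s in 0..t, c s) ≤ a := by
    rw [h1] at h2; simpa using h2
  rw [Real.exp_neg, ← div_eq_mul_inv, div_le_iff₀ (Real.exp_pos _)] at h3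
  exact (h t ht).trans h3

/-- Grönwall's inequality in integral form with a constant coefficient. -/
lemma gronwall_const {g : ℝ → ℝ} {T a K : ℝ} (hK : 0 ≤ K) (ha : 0 ≤ a)
    (hg : ContinuousOn g (Icc 0 T)) (h : ∀ t ∈ Icc 0 T, g t ≤ a + ∫ s in 0..t, K * g s) :
    ∀ t ∈ Icc 0 T, g t ≤ a * Real.exp (K * T) := by
  intro t ht
  refine (gronwall_integral (c := fun _ => K) intervalIntegrable_const (fun _ _ => hK) hg h t
    ht).trans ?_
  simp only [intervalIntegral.integral_const, sub_zero, smul_eq_mul]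
  have : t * K ≤ K * T := by rw [mul_comm]; exact mul_le_left ht.2 hK
  gcongr

/-- Existence and uniqueness for integral equations `y(t) = y₀ + ∫₀ᵗ f(s, y(s)) ds` with a globally
Lipschitz right-hand side that need not be continuous in time. -/
lemma exists_volterra [CompleteSpace E] {T K : ℝ} (hT : 0 ≤ T) (hK : 0 ≤ K) (y₀ : E)
    {f : ℝ → E → E}
    (hint : ∀ y : ℝ → E, Continuous y → IntervalIntegrable (fun s => f s (y s)) volume 0 T)
    (hLip : ∀ s ∈ Icc 0 T, ∀ x x', ‖f s x - f s x'‖ ≤ K * ‖x - x'‖) :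
    ∃ y : ℝ → E, Continuous y ∧ ∀ t ∈ Icc 0 T, y t = y₀ + ∫ s in 0..t, f s (y s) := by
  let X := C(Icc (0 : ℝ) T, E)
  let ext : X → ℝ → E := fun y => IccExtend hT y
  have hext : ∀ y : X, Continuous (ext y) := fun y => y.continuous.Icc_extend'
  let Γ : X → X := fun y => ⟨fun t => y₀ + ∫ s in 0..t, f s (ext y s), by
    have := continuousOn_primitive' hT (hint _ (hext y))
    exact continuous_const.add (continuousOn_iff_continuous_domRestrict.1 this)⟩
  have hΓ : ∀ y z : X, ∀ n : ℕ, ∀ t : Icc (0 : ℝ) T,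
      ‖(Γ^[n] y) t - (Γ^[n] z) t‖ ≤ (K * t) ^ n / (n.factorial : ℝ) * ‖y - z‖ := by
    intro y z n
    induction n with
    | zero => intro t; simpa using! ContinuousMap.norm_coe_le_norm (y - z) t
    | succ n ih =>
      intro t
      rw [Function.iterate_succ_apply', Function.iterate_succ_apply']
      set p := Γ^[n] y
      set q := Γ^[n] z
      have h1 : (Γ p) t - (Γ q) t = ∫ s in 0..t, (f s (ext p s) - f s (ext q s)) := by
        rw [intervalIntegral.integral_sub (intervalIntegrable_sub (hint _ (hext p)) t.2)
          (intervalIntegrable_sub (hint _ (hext q)) t.2)]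
        exact add_sub_add_left_eq_sub _ _ _
      have h2 : ∀ s ∈ Ioc (0 : ℝ) t, ‖f s (ext p s) - f s (ext q s)‖
          ≤ K * ((K * s) ^ n / (n.factorial : ℝ) * ‖y - z‖) := by
        intro s hs
        have hs' : s ∈ Icc (0 : ℝ) T := ⟨hs.1.le, hs.2.trans t.2.2⟩
        refine (hLip s hs' _ _).trans ?_
        gcongr
        have := ih ⟨s, hs'⟩
        simpa [ext, IccExtend_of_mem hT _ hs'] using this
      rw [h1]
      refine (intervalIntegral.norm_integral_le_of_norm_le t.2.1
        (.of_forall h2) (Continuous.intervalIntegrable (by fun_prop) _ _)).trans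
        (le_of_eq ?_)
      have h3 : ∀ s : ℝ, K * ((K * s) ^ n / (n.factorial : ℝ) * ‖y - z‖)
          = (K ^ (n + 1) / (n.factorial : ℝ) * ‖y - z‖) * s ^ n := fun s => by ring
      simp only [h3, intervalIntegral.integral_const_mul, integral_pow]
      rw [Nat.factorial_succ]
      have : (n.factorial : ℝ) ≠ 0 := by exact_mod_cast n.factorial_ne_zero
      push_cast
      field_simp
      simp
      ring
  obtain ⟨n, hn⟩ : ∃ n : ℕ, (K * T) ^ n / (n.factorial : ℝ) < 1 / 2 :=
    ((FloorSemiring.tendsto_pow_div_factorial_atTop (K * T)).eventually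
      (gt_mem_nhds (by norm_num))).exists
  have hcontr : ContractingWith (1 / 2 : NNReal) (Γ^[n]) := by
    refine ⟨by rw [← NNReal.coe_lt_coe]; norm_num, LipschitzWith.of_dist_le_mul fun y z => ?_⟩
    rw [dist_eq_norm, dist_eq_norm, ContinuousMap.norm_le _ (by positivity)]
    intro t
    refine (hΓ y z n t).trans ?_
    refine mul_le_right (le_trans ?_ (hn.le.trans (by norm_num)))
    gcongr
    · exact mul_nonneg hK t.2.1
    · exact t.2.2
  refine ⟨ext (hcontr.fixedPoint _), hext _, fun t ht => ?_⟩
  have h1 := hcontr.isFixedPt_fixedPoint_iterate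
  have h2 := congrArg (fun y : X => y ⟨t, ht⟩) h1
  simp only [ext, IccExtend_of_mem hT _ ht]
  exact h2.symm

lemma IsTestFun.eq_zero {E F : Type*} [NormedAddCommGroup E] [NormedSpace ℝ E]
    [NormedAddCommGroup F] [NormedSpace ℝ F] {U : Set E} {f : E → F} (hf : IsTestFun U f) {x : E}
    (hx : x ∉ U) : f x = 0 :=
  image_eq_zero_of_notMem_tsupport fun h => hx (hf.2.2 h)

/-- The primitive of a test function of mean zero is a test function. -/
lemma isTestFun_primitive {T : ℝ} {χ : ℝ → ℝ} (hχ : IsTestFun (Ioo 0 T) χ)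
    (h0 : ∫ t in Ioo 0 T, χ t = 0) :
    IsTestFun (Ioo 0 T) (fun t => ∫ s in 0..t, χ s) ∧ deriv (fun t => ∫ s in 0..t, χ s) = χ := by
  have hcont := hχ.1.continuous
  have hd : ∀ t, HasDerivAt (fun t => ∫ s in 0..t, χ s) (χ t) t := fun t =>
    intervalIntegral.integral_hasDerivAt_right (hcont.intervalIntegrable _ _)
      (hcont.stronglyMeasurableAtFilter _ _) hcont.continuousAt
  have hderiv : deriv (fun t => ∫ s in 0..t, χ s) = χ := funext fun t => (hd t).deriv
  have hdiff : Differentiable ℝ (fun t => ∫ s in 0..t, χ s) :=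
    fun t => (hd t).differentiableAt
  have hsm : ContDiff ℝ ∞ (fun t => ∫ s in 0..t, χ s) := by
    rw [contDiff_infty_iff_deriv]
    exact ⟨hdiff, by rw [hderiv]; exact hχ.1⟩
  obtain ⟨a, b, ha, hb, hab⟩ : ∃ a b : ℝ, 0 < a ∧ b < T ∧ tsupport χ ⊆ Icc a b := by
    rcases (tsupport χ).eq_empty_or_nonempty with he | hne
    · exact ⟨1, T - 1, one_pos, by linarith, by simp [he]⟩
    · have hK : IsCompact (tsupport χ) := hχ.2.1
      exact ⟨sInf (tsupport χ), sSup (tsupport χ), (hχ.2.2 (hK.sInf_mem hne)).1,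
        (hχ.2.2 (hK.sSup_mem hne)).2, fun x hx =>
          ⟨csInf_le hK.bddBelow hx, le_csSup hK.bddAbove hx⟩⟩
  have hz : Function.support χ ⊆ Icc a b := (subset_tsupport χ).trans hab
  have hsupp : Function.support (fun t => ∫ s in 0..t, χ s) ⊆ Icc a b := by
    refine fun x hx => by_contra fun hcon => hx ?_
    rw [mem_Icc, not_and_or, not_le, not_le] at hcon
    rcases hcon with h | h
    · refine (intervalIntegral.integral_congr fun s hs => ?_).trans intervalIntegral.integral_zero
      by_contra h'
      exact ((hs.2.trans_lt (max_lt ha h)).trans_le (hz h').1).false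
    · have e : ∫ t, χ t = 0 := by
        rw [← setIntegral_eq_integral_of_forall_compl_eq_zero fun t ht => hχ.eq_zero ht]
        exact h0
      exact (intervalIntegral.integral_eq_integral_of_support_subset
        (hz.trans fun y hy => ⟨ha.trans_le hy.1, hy.2.trans h.le⟩)).trans e
  have hts : tsupport (fun t => ∫ s in 0..t, χ s) ⊆ Icc a b := closure_minimal hsupp isClosed_Icc
  exact ⟨⟨hsm, isCompact_Icc.of_isClosed_subset (isClosed_tsupport _) hts,
    hts.trans fun x hx => ⟨ha.trans_le hx.1, hx.2.trans_lt hb⟩⟩, hderiv⟩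

/-- A function with an integrable distributional derivative on `(0,T)` is a primitive of it (lemma
of du Bois-Reymond). -/
lemma exists_ae_eq_primitive [CompleteSpace E] {T : ℝ} (hT : 0 < T) {w g : ℝ → E}
    (hw : IntegrableOn w (Ioo 0 T)) (hg : IntegrableOn g (Ioo 0 T))
    (h : ∀ φ : ℝ → ℝ, IsTestFun (Ioo 0 T) φ →
      ∫ t in Ioo 0 T, deriv φ t • w t = - ∫ t in Ioo 0 T, φ t • g t) :
    ∃ c : E, ∀ᵐ t ∂timeMeasure T, w t = c + ∫ s in 0..t, g s := by
  have hgi : IntervalIntegrable g volume 0 T := by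
    rw [intervalIntegrable_iff_integrableOn_Ioc_of_le hT.le, integrableOn_Ioc_iff_integrableOn_Ioo]
    exact hg
  have hPc := continuousOn_primitive' hT.le hgi
  have hP : IntegrableOn (fun t => ∫ s in 0..t, g s) (Ioo 0 T) :=
    (hPc.integrableOn_Icc).mono_set Ioo_subset_Icc_self
  set W : ℝ → E := fun t => w t - ∫ s in 0..t, g s with hW
  have hWi : IntegrableOn W (Ioo 0 T) := hw.sub hP
  have smul_int : ∀ {φ : ℝ → ℝ} {v : ℝ → E}, Continuous φ → HasCompactSupport φ →
      IntegrableOn v (Ioo 0 T) → IntegrableOn (fun t => φ t • v t) (Ioo 0 T) := by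
    intro φ v hφ hφc hv
    obtain ⟨C, hC⟩ := hφc.exists_bound_of_continuous hφ
    exact hv.bdd_smul C hφ.aestronglyMeasurable (.of_forall hC)
  have h1 : ∀ φ : ℝ → ℝ, IsTestFun (Ioo 0 T) φ → ∫ t in Ioo 0 T, deriv φ t • W t = 0 := by
    intro φ hφ
    have hd : Continuous (deriv φ) := hφ.1.continuous_deriv (by simp)
    have hF : ∀ s ∈ Icc 0 T, φ s = φ 0 + ∫ r in 0..s, deriv φ r := fun s _ => by
      rw [intervalIntegral.integral_deriv_eq_sub (fun x _ => (hφ.1.differentiable (by simp)) x)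
        (hd.intervalIntegrable _ _)]; ring
    have key := (integral_bilin_primitive (ContinuousLinearMap.lsmul ℝ ℝ : ℝ →L[ℝ] E →L[ℝ] E)
      hT.le (hd.intervalIntegrable _ _) hgi hF (G := fun t => ∫ s in 0..t, g s)
      (fun s _ => by simp)).2.2
    rw [hφ.eq_zero (x := T) (by simp), hφ.eq_zero (x := 0) (by simp)] at key
    simp only [map_zero, zero_apply, zero_add, ContinuousLinearMap.lsmul_apply] at key
    rw [integral_of_le hT.le, integral_of_le hT.le,
      integral_Ioc_eq_integral_Ioo, integral_Ioc_eq_integral_Ioo] at key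
    simp only [hW, smul_sub]
    rw [integral_sub (smul_int hd hφ.2.1.deriv hw) (smul_int hd hφ.2.1.deriv hP), h φ hφ,
      eq_neg_of_add_eq_zero_left key.symm, sub_self]
  let b : ContDiffBump (T / 2) := ⟨T / 8, T / 4, by positivity, by linarith⟩
  set θ : ℝ → ℝ := b.normed volume with hθ
  have hθt : IsTestFun (Ioo 0 T) θ := by
    refine ⟨b.contDiff_normed, b.hasCompactSupport_normed, ?_⟩
    rw [hθ, b.tsupport_normed_eq, Real.closedBall_eq_Icc]
    intro x hx
    exact ⟨by have := hx.1; dsimp [b] at this; linarith,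
      by have := hx.2; dsimp [b] at this; linarith⟩
  have hθ1 : ∫ t in Ioo 0 T, θ t = 1 := by
    rw [setIntegral_eq_integral_of_forall_compl_eq_zero fun t ht => hθt.eq_zero ht]; exact b.integral_normed
  set c : E := ∫ t in Ioo 0 T, θ t • W t with hc
  have hloc : LocallyIntegrableOn (fun t => W t - c) (Ioo 0 T) :=
    (hWi.sub (integrableOn_const (by simp))).locallyIntegrableOn
  have h2 : ∀ χ : ℝ → ℝ, ContDiff ℝ ∞ χ → HasCompactSupport χ → tsupport χ ⊆ Ioo 0 T →
      ∫ t, χ t • (W t - c) = 0 := by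
    intro χ hχ1 hχ2 hχ3
    have hχ : IsTestFun (Ioo 0 T) χ := ⟨hχ1, hχ2, hχ3⟩
    set m : ℝ := ∫ t in Ioo 0 T, χ t with hm
    have hψ : IsTestFun (Ioo 0 T) (fun t => χ t - m * θ t) := by
      refine ⟨hχ1.sub (contDiff_const.mul hθt.1), hχ2.sub (hθt.2.1.mul_left), ?_⟩
      refine (tsupport_sub _ _).trans (union_subset hχ3 ?_)
      exact (tsupport_mul_subset_right).trans hθt.2.2
    have i1 : IntegrableOn χ (Ioo 0 T) :=
      (hχ1.continuous.integrable_of_hasCompactSupport hχ2).integrableOn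
    have i2 : IntegrableOn θ (Ioo 0 T) :=
      (hθt.1.continuous.integrable_of_hasCompactSupport hθt.2.1).integrableOn
    obtain ⟨hφ, hφd⟩ := isTestFun_primitive hψ (by
      rw [integral_sub i1 (i2.const_mul m), integral_const_mul, hθ1, mul_one, sub_self])
    have h3 := h1 _ hφ
    rw [hφd] at h3
    have i3 := smul_int hχ1.continuous hχ2 hWi
    have i4 := smul_int hθt.1.continuous hθt.2.1 hWi
    simp only [sub_smul, mul_smul] at h3
    have i5 : IntegrableOn (fun t => m • θ t • W t) (Ioo 0 T) := i4.smul m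
    rw [integral_sub i3 i5, integral_smul, ← hc, sub_eq_zero] at h3
    rw [← setIntegral_eq_integral_of_forall_compl_eq_zero (s := Ioo 0 T)
      fun t ht => by rw [hχ.eq_zero ht, zero_smul]]
    simp only [smul_sub]
    rw [integral_sub i3 (smul_int hχ1.continuous hχ2 (integrableOn_const (by simp))), h3,
      integral_smul_const, ← hm, sub_self]
  have h4 := isOpen_Ioo.ae_eq_zero_of_integral_contDiff_smul_eq_zero hloc h2
  refine ⟨c, ?_⟩
  filter_upwards [(ae_restrict_iff' measurableSet_Ioo).2 h4] with t ht
  rw [sub_eq_zero] at ht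
  rw [← ht, hW, sub_add_cancel]

/-- Two functions that are continuous on `[0,T]` and equal almost everywhere are equal. -/
lemma eqOn_Icc_of_ae_eq {X : Type*} [TopologicalSpace X] [T2Space X] {T : ℝ} (hT : 0 < T)
    {v w : ℝ → X} (hv : ContinuousOn v (Icc 0 T)) (hw : ContinuousOn w (Icc 0 T))
    (h : ∀ᵐ t ∂timeMeasure T, v t = w t) : EqOn v w (Icc 0 T) := by
  have h1 : v =ᵐ[vol (Ioo 0 T)] w := h
  have h2 : EqOn v w (Ioo 0 T) := by
    refine Measure.eqOn_open_of_ae_eq h1 isOpen_Ioo (hv.mono Ioo_subset_Icc_self)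
      (hw.mono Ioo_subset_Icc_self)
  refine h2.of_subset_closure hv hw Ioo_subset_Icc_self ?_
  rw [closure_Ioo hT.ne]

end TimeCalculus

section Control

variable {T : ℝ}

lemma integral_norm_le_sqrt_mul {E : Type*} [NormedAddCommGroup E] (f : Lp E 2 (timeMeasure T)) :
    ∫ s in Ioo 0 T, ‖f s‖ ≤ √T * ‖f‖ := by
  have h1 : eLpNorm f 1 (timeMeasure T) ≤ eLpNorm f 2 (timeMeasure T)
      * (timeMeasure T) univ ^ (1 / (1 : ENNReal).toReal - 1 / (2 : ENNReal).toReal) :=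
    eLpNorm_le_eLpNorm_mul_rpow_measure_univ (by norm_num) (Lp.aestronglyMeasurable f)
  have h2 : (timeMeasure T) univ ^ (1 / (1 : ENNReal).toReal - 1 / (2 : ENNReal).toReal)
      = ofReal (√T) := by
    rcases le_or_gt 0 T with hT | hT
    · rw [Measure.restrict_apply_univ, Real.volume_Ioo, sub_zero, Real.sqrt_eq_rpow,
        ENNReal.ofReal_rpow_of_nonneg hT (by norm_num)]
      norm_num
    · rw [Measure.restrict_apply_univ, Real.volume_Ioo, sub_zero, ENNReal.ofReal_of_nonpos hT.le,
        Real.sqrt_eq_zero_of_nonpos hT.le]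
      norm_num
  have h3 : ∫ s in Ioo 0 T, ‖f s‖ = (eLpNorm f 1 (timeMeasure T)).toReal := by
    rw [eLpNorm_one_eq_lintegral_enorm, integral_norm_eq_lintegral_enorm (Lp.aestronglyMeasurable f)]
  rw [h3, Lp.norm_def, mul_comm]
  have h4 : eLpNorm f 2 (timeMeasure T) * ofReal (√T) ≠ ⊤ :=
    ENNReal.mul_ne_top (Lp.eLpNorm_ne_top f) ENNReal.ofReal_ne_top
  rw [h2] at h1
  refine (ENNReal.toReal_mono h4 h1).trans ?_
  rw [ENNReal.toReal_mul, ENNReal.toReal_ofReal (Real.sqrt_nonneg T)]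

lemma integrableOn_Lp {E : Type*} [NormedAddCommGroup E] (f : Lp E 2 (timeMeasure T)) :
    IntegrableOn f (Ioo 0 T) :=
  (Lp.memLp f).integrable (by norm_num)

/-- A control has an absolutely continuous representative, which it controls in the sup norm. -/
lemma H1.exists_primitive (hT : 0 < T) (u : H1 T) : ∃ w : ℝ → ℝ,
    (∀ᵐ t ∂timeMeasure T, H1.ev u t = w t) ∧
    IntervalIntegrable (fun s => (u : TimePair T).snd s) volume 0 T ∧
    (∀ t, w t = w 0 + ∫ s in 0..t, (u : TimePair T).snd s) ∧
    (∫ s in 0..T, |(u : TimePair T).snd s|) ≤ √T * ‖u‖ ∧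
    (∀ t ∈ Icc 0 T, |w t| ≤ (1 / √T + √T) * ‖u‖) := by
  have hi1 : IntegrableOn (u : TimePair T).fst (Ioo 0 T) := integrableOn_Lp _
  have hi2 : IntegrableOn (u : TimePair T).snd (Ioo 0 T) := integrableOn_Lp _
  obtain ⟨c, hc⟩ := exists_ae_eq_primitive hT hi1 hi2 fun φ hφ => by
    have := (mem_H1_iff (u : TimePair T)).1 u.2 φ hφ
    simpa only [smul_eq_mul, mul_comm] using this
  have hii : IntervalIntegrable (fun s => (u : TimePair T).snd s) volume 0 T := by
    rw [intervalIntegrable_iff_integrableOn_Ioc_of_le hT.le, integrableOn_Ioc_iff_integrableOn_Ioo]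
    exact hi2
  have hn1 : ‖(u : TimePair T).fst‖ ≤ ‖u‖ := WithLp.norm_fst_le _ (u : TimePair T)
  have hn2 : ‖(u : TimePair T).snd‖ ≤ ‖u‖ := WithLp.norm_snd_le _ (u : TimePair T)
  have hb : (∫ s in 0..T, |(u : TimePair T).snd s|) ≤ √T * ‖u‖ := by
    rw [integral_of_le hT.le, integral_Ioc_eq_integral_Ioo]
    refine (integral_norm_le_sqrt_mul (u : TimePair T).snd).trans ?_
    gcongr
  set w : ℝ → ℝ := fun t => c + ∫ s in 0..t, (u : TimePair T).snd s with hw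
  have hw0 : ∀ t, w t = w 0 + ∫ s in 0..t, (u : TimePair T).snd s := fun t => by simp [hw]
  refine ⟨w, hc, hii, hw0, hb, fun t ht => ?_⟩
  set I := ∫ s in 0..T, |(u : TimePair T).snd s| with hI
  have h1 : ∀ s ∈ Ioo 0 T, |w t| - I ≤ |w s| := by
    intro s hs
    have e1 : w t - w s = ∫ r in s..t, (u : TimePair T).snd r := by
      rw [hw0 t, hw0 s, add_sub_add_left_eq_sub]
      have := integral_interval_sub_left
        (intervalIntegrable_sub hii ht) (intervalIntegrable_sub hii (Ioo_subset_Icc_self hs))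
      exact this
    have e2 : |w t - w s| ≤ I := by
      rw [e1, hI, integral_of_le hT.le]
      have e3 := intervalIntegral.norm_integral_le_integral_norm_uIoc
        (f := fun r => (u : TimePair T).snd r) (a := s) (b := t) (μ := volume)
      refine e3.trans ?_
      refine setIntegral_mono_set ?_ (.of_forall fun _ => abs_nonneg _) (LE.le.eventuallyLE ?_)
      · exact ((intervalIntegrable_iff_integrableOn_Ioc_of_le hT.le).1 hii).norm
      · exact fun r hr => ⟨(le_min hs.1.le ht.1).trans_lt hr.1, hr.2.trans (max_le hs.2.le ht.2)⟩
    have := abs_sub_abs_le_abs_sub (w t) (w s)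
    linarith
  have h2 : T * (|w t| - I) ≤ √T * ‖u‖ := by
    have e1 : ∫ s in Ioo 0 T, (|w t| - I) = T * (|w t| - I) := by simp [hT.le]
    have e2 : ∫ s in Ioo 0 T, |w s| ≤ √T * ‖u‖ := by
      have : ∫ s in Ioo 0 T, |w s| = ∫ s in Ioo 0 T, ‖(u : TimePair T).fst s‖ := by
        refine integral_congr_ae ?_
        filter_upwards [hc] with s hs
        rw [hs]; rfl
      rw [this]
      refine (integral_norm_le_sqrt_mul (u : TimePair T).fst).trans ?_
      gcongr
    rw [← e1]
    refine le_trans (setIntegral_mono_on (integrableOn_const (by simp)) ?_ measurableSet_Ioo h1) e2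
    refine (Integrable.congr hi1.norm ?_)
    filter_upwards [hc] with s hs
    rw [hs]; rfl
  have h3 : 0 < √T := Real.sqrt_pos.2 hT
  have h4 : √T * √T = T := Real.mul_self_sqrt hT.le
  have h5 : |w t| - I ≤ 1 / √T * ‖u‖ := by
    have : √T * (√T * (|w t| - I)) ≤ √T * ‖u‖ := by rwa [← mul_assoc, h4]
    have := le_of_mul_le_mul_left this h3
    rw [div_mul_eq_mul_div, one_mul, le_div_iff₀ h3]
    linarith
  linarith

end Control

/-! ### Mild solutions -/

section Mild

open ContinuousLinearMap

variable {ι : V →L[ℂ] H}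

/-- The Hermitian inner product as a real bilinear map. -/
def innerR (H : Type*) [NormedAddCommGroup H] [InnerProductSpace ℂ H] : H →L[ℝ] H →L[ℝ] ℂ :=
  (isBoundedBilinearMap_inner (𝕜 := ℂ) (E := H)).toContinuousLinearMap

lemma innerR_apply (x y : H) : innerR H x y = inner ℂ x y := rfl

/-- `v` is the mild solution of `i v' = M v + f`, i.e. `v(t) = S(t) v(0) - i ∫₀ᵗ S(t-s) f(s) ds`,
written in the interaction picture. -/
structure IsMild (ι : V →L[ℂ] H) (T : ℝ) (v f : ℝ → H) : Prop where
  cont : ContinuousOn v (Icc 0 T)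
  int : IntervalIntegrable f volume 0 T
  eq : ∀ t ∈ Icc 0 T, grp ι (-t) (v t) = v 0 + ∫ s in 0..t, -I • grp ι (-s) (f s)

/-- `i v' = M v + f` in integrated form, tested with the range of `M⁻¹`. -/
def IsVeryWeak (ι : V →L[ℂ] H) (T : ℝ) (v f : ℝ → H) : Prop :=
  ∀ t ∈ Icc 0 T, I • res ι (v t - v 0) = ∫ s in 0..t, (v s + res ι (f s))

lemma aestronglyMeasurable_grp (h : IsGelfand ι) {μ : Measure ℝ} {f : ℝ → H}
    (hf : AEStronglyMeasurable f μ) : AEStronglyMeasurable (fun s => grp ι (-s) (f s)) μ := by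
  have h1 : AEStronglyMeasurable (fun s : ℝ => (-s, f s)) μ :=
    (continuous_neg.aestronglyMeasurable).prodMk hf
  have h2 := (continuous_grp h).comp_aestronglyMeasurable h1
  exact h2

lemma Continuous.grp (h : IsGelfand ι) {α : Type*} [TopologicalSpace α] {a : α → ℝ} {f : α → H}
    (ha : Continuous a) (hf : Continuous f) : Continuous fun s => grp ι (a s) (f s) := by
  have h2 := Continuous.comp (continuous_grp h) (ha.prodMk hf)
  simp only [Function.comp_def] at h2
  exact h2

lemma Continuous.grpV (h : IsGelfand ι) {α : Type*} [TopologicalSpace α] {a : α → ℝ} {f : α → V}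
    (ha : Continuous a) (hf : Continuous f) : Continuous fun s => grpV ι (a s) (f s) := by
  have h2 := Continuous.comp (continuous_grpV h) (ha.prodMk hf)
  simp only [Function.comp_def] at h2
  exact h2

lemma ContinuousOn.grp (h : IsGelfand ι) {S : Set ℝ} {a : ℝ → ℝ} {f : ℝ → H}
    (ha : Continuous a) (hf : ContinuousOn f S) : ContinuousOn (fun s => grp ι (a s) (f s)) S := by
  rw [continuousOn_iff_continuous_domRestrict] at hf ⊢
  exact Continuous.grp h (ha.comp continuous_subtype_val) hf

lemma norm_neg_I_smul_grp (h : IsGelfand ι) (t : ℝ) (x : H) : ‖-I • TDKS.grp ι t x‖ = ‖x‖ := by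
  rw [norm_smul, norm_neg, Complex.norm_I, one_mul, norm_grp h]

lemma intervalIntegrable_grp (h : IsGelfand ι) {a b : ℝ} {f : ℝ → H}
    (hf : IntervalIntegrable f volume a b) :
    IntervalIntegrable (fun s => -I • TDKS.grp ι (-s) (f s)) volume a b := by
  rw [intervalIntegrable_iff] at hf ⊢
  refine Integrable.mono' hf.norm ((aestronglyMeasurable_grp h hf.1).const_smul _) ?_
  exact .of_forall fun s => (norm_neg_I_smul_grp h _ _).le

lemma intervalIntegrable_of_cont {E : Type*} [NormedAddCommGroup E] {T : ℝ} {v : ℝ → E}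
    (hv : ContinuousOn v (Icc 0 T)) {t : ℝ} (ht : t ∈ Icc 0 T) :
    IntervalIntegrable v volume 0 t :=
  (hv.mono (by rw [uIcc_of_le ht.1]; exact Icc_subset_Icc_right ht.2)).intervalIntegrable

namespace IsMild

variable {T : ℝ} {v f : ℝ → H}

lemma primitive (hv : IsMild ι T v f) (h : IsGelfand ι) : ∀ t ∈ Icc 0 T,
    TDKS.grp ι (-t) (v t) = TDKS.grp ι (-0) (v 0)
      + ∫ s in 0..t, -I • TDKS.grp ι (-s) (f s) := fun t ht => by
  rw [neg_zero, grp_zero h]; exact hv.eq t ht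

/-- A mild solution solves the equation tested with the range of `M⁻¹`. -/
lemma isVeryWeak (hv : IsMild ι T v f) (h : IsGelfand ι) : IsVeryWeak ι T v f := by
  intro t ht
  have hf := intervalIntegrable_sub hv.int ht
  have hvc := intervalIntegrable_of_cont hv.cont ht
  have hBf : IntervalIntegrable (fun s => res ι (f s)) volume 0 t := intervalIntegrable_clm (res ι) hf
  have hsum : IntervalIntegrable (fun s => v s + res ι (f s)) volume 0 t := hvc.add hBf
  refine ext_inner_left ℂ fun y => ?_
  refine h.res_dense.induction_on (p := fun y : H => inner ℂ y (I • res ι (v t - v 0))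
    = inner ℂ y (∫ s in 0..t, (v s + res ι (f s)))) y
    (isClosed_eq (by fun_prop) (by fun_prop)) fun x => ?_
  have hc : ∀ s, HasDerivAt (fun s => TDKS.grp ι (-s) (res ι (res ι x)))
      (I • TDKS.grp ι (-s) (res ι x)) s := by
    intro s
    have h1 := (((ContinuousLinearMap.apply ℂ H x).restrictScalars ℝ).hasFDerivAt
      (x := (resExp ι (-s) * res ι))).comp_hasDerivAt s
      ((hasDerivAt_resExp h (-s)).scomp s (hasDerivAt_neg s))
    convert h1 using 1
    · ext r; simp [grp_res h]
    · simp [grp_res h]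
  have hcont : Continuous fun s => I • TDKS.grp ι (-s) (res ι x) :=
    (Continuous.grp h continuous_neg continuous_const).const_smul _
  have key := (integral_bilin_primitive (innerR H) ht.1 (hcont.intervalIntegrable _ _)
    (intervalIntegrable_grp h hf) (F := fun s => TDKS.grp ι (-s) (res ι (res ι x)))
    (G := fun s => TDKS.grp ι (-s) (v s))
    (fun s _ => by
      rw [intervalIntegral.integral_eq_sub_of_hasDerivAt (fun r _ => hc r)
        (hcont.intervalIntegrable _ _)]; abel)
    (fun s hs => hv.primitive h s ⟨hs.1, hs.2.trans ht.2⟩)).2.2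
  simp only [innerR_apply, inner_grp_grp h, inner_smul_left, inner_smul_right,
    Complex.conj_I, intervalIntegral.integral_const_mul] at key
  have h2 := ((innerSL ℂ (res ι x)).intervalIntegral_comp_comm hsum).symm
  simp only [innerSL_apply_apply, inner_add_right] at h2
  have h3 : (∫ s in 0..t, (inner ℂ (res ι x) (v s) + inner ℂ (res ι x) (res ι (f s))))
      = (∫ s in 0..t, inner ℂ (res ι x) (v s)) + ∫ s in 0..t, inner ℂ (res ι x) (res ι (f s)) :=
    intervalIntegral.integral_add (intervalIntegrable_clm (innerSL ℂ (res ι x)) hvc)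
      (intervalIntegrable_clm (innerSL ℂ (res ι x)) hBf)
  rw [h2, h3, inner_smul_right, map_sub, inner_sub_right]
  simp only [inner_res_comm] at key ⊢
  rw [key]
  linear_combination (-1 : ℂ) * ((∫ s in (0:ℝ)..t, inner ℂ x (res ι (v s))) +
    (∫ s in (0:ℝ)..t, inner ℂ x (res ι (res ι (f s))))) * Complex.I_sq

/-- The pairing of two mild solutions is absolutely continuous. -/
lemma inner_eq {w g : ℝ → H} (hv : IsMild ι T v f) (hw : IsMild ι T w g) (h : IsGelfand ι)
    {t : ℝ} (ht : t ∈ Icc 0 T) :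
    IntervalIntegrable (fun s => inner ℂ (f s) (w s)) volume 0 t ∧
    IntervalIntegrable (fun s => inner ℂ (v s) (g s)) volume 0 t ∧
    inner ℂ (v t) (w t) = inner ℂ (v 0) (w 0) + ((∫ s in 0..t, I * inner ℂ (f s) (w s))
        + ∫ s in 0..t, -I * inner ℂ (v s) (g s)) := by
  have key := integral_bilin_primitive (innerR H) ht.1
    (intervalIntegrable_grp h (intervalIntegrable_sub hv.int ht))
    (intervalIntegrable_grp h (intervalIntegrable_sub hw.int ht))
    (fun s hs => hv.primitive h s ⟨hs.1, hs.2.trans ht.2⟩)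
    (fun s hs => hw.primitive h s ⟨hs.1, hs.2.trans ht.2⟩)
  simp only [innerR_apply, inner_grp_grp h, inner_smul_left, inner_smul_right,
    Complex.conj_I, map_neg, neg_neg] at key
  refine ⟨?_, ?_, key.2.2⟩
  · refine (key.1.const_mul (-I)).congr fun s _ => ?_
    simp [← mul_assoc]
  · refine (key.2.1.const_mul (I)).congr fun s _ => ?_
    simp [← mul_assoc]

lemma sub {w g : ℝ → H} (hv : IsMild ι T v f) (hw : IsMild ι T w g) (h : IsGelfand ι) :
    IsMild ι T (fun s => v s - w s) (fun s => f s - g s) where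
  cont := hv.cont.sub hw.cont
  int := hv.int.sub hw.int
  eq t ht := by
    have h1 := intervalIntegrable_grp h (intervalIntegrable_sub hv.int ht)
    have h2 := intervalIntegrable_grp h (intervalIntegrable_sub hw.int ht)
    simp only [map_sub, smul_sub]
    rw [intervalIntegral.integral_sub h1 h2, hv.eq t ht, hw.eq t ht]
    abel

lemma norm_le (hv : IsMild ι T v f) (h : IsGelfand ι) {t : ℝ} (ht : t ∈ Icc 0 T) :
    ‖v t‖ ≤ ‖v 0‖ + ∫ s in 0..t, ‖f s‖ := by
  rw [← norm_grp h (-t) (v t), hv.eq t ht]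
  refine (norm_add_le _ _).trans (add_le_add_right ?_ _)
  refine (intervalIntegral.norm_integral_le_integral_norm ht.1).trans_eq ?_
  simp only [norm_neg_I_smul_grp h]

lemma congr {w g : ℝ → H} (hv : IsMild ι T v f) (hw : EqOn w v (Icc 0 T)) (hT : 0 ≤ T)
    (hg : ∀ᵐ s ∂(vol (Ioc 0 T)), g s = f s) : IsMild ι T w g where
  cont := hv.cont.congr hw
  int := hv.int.congr_ae (by rw [uIoc_of_le hT]; exact hg.mono fun _ h => h.symm)
  eq t ht := by
    rw [hw ht, hw ⟨le_rfl, hT⟩, hv.eq t ht]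
    congr 1
    refine intervalIntegral.integral_congr_ae_restrict ?_
    rw [uIoc_of_le ht.1]
    filter_upwards [ae_restrict_of_ae_restrict_of_subset (Ioc_subset_Ioc_right ht.2) hg] with s hs
    rw [hs]

end IsMild

lemma exists_isMild (h : IsGelfand ι) {T : ℝ} {f : ℝ → H}
    (hf : IntervalIntegrable f volume 0 T) (v₀ : H) : ∃ v, v 0 = v₀ ∧ IsMild ι T v f := by
  have hc : ContinuousOn (fun t => v₀ + ∫ s in 0..t, -I • TDKS.grp ι (-s) (f s)) (Icc 0 T) := by
    rcases le_total 0 T with hT | hT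
    · refine continuousOn_const.add ?_
      have := intervalIntegral.continuousOn_primitive_interval'
        (intervalIntegrable_grp h hf) left_mem_uIcc
      rwa [uIcc_of_le hT] at this
    · exact (subsingleton_Icc_of_ge hT).continuousOn _
  refine ⟨fun t => TDKS.grp ι t (v₀ + ∫ s in 0..t, -I • TDKS.grp ι (-s) (f s)),
    by simp [grp_zero h], ContinuousOn.grp h continuous_id hc, hf, fun t _ => ?_⟩
  simp [grp_zero h, grp_neg_grp h]

/-- Uniqueness in the very weak formulation, by the energy identity for `M⁻¹` of the difference. -/
lemma IsVeryWeak.isMild (h : IsGelfand ι) {T : ℝ} {v f : ℝ → H} (hv : IsVeryWeak ι T v f)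
    (hT : 0 ≤ T) (hc : ContinuousOn v (Icc 0 T)) (hf : IntervalIntegrable f volume 0 T) :
    IsMild ι T v f := by
  obtain ⟨w, hw0, hw⟩ := exists_isMild h hf (v 0)
  refine hw.congr (fun t ht => ?_) hT (.of_forall fun _ => rfl)
  have hz : ∀ s ∈ Icc 0 t, res ι (v s - w s) = res ι (v 0 - w 0)
      + ∫ r in 0..s, -I • (v r - w r) := by
    intro s hs
    have hs' : s ∈ Icc 0 T := ⟨hs.1, hs.2.trans ht.2⟩
    have h1 := hv s hs'
    have h2 := hw.isVeryWeak h s hs'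
    have hfs := intervalIntegrable_clm (res ι) (intervalIntegrable_sub hf hs')
    have h3 := intervalIntegral.integral_sub ((intervalIntegrable_of_cont hc hs').add hfs)
      ((intervalIntegrable_of_cont hw.cont hs').add hfs)
    simp only [add_sub_add_right_eq_sub] at h3
    rw [intervalIntegral.integral_smul, h3, ← h1, ← h2, hw0, sub_self, map_zero, zero_add,
      ← smul_sub, smul_smul]
    simp
  have hd : IntervalIntegrable (fun s => v s - w s) volume 0 t :=
    intervalIntegrable_of_cont (hc.sub hw.cont) ht
  have key := (integral_bilin_primitive (innerR H) ht.1 (hd.smul (-I)) (hd.smul (-I)) hz hz).2.2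
  simp only [innerR_apply, hw0, sub_self, map_zero, zero_add, Pi.smul_apply,
    inner_smul_left, inner_smul_right, Complex.conj_I, map_neg, neg_neg, inner_res_comm,
    intervalIntegral.integral_const_mul] at key
  rw [← sub_eq_zero]
  refine h.res_inj (inner_self_eq_zero (𝕜 := ℂ).mp ?_ |>.trans (map_zero _).symm)
  rw [inner_res_comm, key]
  ring

end Mild

/-! ### The regularised nonlinear equation -/

section Clip

variable {E : Type*} [NormedAddCommGroup E] [NormedSpace ℝ E]

/-- The radial retraction onto the ball of radius `m`. -/
def clip (m : ℝ) (x : E) : E := (m / max m ‖x‖) • x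

lemma clip_of_norm_le {m : ℝ} (hm : 0 < m) {x : E} (hx : ‖x‖ ≤ m) : clip m x = x := by
  rw [clip, max_eq_left hx, div_self hm.ne', one_smul]

lemma norm_clip_le {m : ℝ} (hm : 0 < m) (x : E) : ‖clip m x‖ ≤ m := by
  have h : 0 < max m ‖x‖ := lt_max_of_lt_left hm
  rw [clip, norm_smul, norm_eq_abs, abs_of_nonneg (by positivity), div_mul_eq_mul_div,
    div_le_iff₀ h]
  exact mul_le_left (le_max_right _ _) hm.le

lemma norm_clip_sub_le {m : ℝ} (hm : 0 < m) (x y : E) : ‖clip m x - clip m y‖ ≤ 2 * ‖x - y‖ := by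
  have hx : 0 < max m ‖x‖ := lt_max_of_lt_left hm
  have hy : 0 < max m ‖y‖ := lt_max_of_lt_left hm
  have e : clip m x - clip m y = (m / max m ‖x‖) • (x - y)
      + (m / max m ‖x‖ - m / max m ‖y‖) • y := by
    simp only [clip, smul_sub, sub_smul]; abel
  have h1 : ‖(m / max m ‖x‖) • (x - y)‖ ≤ ‖x - y‖ := by
    rw [norm_smul, norm_eq_abs, abs_of_nonneg (by positivity)]
    exact mul_le_of_le_one_left (norm_nonneg _) ((div_le_one hx).mpr (le_max_left _ _))
  have h2 : ‖(m / max m ‖x‖ - m / max m ‖y‖) • y‖ ≤ ‖x - y‖ := by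
    have h3 : |max m ‖y‖ - max m ‖x‖| ≤ ‖x - y‖ := by
      refine (abs_max_sub_max_le_max m ‖y‖ m ‖x‖).trans ?_
      rw [sub_self, abs_zero, max_eq_right (abs_nonneg _), abs_sub_comm]
      exact abs_norm_sub_norm_le x y
    rw [norm_smul, norm_eq_abs, div_sub_div _ _ hx.ne' hy.ne', abs_div,
      abs_of_pos (mul_pos hx hy), show m * max m ‖y‖ - max m ‖x‖ * m = m * (max m ‖y‖ - max m ‖x‖)
        by ring, abs_mul, abs_of_pos hm, div_mul_eq_mul_div, div_le_iff₀ (mul_pos hx hy)]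
    have := mul_le_mul (mul_le_mul (le_max_left m ‖x‖) h3 (abs_nonneg _) hx.le)
      (le_max_right m ‖y‖) (norm_nonneg _) (by positivity)
    linarith
  rw [e, two_mul]
  exact (norm_add_le _ _).trans (add_le_add h1 h2)

lemma continuous_clip {m : ℝ} (hm : 0 < m) : Continuous (clip m : E → E) :=
  (LipschitzWith.of_dist_le_mul (K := 2) fun x y => by
    rw [dist_eq_norm, dist_eq_norm]; exact norm_clip_sub_le hm x y).continuous

end Clip

/-- An absolutely continuous control with derivative `du`, bounded by `r` in the supremum norm and
in variation. -/
structure IsControl (T r : ℝ) (u du : ℝ → ℝ) : Prop where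
  cont : Continuous u
  bound : ∀ t, |u t| ≤ r
  int : IntervalIntegrable du volume 0 T
  prim : ∀ t ∈ Icc 0 T, u t = u 0 + ∫ s in 0..t, du s
  var : ∫ s in 0..T, |du s| ≤ r

section Abstract

open ContinuousLinearMap

variable {ι : V →L[ℂ] H}

/-- The properties of a nonlinearity `F` on the form domain with potential `G`: it is locally
Lipschitz with respect to the norm of `H`, preserves the charge, and its potential is bounded
below in terms of the charge. -/
structure IsNonlin (ι : V →L[ℂ] H) (F : V → H) (G : V → ℝ) (C : ℝ) : Prop where
  nonneg : 0 ≤ C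
  zero : F 0 = 0
  lip : ∀ p q, ‖F p - F q‖ ≤ C * (1 + ‖p‖ ^ 2 + ‖q‖ ^ 2) * ‖ι (p - q)‖
  sym : ∀ p, (inner ℂ (ι p) (F p)).im = 0
  deriv : ∀ (p : ℝ → V) (p' : V) (t : ℝ), HasDerivAt p p' t →
    HasDerivAt (fun s => G (p s)) (inner ℂ (F (p t)) (ι p')).re t
  lower : ∀ p, -(C * ‖ι p‖ ^ 2) ≤ G p
  upper : ∀ p, G p ≤ C * (‖p‖ ^ 2 + ‖p‖ ^ 4)

variable {F : V → H} {G : V → ℝ} {C : ℝ}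

namespace IsNonlin

lemma norm_le (hF : IsNonlin ι F G C) (p : V) : ‖F p‖ ≤ C * (1 + ‖p‖ ^ 2) * ‖ι p‖ := by
  have := hF.lip p 0
  simpa [hF.zero] using this

lemma lip_of_le (hF : IsNonlin ι F G C) {M : ℝ} {p q : V} (hp : ‖p‖ ≤ M) (hq : ‖q‖ ≤ M) :
    ‖F p - F q‖ ≤ C * (1 + 2 * M ^ 2) * ‖ι p - ι q‖ := by
  have hC := hF.nonneg
  have h1 : ‖p‖ ^ 2 ≤ M ^ 2 := pow_le_pow_left₀ (norm_nonneg _) hp 2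
  have h2 : ‖q‖ ^ 2 ≤ M ^ 2 := pow_le_pow_left₀ (norm_nonneg _) hq 2
  refine (hF.lip p q).trans ?_
  rw [map_sub]
  refine mul_le_right (mul_le_left (by linarith) hC)

lemma continuous (hF : IsNonlin ι F G C) : Continuous F := by
  rw [continuous_iff_continuousAt]
  intro p
  have hc : Continuous fun q : V => C * (1 + ‖q‖ ^ 2 + ‖p‖ ^ 2) * ‖ι (q - p)‖ := by fun_prop
  rw [ContinuousAt, tendsto_iff_norm_sub_tendsto_zero]
  refine squeeze_zero (fun _ => norm_nonneg _) (fun q => hF.lip q p) ?_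
  have := hc.tendsto p
  simpa using this

end IsNonlin

/-- The smoothing operator `(M⁻¹ + ε)⁻³ M⁻²`. -/
def smoothW (ι : V →L[ℂ] H) (ε : ℝ) : H →L[ℂ] H := regInv ι ε * (res ι * regInv ι ε) ^ 2

lemma adjoint_smoothW (ε : ℝ) (x : H) : adjoint ι (smoothW ι ε x) = smoothV ι ε x := rfl

lemma smoothW_eq (ε : ℝ) (x : H) :
    smoothW ι ε x = regInv ι ε (regInv ι ε (regInv ι ε (res ι (res ι x)))) := by
  simp [smoothW, pow_succ, res_regInv_comm]

lemma inner_smoothW_left (h : IsGelfand ι) {ε : ℝ} (hε : 0 < ε) (x y : H) :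
    inner ℂ (smoothW ι ε x) y = inner ℂ x (smoothW ι ε y) := by
  simp only [smoothW_eq, inner_regInv_left h hε, inner_res_comm, res_regInv_comm]

/-- The map that yields `smoothV` after composition with `M⁻²`. -/
def smoothA (ι : V →L[ℂ] H) (ε : ℝ) : H →L[ℂ] V := adjoint ι ∘L (regInv ι ε) ^ 3

lemma smoothA_res_res (ε : ℝ) (x : H) : smoothA ι ε (res ι (res ι x)) = smoothV ι ε x := by
  rw [← adjoint_smoothW, smoothW_eq]; simp [smoothA, pow_succ]

lemma apply_smoothA_res (ε : ℝ) (x : H) : ι (smoothA ι ε (res ι x)) = smoothW ι ε x := by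
  rw [smoothW_eq, ← res_regInv_comm, ← res_regInv_comm, ← res_regInv_comm, res_apply]
  simp [smoothA, pow_succ]
  rfl

lemma hasDerivAt_smoothV_grp (h : IsGelfand ι) (ε : ℝ) {k : ℝ → H} {k' : H} {t : ℝ}
    (hk : HasDerivAt k k' t) :
    HasDerivAt (fun s => smoothV ι ε (grp ι s (k s)))
      (-I • smoothA ι ε (res ι (grp ι t (k t))) + smoothV ι ε (grp ι t k')) t := by
  have h2 : HasDerivAt (fun s => (resExp ι s * res ι) (k s))
      ((-I • resExp ι t) (k t) + (resExp ι t * res ι) k') t := by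
    have hb : IsBoundedBilinearMap ℝ fun p : (H →L[ℂ] H) × H => p.1 p.2 :=
      { add_left := fun _ _ _ => rfl
        smul_left := fun _ _ _ => rfl
        add_right := fun L _ _ => map_add L _ _
        smul_right := fun c L x => by rw [← coe_smul, map_smul, coe_smul]
        bound := ⟨1, one_pos, fun L x => by simpa using L.le_opNorm x⟩ }
    have h3 := (hb.hasFDerivAt (resExp ι t * res ι, k t)).comp_hasDerivAt t
      ((hasDerivAt_resExp h t).prodMk hk)
    rw [add_comm]
    exact h3
  have h4 := (((smoothA ι ε).restrictScalars ℝ).hasFDerivAt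
    (x := (resExp ι t * res ι) (k t))).comp_hasDerivAt t h2
  convert h4 using 1
  · ext s
    simp only [Function.comp_apply, coe_restrictScalars', mul_app]
    rw [← smoothA_res_res, res_grp h, grp_res h, res_resExp h]
  · simp only [coe_restrictScalars', map_add, mul_app, smul_apply, map_smul]
    rw [← smoothA_res_res, res_grp h, grp_res h, res_grp h, grp_res h, res_resExp h]

lemma apply_deriv_smoothV_grp (h : IsGelfand ι) (ε t : ℝ) (x n : H) :
    ι (-I • smoothA ι ε (res ι x) + smoothV ι ε (grp ι t (-I • grp ι (-t) (smooth ι ε n))))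
      = -I • (smoothW ι ε x + smooth ι ε (smooth ι ε n)) := by
  rw [map_add, map_smul, apply_smoothA_res, map_smul, grp_grp_neg h, map_smul, map_smul,
    apply_smoothV, smul_add]

/-- The lower-order terms of the regularised equation. -/
def regTerm (ι : V →L[ℂ] H) (F : V → H) (U : H →L[ℂ] H) (ε a : ℝ) (x : H) : H :=
  F (smoothV ι ε x) + (a : ℂ) • U (smooth ι ε x)

variable {U : H →L[ℂ] H}

lemma im_inner_regTerm (hF : IsNonlin ι F G C) (hU : ∀ x y, inner ℂ (U x) y = inner ℂ x (U y))
    (ε a : ℝ) (x : H) : (inner ℂ (smooth ι ε x) (regTerm ι F U ε a x)).im = 0 := by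
  have h1 : (inner ℂ (smooth ι ε x) (U (smooth ι ε x))).im = 0 := by
    rw [← Complex.conj_eq_iff_im, inner_conj_symm, hU]
  rw [regTerm, inner_add_right, inner_smul_right, Complex.add_im, ← apply_smoothV, hF.sym,
    Complex.im_ofReal_mul, apply_smoothV, h1]
  simp

lemma continuous_regTerm (hF : IsNonlin ι F G C) {α : Type*} [TopologicalSpace α] {ε : ℝ}
    {a : α → ℝ} (ha : Continuous a) {x : α → H} (hx : Continuous x) :
    Continuous fun s => regTerm ι F U ε (a s) (x s) := by
  have := hF.continuous
  unfold regTerm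
  fun_prop

lemma norm_regTerm_sub_le (hF : IsNonlin ι F G C) (h : IsGelfand ι) {ε a r m : ℝ} (hε : 0 < ε)
    (ha : |a| ≤ r) {x y : H} (hx : ‖x‖ ≤ m) (hy : ‖y‖ ≤ m) :
    ‖regTerm ι F U ε a x - regTerm ι F U ε a y‖
      ≤ (C * (1 + 2 * (‖smoothV ι ε‖ * m) ^ 2) + r * ‖U‖) * ‖x - y‖ := by
  have e : regTerm ι F U ε a x - regTerm ι F U ε a y = (F (smoothV ι ε x) - F (smoothV ι ε y))
      + (a : ℂ) • U (smooth ι ε (x - y)) := by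
    simp only [regTerm, map_sub, smul_sub]; abel
  have h0 : ‖smooth ι ε (x - y)‖ ≤ ‖x - y‖ := norm_smooth_le h hε _
  have h1 := hF.lip_of_le (((smoothV ι ε).le_opNorm x).trans (mul_le_left hx))
    (((smoothV ι ε).le_opNorm y).trans (mul_le_left hy))
  rw [apply_smoothV, apply_smoothV, ← map_sub] at h1
  have hC := hF.nonneg
  rw [e, add_mul]
  refine (norm_add_le _ _).trans (add_le_add (h1.trans (mul_le_left h0)) ?_)
  rw [norm_smul, norm_coe, mul_assoc]
  exact mul_le_mul ha ((U.le_opNorm _).trans (mul_le_left h0))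
    (norm_nonneg _) ((abs_nonneg _).trans ha)

/-- The regularised equation has a global solution, since it conserves the charge. -/
lemma exists_regular (h : IsGelfand ι) (hF : IsNonlin ι F G C)
    (hU : ∀ x y, inner ℂ (U x) y = inner ℂ x (U y)) {T r : ℝ} (hT : 0 ≤ T) {u : ℝ → ℝ}
    (hu : Continuous u) (hr : ∀ t, |u t| ≤ r) {ε : ℝ} (hε : 0 < ε) (x₀ : H) :
    ∃ k : ℝ → H, Continuous k ∧ k 0 = x₀ ∧ ∀ t ∈ Icc 0 T, ‖k t‖ = ‖x₀‖ ∧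
      HasDerivAt k (-I • grp ι (-t) (smooth ι ε (regTerm ι F U ε (u t) (grp ι t (k t))))) t := by
  set m := ‖x₀‖ + 1 with hm_def
  have hm : 0 < m := by positivity
  have hC := hF.nonneg
  have hr0 : 0 ≤ r := (abs_nonneg _).trans (hr 0)
  let f : ℝ → H → H := fun s x => -I • grp ι (-s)
    (smooth ι ε (regTerm ι F U ε (u s) (grp ι s (clip m x))))
  have hfc : ∀ y : ℝ → H, Continuous y → Continuous fun s => f s (y s) := fun y hy => by
    refine (Continuous.grp h continuous_neg ((smooth ι ε).continuous.comp ?_)).const_smul _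
    exact continuous_regTerm hF hu (Continuous.grp h continuous_id ((continuous_clip hm).comp hy))
  obtain ⟨y, hy, hyeq⟩ := exists_volterra (f := f) hT
    (K := (C * (1 + 2 * (‖smoothV ι ε‖ * m) ^ 2) + r * ‖U‖) * 2) (by positivity) x₀
    (fun y hy => (hfc y hy).intervalIntegrable _ _) (fun s _ x x' => by
      simp only [f]
      rw [← smul_sub, ← map_sub, norm_neg_I_smul_grp h, ← map_sub]
      refine (norm_smooth_le h hε _).trans ((norm_regTerm_sub_le (m := m) hF h hε (hr s) ?_ ?_).trans ?_)
      · rw [norm_grp h]; exact norm_clip_le hm _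
      · rw [norm_grp h]; exact norm_clip_le hm _
      · rw [← map_sub, norm_grp h, mul_assoc]
        exact mul_le_left (norm_clip_sub_le hm _ _))
  have hre : ∀ s x, (inner ℂ x (f s x)).re = 0 := fun s x => by
    have hc : 0 < m / max m ‖x‖ := div_pos hm (lt_max_of_lt_left hm)
    have h1 := im_inner_regTerm hF hU (ε := ε) (u s) (grp ι s (clip m x))
    rw [clip, ← coe_smul, map_smul, map_smul, inner_smul_left, conj_ofReal,
      Complex.im_ofReal_mul, ← map_smul, coe_smul, ← clip] at h1
    have h2 := (mul_eq_zero.mp h1).resolve_left hc.ne'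
    simp only [f]
    rw [inner_smul_right, ← inner_grp_left h, ← inner_smooth_left h hε]
    simp [h2]
  set k : ℝ → H := fun t => x₀ + ∫ s in 0..t, f s (y s) with hk
  have hkd : ∀ t, HasDerivAt k (f t (y t)) t := fun t =>
    ((hfc y hy).integral_hasStrictDerivAt 0 t).hasDerivAt.const_add x₀
  have hn : ∀ t ∈ Icc 0 T, ‖k t‖ = ‖x₀‖ := fun t ht => by
    have h1 := eq_add_integral_of_hasDerivAt (f' := fun _ => 0) (fun s hs =>
      (hasDerivAt_norm_sq (hkd s)).congr_deriv (by
        rw [show k s = y s from (hyeq s hs).symm, hre, mul_zero])) continuous_const ht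
    rw [intervalIntegral.integral_zero, add_zero, sq_eq_sq₀ (norm_nonneg _) (norm_nonneg _)] at h1
    simpa [hk] using h1
  refine ⟨k, continuous_iff_continuousAt.2 fun t => (hkd t).continuousAt, by simp [hk],
    fun t ht => ⟨hn t ht, (hkd t).congr_deriv ?_⟩⟩
  rw [show y t = k t from hyeq t ht]
  simp only [f]
  rw [clip_of_norm_le hm (by rw [hn t ht]; linarith)]

end Abstract

section Abstract

open ContinuousLinearMap

variable {ι : V →L[ℂ] H} {F : V → H} {G : V → ℝ} {C : ℝ} {U : H →L[ℂ] H}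

/-- The square of the energy bound for initial data of norm `p` and controls of size `r`. -/
def energyBound (C K p r : ℝ) : ℝ :=
  p ^ 2 + 2 * (C * (p ^ 2 + p ^ 4)) + 2 * (C * p ^ 2) + 3 * (r * K * p ^ 2)

/-- The energy identity for the regularised equation. -/
lemma energy_deriv (h : IsGelfand ι) (hF : IsNonlin ι F G C) {ε : ℝ} (hε : 0 < ε) {a t : ℝ}
    {k : ℝ → H} {y : ℝ → V} {n : H} (hn : n = regTerm ι F U ε a (grp ι t (k t)))
    (hk : HasDerivAt k (-I • grp ι (-t) (smooth ι ε n)) t)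
    (hy : HasDerivAt y (-I • grpV ι (-t) (smoothV ι ε n)) t) (hyk : ι (y t) = k t) :
    HasDerivAt (fun s => 1 / 2 * ‖y s‖ ^ 2 + G (smoothV ι ε (grp ι s (k s))))
      (-(1 / 2) * a * (2 * (inner ℂ (U (smooth ι ε (grp ι t (k t))))
        (-I • (smoothW ι ε (grp ι t (k t)) + smooth ι ε (smooth ι ε n)))).re)) t := by
  set x := grp ι t (k t) with hx
  have hψ := hasDerivAt_smoothV_grp h ε hk
  have hG := hF.deriv _ _ _ hψ
  have hy2 := (hasDerivAt_norm_sq hy).const_mul (1 / 2)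
  refine (hy2.add hG).congr_deriv ?_
  have e1 : inner ℂ (y t) (-I • grpV ι (-t) (smoothV ι ε n)) = -I * inner ℂ (smoothW ι ε x) n := by
    rw [inner_smul_right, ← inner_grpV_left h, ← adjoint_smoothW, adjoint_inner_right,
      apply_grpV h, hyk, inner_smoothW_left h hε]
  rw [e1, apply_deriv_smoothV_grp h, ← hx]
  have e4 : F (smoothV ι ε x) = n - (a : ℂ) • U (smooth ι ε x) := by rw [hn, regTerm]; abel
  have e5 : (inner ℂ n (smooth ι ε (smooth ι ε n))).im = 0 := by
    rw [← inner_smooth_left h hε, ← Complex.conj_eq_iff_im, inner_conj_symm]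
  have e6 : (inner ℂ n (smoothW ι ε x)).im = - (inner ℂ (smoothW ι ε x) n).im := by
    rw [← inner_conj_symm, Complex.conj_im]
  rw [e4]
  simp only [inner_sub_left, inner_smul_left, inner_smul_right, inner_add_right, conj_ofReal,
    neg_mul, Complex.neg_re, Complex.I_mul_re, Complex.im_ofReal_mul, Complex.sub_im,
    Complex.add_im, e5, e6]
  ring

lemma norm_grp_smooth_le (h : IsGelfand ι) {ε : ℝ} (hε : 0 < ε) (t : ℝ) (x : H) :
    ‖smooth ι ε (grp ι t x)‖ ≤ ‖x‖ :=
  (norm_smooth_le h hε _).trans_eq (norm_grp h t x)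

/-- Solutions of the regularised equation are bounded in the form domain, uniformly in `ε`. The
time derivative of the control is moved from the charge to the control by partial integration. -/
lemma regular_bound (h : IsGelfand ι) (hF : IsNonlin ι F G C)
    (hU : ∀ x y, inner ℂ (U x) y = inner ℂ x (U y)) {T r : ℝ} {u du : ℝ → ℝ}
    (hu : IsControl T r u du) {ε : ℝ} (hε : 0 < ε) (p₀ : V) {k : ℝ → H} (hkc : Continuous k)
    (hk0 : k 0 = ι p₀) (hk : ∀ t ∈ Icc 0 T, ‖k t‖ = ‖ι p₀‖ ∧ HasDerivAt k (-I • grp ι (-t)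
        (smooth ι ε (regTerm ι F U ε (u t) (grp ι t (k t))))) t) {t : ℝ} (ht : t ∈ Icc 0 T) :
    ∃ y : V, ι y = k t ∧ ‖y‖ ^ 2 ≤ energyBound C ‖U‖ ‖p₀‖ r := by
  have hT : 0 ≤ T := ht.1.trans ht.2
  have hC := hF.nonneg
  have hr0 : 0 ≤ r := (abs_nonneg _).trans (hu.bound 0)
  have h0T : (0 : ℝ) ∈ Icc 0 T := ⟨le_rfl, hT⟩
  obtain ⟨n, hn⟩ : ∃ n : ℝ → H, ∀ s, n s = regTerm ι F U ε (u s) (grp ι s (k s)) := ⟨_, fun _ => rfl⟩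
  have hk' : ∀ s ∈ Icc 0 T, HasDerivAt k (-I • grp ι (-s) (smooth ι ε (n s))) s :=
    fun s hs => by rw [hn]; exact (hk s hs).2
  have hxc : Continuous fun s => grp ι s (k s) := Continuous.grp h continuous_id hkc
  have hnc : Continuous n := (continuous_regTerm hF hu.cont hxc).congr fun s => (hn s).symm
  have hdc : Continuous fun s => -I • grpV ι (-s) (smoothV ι ε (n s)) :=
    (Continuous.grpV h continuous_neg ((smoothV ι ε).continuous.comp hnc)).const_smul _
  have hdk : Continuous fun s => -I • grp ι (-s) (smooth ι ε (n s)) :=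
    (Continuous.grp h continuous_neg ((smooth ι ε).continuous.comp hnc)).const_smul _
  set y : ℝ → V := fun t => p₀ + ∫ s in 0..t, -I • grpV ι (-s) (smoothV ι ε (n s))
    with hy
  have hyd : ∀ s, HasDerivAt y (-I • grpV ι (-s) (smoothV ι ε (n s))) s := fun s =>
    (hdc.integral_hasStrictDerivAt 0 s).hasDerivAt.const_add p₀
  have hyk : ∀ s ∈ Icc 0 T, ι (y s) = k s := fun s hs => by
    have h2 := ι.intervalIntegral_comp_comm (hdc.intervalIntegrable (μ := volume) 0 s)
    simp only [map_smul, apply_grpV h, apply_smoothV] at h2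
    rw [hy, map_add, ← h2, ← hk0]
    exact (eq_add_integral_of_hasDerivAt hk' hdk hs).symm
  -- the charge in the potential `U`
  set q : ℝ → ℝ := fun s => (inner ℂ (U (smooth ι ε (grp ι s (k s))))
    (smooth ι ε (grp ι s (k s)))).re with hq
  set q' : ℝ → ℝ := fun s => 2 * (inner ℂ (U (smooth ι ε (grp ι s (k s))))
    (-I • (smoothW ι ε (grp ι s (k s)) + smooth ι ε (smooth ι ε (n s))))).re with hq'
  have hq'c : Continuous q' := by
    have := hnc
    have := hxc
    fun_prop
  have hqd : ∀ s ∈ Icc 0 T, HasDerivAt q (q' s) s := fun s hs => by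
    have h1 : HasDerivAt (fun s => smooth ι ε (grp ι s (k s))) _ s :=
      (((ι.restrictScalars ℝ).hasFDerivAt.comp_hasDerivAt s
        (hasDerivAt_smoothV_grp h ε (hk' s hs)))).congr_deriv (apply_deriv_smoothV_grp h ..)
    have h2 : HasDerivAt (fun s => U (smooth ι ε (grp ι s (k s)))) _ s :=
      (U.restrictScalars ℝ).hasFDerivAt.comp_hasDerivAt s h1
    refine (hasDerivAt_re_inner h2 h1).congr_deriv ?_
    rw [coe_restrictScalars', hU (-I • _), inner_re_symm' (-I • _), ← two_mul]
  have hqb : ∀ s ∈ Icc 0 T, |q s| ≤ ‖U‖ * ‖p₀‖ ^ 2 := fun s hs => by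
    have h1 : ‖smooth ι ε (grp ι s (k s))‖ ≤ ‖p₀‖ :=
      (norm_grp_smooth_le h hε _ _).trans ((hk s hs).1.trans_le (h.norm_le _))
    refine (abs_re_inner_le _ _).trans ?_
    rw [pow_two, ← mul_assoc]
    exact mul_le_mul ((U.le_opNorm _).trans (mul_le_left h1)) h1 (norm_nonneg _) (by positivity)
  set e : ℝ → ℝ := fun s => 1 / 2 * ‖y s‖ ^ 2 + G (smoothV ι ε (grp ι s (k s))) with he
  have hE : e t = e 0 + ∫ s in 0..t, -(1 / 2) * u s * q' s :=
    eq_add_integral_of_hasDerivAt (fun s hs =>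
      energy_deriv h hF hε (hn s) (hk' s hs) (hyd s) (hyk s hs))
      ((continuous_const.mul hu.cont).mul hq'c) ht
  have hQ : ∀ s ∈ Icc 0 t, q s = q 0 + ∫ r in 0..s, q' r := fun s hs =>
    eq_add_integral_of_hasDerivAt hqd hq'c ⟨hs.1, hs.2.trans ht.2⟩
  have hU' : ∀ s ∈ Icc 0 t, u s = u 0 + ∫ r in 0..s, du r :=
    fun s hs => hu.prim s ⟨hs.1, hs.2.trans ht.2⟩
  -- integration by parts in time: `q` is bounded uniformly in `ε`, its derivative is not
  have hP := integral_bilin_primitive (ContinuousLinearMap.mul ℝ ℝ) ht.1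
    (intervalIntegrable_sub hu.int ht) (hq'c.intervalIntegrable (μ := volume) 0 t) hU' hQ
  simp only [ContinuousLinearMap.mul_apply'] at hP
  have hI : |∫ s in 0..t, du s * q s| ≤ r * (‖U‖ * ‖p₀‖ ^ 2) := by
    have h1 : ‖∫ s in 0..t, du s * q s‖ ≤ ∫ s in 0..t, |du s| * (‖U‖ * ‖p₀‖ ^ 2) := by
      refine intervalIntegral.norm_integral_le_of_norm_le ht.1 (.of_forall fun s hs => ?_)
        ((intervalIntegrable_sub hu.int ht).abs.mul_const _)
      rw [norm_eq_abs, abs_mul]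
      exact mul_le_left (hqb s ⟨hs.1.le, hs.2.trans ht.2⟩)
    rw [intervalIntegral.integral_mul_const] at h1
    refine h1.trans (mul_le_right (le_trans ?_ hu.var))
    exact intervalIntegral.integral_mono_interval le_rfl ht.1 ht.2
      (.of_forall fun _ => abs_nonneg _) hu.int.abs
  have hb : ∀ s ∈ Icc 0 T, |u s * q s| ≤ r * (‖U‖ * ‖p₀‖ ^ 2) := fun s hs => by
    rw [abs_mul]; exact mul_le_mul (hu.bound s) (hqb s hs) (abs_nonneg _) hr0
  have hI2 : (∫ s in 0..t, -(1 / 2) * u s * q' s) = -(1 / 2) * ∫ s in 0..t, u s * q' s := by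
    rw [← intervalIntegral.integral_const_mul]
    simp only [mul_assoc]
  refine ⟨y t, hyk t ht, ?_⟩
  have hlow : -(C * ‖p₀‖ ^ 2) ≤ G (smoothV ι ε (grp ι t (k t))) := by
    refine le_trans ?_ (hF.lower _)
    rw [apply_smoothV, neg_le_neg_iff]
    refine mul_le_left (pow_le_pow_left₀ (norm_nonneg _) ?_ 2) hC
    exact (norm_grp_smooth_le h hε _ _).trans ((hk t ht).1.trans_le (h.norm_le _))
  have hup : e 0 ≤ 1 / 2 * ‖p₀‖ ^ 2 + C * (‖p₀‖ ^ 2 + ‖p₀‖ ^ 4) := by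
    have h1 : ‖smoothV ι ε (ι p₀)‖ ≤ ‖p₀‖ := norm_smoothV_le h hε p₀
    have h2 := hF.upper (smoothV ι ε (ι p₀))
    have h3 : C * (‖smoothV ι ε (ι p₀)‖ ^ 2 + ‖smoothV ι ε (ι p₀)‖ ^ 4)
      ≤ C * (‖p₀‖ ^ 2 + ‖p₀‖ ^ 4) := by gcongr
    simp only [he, hy, hk0, grp_zero h, integral_same, add_zero]
    linarith
  have a1 := abs_le.mp (hb t ht)
  have a2 := abs_le.mp (hb 0 h0T)
  have a3 := abs_le.mp hI
  have a4 := hP.2.2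
  rw [hI2] at hE
  have a5 : e t = 1 / 2 * ‖y t‖ ^ 2 + G (smoothV ι ε (grp ι t (k t))) := rfl
  unfold energyBound
  linarith

end Abstract

/-! ### Existence of mild solutions -/

section Abstract

open ContinuousLinearMap Filter Topology

variable {ι : V →L[ℂ] H} {F : V → H} {G : V → ℝ} {C : ℝ} {U : H →L[ℂ] H}

/-- Limits in `H` of bounded sequences of `V` belong to `V`. -/
lemma exists_of_tendsto (h : IsGelfand ι) {M : ℝ} (hM : 0 ≤ M) {p : ℕ → V} {x : H}
    (hp : ∀ k, ‖p k‖ ≤ M) (hx : Tendsto (fun k => ι (p k)) atTop (𝓝 x)) :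
    ∃ q : V, ι q = x ∧ ‖q‖ ≤ M := by
  obtain ⟨q, hq, hqx⟩ := exists_adjoint_eq_of_bound (adjoint ι) h.adjoint_dense x hM fun z => by
    refine le_of_tendsto ((hx.inner (tendsto_const_nhds (x := z))).norm) (.of_forall fun k => ?_)
    rw [← adjoint_inner_right]
    exact (norm_inner_le_norm _ _).trans (mul_le_right (hp k))
  exact ⟨q, by rwa [adjoint_adjoint] at hqx, hq⟩

lemma norm_regTerm_le (hF : IsNonlin ι F G C) (h : IsGelfand ι) {ε a r M : ℝ} (hε : 0 < ε)
    (ha : |a| ≤ r) {y : V} (hy : ‖y‖ ≤ M) :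
    ‖regTerm ι F U ε a (ι y)‖ ≤ (C * (1 + 2 * M ^ 2) + r * ‖U‖) * M := by
  have hC := hF.nonneg
  have hM := (norm_nonneg _).trans hy
  have h1 : ‖smoothV ι ε (ι y)‖ ≤ M := (norm_smoothV_le h hε y).trans hy
  have h2 : ‖smooth ι ε (ι y)‖ ≤ M := (norm_smooth_le h hε _).trans ((h.norm_le y).trans hy)
  have h3 := hF.lip_of_le h1 (q := 0) (by simpa using hM)
  rw [hF.zero, map_zero, sub_zero, sub_zero, apply_smoothV] at h3
  rw [regTerm, add_mul]
  refine (norm_add_le _ _).trans (add_le_add (h3.trans (mul_le_left h2)) ?_)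
  rw [norm_smul, norm_coe, mul_assoc]
  exact mul_le_mul ha ((U.le_opNorm _).trans (mul_le_left h2))
    (norm_nonneg _) ((abs_nonneg _).trans ha)

lemma norm_regTerm_sub_regTerm_le (hF : IsNonlin ι F G C) (h : IsGelfand ι) {ε δ a r M : ℝ}
    (hε : 0 < ε) (hδ : 0 < δ) (ha : |a| ≤ r) {y z : V} (hy : ‖y‖ ≤ M) (hz : ‖z‖ ≤ M) :
    ‖regTerm ι F U ε a (ι y) - regTerm ι F U δ a (ι z)‖ ≤ (C * (1 + 2 * M ^ 2) + r * ‖U‖)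
        * (‖ι y - ι z‖ + 3 * M * (√(2 * ε) + √(2 * δ))) := by
  have hC := hF.nonneg
  have hr := (abs_nonneg _).trans ha
  have h0 : ‖smooth ι ε (ι y) - smooth ι δ (ι z)‖
      ≤ ‖ι y - ι z‖ + 3 * M * (√(2 * ε) + √(2 * δ)) := by
    have e : smooth ι ε (ι y) - smooth ι δ (ι z) = (ι y - ι z) - (ι y - smooth ι ε (ι y))
        + (ι z - smooth ι δ (ι z)) := by abel
    have h1 := norm_sub_smooth_le h hε y
    have h2 := norm_sub_smooth_le h hδ z
    have h3 : 3 * √(2 * ε) * ‖y‖ ≤ 3 * √(2 * ε) * M := by gcongr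
    have h4 : 3 * √(2 * δ) * ‖z‖ ≤ 3 * √(2 * δ) * M := by gcongr
    rw [e]
    refine (norm_add_le _ _).trans ((add_le_add_left (norm_sub_le _ _) _).trans ?_)
    linarith
  have e : regTerm ι F U ε a (ι y) - regTerm ι F U δ a (ι z)
      = (F (smoothV ι ε (ι y)) - F (smoothV ι δ (ι z)))
        + (a : ℂ) • U (smooth ι ε (ι y) - smooth ι δ (ι z)) := by
    simp only [regTerm, map_sub, smul_sub]; abel
  have h1 := hF.lip_of_le ((norm_smoothV_le h hε y).trans hy) ((norm_smoothV_le h hδ z).trans hz)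
  rw [apply_smoothV, apply_smoothV] at h1
  rw [e, add_mul]
  refine (norm_add_le _ _).trans (add_le_add (h1.trans (mul_le_left h0)) ?_)
  rw [norm_smul, norm_coe, mul_assoc]
  exact mul_le_mul ha ((U.le_opNorm _).trans (mul_le_left h0)) (norm_nonneg _) hr

/-- The difference of two regularised solutions: the smoothing operators are moved to the
difference, where they are close to the identity because it is bounded in `V`. -/
lemma regular_diff (h : IsGelfand ι) (hF : IsNonlin ι F G C) {ε δ a r M : ℝ} (hε : 0 < ε)
    (hδ : 0 < δ) (ha : |a| ≤ r) {y z : V} (hy : ‖y‖ ≤ M) (hz : ‖z‖ ≤ M) :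
    ‖inner ℂ (ι y - ι z) (smooth ι ε (regTerm ι F U ε a (ι y))
        - smooth ι δ (regTerm ι F U δ a (ι z)))‖
      ≤ (C * (1 + 2 * M ^ 2) + r * ‖U‖)
        * (‖ι y - ι z‖ ^ 2 + 12 * M ^ 2 * (√(2 * ε) + √(2 * δ))) := by
  have hM := (norm_nonneg _).trans hy
  have hC := hF.nonneg
  have hr := (abs_nonneg _).trans ha
  set K := C * (1 + 2 * M ^ 2) + r * ‖U‖ with hK
  have hK0 : 0 ≤ K := by positivity
  have hyz : ‖y - z‖ ≤ 2 * M := (norm_sub_le _ _).trans (by linarith)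
  have hX : ‖ι y - ι z‖ ≤ 2 * M := by rw [← map_sub]; exact (h.norm_le _).trans hyz
  set n₁ := regTerm ι F U ε a (ι y)
  set n₂ := regTerm ι F U δ a (ι z)
  have e : inner ℂ (ι y - ι z) (smooth ι ε n₁ - smooth ι δ n₂)
      = inner ℂ (ι y - ι z) (n₁ - n₂) - inner ℂ (ι (y - z) - smooth ι ε (ι (y - z))) n₁
        + inner ℂ (ι (y - z) - smooth ι δ (ι (y - z))) n₂ := by
    rw [inner_sub_right, ← inner_smooth_left h hε, ← inner_smooth_left h hδ]
    simp only [inner_sub_left, inner_sub_right, map_sub]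
    ring
  have b1 : ‖inner ℂ (ι y - ι z) (n₁ - n₂)‖
      ≤ ‖ι y - ι z‖ * (K * (‖ι y - ι z‖ + 3 * M * (√(2 * ε) + √(2 * δ)))) :=
    (norm_inner_le_norm _ _).trans (mul_le_left (norm_regTerm_sub_regTerm_le hF h hε hδ ha hy hz))
  have b2 : ‖inner ℂ (ι (y - z) - smooth ι ε (ι (y - z))) n₁‖
      ≤ (3 * √(2 * ε) * (2 * M)) * (K * M) :=
    (norm_inner_le_norm _ _).trans (mul_le_mul ((norm_sub_smooth_le h hε _).trans
      (mul_le_left hyz)) (norm_regTerm_le hF h hε ha hy)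
      (norm_nonneg _) (by positivity))
  have b3 : ‖inner ℂ (ι (y - z) - smooth ι δ (ι (y - z))) n₂‖
      ≤ (3 * √(2 * δ) * (2 * M)) * (K * M) :=
    (norm_inner_le_norm _ _).trans (mul_le_mul ((norm_sub_smooth_le h hδ _).trans
      (mul_le_left hyz)) (norm_regTerm_le hF h hδ ha hz)
      (norm_nonneg _) (by positivity))
  have b4 : ‖ι y - ι z‖ * (K * (3 * M * (√(2 * ε) + √(2 * δ))))
      ≤ 2 * M * (K * (3 * M * (√(2 * ε) + √(2 * δ)))) :=
    mul_le_right hX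
  rw [e]
  refine (norm_add_le _ _).trans ((add_le_add_left (norm_sub_le _ _) _).trans ?_)
  nlinarith [b1, b2, b3, b4]

/-- Two regularised solutions differ by `O(√ε + √δ)` in the square of the norm. -/
lemma regular_cauchy (h : IsGelfand ι) (hF : IsNonlin ι F G C) {T r M ε δ : ℝ} {u : ℝ → ℝ}
    (hu : Continuous u) (hr : ∀ t, |u t| ≤ r) (hε : 0 < ε) (hδ : 0 < δ) {k l : ℝ → H}
    (hT : 0 ≤ T)
    (hkc : Continuous k) (hlc : Continuous l) (h0 : k 0 = l 0)
    (hk : ∀ t ∈ Icc 0 T, (∃ y : V, ι y = k t ∧ ‖y‖ ≤ M) ∧ HasDerivAt k (-I • grp ι (-t)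
        (smooth ι ε (regTerm ι F U ε (u t) (grp ι t (k t))))) t)
    (hl : ∀ t ∈ Icc 0 T, (∃ y : V, ι y = l t ∧ ‖y‖ ≤ M) ∧ HasDerivAt l (-I • grp ι (-t)
        (smooth ι δ (regTerm ι F U δ (u t) (grp ι t (l t))))) t) {t : ℝ} (ht : t ∈ Icc 0 T) :
    ‖k t - l t‖ ^ 2 ≤ (2 * (C * (1 + 2 * M ^ 2) + r * ‖U‖) * (12 * M ^ 2) * T
      * Real.exp (2 * (C * (1 + 2 * M ^ 2) + r * ‖U‖) * T)) * (√(2 * ε) + √(2 * δ)) := by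
  have hC := hF.nonneg
  have hr0 := (abs_nonneg _).trans (hr 0)
  set K := C * (1 + 2 * M ^ 2) + r * ‖U‖ with hK
  have hK0 : 0 ≤ K := by positivity
  set σ := √(2 * ε) + √(2 * δ) with hσ
  obtain ⟨f, hf⟩ : ∃ f : ℝ → H, ∀ s, f s = -I • grp ι (-s)
        (smooth ι ε (regTerm ι F U ε (u s) (grp ι s (k s)))) := ⟨_, fun _ => rfl⟩
  obtain ⟨g, hg⟩ : ∃ g : ℝ → H, ∀ s, g s = -I • grp ι (-s)
        (smooth ι δ (regTerm ι F U δ (u s) (grp ι s (l s)))) := ⟨_, fun _ => rfl⟩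
  have hfc : Continuous f := ((Continuous.grp h continuous_neg ((smooth ι ε).continuous.comp
    (continuous_regTerm hF hu (Continuous.grp h continuous_id hkc)))).const_smul
      (-I)).congr fun s => (hf s).symm
  have hgc : Continuous g := ((Continuous.grp h continuous_neg ((smooth ι δ).continuous.comp
    (continuous_regTerm hF hu (Continuous.grp h continuous_id hlc)))).const_smul
      (-I)).congr fun s => (hg s).symm
  have hd : ∀ s ∈ Icc 0 T, HasDerivAt (fun s => ‖k s - l s‖ ^ 2)
      (2 * (inner ℂ (k s - l s) (f s - g s)).re) s := fun s hs => by
    have h1 : HasDerivAt (fun s => k s - l s) (f s - g s) s := by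
      rw [hf, hg]; exact (hk s hs).2.sub (hl s hs).2
    exact hasDerivAt_norm_sq h1
  have hle : ∀ s ∈ Icc 0 T, 2 * (inner ℂ (k s - l s) (f s - g s)).re
      ≤ 2 * K * (‖k s - l s‖ ^ 2 + 12 * M ^ 2 * σ) := fun s hs => by
    obtain ⟨y, hy, hyM⟩ := (hk s hs).1
    obtain ⟨z, hz, hzM⟩ := (hl s hs).1
    have h1 := regular_diff (U := U) h hF hε hδ (hr s) (y := grpV ι s y) (z := grpV ι s z)
      (M := M) (by rwa [norm_grpV h]) (by rwa [norm_grpV h])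
    rw [apply_grpV h, apply_grpV h, hy, hz, ← map_sub, norm_grp h] at h1
    have h2 : inner ℂ (k s - l s) (f s - g s) = -I * inner ℂ (grp ι s (k s - l s))
        (smooth ι ε (regTerm ι F U ε (u s) (grp ι s (k s)))
          - smooth ι δ (regTerm ι F U δ (u s) (grp ι s (l s)))) := by
      rw [hf, hg, ← smul_sub, ← map_sub, inner_smul_right, inner_grp_left h]
    have h3 : (inner ℂ (k s - l s) (f s - g s)).re ≤ ‖inner ℂ (k s - l s) (f s - g s)‖ :=
      Complex.re_le_norm _
    rw [h2, norm_mul, norm_neg, Complex.norm_I, one_mul, ← h2] at h3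
    linarith
  have hcd : Continuous fun s => 2 * (inner ℂ (k s - l s) (f s - g s)).re := by fun_prop
  have hcn : Continuous fun s => ‖k s - l s‖ ^ 2 := by fun_prop
  have key := gronwall_const (g := fun s => ‖k s - l s‖ ^ 2) (T := T)
    (a := 2 * K * (12 * M ^ 2 * σ) * T) (K := 2 * K) (by positivity) (by positivity)
    hcn.continuousOn (fun s hs => by
      have h1 := eq_add_integral_of_hasDerivAt hd hcd hs
      simp only [h0, sub_self, norm_zero] at h1
      have h2 := integral_mono_on hs.1 (hcd.intervalIntegrable (μ := volume) 0 s)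
        ((((hcn.const_mul (2 * K)).add_const (2 * K * (12 * M ^ 2 * σ)))).intervalIntegrable 0 s)
        (fun r hr => (hle r ⟨hr.1, hr.2.trans hs.2⟩).trans_eq (mul_add _ _ _))
      rw [intervalIntegral.integral_add ((hcn.const_mul (2 * K)).intervalIntegrable _ _)
        (by simp), intervalIntegral.integral_const] at h2
      have h3 : (s - 0) • (2 * K * (12 * M ^ 2 * σ)) ≤ 2 * K * (12 * M ^ 2 * σ) * T := by
        rw [smul_eq_mul, sub_zero, mul_comm]
        exact mul_le_left hs.2
      linarith) t ht
  refine key.trans_eq ?_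
  ring

lemma IsNonlin.tendsto_comp (hF : IsNonlin ι F G C) {α : Type*} {l : Filter α} {M : ℝ} {p : α → V}
    {q : V} (hp : ∀ᶠ a in l, ‖p a‖ ≤ M) (hq : ‖q‖ ≤ M) (hpq : Tendsto (fun a => ι (p a)) l (𝓝 (ι q))) :
    Tendsto (fun a => F (p a)) l (𝓝 (F q)) := by
  rw [tendsto_iff_norm_sub_tendsto_zero] at hpq ⊢
  refine squeeze_zero' (.of_forall fun _ => norm_nonneg _)
    (hp.mono fun a ha => hF.lip_of_le ha hq) ?_
  simpa using hpq.const_mul (C * (1 + 2 * M ^ 2))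

lemma IsNonlin.continuousOn_comp (hF : IsNonlin ι F G C) {S : Set ℝ} {M : ℝ} {p : ℝ → V}
    (hp : ∀ t ∈ S, ‖p t‖ ≤ M) (hc : ContinuousOn (fun t => ι (p t)) S) :
    ContinuousOn (fun t => F (p t)) S := fun t ht =>
  hF.tendsto_comp (eventually_nhdsWithin_of_forall hp) (hp t ht) (hc t ht)

lemma tendsto_smooth_seq (h : IsGelfand ι) {ε : ℕ → ℝ} (hε : ∀ k, 0 < ε k)
    (hε0 : Tendsto ε atTop (𝓝 0)) {x : ℕ → H} {y : H} (hx : Tendsto x atTop (𝓝 y)) :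
    Tendsto (fun k => smooth ι (ε k) (x k)) atTop (𝓝 y) := by
  have h1 : Tendsto (fun k => smooth ι (ε k) y) atTop (𝓝 y) :=
    (tendsto_smooth h y).comp (tendsto_nhdsWithin_iff.mpr ⟨hε0, .of_forall hε⟩)
  have h2 : Tendsto (fun k => smooth ι (ε k) (x k - y)) atTop (𝓝 0) :=
    squeeze_zero_norm (fun k => norm_smooth_le h (hε k) _) (tendsto_iff_norm_sub_tendsto_zero.mp hx)
  have := h2.add h1
  simpa using this

/-- Existence of a mild solution that stays bounded in the form domain. -/
lemma exists_mild_solution (h : IsGelfand ι) (hF : IsNonlin ι F G C)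
    (hU : ∀ x y, inner ℂ (U x) y = inner ℂ x (U y)) {T r : ℝ} (hT : 0 ≤ T) {u du : ℝ → ℝ}
    (hu : IsControl T r u du) (p₀ : V) :
    ∃ ψ : ℝ → V, ψ 0 = p₀ ∧ (∀ t ∈ Icc 0 T, ‖ψ t‖ ≤ √(energyBound C ‖U‖ ‖p₀‖ r)) ∧
      IsMild ι T (fun t => ι (ψ t)) (fun t => F (ψ t) + (u t : ℂ) • U (ι (ψ t))) := by
  have hC := hF.nonneg
  have hr0 : 0 ≤ r := (abs_nonneg _).trans (hu.bound 0)
  set M := √(energyBound C ‖U‖ ‖p₀‖ r) with hM_def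
  have hM : 0 ≤ M := Real.sqrt_nonneg _
  have h0T : (0 : ℝ) ∈ Icc 0 T := ⟨le_rfl, hT⟩
  set ε : ℕ → ℝ := fun k => 1 / ((k : ℝ) + 1) with hε_def
  have hε : ∀ k, 0 < ε k := fun k => by positivity
  have hε0 : Tendsto ε atTop (𝓝 0) := tendsto_one_div_add_atTop_nhds_zero_nat
  choose k hkc hk0 hk using fun j => exists_regular h hF hU hT hu.cont hu.bound (hε j) (ι p₀)
  have hkV : ∀ j, ∀ t ∈ Icc 0 T, ∃ y : V, ι y = k j t ∧ ‖y‖ ≤ M := fun j t ht => by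
    obtain ⟨y, hy, hyM⟩ := regular_bound h hF hU hu (hε j) p₀ (hkc j) (hk0 j) (hk j) ht
    exact ⟨y, hy, Real.le_sqrt_of_sq_le hyM⟩
  set K := C * (1 + 2 * M ^ 2) + r * ‖U‖ with hK
  have hK0 : 0 ≤ K := by positivity
  set c := 2 * K * (12 * M ^ 2) * T * Real.exp (2 * K * T) with hc
  have hc0 : 0 ≤ c := by positivity
  -- the rate from `regular_cauchy`
  set b : ℕ → ℝ := fun j => √(c * (2 * √(2 * ε j))) with hb
  have hb0 : Tendsto b atTop (𝓝 0) := by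
    have h1 : Continuous fun e : ℝ => √(c * (2 * √(2 * e))) := by fun_prop
    have h2 : Tendsto b atTop (𝓝 (√(c * (2 * √(2 * 0))))) := (h1.tendsto 0).comp hε0
    rwa [mul_zero, Real.sqrt_zero, mul_zero, mul_zero, Real.sqrt_zero] at h2
  have hdist : ∀ t ∈ Icc 0 T, ∀ i j, i ≤ j → dist (k i t) (k j t) ≤ b i := fun t ht i j hij => by
    have h1 := regular_cauchy h hF hu.cont hu.bound (hε i) (hε j) hT (hkc i) (hkc j)
      ((hk0 i).trans (hk0 j).symm) (fun s hs => ⟨hkV i s hs, (hk i s hs).2⟩)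
      (fun s hs => ⟨hkV j s hs, (hk j s hs).2⟩) ht
    rw [dist_eq_norm]
    refine Real.le_sqrt_of_sq_le (h1.trans (mul_le_left ?_ hc0))
    have h2 : ε j ≤ ε i := one_div_le_one_div_of_le (by positivity) (by gcongr)
    have h3 : √(2 * ε j) ≤ √(2 * ε i) := Real.sqrt_le_sqrt (by linarith)
    linarith
  have hlim : ∀ t ∈ Icc 0 T, ∃ x : H, Tendsto (fun j => k j t) atTop (𝓝 x) := fun t ht =>
    cauchySeq_tendsto_of_complete (cauchySeq_of_le_tendsto_0' b (hdist t ht) hb0)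
  choose! L hL using hlim
  have hLc : ContinuousOn L (Icc 0 T) := by
    refine TendstoUniformlyOn.continuousOn (F := k) (p := atTop) ?_
      (Frequently.of_forall fun j => (hkc j).continuousOn)
    rw [Metric.tendstoUniformlyOn_iff]
    intro e he
    filter_upwards [hb0.eventually_lt_const he] with j hj t ht
    refine lt_of_le_of_lt ?_ hj
    rw [dist_comm]
    exact le_of_tendsto (tendsto_const_nhds.dist (hL t ht))
      ((eventually_ge_atTop j).mono fun i hi => hdist t ht j i hi)
  have hψ : ∀ t ∈ Icc 0 T, ∃ q : V, ι q = grp ι t (L t) ∧ ‖q‖ ≤ M := fun t ht => by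
    choose y hy hyM using fun j => hkV j t ht
    refine exists_of_tendsto h hM (p := fun j => grpV ι t (y j))
      (fun j => by rw [norm_grpV h]; exact hyM j) ?_
    simp only [apply_grpV h, hy]
    exact ((grp ι t).continuous.tendsto _).comp (hL t ht)
  choose! ψ hψ using hψ
  have hL0 : L 0 = ι p₀ := tendsto_nhds_unique (hL 0 h0T) (by simp only [hk0]; exact tendsto_const_nhds)
  have hψc : ContinuousOn (fun t => ι (ψ t)) (Icc 0 T) :=
    (ContinuousOn.grp h continuous_id hLc).congr fun t ht => (hψ t ht).1
  have hNc : ContinuousOn (fun t => F (ψ t) + (u t : ℂ) • U (ι (ψ t))) (Icc 0 T) :=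
    (hF.continuousOn_comp (fun t ht => (hψ t ht).2) hψc).add
      ((Complex.continuous_ofReal.comp hu.cont).continuousOn.smul (U.continuous.comp_continuousOn hψc))
  refine ⟨ψ, ?_, fun t ht => (hψ t ht).2, hψc, intervalIntegrable_of_cont hNc ⟨hT, le_rfl⟩,
    fun t ht => ?_⟩
  · apply h.inj
    rw [(hψ 0 h0T).1, grp_zero h, hL0]
  rw [(hψ t ht).1, (hψ 0 h0T).1, grp_zero h, grp_neg_grp h, hL0]
  -- pass to the limit in the integrated regularised equation
  obtain ⟨f, hf⟩ : ∃ f : ℕ → ℝ → H, ∀ j s, f j s = -I • grp ι (-s)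
      (smooth ι (ε j) (regTerm ι F U (ε j) (u s) (grp ι s (k j s)))) := ⟨_, fun _ _ => rfl⟩
  have hfc : ∀ j, Continuous (f j) := fun j =>
    ((Continuous.grp h continuous_neg ((smooth ι (ε j)).continuous.comp
      (continuous_regTerm hF hu.cont (Continuous.grp h continuous_id (hkc j))))).const_smul
        (-I)).congr fun s => (hf j s).symm
  have hkeq : ∀ j, k j t = ι p₀ + ∫ s in 0..t, f j s := fun j => by
    rw [eq_add_integral_of_hasDerivAt (fun s hs => (hk j s hs).2) ((hfc j).congr (hf j)) ht, hk0]
    simp only [hf]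
  refine tendsto_nhds_unique (hL t ht) ?_
  simp only [hkeq]
  refine tendsto_const_nhds.add (intervalIntegral.tendsto_integral_filter_of_dominated_convergence
    (fun _ => K * M) (.of_forall fun j => (hfc j).aestronglyMeasurable)
    (.of_forall fun j => .of_forall fun s hs => ?_) (by simp)
    (.of_forall fun s hs => ?_))
  · rw [uIoc_of_le ht.1] at hs
    obtain ⟨y, hy, hyM⟩ := hkV j s ⟨hs.1.le, hs.2.trans ht.2⟩
    rw [hf, norm_neg_I_smul_grp h, ← hy, ← apply_grpV h]
    exact (norm_smooth_le h (hε j) _).trans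
      (norm_regTerm_le hF h (hε j) (hu.bound s) (by rwa [norm_grpV h]))
  · rw [uIoc_of_le ht.1] at hs
    have hsT : s ∈ Icc 0 T := ⟨hs.1.le, hs.2.trans ht.2⟩
    have h1 : Tendsto (fun j => grp ι s (k j s)) atTop (𝓝 (ι (ψ s))) := by
      rw [(hψ s hsT).1]
      exact ((grp ι s).continuous.tendsto _).comp (hL s hsT)
    have h2 := tendsto_smooth_seq h hε hε0 h1
    have h3 : Tendsto (fun j => regTerm ι F U (ε j) (u s) (grp ι s (k j s))) atTop
        (𝓝 (F (ψ s) + (u s : ℂ) • U (ι (ψ s)))) := by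
      refine (hF.tendsto_comp (M := M) (.of_forall fun j => ?_) (hψ s hsT).2 ?_).add
        (((U.continuous.tendsto _).comp h2).const_smul _)
      · obtain ⟨y, hy, hyM⟩ := hkV j s hsT
        rw [← hy, ← apply_grpV h]
        exact (norm_smoothV_le h (hε j) _).trans (by rwa [norm_grpV h])
      · simpa only [apply_smoothV] using h2
    simp only [hf]
    exact (((grp ι (-s)).continuous.tendsto _).comp
      (tendsto_smooth_seq h hε hε0 h3)).const_smul (-I)

end Abstract

/-! ### Stability and regularity of mild solutions -/

section Abstract

open ContinuousLinearMap Filter Topology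

variable {ι : V →L[ℂ] H} {F : V → H} {G : V → ℝ} {C : ℝ} {U : H →L[ℂ] H}

lemma IsMild.norm_sub_le_exp (h : IsGelfand ι) {T : ℝ} {v w f g : ℝ → H} (hv : IsMild ι T v f)
    (hw : IsMild ι T w g) {c b : ℝ → ℝ} (hc : IntervalIntegrable c volume 0 T)
    (hb : IntervalIntegrable b volume 0 T) (hc0 : ∀ s ∈ Icc 0 T, 0 ≤ c s)
    (hb0 : ∀ s ∈ Icc 0 T, 0 ≤ b s)
    (hle : ∀ᵐ s ∂vol (Ioc 0 T), ‖f s - g s‖ ≤ c s * ‖v s - w s‖ + b s)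
    {t : ℝ} (ht : t ∈ Icc 0 T) :
    ‖v t - w t‖ ≤ (‖v 0 - w 0‖ + ∫ s in 0..T, b s) * Real.exp (∫ s in 0..t, c s) := by
  have hd := hv.sub hw h
  have hT : 0 ≤ T := ht.1.trans ht.2
  refine gronwall_integral (g := fun t => ‖v t - w t‖) hc hc0 hd.cont.norm (fun t ht => ?_) t ht
  have hbt := intervalIntegrable_sub hb ht
  have hct : IntervalIntegrable (fun s => c s * ‖v s - w s‖) volume 0 t :=
    (intervalIntegrable_sub hc ht).mul_continuousOn (by
      rw [uIcc_of_le ht.1]; exact hd.cont.norm.mono (Icc_subset_Icc_right ht.2))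
  have h1 := hd.norm_le h ht
  have h2 : (∫ s in 0..t, ‖f s - g s‖) ≤ ∫ s in 0..t, (c s * ‖v s - w s‖ + b s) := by
    refine intervalIntegral.integral_mono_ae_restrict ht.1
      (intervalIntegrable_sub hd.int ht).norm (hct.add hbt) ?_
    rw [Filter.EventuallyLE, ← Measure.restrict_congr_set Ioc_ae_eq_Icc]
    exact ae_restrict_of_ae_restrict_of_subset (Ioc_subset_Ioc_right ht.2) hle
  rw [intervalIntegral.integral_add hct hbt] at h2
  have h3 : (∫ s in 0..t, b s) ≤ ∫ s in 0..T, b s := by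
    rw [integral_of_le ht.1, integral_of_le hT]
    refine setIntegral_mono_set ((intervalIntegrable_iff_integrableOn_Ioc_of_le hT).mp hb) ?_
      (Ioc_subset_Ioc_right ht.2).eventuallyLE
    filter_upwards [ae_restrict_mem measurableSet_Ioc] with s hs using hb0 s ⟨hs.1.le, hs.2⟩
  linarith

lemma aestronglyMeasurable_form (h : IsGelfand ι) {T : ℝ} {ψ : ℝ → V}
    (hc : ContinuousOn (fun t => ι (ψ t)) (Icc 0 T)) :
    AEStronglyMeasurable ψ (vol (Ioo 0 T)) := by
  set ε : ℕ → ℝ := fun k => 1 / ((k : ℝ) + 1) with hε_def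
  have hε : ∀ k, 0 < ε k := fun k => by positivity
  have hε0 : Tendsto ε atTop (𝓝 0) := tendsto_one_div_add_atTop_nhds_zero_nat
  refine aestronglyMeasurable_of_tendsto_ae atTop
    (f := fun k t => adjoint ι (regInv ι (ε k) (ι (ψ t)))) (fun k => ?_)
    (.of_forall fun t => (tendsto_regV h (ψ t)).comp
      (tendsto_nhdsWithin_iff.mpr ⟨hε0, .of_forall hε⟩))
  have h1 : AEStronglyMeasurable (fun t => ι (ψ t)) (vol (Ioo 0 T)) :=
    (hc.mono Ioo_subset_Icc_self).aestronglyMeasurable measurableSet_Ioo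
  exact (adjoint ι ∘L regInv ι (ε k)).continuous.comp_aestronglyMeasurable h1

/-- The weak form of the equation, tested with arbitrary elements of the form domain. -/
lemma IsMild.inner_form_eq (h : IsGelfand ι) {T M : ℝ} {ψ : ℝ → V} {f : ℝ → H}
    (hv : IsMild ι T (fun t => ι (ψ t)) f) (hψ : ∀ t ∈ Icc 0 T, ‖ψ t‖ ≤ M) (Φ : V) {t : ℝ}
    (ht : t ∈ Icc 0 T) :
    IntervalIntegrable (fun s => -I * (inner ℂ Φ (ψ s) + inner ℂ (ι Φ) (f s))) volume 0 t ∧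
    inner ℂ (ι Φ) (ι (ψ t)) = inner ℂ (ι Φ) (ι (ψ 0))
      + ∫ s in 0..t, -I * (inner ℂ Φ (ψ s) + inner ℂ (ι Φ) (f s)) := by
  have hf := intervalIntegrable_sub hv.int ht
  have hvc := intervalIntegrable_of_cont hv.cont ht
  have hψi : IntervalIntegrable ψ volume 0 t := by
    rw [intervalIntegrable_iff_integrableOn_Ioo_of_le ht.1]
    refine Integrable.of_bound ?_ M ?_
    · exact (aestronglyMeasurable_form h hv.cont).mono_measure
        (Measure.restrict_mono (Ioo_subset_Ioo_right ht.2) le_rfl)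
    · filter_upwards [ae_restrict_mem measurableSet_Ioo] with s hs
      exact hψ s ⟨hs.1.le, hs.2.le.trans ht.2⟩
  have hcon : ∀ Φ : V, (∫ s in 0..t, -I * (inner ℂ Φ (ψ s) + inner ℂ (ι Φ) (f s)))
      = -I * (inner ℂ Φ (∫ s in 0..t, ψ s) + inner ℂ (ι Φ) (∫ s in 0..t, f s)) := fun Φ => by
    rw [intervalIntegral.integral_const_mul]
    have h1 := (innerSL ℂ Φ).intervalIntegral_comp_comm hψi
    have h2 := (innerSL ℂ (ι Φ)).intervalIntegral_comp_comm hf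
    simp only [innerSL_apply_apply] at h1 h2
    rw [← h1, ← h2, ← intervalIntegral.integral_add]
    · exact intervalIntegrable_clm (innerSL ℂ Φ) hψi
    · exact intervalIntegrable_clm (innerSL ℂ (ι Φ)) hf
  refine ⟨(((intervalIntegrable_clm (innerSL ℂ Φ) hψi).add
    (intervalIntegrable_clm (innerSL ℂ (ι Φ)) hf)).const_mul _), ?_⟩
  rw [hcon]
  refine h.adjoint_dense.induction_on (p := fun Φ : V => inner ℂ (ι Φ) (ι (ψ t))
    = inner ℂ (ι Φ) (ι (ψ 0)) + -I * (inner ℂ Φ (∫ s in 0..t, ψ s)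
        + inner ℂ (ι Φ) (∫ s in 0..t, f s))) Φ
    (isClosed_eq (by fun_prop) (by fun_prop)) fun x => ?_
  have h1 := hv.isVeryWeak h t ht
  have h2 := congrArg (fun y => inner ℂ x y) h1
  have h3 : (∫ s in 0..t, (ι (ψ s) + res ι (f s)))
      = (∫ s in 0..t, ι (ψ s)) + ∫ s in 0..t, res ι (f s) :=
    intervalIntegral.integral_add hvc (intervalIntegrable_clm (res ι) hf)
  have h4 := ι.intervalIntegral_comp_comm hψi
  have h5 := (res ι).intervalIntegral_comp_comm hf
  simp only at h2
  rw [h3, h4, h5, inner_smul_right, inner_add_right, ← inner_res_comm, ← inner_res_comm,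
    inner_sub_right, ← adjoint_inner_left ι (∫ s in 0..t, ψ s) x] at h2
  rw [← res_apply]
  linear_combination -I * h2 + (inner ℂ (res ι x) (ι (ψ t)) - inner ℂ (res ι x) (ι (ψ 0)))
    * Complex.I_sq

/-- Testing the very weak formulation with vectors, backwards from the final time. -/
lemma isVeryWeak_iff {T : ℝ} (hT : 0 ≤ T) {v f : ℝ → H} (hv : ContinuousOn v (Icc 0 T))
    (hf : IntervalIntegrable f volume 0 T) :
    IsVeryWeak ι T v f ↔ ∀ x, ∀ t ∈ Icc 0 T,
      I * inner ℂ (res ι x) (v T) - I * inner ℂ (res ι x) (v t)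
        = ∫ s in t..T, (inner ℂ x (v s) + inner ℂ (res ι x) (f s)) := by
  have h0T : (0 : ℝ) ∈ Icc 0 T := ⟨le_rfl, hT⟩
  have hTT : T ∈ Icc 0 T := ⟨hT, le_rfl⟩
  have hi : IntervalIntegrable (fun s => v s + res ι (f s)) volume 0 T :=
    (intervalIntegrable_of_cont hv hTT).add (intervalIntegrable_clm (res ι) hf)
  have hix : ∀ x, IntervalIntegrable (fun s => inner ℂ x (v s) + inner ℂ (res ι x) (f s))
      volume 0 T := fun x => by
    simp only [inner_res_comm, ← inner_add_right]
    exact intervalIntegrable_clm (innerSL ℂ x) hi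
  have hin : ∀ x, ∀ t ∈ Icc 0 T, inner ℂ x (∫ s in 0..t, (v s + res ι (f s)))
      = ∫ s in 0..t, (inner ℂ x (v s) + inner ℂ (res ι x) (f s)) := fun x t ht => by
    have h1 := (innerSL ℂ x).intervalIntegral_comp_comm (intervalIntegrable_sub hi ht)
    simp only [innerSL_apply_apply, inner_add_right] at h1
    rw [← h1]
    simp only [inner_res_comm]
  have hsub : ∀ x, ∀ t ∈ Icc 0 T, (∫ s in t..T, (inner ℂ x (v s) + inner ℂ (res ι x) (f s)))
      = (∫ s in 0..T, (inner ℂ x (v s) + inner ℂ (res ι x) (f s)))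
        - ∫ s in 0..t, (inner ℂ x (v s) + inner ℂ (res ι x) (f s)) := fun x t ht =>
    (integral_interval_sub_left (hix x) (intervalIntegrable_sub (hix x) ht)).symm
  constructor
  · intro hw x t ht
    have h1 := congrArg (fun y => inner ℂ x y) (hw T hTT)
    have h2 := congrArg (fun y => inner ℂ x y) (hw t ht)
    simp only [hin x T hTT, hin x t ht, inner_smul_right, ← inner_res_comm,
      inner_sub_right] at h1 h2
    rw [hsub x t ht]
    linear_combination h1 - h2
  · intro hw t ht
    refine ext_inner_left ℂ fun x => ?_
    have h1 := hw x t ht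
    have h2 := hw x 0 h0T
    rw [hsub x t ht] at h1
    rw [inner_smul_right, ← inner_res_comm, inner_sub_right, hin x t ht]
    linear_combination h2 - h1

/-! ### The linear backward equation -/

lemma IsMild.norm_le_backward (h : IsGelfand ι) {T : ℝ} {v f : ℝ → H} (hv : IsMild ι T v f)
    {t : ℝ} (ht : t ∈ Icc 0 T) : ‖v t‖ ≤ ‖v T‖ + ∫ s in t..T, ‖f s‖ := by
  have hT : 0 ≤ T := ht.1.trans ht.2
  have hTT : T ∈ Icc 0 T := ⟨hT, le_rfl⟩
  have hg := intervalIntegrable_grp h hv.int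
  have e : grp ι (-t) (v t) = grp ι (-T) (v T) - ∫ s in t..T, -I • grp ι (-s) (f s) := by
    rw [hv.eq t ht, hv.eq T hTT, ← integral_interval_sub_left hg (intervalIntegrable_sub hg ht)]
    abel
  rw [← norm_grp h (-t) (v t), e]
  refine (norm_sub_le _ _).trans ?_
  rw [norm_grp h]
  refine add_le_add_right ((intervalIntegral.norm_integral_le_integral_norm ht.2).trans_eq ?_) _
  simp only [norm_neg_I_smul_grp h]

/-- Uniqueness for the backward problem. -/
lemma IsMild.eqOn_of_final (h : IsGelfand ι) {T K : ℝ} (hK : 0 ≤ K) {v w f g : ℝ → H}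
    (hv : IsMild ι T v f) (hw : IsMild ι T w g) (hT : v T = w T)
    (hle : ∀ᵐ s ∂vol (Ioc 0 T), ‖f s - g s‖ ≤ K * ‖v s - w s‖) :
    EqOn v w (Icc 0 T) := by
  have hd := hv.sub hw h
  have hc : ContinuousOn (fun τ => ‖v (T - τ) - w (T - τ)‖) (Icc 0 T) :=
    hd.cont.norm.comp (by fun_prop) fun τ hτ => ⟨by linarith [hτ.2], by linarith [hτ.1]⟩
  have key := gronwall_const (g := fun τ => ‖v (T - τ) - w (T - τ)‖) hK le_rfl hc (fun τ hτ => by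
      have ht : T - τ ∈ Icc 0 T := ⟨by linarith [hτ.2], by linarith [hτ.1]⟩
      have h1 := hd.norm_le_backward h ht
      rw [hT, sub_self, norm_zero] at h1
      refine h1.trans (add_le_add_right ?_ _)
      rw [intervalIntegral.integral_comp_sub_left (fun s => K * ‖v s - w s‖), sub_zero]
      have hI : IntervalIntegrable (fun s => K * ‖v s - w s‖) volume (T - τ) T := by
        refine ContinuousOn.intervalIntegrable ?_
        rw [uIcc_of_le ht.2]
        exact (hd.cont.norm.mono (Icc_subset_Icc_left ht.1)).const_smul K
      refine intervalIntegral.integral_mono_ae_restrict ht.2 (((hd.int.mono_set (by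
          rw [uIcc_of_le ht.2, uIcc_of_le (ht.1.trans ht.2)]
          exact Icc_subset_Icc_left ht.1))).norm) hI ?_
      rw [Filter.EventuallyLE, ← Measure.restrict_congr_set Ioc_ae_eq_Icc]
      exact ae_restrict_of_ae_restrict_of_subset (Ioc_subset_Ioc_left ht.1) hle)
  intro t ht
  have h1 := key (T - t) ⟨by linarith [ht.2], by linarith [ht.1]⟩
  simp only [sub_sub_cancel, zero_mul] at h1
  exact sub_eq_zero.mp (norm_le_zero_iff.mp h1)

/-- Existence for the backward problem. -/
lemma exists_isMild_final (h : IsGelfand ι) {T K : ℝ} (hT : 0 ≤ T) (hK : 0 ≤ K) {L : ℝ → H → H}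
    (hint : ∀ y : ℝ → H, Continuous y → IntervalIntegrable (fun s => L s (y s)) volume 0 T)
    (hL : ∀ s ∈ Icc 0 T, ∀ x y, ‖L s x - L s y‖ ≤ K * ‖x - y‖) (l : H) :
    ∃ Λ : ℝ → H, Continuous Λ ∧ Λ T = l ∧ IsMild ι T Λ (fun s => L s (Λ s)) := by
  have hneg : ∀ y : ℝ → H, Continuous y → IntervalIntegrable
      (fun s => I • grp ι (-s) (L s (grp ι s (y s)))) volume 0 T := fun y hy => by
    have h1 := intervalIntegrable_grp h (hint _ (Continuous.grp h continuous_id hy))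
    exact h1.neg.congr fun s _ => by simp
  obtain ⟨κ, hκc, hκ⟩ := exists_volterra (T := T) (K := K)
    (f := fun σ x => I • grp ι (-(T - σ)) (L (T - σ) (grp ι (T - σ) x))) hT hK
    (grp ι (-T) l) (fun y hy => by
      have h1 := (hneg (fun s => y (T - s)) (by fun_prop)).comp_sub_left T
      simp only [sub_zero, sub_self, sub_sub_cancel] at h1
      exact h1.symm)
    (fun s hs x x' => by
      rw [← smul_sub, ← map_sub, norm_smul, Complex.norm_I, one_mul, norm_grp h]
      refine (hL (T - s) ⟨by linarith [hs.2], by linarith [hs.1]⟩ _ _).trans_eq ?_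
      rw [← map_sub, norm_grp h])
  set k : ℝ → H := fun t => κ (T - t) with hk
  have hkc : Continuous k := by fun_prop
  have hg := hint _ (Continuous.grp h continuous_id hkc)
  have hI := hneg k hkc
  have hkt : ∀ t ∈ Icc 0 T, k t = grp ι (-T) l
      + ∫ s in t..T, I • grp ι (-s) (L s (grp ι s (k s))) := fun t ht => by
    rw [hk]
    simp only
    rw [hκ (T - t) ⟨by linarith [ht.2], by linarith [ht.1]⟩]
    congr 1
    have h1 := intervalIntegral.integral_comp_sub_left (a := 0) (b := T - t)
      (fun s => I • grp ι (-s) (L s (grp ι s (κ (T - s))))) T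
    simp only [sub_sub_cancel, sub_zero] at h1
    exact h1
  refine ⟨fun t => grp ι t (k t), Continuous.grp h continuous_id hkc, ?_,
    (Continuous.grp h continuous_id hkc).continuousOn, hg, fun t ht => ?_⟩
  · simp only
    rw [hkt T ⟨hT, le_rfl⟩, integral_same, add_zero, grp_grp_neg h]
  · rw [grp_neg_grp h, grp_zero h, hkt t ht, hkt 0 ⟨le_rfl, hT⟩,
      ← integral_interval_sub_left hI (intervalIntegrable_sub hI ht)]
    simp only [neg_smul, intervalIntegral.integral_neg]
    abel

/-! ### Solutions in the domain of the generator -/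

lemma IsMild.shift (h : IsGelfand ι) {T : ℝ} {v f : ℝ → H} (hv : IsMild ι T v f) {k : ℝ}
    (hk : k ∈ Icc 0 T) : IsMild ι (T - k) (fun t => v (t + k)) (fun t => f (t + k)) where
  cont := hv.cont.comp (by fun_prop) fun t ht => ⟨by linarith [ht.1, hk.1], by linarith [ht.2]⟩
  int := by
    have h1 : IntervalIntegrable f volume (0 + k) (T - k + k) := hv.int.mono_set (by
      rw [zero_add, sub_add_cancel, uIcc_of_le hk.2, uIcc_of_le (hk.1.trans hk.2)]
      exact Icc_subset_Icc_left hk.1)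
    have h2 := h1.comp_add_right k
    simpa using h2
  eq t ht := by
    have htk : t + k ∈ Icc 0 T := ⟨by linarith [ht.1, hk.1], by linarith [ht.2]⟩
    have hg := intervalIntegrable_grp h hv.int
    have e1 : v (t + k) = grp ι (t + k) (v 0 + ∫ s in 0..t + k, -I • grp ι (-s) (f s)) := by
      rw [← hv.eq _ htk, grp_grp_neg h]
    have e2 : v k = grp ι k (v 0 + ∫ s in 0..k, -I • grp ι (-s) (f s)) := by
      rw [← hv.eq _ hk, grp_grp_neg h]
    have e3 := integral_interval_sub_left (intervalIntegrable_sub hg htk)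
      (intervalIntegrable_sub hg hk)
    have e4 := intervalIntegral.integral_comp_add_right (a := 0) (b := t)
      (fun s => -I • grp ι (-s) (f s)) k
    rw [zero_add] at e4
    have hgi : IntervalIntegrable (fun s => -I • grp ι (-(s + k)) (f (s + k))) volume 0 t := by
      have h1 : IntervalIntegrable (fun s => -I • grp ι (-s) (f s)) volume (0 + k) (t + k) :=
        hg.mono_set (by
          rw [zero_add, uIcc_of_le (by linarith [ht.1]), uIcc_of_le (hk.1.trans hk.2)]
          exact Icc_subset_Icc hk.1 htk.2)
      have h2 := h1.comp_add_right k
      simpa using h2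
    have e5 := (grp ι k).intervalIntegral_comp_comm hgi
    simp only [zero_add]
    rw [e1, grp_grp h, neg_add_cancel_left, e2, ← sub_eq_iff_eq_add', ← map_sub, add_sub_add_left_eq_sub,
      e3, ← e4, ← e5]
    refine intervalIntegral.integral_congr fun s _ => ?_
    rw [map_smul, grp_grp h]
    congr 3
    ring

lemma IsControl.integral_abs_sub_le {T r : ℝ} {u du : ℝ → ℝ} (hu : IsControl T r u du) {k t : ℝ}
    (hk : 0 ≤ k) (ht : 0 ≤ t) (htk : t + k ≤ T) :
    ∫ s in 0..t, |u (s + k) - u s| ≤ k * r := by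
  have hT : 0 ≤ T := by linarith
  have habs := hu.int.abs
  set W : ℝ → ℝ := fun t => ∫ s in 0..t, |du s| with hW
  have hWc : ContinuousOn W (Icc 0 T) := by
    have := intervalIntegral.continuousOn_primitive_interval' habs left_mem_uIcc
    rwa [uIcc_of_le hT] at this
  have hWi : ∀ a b, a ∈ Icc 0 T → b ∈ Icc 0 T → IntervalIntegrable W volume a b := fun a b ha hb =>
    (hWc.mono (uIcc_subset_Icc ha hb)).intervalIntegrable
  have hdi : ∀ a b, a ∈ Icc 0 T → b ∈ Icc 0 T → IntervalIntegrable du volume a b := fun a b ha hb =>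
    hu.int.mono_set (by rw [uIcc_of_le hT]; exact uIcc_subset_Icc ha hb)
  have h0 : (0 : ℝ) ∈ Icc 0 T := ⟨le_rfl, hT⟩
  have htT : t ∈ Icc 0 T := ⟨ht, by linarith⟩
  have hkT : k ∈ Icc 0 T := ⟨hk, by linarith⟩
  have htkT : t + k ∈ Icc 0 T := ⟨by linarith, htk⟩
  have hle : ∀ s ∈ Icc 0 t, |u (s + k) - u s| ≤ W (s + k) - W s := fun s hs => by
    have hs1 : s ∈ Icc 0 T := ⟨hs.1, by linarith [hs.2]⟩
    have hs2 : s + k ∈ Icc 0 T := ⟨by linarith [hs.1], by linarith [hs.2]⟩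
    rw [hu.prim _ hs2, hu.prim _ hs1, add_sub_add_left_eq_sub, hW,
      integral_interval_sub_left (hdi _ _ h0 hs2) (hdi _ _ h0 hs1),
      integral_interval_sub_left (hdi _ _ h0 hs2).abs (hdi _ _ h0 hs1).abs]
    exact intervalIntegral.abs_integral_le_integral_abs (by linarith)
  have hWk : IntervalIntegrable (fun s => W (s + k)) volume 0 t := by
    have h2 := (hWi (0 + k) (t + k) (by simpa using hkT) htkT).comp_add_right k
    simpa using h2
  have h1 : (∫ s in 0..t, |u (s + k) - u s|) ≤ ∫ s in 0..t, (W (s + k) - W s) := integral_mono_on ht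
      (Continuous.intervalIntegrable (by have := hu.cont; fun_prop) _ _)
      (hWk.sub (hWi 0 t h0 htT)) hle
  rw [intervalIntegral.integral_sub hWk (hWi 0 t h0 htT),
    intervalIntegral.integral_comp_add_right (fun s => W s), zero_add,
    ← integral_interval_sub_left (hWi 0 _ h0 htkT) (hWi 0 _ h0 hkT)] at h1
  have h2 := integral_interval_sub_left (hWi 0 _ h0 htkT) (hWi 0 _ h0 htT)
  have h3 : 0 ≤ ∫ s in 0..k, W s := intervalIntegral.integral_nonneg hk fun s hs =>
    intervalIntegral.integral_nonneg hs.1 fun _ _ => abs_nonneg _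
  have h4 : (∫ s in t..t + k, W s) ≤ ∫ s in t..t + k, r :=
    integral_mono_on (by linarith) (hWi _ _ htT htkT) (by simp) fun s hs => by
      refine le_trans ?_ hu.var
      exact intervalIntegral.integral_mono_interval le_rfl (ht.trans hs.1) (hs.2.trans htk)
        (.of_forall fun _ => abs_nonneg _) habs
  rw [intervalIntegral.integral_const, smul_eq_mul, add_sub_cancel_left] at h4
  linarith

/-- Solutions with initial values in the domain of the generator are Lipschitz in time, by an
estimate of difference quotients. -/
lemma IsMild.lipschitz (h : IsGelfand ι) {T r K B N : ℝ} {v f : ℝ → H} (hv : IsMild ι T v f)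
    {u du : ℝ → ℝ} (hu : IsControl T r u du) (hK : 0 ≤ K) (hB : 0 ≤ B)
    (hN : ∀ s ∈ Icc 0 T, ‖f s‖ ≤ N)
    (hf : ∀ s ∈ Icc 0 T, ∀ t ∈ Icc 0 T, ‖f s - f t‖ ≤ K * ‖v s - v t‖ + B * |u s - u t|)
    {x₀ : H} (h0 : v 0 = res ι x₀) {t k : ℝ} (ht : 0 ≤ t) (hk : 0 ≤ k) (htk : t + k ≤ T) :
    ‖v (t + k) - v t‖ ≤ (‖x₀‖ + N + B * r) * Real.exp (K * T) * k := by
  have hT : 0 ≤ T := by linarith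
  have hkT : k ∈ Icc 0 T := ⟨hk, by linarith⟩
  have hN0 : 0 ≤ N := (norm_nonneg _).trans (hN 0 ⟨le_rfl, hT⟩)
  have hsh := hv.shift h hkT
  have hvt : IsMild ι (T - k) v f :=
    { cont := hv.cont.mono (Icc_subset_Icc_right (by linarith))
      int := intervalIntegrable_sub hv.int ⟨by linarith, by linarith⟩
      eq := fun s hs => hv.eq s ⟨hs.1, by linarith [hs.2]⟩ }
  have hbc : Continuous fun s => B * |u (s + k) - u s| := by have := hu.cont; fun_prop
  have h1 := hsh.norm_sub_le_exp h hvt (c := fun _ => K) (b := fun s => B * |u (s + k) - u s|)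
    (by simp) (hbc.intervalIntegrable _ _) (fun _ _ => hK)
    (fun _ _ => mul_nonneg hB (abs_nonneg _)) (by
      filter_upwards [ae_restrict_mem measurableSet_Ioc] with s hs
      exact hf _ ⟨by linarith [hs.1], by linarith [hs.2]⟩ _ ⟨hs.1.le, by linarith [hs.2]⟩)
    (t := t) ⟨ht, by linarith⟩
  have h2 : ‖v (0 + k) - v 0‖ ≤ (‖x₀‖ + N) * k := by
    have e1 : v k = grp ι k (v 0 + ∫ s in 0..k, -I • grp ι (-s) (f s)) := by
      rw [← hv.eq _ hkT, grp_grp_neg h]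
    have e2 : v k - v 0 = (grp ι k (res ι x₀) - res ι x₀)
        + grp ι k (∫ s in 0..k, -I • grp ι (-s) (f s)) := by
      rw [e1, map_add, h0]; abel
    rw [zero_add, e2, add_mul]
    refine (norm_add_le _ _).trans (add_le_add ?_ ?_)
    · refine (norm_grp_res_sub_le h k x₀).trans_eq ?_
      rw [abs_of_nonneg hk, mul_comm]
    · rw [norm_grp h]
      refine (intervalIntegral.norm_integral_le_of_norm_le_const (C := N) fun s hs => ?_).trans_eq ?_
      · rw [uIoc_of_le hk] at hs
        rw [norm_neg_I_smul_grp h]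
        exact hN s ⟨hs.1.le, hs.2.trans hkT.2⟩
      · rw [sub_zero, abs_of_nonneg hk]
  have h3 : (∫ s in 0..(T - k), B * |u (s + k) - u s|) ≤ B * r * k := by
    rw [intervalIntegral.integral_const_mul, mul_assoc, mul_comm r k]
    exact mul_le_left (hu.integral_abs_sub_le hk (by linarith) (by linarith)) hB
  have h4 : Real.exp (∫ s in 0..t, K) ≤ Real.exp (K * T) := by
    rw [intervalIntegral.integral_const, sub_zero, smul_eq_mul, mul_comm]
    exact Real.exp_le_exp.mpr (mul_le_left (by linarith) hK)
  refine h1.trans ((mul_le_mul (add_le_add h2 h3) h4 (Real.exp_pos _).le ?_).trans_eq (by ring))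
  have hr : 0 ≤ r := (abs_nonneg _).trans (hu.bound 0)
  positivity

lemma adjoint_res : adjoint (res ι) = res ι :=
  ((eq_adjoint_iff _ _).mpr fun x y => inner_res_comm x y).symm

/-- A mild solution that is Lipschitz in time takes values in the domain of the generator. -/
lemma IsMild.exists_res_eq (h : IsGelfand ι) {T L N : ℝ} (hT : 0 < T) {v f : ℝ → H}
    (hv : IsMild ι T v f) (hfc : ContinuousOn f (Icc 0 T)) (hN : ∀ s ∈ Icc 0 T, ‖f s‖ ≤ N)
    (hL : 0 ≤ L) (hLip : ∀ t k, 0 ≤ t → 0 ≤ k → t + k ≤ T → ‖v (t + k) - v t‖ ≤ L * k)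
    {t : ℝ} (ht : t ∈ Icc 0 T) : ∃ x : H, res ι x = v t ∧ ‖x‖ ≤ L + N := by
  have hN0 : 0 ≤ N := (norm_nonneg _).trans (hN 0 ⟨le_rfl, hT.le⟩)
  have hvw := hv.isVeryWeak h
  have hLip' : ∀ s ∈ Icc 0 T, ∀ t ∈ Icc 0 T, ‖v s - v t‖ ≤ L * |s - t| := by
    intro s hs t ht
    rcases le_total s t with hst | hst
    · have := hLip s (t - s) hs.1 (by linarith) (by linarith [ht.2])
      rw [add_sub_cancel] at this
      rwa [norm_sub_rev, abs_sub_comm, abs_of_nonneg (by linarith)]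
    · have := hLip t (s - t) ht.1 (by linarith) (by linarith [hs.2])
      rw [add_sub_cancel] at this
      rwa [abs_of_nonneg (by linarith)]
  have hg : ContinuousOn (fun s => v s + res ι (f s)) (Icc 0 T) :=
    hv.cont.add ((res ι).continuous.comp_continuousOn hfc)
  have hbd : ∀ z : H, ∀ s ∈ Icc 0 T, ‖inner ℂ z (v s)‖ ≤ (L + N) * ‖res ι z‖ := by
    intro z
    have hint : ∀ s ∈ Ioo 0 T, ‖inner ℂ z (v s)‖ ≤ (L + N) * ‖res ι z‖ := by
      intro s hs
      have hsn : Icc 0 T ∈ 𝓝 s := Icc_mem_nhds hs.1 hs.2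
      have h1 : HasDerivAt (fun τ => ∫ r in 0..τ, (v r + res ι (f r))) (v s + res ι (f s)) s :=
        intervalIntegral.integral_hasDerivAt_right
          (intervalIntegrable_of_cont hg ⟨hs.1.le, hs.2.le⟩)
          (hg.stronglyMeasurableAtFilter_nhdsWithin measurableSet_Icc s |>.filter_mono
            (by rw [nhdsWithin_eq_nhds.mpr hsn]))
          (hg.continuousAt hsn)
      have h2 : HasDerivAt (fun τ => inner ℂ z (∫ r in 0..τ, (v r + res ι (f r))))
          (inner ℂ z (v s + res ι (f s))) s :=
        ((innerSL ℂ z).restrictScalars ℝ).hasFDerivAt.comp_hasDerivAt s h1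
      have h3 : ‖inner ℂ z (v s + res ι (f s))‖ ≤ (‖res ι z‖ * L).toNNReal := by
        refine HasDerivAt.le_of_lipschitzOn h2 hsn (LipschitzOnWith.of_dist_le_mul fun a ha b hb => ?_)
        rw [← hvw a ha, ← hvw b hb, dist_eq_norm, ← inner_sub_right, ← smul_sub, ← map_sub,
          sub_sub_sub_cancel_right, inner_smul_right, norm_mul, Complex.norm_I, one_mul,
          ← inner_res_comm, Real.coe_toNNReal _ (by positivity), mul_assoc]
        exact (norm_inner_le_norm _ _).trans (mul_le_left (hLip' a ha b hb))
      rw [Real.coe_toNNReal _ (by positivity), inner_add_right, ← inner_res_comm] at h3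
      have h4 : ‖inner ℂ (res ι z) (f s)‖ ≤ ‖res ι z‖ * N := (norm_inner_le_norm _ _).trans
          (mul_le_left (hN s ⟨hs.1.le, hs.2.le⟩))
      have h5 := norm_sub_le (inner ℂ z (v s) + inner ℂ (res ι z) (f s)) (inner ℂ (res ι z) (f s))
      rw [add_sub_cancel_right] at h5
      linarith
    have hc : ContinuousOn (fun s => ‖inner ℂ z (v s)‖) (Icc 0 T) :=
      ((innerSL ℂ z).continuous.comp_continuousOn hv.cont).norm
    have hcl := hc.preimage_isClosed_of_isClosed isClosed_Icc (isClosed_Iic (a := (L + N) * ‖res ι z‖))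
    have h6 : closure (Ioo 0 T) ⊆ Icc 0 T ∩ (fun s => ‖inner ℂ z (v s)‖) ⁻¹' Iic ((L + N) * ‖res ι z‖) :=
      closure_minimal (fun s hs => ⟨Ioo_subset_Icc_self hs, hint s hs⟩) hcl
    rw [closure_Ioo hT.ne] at h6
    exact fun s hs => (h6 hs).2
  obtain ⟨x, hx, hxv⟩ := exists_adjoint_eq_of_bound (res ι) h.res_dense (v t)
    (add_nonneg hL hN0) fun z => by rw [norm_inner_symm]; exact hbd z t ht
  rw [adjoint_res] at hxv
  exact ⟨x, hxv, hx⟩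

end Abstract

/-! ### The space `H¹₀` -/

section TestFunctions

variable {E F : Type*} [NormedAddCommGroup E] [NormedSpace ℝ E]
  [NormedAddCommGroup F] [NormedSpace ℝ F] {U : Set E} {f g : E → F}

lemma IsTestFun.add (hf : IsTestFun U f) (hg : IsTestFun U g) : IsTestFun U (fun x => f x + g x) :=
  ⟨hf.1.add hg.1, hf.2.1.add hg.2.1, (tsupport_add f g).trans (union_subset hf.2.2 hg.2.2)⟩

lemma IsTestFun.of_eq_zero {F' : Type*} [NormedAddCommGroup F'] [NormedSpace ℝ F'] {k : E → F'}
    (hf : IsTestFun U f) (hk : ContDiff ℝ ∞ k) (h : ∀ x, f x = 0 → k x = 0) : IsTestFun U k := by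
  have hs : Function.support k ⊆ Function.support f := fun x hx h0 => hx (h x h0)
  exact ⟨hk, hf.2.1.mono hs, (closure_mono hs).trans hf.2.2⟩

lemma IsTestFun.eq_zero_of_notMem (hf : IsTestFun U f) {x : E} (hx : x ∉ U) : f x = 0 :=
  image_eq_zero_of_notMem_tsupport fun h => hx (hf.2.2 h)

lemma IsTestFun.fderiv_apply (hf : IsTestFun U f) (v : E) : IsTestFun U fun x => fderiv ℝ f x v :=
  ⟨(hf.1.fderiv_right (m := ∞) (by simp)).clm_apply contDiff_const, hf.2.1.fderiv_apply (𝕜 := ℝ) v,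
    (tsupport_fderiv_apply_subset ℝ v).trans hf.2.2⟩

lemma IsTestFun.memLp [MeasurableSpace E] [BorelSpace E] [FiniteDimensional ℝ E] (hf : IsTestFun U f)
    (p : ENNReal) (μ : Measure E) [IsFiniteMeasureOnCompacts μ] : MemLp f p μ :=
  hf.1.continuous.memLp_of_hasCompactSupport hf.2.1

end TestFunctions

namespace H10

open Filter Topology

/-- Bounded operators between Hilbert spaces, with the algebraic and topological structure derived
from the inner products. -/
abbrev HilbertMap (V H : Type*) [NormedAddCommGroup V] [InnerProductSpace ℂ V]
    [NormedAddCommGroup H] [InnerProductSpace ℂ H] : Type _ := V →L[ℂ] H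

/-- The embedding `H¹₀ → L²`. -/
def ι {n : ℕ} (Ω : Set (Sp n)) (N : ℕ) : HilbertMap (H10 Ω N) (L2 Ω N) := WithLp.fstL 2 ℂ (L2 Ω N) _ ∘L (H10 Ω N).subtypeL

/-- The gradient as an operator on `H¹₀`. -/
def gradL {n : ℕ} (Ω : Set (Sp n)) (N : ℕ) :
    HilbertMap (H10 Ω N) (PiLp 2 (fun _ : Fin n => L2 Ω N)) :=
  WithLp.sndL 2 ℂ (L2 Ω N) _ ∘L (H10 Ω N).subtypeL

lemma ι_apply (w : H10 Ω N) : ι Ω N w = fn w := rfl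

lemma inner_eq (ξ w : H10 Ω N) :
    inner ℂ ξ w = inner ℂ (fn ξ) (fn w) + inner ℂ (grad ξ) (grad w) := by
  rw [Submodule.coe_inner, WithLp.prod_inner_apply]; rfl

lemma norm_sq_eq (w : H10 Ω N) : ‖w‖ ^ 2 = ‖fn w‖ ^ 2 + ‖grad w‖ ^ 2 := by
  exact WithLp.prod_norm_sq_eq_of_L2 (w : SpacePair Ω N)

lemma norm_fn_le (w : H10 Ω N) : ‖fn w‖ ≤ ‖w‖ := by
  refine le_of_sq_le_sq ?_ (norm_nonneg _)
  rw [norm_sq_eq]; nlinarith [sq_nonneg ‖grad w‖]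

lemma norm_grad_le (w : H10 Ω N) : ‖grad w‖ ≤ ‖w‖ := by
  refine le_of_sq_le_sq ?_ (norm_nonneg _)
  rw [norm_sq_eq]; nlinarith [sq_nonneg ‖fn w‖]

lemma norm_grad_apply_le (w : H10 Ω N) (i : Fin n) : ‖grad w i‖ ≤ ‖w‖ :=
  (PiLp.norm_apply_le (grad w) i).trans (norm_grad_le w)

/-- `w` is given by the test function `φ`. -/
def IsTest (w : H10 Ω N) (φ : Sp n → Orb N) : Prop := IsTestFun Ω φ ∧ fn w =ᵐ[vol Ω] φ ∧
    ∀ i : Fin n, grad w i =ᵐ[vol Ω]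
      fun x => fderiv ℝ φ x (single i 1)

lemma exists_isTest {φ : Sp n → Orb N} (hφ : IsTestFun Ω φ) : ∃ w : H10 Ω N, IsTest w φ := by
  have h1 := hφ.memLp 2 (vol Ω)
  have h2 := fun i : Fin n => (hφ.fderiv_apply (single i 1)).memLp 2 (vol Ω)
  let p : SpacePair Ω N := WithLp.toLp 2 (h1.toLp _, WithLp.toLp 2 fun i => (h2 i).toLp _)
  have hp : p ∈ H10 Ω N := Submodule.le_topologicalClosure _ (Submodule.subset_span
    ⟨φ, hφ, h1.coeFn_toLp, fun i => (h2 i).coeFn_toLp⟩)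
  exact ⟨⟨p, hp⟩, hφ, h1.coeFn_toLp, fun i => (h2 i).coeFn_toLp⟩

lemma exists_seq (w : H10 Ω N) : ∃ (p : ℕ → H10 Ω N) (φ : ℕ → Sp n → Orb N),
    (∀ k, IsTest (p k) (φ k)) ∧ Tendsto p atTop (𝓝 w) := by
  have hspan : ∀ p ∈ Submodule.span ℂ {w : SpacePair Ω N | ∃ φ : Sp n → Orb N, IsTestFun Ω φ ∧
      w.fst =ᵐ[vol Ω] φ ∧
      ∀ i : Fin n, w.snd i =ᵐ[vol Ω]
        fun x => fderiv ℝ φ x (single i 1)},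
      ∃ φ : Sp n → Orb N, IsTestFun Ω φ ∧ p.fst =ᵐ[vol Ω] φ ∧
      ∀ i : Fin n, p.snd i =ᵐ[vol Ω]
        fun x => fderiv ℝ φ x (single i 1) := by
    intro p hp
    induction hp using Submodule.span_induction with
    | mem x hx => exact hx
    | zero =>
      refine ⟨fun _ => 0, ⟨contDiff_const, HasCompactSupport.zero, by simp [tsupport]⟩,
        Lp.coeFn_zero _ _ _, fun i => ?_⟩
      simp only [fderiv_fun_const, Pi.zero_apply, zero_apply]
      exact Lp.coeFn_zero (Orb N) 2 (vol Ω)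
    | add x y _ _ hx hy =>
      obtain ⟨φ, hφ, h1, h2⟩ := hx
      obtain ⟨χ, hχ, h3, h4⟩ := hy
      refine ⟨fun x => φ x + χ x, hφ.add hχ, ?_, fun i => ?_⟩
      · filter_upwards [Lp.coeFn_add x.fst y.fst, h1, h3] with z e1 e2 e3
        rw [WithLp.add_fst, e1, Pi.add_apply, e2, e3]
      · filter_upwards [Lp.coeFn_add (x.snd i) (y.snd i), h2 i, h4 i] with z e1 e2 e3
        rw [WithLp.add_snd, PiLp.add_apply, e1, Pi.add_apply, e2, e3]
        rw [fderiv_fun_add (hφ.1.differentiable (by simp) z) (hχ.1.differentiable (by simp) z)]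
        rfl
    | smul a x _ hx =>
      obtain ⟨φ, hφ, h1, h2⟩ := hx
      refine ⟨fun x => a • φ x, hφ.of_eq_zero (hφ.1.const_smul a)
        (fun x hx => by rw [hx, smul_zero]), ?_, fun i => ?_⟩
      · filter_upwards [Lp.coeFn_smul a x.fst, h1] with z e1 e2
        rw [WithLp.smul_fst, e1, Pi.smul_apply, e2]
      · filter_upwards [Lp.coeFn_smul a (x.snd i), h2 i] with z e1 e2
        rw [WithLp.smul_snd, PiLp.smul_apply, e1, Pi.smul_apply, e2,
          fderiv_fun_const_smul (hφ.1.differentiable (by simp) z)]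
        rfl
  obtain ⟨x, hx, hxw⟩ := mem_closure_iff_seq_limit.mp
    (show (w : SpacePair Ω N) ∈ closure (SetLike.coe (Submodule.span ℂ _)) from w.2)
  choose φ hφ using fun k => hspan (x k) (hx k)
  refine ⟨fun k => ⟨x k, Submodule.le_topologicalClosure _ (hx k)⟩, φ, fun k => hφ k, ?_⟩
  exact tendsto_subtype_rng.mpr hxw

/-- Closed properties hold on `H¹₀` if they hold for test functions. -/
lemma induction_on {p : H10 Ω N → Prop} (w : H10 Ω N) (hp : IsClosed {w | p w})
    (h : ∀ w φ, IsTest w φ → p w) : p w := by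
  obtain ⟨q, φ, hq, hlim⟩ := exists_seq w
  exact hp.mem_of_tendsto hlim (.of_forall fun k => h _ _ (hq k))

lemma setIntegral_eq_of_zero {E : Type*} [NormedAddCommGroup E] [NormedSpace ℝ E] {f : Sp n → E}
    (h : ∀ x ∉ Ω, f x = 0) : ∫ x in Ω, f x = ∫ x, f x :=
  setIntegral_eq_integral_of_forall_compl_eq_zero h

/-- A component of the gradient as an operator on `H¹₀`. -/
def gradI {n : ℕ} (Ω : Set (Sp n)) (N : ℕ) (i : Fin n) : HilbertMap (H10 Ω N) (L2 Ω N) :=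
  PiLp.proj (𝕜 := ℂ) 2 (fun _ : Fin n => L2 Ω N) i ∘L gradL Ω N

/-- The real inner product of the values as a bilinear map is used for integration by parts. -/
lemma inner_grad_fn (ξ w : H10 Ω N) (i : Fin n) :
    inner ℂ (grad ξ i) (fn w) = -inner ℂ (fn ξ) (grad w i) := by
  have hg : Continuous fun w : H10 Ω N => grad w i := (gradI Ω N i).continuous
  have hf : Continuous fun w : H10 Ω N => fn w := (ι Ω N).continuous
  refine induction_on (p := fun ξ => inner ℂ (grad ξ i) (fn w) = -inner ℂ (fn ξ) (grad w i)) ξ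
    (isClosed_eq (hg.inner continuous_const) (hf.inner continuous_const).neg) fun ξ φ hφ => ?_
  refine induction_on (p := fun w => inner ℂ (grad ξ i) (fn w) = -inner ℂ (fn ξ) (grad w i)) w
    (isClosed_eq (continuous_const.inner hf) (continuous_const.inner hg).neg) fun w χ hχ => ?_
  have hφ' := hφ.1.fderiv_apply (single i 1)
  have hχ' := hχ.1.fderiv_apply (single i 1)
  have e1 : inner ℂ (grad ξ i) (fn w) = ∫ x, innerR (Orb N) (fderiv ℝ φ x (single i 1)) (χ x) := by
    rw [L2.inner_def, ← setIntegral_eq_of_zero (Ω := Ω)]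
    · refine integral_congr_ae ?_
      filter_upwards [hφ.2.2 i, hχ.2.1] with x h1 h2
      rw [h1, h2, innerR_apply]
    · intro x hx
      rw [hχ.1.eq_zero_of_notMem hx, map_zero]
  have e2 : inner ℂ (fn ξ) (grad w i) = ∫ x, innerR (Orb N) (φ x) (fderiv ℝ χ x (single i 1)) := by
    rw [L2.inner_def, ← setIntegral_eq_of_zero (Ω := Ω)]
    · refine integral_congr_ae ?_
      filter_upwards [hφ.2.1, hχ.2.2 i] with x h1 h2
      rw [h1, h2, innerR_apply]
    · intro x hx
      rw [hφ.1.eq_zero_of_notMem hx, map_zero, zero_apply]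
  have hint : ∀ {a b : Sp n → Orb N}, IsTestFun Ω a → IsTestFun Ω b →
      Integrable fun x => innerR (Orb N) (a x) (b x) := fun ha hb => by
    have h1 := (innerR (Orb N)).memLp_of_bilin 1 (ha.memLp 2 volume) (hb.memLp 2 volume)
    exact memLp_one_iff_integrable.mp h1
  rw [e1, e2, integral_bilinear_fderiv_right_eq_neg_left_of_integrable (hint hφ' hχ.1)
    (hint hφ.1 hχ') (hint hφ.1 hχ.1) (fun x _ => hφ.1.1.differentiable (by simp) x)
    (fun x _ => hχ.1.1.differentiable (by simp) x), neg_neg]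

lemma denseRange_ι (hΩ : IsOpen Ω) : DenseRange (ι Ω N) := by
  have h1 : (LinearMap.range (ι Ω N).toLinearMap)ᗮ = ⊥ := by
    rw [Submodule.eq_bot_iff]
    intro f hf
    rw [Submodule.mem_orthogonal] at hf
    have h2 : ∀ j : Fin N, ∀ᵐ x ∂vol Ω, f x j = 0 := fun j => by
      rw [ae_restrict_iff' hΩ.measurableSet]
      have hloc : LocallyIntegrableOn (fun x => f x j) Ω volume := by
        refine locallyIntegrableOn_of_locallyIntegrable_restrict ?_
        exact ((EuclideanSpace.proj (𝕜 := ℂ) j).comp_memLp' (Lp.memLp f)).locallyIntegrable one_le_two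
      refine hΩ.ae_eq_zero_of_integral_contDiff_smul_eq_zero hloc fun g h1 h2 h3 => ?_
      have hg : IsTestFun Ω fun x => (g x : ℝ) • (EuclideanSpace.single j 1 : Orb N) :=
        IsTestFun.of_eq_zero (f := g) ⟨h1, h2, h3⟩ (h1.smul contDiff_const)
          fun x hx => by rw [hx, zero_smul]
      obtain ⟨w, hw⟩ := exists_isTest hg
      have h4 := hf _ ⟨w, rfl⟩
      change inner ℂ (fn w) f = 0 at h4
      rw [L2.inner_def] at h4
      rw [← h4, ← setIntegral_eq_of_zero (Ω := Ω)]
      · refine integral_congr_ae ?_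
        filter_upwards [hw.2.1] with x hx
        rw [hx, inner_smul_left_eq_smul, EuclideanSpace.inner_single_left]
        simp
      · intro x hx
        rw [image_eq_zero_of_notMem_tsupport fun h => hx (h3 h), zero_smul]
    rw [Lp.eq_zero_iff_ae_eq_zero]
    filter_upwards [ae_all_iff.mpr h2] with x hx
    ext j
    simpa using hx j
  rw [← Submodule.topologicalClosure_eq_top_iff] at h1
  have h3 := congrArg (SetLike.coe) h1
  rw [Submodule.topologicalClosure_coe] at h3
  exact dense_iff_closure_eq.mpr h3

lemma isGelfand (hΩ : IsOpen Ω) : IsGelfand (ι Ω N) where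
  inj := by
    refine (injective_iff_map_eq_zero (ι Ω N)).mpr fun w hw => ?_
    have h0 : fn w = 0 := hw
    have h1 : ∀ i, grad w i = 0 := fun i => by
      refine (denseRange_ι hΩ).eq_zero_of_inner_right ℂ fun ξ => ?_
      have h2 := inner_grad_fn ξ w i
      rw [h0, inner_zero_right] at h2
      exact neg_eq_zero.mp h2.symm
    have h2 : grad w = 0 := by ext1 i; exact h1 i
    have h3 := norm_sq_eq w
    rw [h0, h2, norm_zero, norm_zero] at h3
    exact norm_eq_zero.mp (by nlinarith [norm_nonneg w])
  dense := denseRange_ι hΩ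
  norm_le := norm_fn_le

lemma isNegLaplacian_iff (Φ : H10 Ω N) (g : L2 Ω N) :
    IsNegLaplacian Φ g ↔ Φ = ContinuousLinearMap.adjoint (ι Ω N) (fn Φ + g) := by
  constructor
  · intro h
    refine ext_inner_left ℂ fun ξ => ?_
    rw [ContinuousLinearMap.adjoint_inner_right, inner_eq, h ξ, inner_add_right]; rfl
  · intro h ξ
    have h1 : inner ℂ ξ Φ = inner ℂ ξ (ContinuousLinearMap.adjoint (ι Ω N) (fn Φ + g)) :=
      congrArg _ h
    rw [ContinuousLinearMap.adjoint_inner_right, inner_eq, inner_add_right] at h1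
    exact add_left_cancel h1

end H10

/-! ### Radial kernels and Hardy's inequality -/

section Radial

/-- The regularised square distance `|y - x|² + ε²`. -/
def sqDist (x : Sp n) (ε : ℝ) (y : Sp n) : ℝ := ‖y - x‖ ^ 2 + ε ^ 2

lemma sqDist_pos {x : Sp n} {ε : ℝ} (hε : 0 < ε) (y : Sp n) : 0 < sqDist x ε y := by
  unfold sqDist; positivity

lemma contDiff_sqDist (x : Sp n) (ε : ℝ) : ContDiff ℝ ∞ (sqDist x ε) := by
  unfold sqDist
  exact ((contDiff_id.sub contDiff_const).norm_sq ℝ).add contDiff_const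

lemma hasLineDerivAt_sqDist (x : Sp n) (ε : ℝ) (i : Fin n) (y : Sp n) :
    HasLineDerivAt ℝ (sqDist x ε) (2 * (y i - x i)) y (single i 1) := by
  have h1 : (fun t : ℝ => sqDist x ε (y + t • single i 1))
      = fun t => (‖y - x‖ ^ 2 + ε ^ 2) + 2 * (y i - x i) * t + t ^ 2 := by
    funext t
    have e : y + t • single i (1 : ℝ) - x = (y - x) + t • single i (1 : ℝ) := by abel
    rw [sqDist, e, norm_add_sq_real, inner_smul_right, EuclideanSpace.inner_single_right, norm_smul,
      PiLp.norm_single]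
    simp
    ring
  rw [HasLineDerivAt, h1]
  have h2 := (((hasDerivAt_id (0 : ℝ)).const_mul (2 * (y i - x i))).const_add
    (‖y - x‖ ^ 2 + ε ^ 2)).add ((hasDerivAt_id (0 : ℝ)).pow 2)
  exact h2.congr_deriv (by simp)

lemma hasLineDerivAt_coord (x : Sp n) (i : Fin n) (y : Sp n) :
    HasLineDerivAt ℝ (fun y : Sp n => y i - x i) 1 y (single i 1) := by
  have h1 : (fun t : ℝ => (y + t • single i (1 : ℝ)) i - x i) = fun t => (y i - x i) + t := by
    funext t; simp; ring
  rw [HasLineDerivAt, h1]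
  simpa using (hasDerivAt_id (0 : ℝ)).const_add (y i - x i)

lemma hasLineDerivAt_rpow {x : Sp n} {ε : ℝ} (hε : 0 < ε) (q : ℝ) (i : Fin n) (y : Sp n) :
    HasLineDerivAt ℝ (fun y => sqDist x ε y ^ q)
      (2 * (y i - x i) * q * sqDist x ε y ^ (q - 1)) y (single i 1) := by
  have h1 := (hasLineDerivAt_sqDist x ε i y)
  rw [HasLineDerivAt] at h1 ⊢
  have h2 := h1.rpow_const (p := q) (Or.inl (by simpa using (sqDist_pos hε y).ne'))
  simpa using h2

lemma hasLineDerivAt_field {x : Sp n} {ε : ℝ} (hε : 0 < ε) (q : ℝ) (i : Fin n) (y : Sp n) :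
    HasLineDerivAt ℝ (fun y => (y i - x i) * sqDist x ε y ^ q)
      (sqDist x ε y ^ q + 2 * q * (y i - x i) ^ 2 * sqDist x ε y ^ (q - 1)) y
      (single i 1) := by
  have h1 := hasLineDerivAt_coord x i y
  have h2 := hasLineDerivAt_rpow (x := x) hε q i y
  rw [HasLineDerivAt] at h1 h2 ⊢
  have h3 := h1.mul h2
  refine h3.congr_deriv ?_
  simp
  ring

lemma continuous_sqDist_rpow {x : Sp n} {ε : ℝ} (hε : 0 < ε) (q : ℝ) :
    Continuous fun y : Sp n => sqDist x ε y ^ q :=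
  (contDiff_sqDist x ε).continuous.rpow_const fun y => Or.inl (sqDist_pos hε y).ne'

/-- The divergence of the field `(y - x) σ^q`. -/
lemma sum_field_deriv {x : Sp n} {ε : ℝ} (hε : 0 < ε) (q : ℝ) (y : Sp n) :
    ∑ i, (sqDist x ε y ^ q + 2 * q * (y i - x i) ^ 2 * sqDist x ε y ^ (q - 1))
      = (n + 2 * q) * sqDist x ε y ^ q - 2 * q * ε ^ 2 * sqDist x ε y ^ (q - 1) := by
  have h1 : ∑ i, (y i - x i) ^ 2 = sqDist x ε y - ε ^ 2 := by
    rw [sqDist, EuclideanSpace.norm_sq_eq, add_sub_cancel_right]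
    simp
  have h2 : sqDist x ε y ^ q = sqDist x ε y ^ (q - 1) * sqDist x ε y := by
    rw [← Real.rpow_add_one (sqDist_pos hε y).ne', sub_add_cancel]
  rw [Finset.sum_add_distrib, Finset.sum_const, Finset.card_univ, Fintype.card_fin, nsmul_eq_mul,
    ← Finset.sum_mul, ← Finset.mul_sum, h1, h2]
  ring

/-- Integration by parts against a function with compact support. -/
lemma integral_mul_lineDeriv {a b k k' : Sp n → ℝ} {v : Sp n} (ha : Continuous a)
    (hb : Continuous b) (hk : Continuous k) (hk' : Continuous k') (hks : HasCompactSupport k)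
    (hk's : HasCompactSupport k') (hab : ∀ y, HasLineDerivAt ℝ a (b y) y v)
    (hkk : ∀ y, HasLineDerivAt ℝ k (k' y) y v) : ∫ y, b y * k y = -∫ y, a y * k' y := by
  have h := integral_bilinear_hasLineDerivAt_right_eq_neg_left_of_integrable
    (B := ContinuousLinearMap.mul ℝ ℝ) (f := a) (f' := b) (g := k) (g' := k') (μ := volume)
    ((hb.mul hk).integrable_of_hasCompactSupport hks.mul_left)
    ((ha.mul hk').integrable_of_hasCompactSupport hk's.mul_left)
    ((ha.mul hk).integrable_of_hasCompactSupport hks.mul_left)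
    (fun y _ => hab y) (fun y _ => hkk y)
  simp only [ContinuousLinearMap.mul_apply'] at h
  rw [h, neg_neg]

end Radial

lemma integral_mul_norm_le {α E F : Type*} [MeasurableSpace α] {μ : Measure α}
    [NormedAddCommGroup E] [NormedAddCommGroup F]
    (f : Lp E 2 μ) (g : Lp F 2 μ) :
    Integrable (fun x => ‖f x‖ * ‖g x‖) μ ∧ ∫ x, ‖f x‖ * ‖g x‖ ∂μ ≤ ‖f‖ * ‖g‖ := by
  have hf := (Lp.memLp f).norm
  have hg := (Lp.memLp g).norm
  have h1 := real_inner_le_norm (hf.toLp _) (hg.toLp _)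
  rw [Lp.norm_toLp, Lp.norm_toLp, eLpNorm_norm, eLpNorm_norm, ← Lp.norm_def, ← Lp.norm_def,
    L2.inner_def] at h1
  have h2 : (∫ x, inner ℝ ((hf.toLp _ : α → ℝ) x) ((hg.toLp _ : α → ℝ) x) ∂μ)
      = ∫ x, ‖f x‖ * ‖g x‖ ∂μ := by
    refine integral_congr_ae ?_
    filter_upwards [hf.coeFn_toLp, hg.coeFn_toLp] with x h1 h2
    rw [h1, h2]
    simp [mul_comm]
  rw [h2] at h1
  refine ⟨?_, h1⟩
  exact hf.integrable_mul hg

namespace H10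

open Filter Topology

lemma hasLineDerivAt_of_isTestFun {F : Type*} [NormedAddCommGroup F] [NormedSpace ℝ F]
    {φ : Sp n → F} (hφ : IsTestFun Ω φ) (v y : Sp n) :
    HasLineDerivAt ℝ φ (fderiv ℝ φ y v) y v :=
  (hφ.1.differentiable (by simp) y).hasFDerivAt.hasLineDerivAt v

lemma hasLineDerivAt_norm_sq {φ : Sp n → Orb N} (hφ : IsTestFun Ω φ) (v y : Sp n) :
    HasLineDerivAt ℝ (fun y => ‖φ y‖ ^ 2) (2 * (inner ℂ (φ y) (fderiv ℝ φ y v)).re) y v := by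
  have h1 := hasLineDerivAt_of_isTestFun hφ v y
  rw [HasLineDerivAt] at h1 ⊢
  have h2 := hasDerivAt_re_inner h1 h1
  rw [inner_re_symm' (fderiv ℝ φ y v), ← two_mul] at h2
  simp only [zero_smul, add_zero] at h2
  refine h2.congr_of_eventuallyEq (.of_forall fun s => ?_)
  exact (inner_self_eq_norm_sq (𝕜 := ℂ) _).symm

/-- Hardy's inequality for a regularised kernel. -/
lemma hardy_regular {x : Sp n} {ε : ℝ} (hε : 0 < ε) (hn : 2 ≤ n) {w : H10 Ω N} {φ : Sp n → Orb N}
    (hφ : IsTest w φ) :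
    ∫ y in Ω, sqDist x ε y ^ (-1 / 2 : ℝ) * ‖fn w y‖ ^ 2 ≤ 2 * n * ‖fn w‖ * ‖w‖ := by
  set d : Fin n → Sp n → Orb N := fun i y => fderiv ℝ φ y (single i 1) with hd
  have hφc : Continuous φ := hφ.1.1.continuous
  have hdc : ∀ i, Continuous (d i) := fun i => (hφ.1.fderiv_apply _).1.continuous
  set b : Fin n → Sp n → ℝ := fun i y => sqDist x ε y ^ (-1 / 2 : ℝ)
    + 2 * (-1 / 2) * (y i - x i) ^ 2 * sqDist x ε y ^ ((-1 / 2 : ℝ) - 1) with hb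
  have hcoord : ∀ i, Continuous fun y : Sp n => y i - x i := fun i =>
    (EuclideanSpace.proj (𝕜 := ℝ) i).continuous.sub continuous_const
  have hbc : ∀ i, Continuous (b i) := fun i => by
    have h1 := continuous_sqDist_rpow (x := x) hε (-1 / 2)
    have h2 := continuous_sqDist_rpow (x := x) hε ((-1 / 2 : ℝ) - 1)
    exact h1.add ((continuous_const.mul ((hcoord i).pow 2)).mul h2)
  have hks : HasCompactSupport fun y => ‖φ y‖ ^ 2 := hφ.1.2.1.mono fun y hy h0 => hy (by simp [h0])
  have hk's : ∀ i, HasCompactSupport fun y => 2 * (inner ℂ (φ y) (d i y)).re := fun i =>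
    hφ.1.2.1.mono fun y hy h0 => hy (by simp [h0])
  have hreg : ∀ y : Sp n, 0 ≤ sqDist x ε y ^ (-1 / 2 : ℝ) := fun y =>
    Real.rpow_nonneg (sqDist_pos hε y).le _
  have hi : ∀ i, ∫ y, b i y * ‖φ y‖ ^ 2 ≤ 2 * (‖fn w‖ * ‖w‖) := fun i => by
    have e1 : ∫ y, b i y * ‖φ y‖ ^ 2 = -∫ y, ((y i - x i) * sqDist x ε y ^ (-1 / 2 : ℝ)) *
        (2 * (inner ℂ (φ y) (d i y)).re) := integral_mul_lineDeriv
      ((hcoord i).mul (continuous_sqDist_rpow (x := x) hε (-1 / 2)))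
      (hbc i) (hφc.norm.pow 2) (continuous_const.mul (Complex.continuous_re.comp
        (hφc.inner (hdc i)))) hks (hk's i) (hasLineDerivAt_field (x := x) hε (-1 / 2) i)
      (fun y => hasLineDerivAt_norm_sq hφ.1 _ y)
    have e2 := integral_mul_norm_le (fn w) (grad w i)
    have e3 : ∫ y in Ω, ‖fn w y‖ * ‖grad w i y‖ = ∫ y, ‖φ y‖ * ‖d i y‖ := by
      rw [← setIntegral_eq_of_zero (Ω := Ω)]
      · refine integral_congr_ae ?_
        filter_upwards [hφ.2.1, hφ.2.2 i] with y h1 h2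
        rw [h1, h2]
      · intro y hy
        rw [hφ.1.eq_zero_of_notMem hy, norm_zero, zero_mul]
    have e4 : |∫ y, ((y i - x i) * sqDist x ε y ^ (-1 / 2 : ℝ)) *
        (2 * (inner ℂ (φ y) (d i y)).re)| ≤ ∫ y, 2 * (‖φ y‖ * ‖d i y‖) := by
      rw [← norm_eq_abs]
      refine norm_integral_le_of_norm_le
        (((hφc.norm.mul (hdc i).norm).integrable_of_hasCompactSupport
          (hφ.1.2.1.norm.mul_right)).const_mul 2) (.of_forall fun y => ?_)
      have h1 : |(y i - x i) * sqDist x ε y ^ (-1 / 2 : ℝ)| ≤ 1 := by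
        have h2 : |y i - x i| ≤ √(sqDist x ε y) := by
          refine Real.abs_le_sqrt ?_
          have h3 : ‖(y - x) i‖ ≤ ‖y - x‖ := PiLp.norm_apply_le (y - x) i
          rw [sqDist]
          have h4 := pow_le_pow_left₀ (norm_nonneg _) h3 2
          rw [norm_eq_abs, sq_abs] at h4
          have h5 : (y - x) i = y i - x i := rfl
          rw [h5] at h4
          nlinarith [sq_nonneg ε]
        have h6 : sqDist x ε y ^ (-1 / 2 : ℝ) = (√(sqDist x ε y))⁻¹ := by
          rw [Real.sqrt_eq_rpow, ← Real.rpow_neg (sqDist_pos hε y).le]; norm_num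
        rw [abs_mul, h6, abs_of_nonneg (inv_nonneg.mpr (Real.sqrt_nonneg _)), ← div_eq_mul_inv]
        exact div_le_one_of_le₀ h2 (Real.sqrt_nonneg _)
      have h2 : |(inner ℂ (φ y) (d i y)).re| ≤ ‖φ y‖ * ‖d i y‖ :=
        abs_re_inner_le _ _
      rw [norm_eq_abs, abs_mul, abs_mul 2, abs_two]
      nlinarith [abs_nonneg ((y i - x i) * sqDist x ε y ^ (-1 / 2 : ℝ)),
        abs_nonneg (inner ℂ (φ y) (d i y)).re]
    rw [integral_const_mul] at e4
    have e5 : ‖fn w‖ * ‖grad w i‖ ≤ ‖fn w‖ * ‖w‖ := mul_le_left (norm_grad_apply_le w i)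
    have e6 := (abs_le.mp e4).1
    have e7 := e2.2
    rw [e3] at e7
    rw [e1]
    linarith
  have hint : ∀ i, Integrable fun y => b i y * ‖φ y‖ ^ 2 := fun i =>
    ((hbc i).mul (hφc.norm.pow 2)).integrable_of_hasCompactSupport hks.mul_left
  have hle : ∫ y, sqDist x ε y ^ (-1 / 2 : ℝ) * ‖φ y‖ ^ 2 ≤ ∫ y, ∑ i, b i y * ‖φ y‖ ^ 2 := by
    refine integral_mono (((continuous_sqDist_rpow (x := x) hε (-1 / 2)).mul
      (hφc.norm.pow 2)).integrable_of_hasCompactSupport hks.mul_left)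
      (integrable_finsetSum _ fun i _ => hint i) fun y => ?_
    simp only
    rw [← Finset.sum_mul, sum_field_deriv hε]
    refine mul_le_right ?_
    have h1 : 0 ≤ ε ^ 2 * sqDist x ε y ^ ((-1 / 2 : ℝ) - 1) :=
      mul_nonneg (sq_nonneg _) (Real.rpow_nonneg (sqDist_pos hε y).le _)
    have h2 : (2 : ℝ) ≤ n := by exact_mod_cast hn
    nlinarith [hreg y]
  have e8 : ∫ y in Ω, sqDist x ε y ^ (-1 / 2 : ℝ) * ‖fn w y‖ ^ 2
      = ∫ y, sqDist x ε y ^ (-1 / 2 : ℝ) * ‖φ y‖ ^ 2 := by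
    rw [← setIntegral_eq_of_zero (Ω := Ω)]
    · refine integral_congr_ae ?_
      filter_upwards [hφ.2.1] with y h1
      rw [h1]
    · intro y hy
      rw [hφ.1.eq_zero_of_notMem hy]; simp
  rw [e8]
  refine hle.trans ?_
  rw [integral_finsetSum _ fun i _ => hint i]
  refine (Finset.sum_le_sum fun i _ => hi i).trans_eq ?_
  simp
  ring

/-- Hardy's inequality `∫ |w|² / |x - y| dy ≤ C ‖w‖ ‖w‖_{H¹}`. -/
lemma hardy (hn : 2 ≤ n) (w : H10 Ω N) (x : Sp n) :
    Integrable (fun y => ‖fn w y‖ ^ 2 / ‖x - y‖) (vol Ω) ∧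
      ∫ y in Ω, ‖fn w y‖ ^ 2 / ‖x - y‖ ≤ 2 * n * ‖fn w‖ * ‖w‖ := by
  obtain ⟨p, φ, hp, hlim⟩ := exists_seq w
  have hfn : Tendsto (fun k => fn (p k)) atTop (𝓝 (fn w)) :=
    ((ι Ω N).continuous.tendsto w).comp hlim
  obtain ⟨ns, hns, hae⟩ := (tendstoInMeasure_of_tendsto_Lp hfn).exists_seq_tendsto_ae
  set ε : ℕ → ℝ := fun k => 1 / ((k : ℝ) + 1) with hε_def
  have hε : ∀ k, 0 < ε k := fun k => by positivity
  have hε0 : Tendsto ε atTop (𝓝 0) := tendsto_one_div_add_atTop_nhds_zero_nat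
  set f : ℕ → Sp n → ℝ := fun k y => sqDist x (ε k) y ^ (-1 / 2 : ℝ) * ‖fn (p (ns k)) y‖ ^ 2 with hf
  have hf0 : ∀ k y, 0 ≤ f k y := fun k y =>
    mul_nonneg (Real.rpow_nonneg (sqDist_pos (hε k) y).le _) (sq_nonneg _)
  have hfm : ∀ k, AEStronglyMeasurable (f k) (vol Ω) := fun k =>
    ((continuous_sqDist_rpow (hε k) _).aestronglyMeasurable).mul
      ((Lp.aestronglyMeasurable (fn (p (ns k)))).norm.pow 2)
  have hfi : ∀ k, Integrable (f k) (vol Ω) := fun k => by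
    refine Integrable.bdd_mul (c := (ε k ^ 2) ^ (-1 / 2 : ℝ)) ?_
      (continuous_sqDist_rpow (hε k) _).aestronglyMeasurable (.of_forall fun y => ?_)
    · exact (memLp_two_iff_integrable_sq_norm (Lp.aestronglyMeasurable _)).mp (Lp.memLp (fn (p (ns k))))
    · rw [norm_of_nonneg (Real.rpow_nonneg (sqDist_pos (hε k) y).le _)]
      refine Real.rpow_le_rpow_of_nonpos (pow_pos (hε k) 2) ?_ (by norm_num)
      rw [sqDist]; linarith [sq_nonneg ‖y - x‖]
  have hbound : ∀ k, ∫⁻ y in Ω, ofReal (f k y)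
      ≤ ofReal (2 * n * ‖fn (p (ns k))‖ * ‖p (ns k)‖) := fun k => by
    rw [← ofReal_integral_eq_lintegral_ofReal (hfi k) (.of_forall (hf0 k))]
    exact ENNReal.ofReal_le_ofReal (hardy_regular (hε k) hn (hp _))
  have hlimf : ∀ᵐ y ∂vol Ω, Tendsto (fun k => f k y) atTop (𝓝 (‖fn w y‖ ^ 2 / ‖x - y‖)) := by
    have hx : ∀ᵐ y ∂vol Ω, y ≠ x := by
      refine ae_restrict_of_ae ?_
      have : Nontrivial (Sp n) := by
        have : Nonempty (Fin n) := ⟨⟨0, by omega⟩⟩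
        infer_instance
      exact Measure.ae_ne volume x
    filter_upwards [hae, hx] with y hy hyx
    have hpos : 0 < ‖y - x‖ := norm_pos_iff.mpr (sub_ne_zero.mpr hyx)
    have h1 : Tendsto (fun k => sqDist x (ε k) y ^ (-1 / 2 : ℝ)) atTop
        (𝓝 ((‖y - x‖ ^ 2 + 0 ^ 2) ^ (-1 / 2 : ℝ))) :=
      ((hε0.pow 2).const_add (‖y - x‖ ^ 2)).rpow_const (Or.inl (by positivity))
    have h2 := h1.mul ((hy.norm).pow 2)
    have e : (‖y - x‖ ^ 2 + 0 ^ 2) ^ (-1 / 2 : ℝ) * ‖fn w y‖ ^ 2 = ‖fn w y‖ ^ 2 / ‖x - y‖ := by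
      rw [zero_pow two_ne_zero, add_zero, ← Real.rpow_natCast ‖y - x‖, ← Real.rpow_mul hpos.le,
        norm_sub_rev x y]
      norm_num [Real.rpow_neg_one]
      ring
    rwa [e] at h2
  have hfatou : ∫⁻ y in Ω, ofReal (‖fn w y‖ ^ 2 / ‖x - y‖)
      ≤ ofReal (2 * n * ‖fn w‖ * ‖w‖) := by
    have h1 : ∫⁻ y in Ω, ofReal (‖fn w y‖ ^ 2 / ‖x - y‖)
        = ∫⁻ y in Ω, liminf (fun k => ofReal (f k y)) atTop := by
      refine lintegral_congr_ae ?_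
      filter_upwards [hlimf] with y hy
      exact ((ENNReal.tendsto_ofReal hy).liminf_eq).symm
    rw [h1]
    refine (lintegral_liminf_le' fun k => (hfm k).aemeasurable.ennreal_ofReal).trans ?_
    have h2 : Tendsto (fun k => ofReal (2 * n * ‖fn (p (ns k))‖ * ‖p (ns k)‖)) atTop
        (𝓝 (ofReal (2 * n * ‖fn w‖ * ‖w‖))) :=
      ENNReal.tendsto_ofReal (((hfn.comp hns.tendsto_atTop).norm.const_mul _).mul
        ((hlim.comp hns.tendsto_atTop).norm))
    rw [← h2.liminf_eq]
    exact liminf_le_liminf (.of_forall hbound)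
  have hm : AEStronglyMeasurable (fun y => ‖fn w y‖ ^ 2 / ‖x - y‖) (vol Ω) :=
    aestronglyMeasurable_of_tendsto_ae _ hfm hlimf
  have h0 : ∀ y, 0 ≤ ‖fn w y‖ ^ 2 / ‖x - y‖ := fun y => by positivity
  have hint : Integrable (fun y => ‖fn w y‖ ^ 2 / ‖x - y‖) (vol Ω) := by
    refine ⟨hm, ?_⟩
    rw [hasFiniteIntegral_iff_ofReal (.of_forall h0)]
    exact hfatou.trans_lt ENNReal.ofReal_lt_top
  refine ⟨hint, ?_⟩
  rw [← ofReal_integral_eq_lintegral_ofReal hint (.of_forall h0)] at hfatou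
  exact (ENNReal.ofReal_le_ofReal_iff (by positivity)).mp hfatou

end H10

/-! ### The exchange-correlation term -/

section Radial

open Filter Topology

lemma hasDerivAt_ite_le {a b a' b' : ℝ → ℝ} {c : ℝ} {s : Set ℝ}
    (ha : ∀ y ∈ s, HasDerivAt a (a' y) y) (hb : ∀ y ∈ s, HasDerivAt b (b' y) y) (hc : a c = b c)
    (hc' : a' c = b' c) {x : ℝ} (hx : x ∈ s) :
    HasDerivAt (fun y => if y ≤ c then a y else b y) (if x ≤ c then a' x else b' x) x := by
  rcases lt_trichotomy x c with h | h | h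
  · rw [if_pos h.le]
    refine (ha x hx).congr_of_eventuallyEq ?_
    filter_upwards [Iio_mem_nhds h] with y hy
    exact if_pos (le_of_lt hy)
  · subst h
    rw [if_pos le_rfl]
    have h1 : HasDerivWithinAt (fun y => if y ≤ x then a y else b y) (a' x) (Iic x) x :=
      (ha x hx).hasDerivWithinAt.congr (fun y hy => if_pos hy) (if_pos le_rfl)
    have h2 : HasDerivWithinAt (fun y => if y ≤ x then a y else b y) (a' x) (Ici x) x := by
      rw [hc']
      refine (hb x hx).hasDerivWithinAt.congr (fun y hy => ?_) (by rw [if_pos le_rfl, hc])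
      rcases eq_or_lt_of_le (show x ≤ y from hy) with e | e
      · subst e; rw [if_pos le_rfl, hc]
      · exact if_neg (not_le.mpr e)
    have h3 := h1.union h2
    rwa [Iic_union_Ici, hasDerivWithinAt_univ] at h3
  · rw [if_neg (not_le.mpr h)]
    refine (hb x hx).congr_of_eventuallyEq ?_
    filter_upwards [Ioi_mem_nhds h] with y hy
    exact if_neg (not_le.mpr hy)

lemma exists_bound_of_eq_const {g : ℝ → ℝ} (hg : Continuous g) {c : ℝ}
    (h : ∀ ρ, c ≤ ρ → g ρ = g c) : ∃ K, ∀ ρ, 0 ≤ ρ → |g ρ| ≤ K := by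
  obtain ⟨K, hK⟩ := (isCompact_Icc (a := 0) (b := c)).exists_bound_of_continuousOn hg.continuousOn
  refine ⟨max K |g c|, fun ρ h0 => ?_⟩
  rcases le_total ρ c with hρ | hρ
  · exact (hK ρ ⟨h0, hρ⟩).trans (le_max_left _ _)
  · rw [h ρ hρ]; exact le_max_right _ _

/-- The derivative of `cutoffPoly n R`. -/
def cutoffSlope (n : ℕ) (R ρ : ℝ) : ℝ := R ^ (1 / n : ℝ) / n ^ 2 * ((n + 1) * ρ ^ 3 / R ^ 4
  - (4 * n + 5) * ρ ^ 2 / R ^ 3 + 4 * (n + 2) * ρ / R ^ 2 - 4 / R)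

/-- `ρ V_x'(ρ)`, up to the factor `exchangeConst n`. -/
def exchangeSlope (n : ℕ) (R ρ : ℝ) : ℝ := if ρ ≤ R then (1 / n : ℝ) * ρ ^ (1 / n : ℝ)
  else if ρ ≤ 2 * R then ρ * cutoffSlope n R ρ else 0

lemma exchange_eq (n : ℕ) {R : ℝ} : exchange n R = fun ρ => exchangeConst n *
    (if ρ ≤ R then ρ ^ (1 / n : ℝ)
      else if ρ ≤ 2 * R then cutoffPoly n R ρ else cutoffPoly n R (2 * R)) := by
  funext ρ
  rw [exchange]
  congr 1
  split_ifs with h1 h2 h3 h3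
  · rfl
  · rfl
  · exact absurd h2.le h3
  · rw [le_antisymm h3 (not_lt.mp h2)]
  · rfl

lemma cutoffPoly_eq (n : ℕ) {R : ℝ} (hR : 0 < R) (ρ : ℝ) : cutoffPoly n R ρ
    = (n + 1) * R ^ (1 / n : ℝ) / (4 * n ^ 2 * R ^ 4) * ρ ^ 4
      - (4 * n + 5) * R ^ (1 / n : ℝ) / (3 * n ^ 2 * R ^ 3) * ρ ^ 3
      + 2 * (n + 2) * R ^ (1 / n : ℝ) / (n ^ 2 * R ^ 2) * ρ ^ 2
      - 4 * R ^ (1 / n : ℝ) / (n ^ 2 * R) * ρ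
      + (12 * n ^ 2 - 11 * n + 17) * R ^ (1 / n : ℝ) / (12 * n ^ 2) := by
  simp only [cutoffPoly, Real.rpow_sub hR, Real.rpow_one, Real.rpow_ofNat]
  field_simp

lemma continuous_cutoffPoly (n : ℕ) (R : ℝ) : Continuous (cutoffPoly n R) := by
  unfold cutoffPoly; fun_prop

lemma cutoffPoly_self (hn : n ≠ 0) {R : ℝ} (hR : 0 < R) : cutoffPoly n R R = R ^ (1 / n : ℝ) := by
  have h : (n : ℝ) ≠ 0 := by exact_mod_cast hn
  rw [cutoffPoly_eq n hR]
  field_simp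
  ring

lemma hasDerivAt_cutoffPoly (n : ℕ) {R : ℝ} (hR : 0 < R) (ρ : ℝ) :
    HasDerivAt (cutoffPoly n R) (cutoffSlope n R ρ) ρ := by
  have e : cutoffPoly n R = _ := funext (cutoffPoly_eq n hR)
  rw [e]
  have hp : ∀ k : ℕ, HasDerivAt (fun y : ℝ => y ^ k) (k * ρ ^ (k - 1)) ρ := fun k => hasDerivAt_pow k ρ
  have h := ((((((hp 4).const_mul ((n + 1) * R ^ (1 / n : ℝ) / (4 * n ^ 2 * R ^ 4))).sub
    ((hp 3).const_mul ((4 * n + 5) * R ^ (1 / n : ℝ) / (3 * n ^ 2 * R ^ 3)))).add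
    ((hp 2).const_mul (2 * (n + 2) * R ^ (1 / n : ℝ) / (n ^ 2 * R ^ 2)))).sub
    ((hasDerivAt_id ρ).const_mul (4 * R ^ (1 / n : ℝ) / (n ^ 2 * R)))).add_const
    ((12 * n ^ 2 - 11 * n + 17) * R ^ (1 / n : ℝ) / (12 * n ^ 2)))
  refine h.congr_deriv ?_
  rw [cutoffSlope]
  rcases eq_or_ne (n : ℝ) 0 with h0 | h0
  · simp [h0]
  · field_simp
    push_cast
    ring

lemma hasDerivAt_exchange (hn : n ≠ 0) {R : ℝ} (hR : 0 < R) {ρ : ℝ} (hρ : 0 < ρ) :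
    HasDerivAt (exchange n R) (exchangeConst n * (exchangeSlope n R ρ / ρ)) ρ := by
  have h : (n : ℝ) ≠ 0 := by exact_mod_cast hn
  rw [exchange_eq]
  refine HasDerivAt.const_mul _ ?_
  have e : ∀ y : ℝ, 0 < y → exchangeSlope n R y / y = if y ≤ R then (1 / n : ℝ) * y ^ (1 / n - 1 : ℝ)
      else if y ≤ 2 * R then cutoffSlope n R y else 0 := fun y hy => by
    unfold exchangeSlope
    split_ifs
    · rw [Real.rpow_sub_one hy.ne']; ring
    · rw [mul_div_cancel_left₀ _ hy.ne']
    · simp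
  rw [e ρ hρ]
  refine hasDerivAt_ite_le (s := Ioi 0) (a' := fun y => (1 / n : ℝ) * y ^ (1 / n - 1 : ℝ))
    (b' := fun y => if y ≤ 2 * R then cutoffSlope n R y else 0)
    (fun y hy => Real.hasDerivAt_rpow_const (Or.inl (ne_of_gt hy)))
    (fun y hy => hasDerivAt_ite_le (s := univ) (b' := fun _ => 0)
      (fun z _ => hasDerivAt_cutoffPoly n hR z)
      (fun z _ => hasDerivAt_const z _) rfl ?_ (mem_univ y)) ?_ ?_ hρ
  · rw [cutoffSlope]
    field_simp
    ring
  · rw [if_pos (by linarith), cutoffPoly_self hn hR]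
  · rw [if_pos (by linarith), Real.rpow_sub_one hR.ne', cutoffSlope]
    field_simp
    ring

lemma continuous_exchange (hn : n ≠ 0) {R : ℝ} (hR : 0 < R) : Continuous (exchange n R) := by
  rw [exchange_eq]
  refine continuous_const.mul (Continuous.if_le ?_ (Continuous.if_le (continuous_cutoffPoly n R)
    continuous_const continuous_id continuous_const ?_) continuous_id continuous_const ?_)
  · exact continuous_id.rpow_const fun _ => Or.inr (by positivity)
  · rintro x rfl; rfl
  · rintro x rfl
    rw [if_pos (by linarith), cutoffPoly_self hn hR]

lemma continuous_exchangeSlope (hn : n ≠ 0) {R : ℝ} (hR : 0 < R) :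
    Continuous (exchangeSlope n R) := by
  have h : (n : ℝ) ≠ 0 := by exact_mod_cast hn
  unfold exchangeSlope cutoffSlope
  refine Continuous.if_le ?_ (Continuous.if_le (by fun_prop)
    continuous_const continuous_id continuous_const ?_) continuous_id continuous_const ?_
  · exact continuous_const.mul (continuous_id.rpow_const fun _ => Or.inr (by positivity))
  · rintro x rfl
    field_simp
    ring
  · rintro x rfl
    rw [if_pos (by linarith)]
    field_simp
    ring

lemma exists_bound_exchange (hn : n ≠ 0) {R : ℝ} (hR : 0 < R) :
    ∃ K, ∀ ρ, 0 ≤ ρ → |exchange n R ρ| ≤ K ∧ |exchangeSlope n R ρ| ≤ K := by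
  have h : (n : ℝ) ≠ 0 := by exact_mod_cast hn
  obtain ⟨K₁, h1⟩ := exists_bound_of_eq_const (continuous_exchange hn hR) (c := 2 * R) fun ρ hρ => by
    rw [exchange, exchange, if_neg (by linarith), if_neg (by linarith), if_neg (by linarith),
      if_neg (by linarith)]
  obtain ⟨K₂, h2⟩ := exists_bound_of_eq_const (continuous_exchangeSlope hn hR) (c := 3 * R)
    fun ρ hρ => by
      rw [exchangeSlope, exchangeSlope, if_neg (by linarith), if_neg (by linarith),
        if_neg (by linarith), if_neg (by linarith)]
  exact ⟨max K₁ K₂, fun ρ hρ => ⟨(h1 ρ hρ).trans (le_max_left _ _),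
    (h2 ρ hρ).trans (le_max_right _ _)⟩⟩

/-- The real-linear functional `l ↦ Re (z, l)`. -/
def reInner (z : Orb N) : Orb N →L[ℝ] ℝ := reCLM ∘L innerR (Orb N) z

lemma reInner_apply (z l : Orb N) : reInner z l = (inner ℂ z l).re := rfl

lemma abs_reInner_le (z l : Orb N) : |reInner z l| ≤ ‖z‖ * ‖l‖ :=
  abs_re_inner_le z l

lemma continuous_reInner : Continuous (reInner (N := N)) :=
  (ContinuousLinearMap.compL ℝ (Orb N) ℂ ℝ reCLM).continuous.comp (innerR (Orb N)).continuous

lemma hasFDerivAt_norm_sq (z : Orb N) :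
    HasFDerivAt (fun w : Orb N => ‖w‖ ^ 2) ((2 : ℝ) • reInner z) z := by
  have h1 : HasFDerivAt (fun w : Orb N => (innerR (Orb N) w w)) _ z :=
    (innerR (Orb N)).hasFDerivAt_of_bilinear (hasFDerivAt_id z) (hasFDerivAt_id z)
  have h2 := reCLM.hasFDerivAt.comp z h1
  have e : (fun w : Orb N => ‖w‖ ^ 2) = reCLM ∘ fun w => innerR (Orb N) w w := by
    funext w
    exact (inner_self_eq_norm_sq (𝕜 := ℂ) w).symm
  rw [e]
  refine h2.congr_fderiv ?_
  ext l
  simp only [ContinuousLinearMap.comp_apply, smul_apply, reInner_apply, smul_eq_mul]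
  simp [innerR_apply]
  rw [← inner_re_symm' z l]
  ring

/-- The derivative of `z ↦ V(|z|²) z` at `z`, where `d` is the derivative of `V` at `|z|²`. -/
def radialDeriv (V : ℝ → ℝ) (d : ℝ) (z : Orb N) : Orb N →L[ℝ] Orb N :=
  V (‖z‖ ^ 2) • ContinuousLinearMap.id ℝ (Orb N) + (d * 2) • (reInner z).smulRight z

lemma radialDeriv_apply (V : ℝ → ℝ) (d : ℝ) (z l : Orb N) : radialDeriv V d z l
    = V (‖z‖ ^ 2) • l + (d * (2 * (inner ℂ z l).re)) • z := by
  simp [radialDeriv, reInner_apply, smul_smul, mul_assoc]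

lemma hasFDerivAt_radial {V : ℝ → ℝ} (hV : ContinuousOn V (Ici 0)) {d : ℝ} {z : Orb N}
    (hd : z ≠ 0 → HasDerivAt V d (‖z‖ ^ 2)) :
    HasFDerivAt (fun w : Orb N => V (‖w‖ ^ 2) • w) (radialDeriv V d z) z := by
  rcases eq_or_ne z 0 with rfl | hz
  · have e : radialDeriv V d (0 : Orb N) = V 0 • ContinuousLinearMap.id ℝ (Orb N) := by
      ext1 l; simp [radialDeriv_apply]
    rw [e, hasFDerivAt_iff_isLittleO_nhds_zero, Asymptotics.isLittleO_iff]
    intro c hc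
    have h1 : Tendsto (fun w : Orb N => V (‖w‖ ^ 2)) (𝓝 0) (𝓝 (V 0)) := by
      have h2 : Tendsto (fun w : Orb N => ‖w‖ ^ 2) (𝓝 0) (𝓝[Ici 0] 0) := by
        refine tendsto_nhdsWithin_iff.mpr ⟨?_, .of_forall fun w => sq_nonneg ‖w‖⟩
        have h3 : Continuous fun w : Orb N => ‖w‖ ^ 2 := by fun_prop
        simpa using h3.tendsto 0
      exact (hV 0 self_mem_Ici).tendsto.comp h2
    filter_upwards [Metric.tendsto_nhds.mp h1 c hc] with w hw
    rw [dist_eq_norm] at hw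
    have e2 : V (‖(0 : Orb N) + w‖ ^ 2) • (0 + w) - V (‖(0 : Orb N)‖ ^ 2) • (0 : Orb N)
        - (V 0 • ContinuousLinearMap.id ℝ (Orb N)) w = (V (‖w‖ ^ 2) - V 0) • w := by
      simp [sub_smul]
    rw [e2, norm_smul]
    exact mul_le_right hw.le
  · have h1 := ((hd hz).comp_hasFDerivAt z (hasFDerivAt_norm_sq z)).smul (hasFDerivAt_id z)
    refine h1.congr_fderiv ?_
    ext1 l
    simp [radialDeriv_apply, reInner_apply, smul_smul, mul_assoc]

lemma differentiableAt_of_radial {V : ℝ → ℝ}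
    (h : Differentiable ℝ fun z : Orb N => V (‖z‖ ^ 2) • z) {z : Orb N} (hz : z ≠ 0) :
    DifferentiableAt ℝ V (‖z‖ ^ 2) := by
  have hz' : 0 < ‖z‖ := norm_pos_iff.mpr hz
  have hpos : (0 : ℝ) < ‖z‖ ^ 2 := by positivity
  set e : Orb N := (‖z‖⁻¹ : ℝ) • z with he
  have hen : ‖e‖ = 1 := by rw [he, norm_smul, norm_inv, norm_norm, inv_mul_cancel₀ hz'.ne']
  -- `V` is recovered from its radial map along the ray through `z`
  have h1 : DifferentiableAt ℝ (fun ρ : ℝ => (√ρ)⁻¹ * reInner e (V (‖√ρ • e‖ ^ 2) • (√ρ • e)))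
      (‖z‖ ^ 2) := by
    have hs : DifferentiableAt ℝ (fun ρ : ℝ => √ρ) (‖z‖ ^ 2) :=
      (Real.hasDerivAt_sqrt hpos.ne').differentiableAt
    refine (hs.inv (Real.sqrt_pos.mpr hpos).ne').mul ?_
    refine (reInner e).differentiableAt.comp _ ?_
    exact DifferentiableAt.comp (𝕜 := ℝ) (g := fun z : Orb N => V (‖z‖ ^ 2) • z)
      (f := fun ρ : ℝ => √ρ • e) _ (h _) (hs.smul_const e)
  refine h1.congr_of_eventuallyEq ?_
  filter_upwards [Ioi_mem_nhds hpos] with ρ hρ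
  have hρ' : 0 < √ρ := Real.sqrt_pos.mpr hρ
  rw [norm_smul, hen, mul_one, norm_of_nonneg hρ'.le, Real.sq_sqrt (le_of_lt hρ), map_smul,
    map_smul, smul_eq_mul, smul_eq_mul, reInner_apply]
  have : (inner ℂ e e).re = 1 := by
    have := inner_self_eq_norm_sq (𝕜 := ℂ) e
    rw [hen] at this; simpa using this
  rw [this]
  field_simp

lemma contDiff_exchange (hn : n ≠ 0) {R : ℝ} (hR : 0 < R) :
    ContDiff ℝ 1 (fun z : Orb N => exchange n R (‖z‖ ^ 2) • z) ∧
    ∃ L, ∀ z : Orb N, ‖fderiv ℝ (fun z : Orb N => exchange n R (‖z‖ ^ 2) • z) z‖ ≤ L := by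
  obtain ⟨K, hK⟩ := exists_bound_exchange hn hR
  set D : Orb N → (Orb N →L[ℝ] Orb N) := fun z => radialDeriv (exchange n R)
    (exchangeConst n * (exchangeSlope n R (‖z‖ ^ 2) / ‖z‖ ^ 2)) z with hD
  have hd : ∀ z : Orb N, HasFDerivAt (fun z : Orb N => exchange n R (‖z‖ ^ 2) • z) (D z) z :=
    fun z => hasFDerivAt_radial (continuous_exchange hn hR).continuousOn fun hz =>
      hasDerivAt_exchange hn hR (pow_pos (norm_pos_iff.mpr hz) 2)
  have hfd : fderiv ℝ (fun z : Orb N => exchange n R (‖z‖ ^ 2) • z) = D :=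
    funext fun z => (hd z).fderiv
  have hr : ∀ z : Orb N, ‖(reInner z).smulRight z‖ ≤ ‖z‖ ^ 2 := fun z => by
    refine ContinuousLinearMap.opNorm_le_bound _ (sq_nonneg _) fun l => ?_
    rw [ContinuousLinearMap.smulRight_apply, norm_smul, sq]
    nlinarith [abs_reInner_le z l, norm_nonneg z, norm_eq_abs (reInner z l)]
  have hE : ∀ z : Orb N, ‖(exchangeConst n * (exchangeSlope n R (‖z‖ ^ 2) / ‖z‖ ^ 2) * 2) •
      (reInner z).smulRight z‖ ≤ 2 * |exchangeConst n| * |exchangeSlope n R (‖z‖ ^ 2)| := fun z => by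
    rw [norm_smul]
    refine (mul_le_left (hr z)).trans ?_
    rw [norm_eq_abs, abs_mul, abs_mul, abs_div, abs_two, abs_of_nonneg (sq_nonneg ‖z‖)]
    rcases eq_or_ne ‖z‖ 0 with h0 | h0
    · rw [h0]; simp; positivity
    · field_simp; exact le_rfl
  have hz2 : Continuous fun z : Orb N => ‖z‖ ^ 2 := by fun_prop
  have hslope := (continuous_exchangeSlope hn hR).comp hz2
  have hDc : Continuous D := by
    refine (((continuous_exchange hn hR).comp hz2).smul continuous_const).add ?_
    rw [continuous_iff_continuousAt]
    intro z
    rcases eq_or_ne z 0 with rfl | hz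
    · rw [ContinuousAt, tendsto_iff_norm_sub_tendsto_zero]
      have h0 : exchangeSlope n R 0 = 0 := by
        rw [exchangeSlope, if_pos hR.le, Real.zero_rpow (by positivity), mul_zero]
      have h1 := ((hslope.tendsto (0 : Orb N)).abs).const_mul (2 * |exchangeConst n|)
      simp only [Function.comp_apply, norm_zero, ne_eq, OfNat.ofNat_ne_zero, not_false_eq_true,
        zero_pow, h0, abs_zero, mul_zero] at h1
      refine squeeze_zero (fun _ => norm_nonneg _) (fun w => ?_) h1
      refine le_trans (le_of_eq ?_) (hE w)
      congr 1
      simp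
      exact smul_zero (A := Orb N →L[ℝ] Orb N) (0 : ℝ)
    · have hne : ‖z‖ ^ 2 ≠ 0 := by simpa using hz
      have h1 : ContinuousAt (fun z : Orb N => exchangeConst n *
          (exchangeSlope n R (‖z‖ ^ 2) / ‖z‖ ^ 2) * 2) z :=
        (continuousAt_const.mul (hslope.continuousAt.div hz2.continuousAt hne)).mul
          continuousAt_const
      refine h1.smul ?_
      · have h2 : Continuous fun w : Orb N => (reInner w).smulRight w := by
          have := continuous_reInner (N := N)
          fun_prop
        exact h2.continuousAt
  refine ⟨contDiff_one_iff_fderiv.mpr ⟨fun z => (hd z).differentiableAt, hfd ▸ hDc⟩,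
    K + 2 * |exchangeConst n| * K, fun z => ?_⟩
  rw [hfd]
  have hk := hK (‖z‖ ^ 2) (sq_nonneg _)
  have hK0 : 0 ≤ K := (abs_nonneg _).trans hk.1
  refine (norm_add_le _ _).trans (add_le_add ?_ ((hE z).trans ?_))
  · rw [norm_smul]
    have := ContinuousLinearMap.norm_id_le (𝕜 := ℝ) (E := Orb N)
    calc _ ≤ ‖exchange n R (‖z‖ ^ 2)‖ * 1 := by gcongr
      _ ≤ K := by rw [mul_one]; exact hk.1
  · have := hk.2
    gcongr

end Radial

namespace Problem

variable (P : Problem n N)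

/-- The map `z ↦ V_xc(|z|²) z` on `ℂᴺ`. -/
def xcMap (z : Orb N) : Orb N := P.Vxc (‖z‖ ^ 2) • z

/-- The properties of the exchange-correlation term on which the analysis rests. -/
structure XcBound (L : ℝ) : Prop where
  nonneg : 0 ≤ L
  contDiff : ContDiff ℝ 1 P.xcMap
  norm_fderiv_le : ∀ z, ‖fderiv ℝ P.xcMap z‖ ≤ L
  continuousOn : ContinuousOn P.Vxc (Ici 0)
  abs_le : ∀ ρ, 0 ≤ ρ → |P.Vxc ρ| ≤ L
  fderiv_apply : ∀ z l, fderiv ℝ P.xcMap z l = P.Vxc (‖z‖ ^ 2) • l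
    + (deriv P.Vxc (‖z‖ ^ 2) * (2 * (inner ℂ z l).re)) • z

lemma exists_xcBound (hn : n ≠ 0) (hR : 0 < P.R) (hVc : P.CorrelationAssumption) :
    ∃ L, P.XcBound L := by
  obtain ⟨K₁, h1⟩ := exists_bound_exchange hn hR
  obtain ⟨K₂, h2⟩ := hVc.bounded
  obtain ⟨hx, L₁, h3⟩ := contDiff_exchange (N := N) hn hR
  obtain ⟨L₂, h4⟩ := hVc.bounded_fderiv
  have hc := hVc.contDiff
  have e : P.xcMap = (fun z : Orb N => exchange n P.R (‖z‖ ^ 2) • z)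
      + fun z : Orb N => P.Vc (‖z‖ ^ 2) • z := by
    funext z; simp [xcMap, Vxc, add_smul]
  have hcont : ContinuousOn P.Vxc (Ici 0) :=
    (continuous_exchange hn hR).continuousOn.add hVc.continuousOn
  refine ⟨max (K₁ + K₂) (L₁ + L₂), ?_, ?_, fun z => ?_, hcont, fun ρ hρ => ?_, fun z l => ?_⟩
  · exact le_max_of_le_right (add_nonneg ((norm_nonneg _).trans (h3 0)) ((norm_nonneg _).trans (h4 0)))
  · rw [e]; exact hx.add hc
  · rw [e, fderiv_add (hx.differentiable one_ne_zero z) (hc.differentiable one_ne_zero z)]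
    exact le_max_of_le_right ((norm_add_le _ _).trans (add_le_add (h3 z) (h4 z)))
  · exact le_max_of_le_left ((abs_add_le _ _).trans (add_le_add (h1 ρ hρ).1 (h2 ρ hρ)))
  · have h5 : HasFDerivAt P.xcMap (radialDeriv P.Vxc (deriv P.Vxc (‖z‖ ^ 2)) z) z := by
      refine hasFDerivAt_radial hcont fun hz => ?_
      refine DifferentiableAt.hasDerivAt ?_
      exact (hasDerivAt_exchange hn hR (pow_pos (norm_pos_iff.mpr hz) 2)).differentiableAt.add
        (differentiableAt_of_radial (hc.differentiable one_ne_zero) hz)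
    rw [h5.fderiv, radialDeriv_apply]

end Problem

/-! ### Superposition operators on `L²` -/

section Superposition

open Filter Topology

variable {α : Type*} [MeasurableSpace α] {μ : Measure α} {E F G : Type*} [NormedAddCommGroup E]
  [NormedSpace ℝ E] [NormedAddCommGroup F] [NormedSpace ℝ F] [NormedAddCommGroup G]
  [NormedSpace ℝ G]

lemma Lp.real_norm_sq (q : Lp ℝ 2 μ) : ‖q‖ ^ 2 = ∫ x, q x ^ 2 ∂μ := by
  rw [← real_inner_self_eq_norm_sq, L2.inner_def]
  refine integral_congr_ae (.of_forall fun x => ?_)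
  simp

/-- Dominated convergence along an `L²`-convergent sequence of arguments. -/
lemma tendsto_norm_superposition {ψ : ℕ → Lp E 2 μ} {ψ₀ : Lp E 2 μ}
    (hψ : Tendsto ψ atTop (𝓝 ψ₀)) {g : α → E → ℝ} {C : ℝ} (hg : ∀ x z, |g x z| ≤ C)
    (hg0 : ∀ᵐ x ∂μ, Tendsto (g x) (𝓝 (ψ₀ x)) (𝓝 0)) (h : Lp F 2 μ) {q : ℕ → Lp ℝ 2 μ}
    (hq : ∀ k, q k =ᵐ[μ] fun x => g x (ψ k x) * ‖h x‖) :
    Tendsto (fun k => ‖q k‖) atTop (𝓝 0) := by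
  refine tendsto_of_subseq_tendsto fun ns hns => ?_
  obtain ⟨ms, -, hae⟩ := (tendstoInMeasure_of_tendsto_Lp (hψ.comp hns)).exists_seq_tendsto_ae
  refine ⟨ms, ?_⟩
  have h1 : Tendsto (fun k => ∫ x, q (ns (ms k)) x ^ 2 ∂μ) atTop (𝓝 (∫ _, (0 : ℝ) ∂μ)) := by
    refine tendsto_integral_of_dominated_convergence (fun x => C ^ 2 * ‖h x‖ ^ 2)
      (fun k => (Lp.aestronglyMeasurable _).pow 2) ?_ (fun k => ?_) ?_
    · exact ((Lp.memLp h).norm.integrable_sq).const_mul _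
    · filter_upwards [hq (ns (ms k))] with x hx
      rw [hx, mul_pow, norm_mul, norm_pow, norm_pow, norm_norm, norm_eq_abs]
      gcongr
      exact hg _ _
    · filter_upwards [hae, hg0, ae_all_iff.mpr hq] with x h1 h2 h3
      simp only [h3]
      have := ((h2.comp h1).mul_const ‖h x‖).pow 2
      simpa using this
  rw [integral_zero] at h1
  have h2 := h1.sqrt
  rw [Real.sqrt_zero] at h2
  refine h2.congr fun k => ?_
  rw [← Lp.real_norm_sq, Real.sqrt_sq (norm_nonneg _)]

/-- A bounded continuous coefficient. -/
structure IsCoeff (A : E → F →L[ℝ] G) (K : ℝ) : Prop where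
  cont : Continuous A
  bound : ∀ z, ‖A z‖ ≤ K

variable {A : E → F →L[ℝ] G} {K : ℝ}

lemma IsCoeff.nonneg (hA : IsCoeff A K) : 0 ≤ K := (norm_nonneg _).trans (hA.bound 0)

lemma IsCoeff.norm_apply_le (hA : IsCoeff A K) (z : E) (w : F) : ‖A z w‖ ≤ K * ‖w‖ :=
  ((A z).le_opNorm w).trans (mul_le_right (hA.bound z))

lemma IsCoeff.memLp (hA : IsCoeff A K) (ψ : Lp E 2 μ) (h : Lp F 2 μ) :
    MemLp (fun x => A (ψ x) (h x)) 2 μ := by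
  refine MemLp.of_le_mul (c := K) (Lp.memLp h) ?_ (.of_forall fun x => hA.norm_apply_le _ _)
  have h1 : Continuous fun p : E × F => A p.1 p.2 :=
    (hA.cont.comp continuous_fst).clm_apply continuous_snd
  exact h1.comp_aestronglyMeasurable
    ((Lp.aestronglyMeasurable ψ).prodMk (Lp.aestronglyMeasurable h))

/-- The function `x ↦ A(ψ(x)) h(x)` as an element of `L²`. -/
def superpose (hA : IsCoeff A K) (ψ : Lp E 2 μ) (h : Lp F 2 μ) : Lp G 2 μ := (hA.memLp ψ h).toLp _

lemma coeFn_superpose (hA : IsCoeff A K) (ψ : Lp E 2 μ) (h : Lp F 2 μ) :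
    superpose hA ψ h =ᵐ[μ] fun x => A (ψ x) (h x) := MemLp.coeFn_toLp _

lemma superpose_sub (hA : IsCoeff A K) (ψ : Lp E 2 μ) (h k : Lp F 2 μ) :
    superpose hA ψ (h - k) = superpose hA ψ h - superpose hA ψ k := by
  refine Lp.ext ?_
  filter_upwards [coeFn_superpose hA ψ (h - k), coeFn_superpose hA ψ h, coeFn_superpose hA ψ k,
    Lp.coeFn_sub h k, Lp.coeFn_sub (superpose hA ψ h) (superpose hA ψ k)] with x h1 h2 h3 h4 h5
  rw [h1, h5, Pi.sub_apply, h2, h3, h4, Pi.sub_apply, map_sub]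

lemma norm_superpose_le (hA : IsCoeff A K) (ψ : Lp E 2 μ) (h : Lp F 2 μ) :
    ‖superpose hA ψ h‖ ≤ K * ‖h‖ := by
  refine Lp.norm_le_mul_norm_of_ae_le_mul ?_
  filter_upwards [coeFn_superpose hA ψ h] with x h1
  rw [h1]
  exact hA.norm_apply_le _ _

lemma continuous_superpose (hA : IsCoeff A K) :
    Continuous fun p : Lp E 2 μ × Lp F 2 μ => superpose hA p.1 p.2 := by
  have hK := hA.nonneg
  refine continuous_iff_seqContinuous.mpr fun p p₀ hp => ?_
  have hp1 : Tendsto (fun k => (p k).1) atTop (𝓝 p₀.1) := (continuous_fst.tendsto _).comp hp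
  have hp2 : Tendsto (fun k => (p k).2) atTop (𝓝 p₀.2) := (continuous_snd.tendsto _).comp hp
  have hm : ∀ ψ : Lp E 2 μ, MemLp (fun x => ‖A (ψ x) - A (p₀.1 x)‖ * ‖p₀.2 x‖) 2 μ := fun ψ => by
    refine MemLp.of_le_mul (c := 2 * K) (Lp.memLp p₀.2) ?_ (.of_forall fun x => ?_)
    · exact (((hA.cont.comp_aestronglyMeasurable (Lp.aestronglyMeasurable ψ)).sub
        (hA.cont.comp_aestronglyMeasurable (Lp.aestronglyMeasurable p₀.1))).norm).mul
        (Lp.aestronglyMeasurable p₀.2).norm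
    · rw [norm_mul, norm_norm, norm_norm]
      refine mul_le_right ((norm_sub_le _ _).trans ?_)
      linarith [hA.bound (ψ x), hA.bound (p₀.1 x)]
  have h1 : Tendsto (fun k => ‖(hm (p k).1).toLp _‖) atTop (𝓝 0) := by
    refine tendsto_norm_superposition hp1 (g := fun x z => ‖A z - A (p₀.1 x)‖) (C := 2 * K)
      (fun x z => ?_) (.of_forall fun x => ?_) p₀.2 fun k => MemLp.coeFn_toLp _
    · rw [abs_of_nonneg (norm_nonneg _)]
      exact (norm_sub_le _ _).trans (by linarith [hA.bound z, hA.bound (p₀.1 x)])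
    · have hc : Continuous fun z => ‖A z - A (p₀.1 x)‖ := (hA.cont.sub continuous_const).norm
      have := hc.tendsto (p₀.1 x)
      simpa using this
  rw [tendsto_iff_norm_sub_tendsto_zero]
  have h2 : Tendsto (fun k => K * ‖(p k).2 - p₀.2‖ + ‖(hm (p k).1).toLp _‖) atTop (𝓝 0) := by
    have := ((tendsto_iff_norm_sub_tendsto_zero.mp hp2).const_mul K).add h1
    simpa using this
  refine squeeze_zero (fun _ => norm_nonneg _) (fun k => ?_) h2
  have e : superpose hA (p k).1 (p k).2 - superpose hA p₀.1 p₀.2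
      = superpose hA (p k).1 ((p k).2 - p₀.2)
        + (superpose hA (p k).1 p₀.2 - superpose hA p₀.1 p₀.2) := by
    rw [superpose_sub]; abel
  change ‖superpose hA (p k).1 (p k).2 - superpose hA p₀.1 p₀.2‖ ≤ _
  rw [e]
  refine (norm_add_le _ _).trans (add_le_add (norm_superpose_le _ _ _) ?_)
  refine Lp.norm_le_norm_of_ae_le ?_
  filter_upwards [Lp.coeFn_sub (superpose hA (p k).1 p₀.2) (superpose hA p₀.1 p₀.2),
    coeFn_superpose hA (p k).1 p₀.2, coeFn_superpose hA p₀.1 p₀.2,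
    (hm (p k).1).coeFn_toLp] with x h1 h2 h3 h4
  rw [h1, h4, Pi.sub_apply, h2, h3, ← sub_apply, norm_mul, norm_norm, norm_norm]
  exact ContinuousLinearMap.le_opNorm _ _

end Superposition

section Multiplication

open Filter Topology H10

/-- A measurable function with `|m| ≤ C` almost everywhere on `Ω`. -/
structure IsBdd (Ω : Set (Sp n)) (m : Sp n → ℝ) (C : ℝ) : Prop where
  meas : AEStronglyMeasurable m (vol Ω)
  nonneg : 0 ≤ C
  bound : ∀ᵐ x ∂vol Ω, |m x| ≤ C

variable {m : Sp n → ℝ} {C : ℝ}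

lemma isBdd_Lp (m : Lp ℝ ⊤ (vol Ω)) : IsBdd Ω m ‖m‖ where
  meas := Lp.aestronglyMeasurable m
  nonneg := norm_nonneg _
  bound := by
    filter_upwards [ae_le_eLpNormEssSup (f := m) (μ := vol Ω)] with x hx
    rw [Lp.norm_def, eLpNorm_exponent_top]
    have h1 := ENNReal.toReal_mono (by
      rw [← eLpNorm_exponent_top]; exact (Lp.eLpNorm_lt_top m).ne) hx
    simpa using h1

lemma IsBdd.memLp (hm : IsBdd Ω m C) (f : L2 Ω N) : MemLp (fun x => m x • f x) 2 (vol Ω) := by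
  refine MemLp.of_le_mul (c := C) (Lp.memLp f) (hm.meas.smul (Lp.aestronglyMeasurable f)) ?_
  filter_upwards [hm.bound] with x hx
  rw [norm_smul, norm_eq_abs]
  exact mul_le_right hx

/-- Multiplication by a bounded real function. -/
def mulOp (N : ℕ) (hm : IsBdd Ω m C) : HilbertMap (L2 Ω N) (L2 Ω N) := LinearMap.mkContinuous
    { toFun := fun f => (hm.memLp f).toLp _
      map_add' := fun f g => by
        refine Lp.ext ?_
        filter_upwards [(hm.memLp (f + g)).coeFn_toLp, (hm.memLp f).coeFn_toLp,
          (hm.memLp g).coeFn_toLp, Lp.coeFn_add f g,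
          Lp.coeFn_add ((hm.memLp f).toLp _) ((hm.memLp g).toLp _)] with x h1 h2 h3 h4 h5
        rw [h1, h5, Pi.add_apply, h2, h3, h4, Pi.add_apply, smul_add]
      map_smul' := fun a f => by
        refine Lp.ext ?_
        filter_upwards [(hm.memLp (a • f)).coeFn_toLp, (hm.memLp f).coeFn_toLp,
          Lp.coeFn_smul a f, Lp.coeFn_smul a ((hm.memLp f).toLp _)] with x h1 h2 h3 h4
        rw [h1, RingHom.id_apply, h4, Pi.smul_apply, h2, h3, Pi.smul_apply, smul_comm] } C
    fun f => by
      refine Lp.norm_le_mul_norm_of_ae_le_mul ?_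
      filter_upwards [(hm.memLp f).coeFn_toLp, hm.bound] with x h1 h2
      change ‖((hm.memLp f).toLp _ : Sp n → Orb N) x‖ ≤ _
      rw [h1, norm_smul, norm_eq_abs]
      exact mul_le_right h2

lemma coeFn_mulOp (hm : IsBdd Ω m C) (f : L2 Ω N) :
    mulOp N hm f =ᵐ[vol Ω] fun x => m x • f x := (hm.memLp f).coeFn_toLp

lemma norm_mulOp_le (hm : IsBdd Ω m C) : ‖mulOp N hm‖ ≤ C :=
  LinearMap.mkContinuous_norm_le _ hm.nonneg _

lemma norm_mulOp_apply_le (hm : IsBdd Ω m C) (f : L2 Ω N) : ‖mulOp N hm f‖ ≤ C * ‖f‖ :=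
  ((mulOp N hm).le_opNorm f).trans (mul_le_right (norm_mulOp_le hm))

lemma inner_mulOp (hm : IsBdd Ω m C) (f g : L2 Ω N) :
    inner ℂ (mulOp N hm f) g = inner ℂ f (mulOp N hm g) := by
  rw [L2.inner_def, L2.inner_def]
  refine integral_congr_ae ?_
  filter_upwards [coeFn_mulOp hm f, coeFn_mulOp hm g] with x h1 h2
  rw [h1, h2, ← coe_smul, ← coe_smul, inner_smul_left, inner_smul_right,
    conj_ofReal]

lemma im_inner_mulOp (hm : IsBdd Ω m C) (f : L2 Ω N) : (inner ℂ f (mulOp N hm f)).im = 0 := by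
  rw [← Complex.conj_eq_iff_im, inner_conj_symm, inner_mulOp]

end Multiplication

/-! ### The Hartree term -/

section Hartree

open Filter Topology H10
open scoped ENNReal

/-- The square root of the Coulomb kernel. -/
def sqrtKernel (x y : Sp n) : ℝ≥0∞ := ofReal (√(‖x - y‖⁻¹))

lemma sqrtKernel_comm (x y : Sp n) : sqrtKernel x y = sqrtKernel y x := by
  rw [sqrtKernel, sqrtKernel, norm_sub_rev]

lemma sqrtKernel_mul_self (x y : Sp n) :
    sqrtKernel x y * sqrtKernel x y = ofReal ‖x - y‖⁻¹ := by
  rw [sqrtKernel, ← ENNReal.ofReal_mul (Real.sqrt_nonneg _), Real.mul_self_sqrt (by positivity)]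

lemma measurable_sqrtKernel : Measurable fun p : Sp n × Sp n => sqrtKernel p.1 p.2 := by
  unfold sqrtKernel
  fun_prop

/-- The bound for `∫ |w|² / |x - y| dy` in Hardy's inequality. -/
def kato (w : H10 Ω N) : ℝ := 2 * n * ‖fn w‖ * ‖w‖

lemma kato_nonneg (w : H10 Ω N) : 0 ≤ kato w := by unfold kato; positivity

lemma lintegral_kato (hn : 2 ≤ n) (w : H10 Ω N) (x : Sp n) :
    ∫⁻ y in Ω, (‖fn w y‖ₑ * sqrtKernel x y) ^ 2 ≤ ofReal (kato w) := by
  obtain ⟨h1, h2⟩ := hardy hn w x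
  refine le_trans (le_of_eq ?_) (ENNReal.ofReal_le_ofReal h2)
  rw [ofReal_integral_eq_lintegral_ofReal h1 (.of_forall fun y => by positivity)]
  refine lintegral_congr fun y => ?_
  rw [mul_pow, sq (sqrtKernel x y), sqrtKernel_mul_self, ← ofReal_norm,
    ← ENNReal.ofReal_pow (norm_nonneg _), ← ENNReal.ofReal_mul (by positivity), div_eq_mul_inv]

lemma lintegral_sq_enorm {α F : Type*} [MeasurableSpace α] {μ : Measure α} [NormedAddCommGroup F]
    (f : Lp F 2 μ) : ∫⁻ x, ‖f x‖ₑ ^ 2 ∂μ = ‖f‖ₑ ^ 2 := by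
  rw [Lp.enorm_def, eLpNorm_eq_lintegral_rpow_enorm_toReal (by simp) (by simp)]
  rw [← ENNReal.rpow_natCast, ← ENNReal.rpow_mul]
  norm_num

lemma lintegral_mul_sq_le {α : Type*} [MeasurableSpace α] {μ : Measure α} {f g : α → ℝ≥0∞}
    (hf : AEMeasurable f μ) (hg : AEMeasurable g μ) :
    (∫⁻ x, f x * g x ∂μ) ^ 2 ≤ (∫⁻ x, f x ^ 2 ∂μ) * ∫⁻ x, g x ^ 2 ∂μ := by
  have h := ENNReal.lintegral_mul_le_Lp_mul_Lq μ (Real.HolderConjugate.two_two) hf hg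
  refine (pow_le_pow_left' h 2).trans_eq ?_
  rw [mul_pow, ← ENNReal.rpow_natCast, ← ENNReal.rpow_natCast, ← ENNReal.rpow_mul,
    ← ENNReal.rpow_mul]
  norm_num

/-- `∫ |a| |b| / |x - y| dy`. -/
def absHartree (a : L2 Ω N) (b : H10 Ω N) (x : Sp n) : ℝ≥0∞ :=
  ∫⁻ y in Ω, (‖a y‖ₑ * sqrtKernel x y) * (‖fn b y‖ₑ * sqrtKernel x y)

lemma absHartree_sq_le (hn : 2 ≤ n) (a : L2 Ω N) (b : H10 Ω N) (x : Sp n) : absHartree a b x ^ 2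
      ≤ (∫⁻ y in Ω, (‖a y‖ₑ * sqrtKernel x y) ^ 2) * ofReal (kato b) := by
  have hk : AEMeasurable (fun y => sqrtKernel x y) (vol Ω) :=
    (measurable_sqrtKernel.comp measurable_prodMk_left).aemeasurable
  exact (lintegral_mul_sq_le ((Lp.aestronglyMeasurable a).enorm.mul hk)
    ((Lp.aestronglyMeasurable (fn b)).enorm.mul hk)).trans (mul_le_mul_right (lintegral_kato hn b x) _)

lemma absHartree_sq_le_kato (hn : 2 ≤ n) (a b : H10 Ω N) (x : Sp n) :
    absHartree (fn a) b x ^ 2 ≤ ofReal (kato a * kato b) := by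
  refine (absHartree_sq_le hn (fn a) b x).trans ?_
  rw [ENNReal.ofReal_mul (kato_nonneg a)]
  gcongr
  exact lintegral_kato hn a x

lemma aemeasurable_kernel {f : Sp n → ℝ≥0∞} (hf : AEMeasurable f (vol Ω)) :
    AEMeasurable (fun p : Sp n × Sp n => f p.2 * sqrtKernel p.1 p.2) ((vol Ω).prod (vol Ω)) :=
  (hf.comp_snd).mul measurable_sqrtKernel.aemeasurable

lemma aemeasurable_absHartree (a : L2 Ω N) (b : H10 Ω N) :
    AEMeasurable (absHartree a b) (vol Ω) := by
  refine AEMeasurable.lintegral_prod_right' (f := fun p : Sp n × Sp n =>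
    (‖a p.2‖ₑ * sqrtKernel p.1 p.2) * (‖fn b p.2‖ₑ * sqrtKernel p.1 p.2)) ?_
  exact (aemeasurable_kernel (Lp.aestronglyMeasurable a).enorm).mul
    (aemeasurable_kernel (Lp.aestronglyMeasurable (fn b)).enorm)

/-- The basic estimate for the Hartree term, by the inequalities of Cauchy-Schwarz and Hardy. -/
lemma lintegral_absHartree_le (hn : 2 ≤ n) (a : L2 Ω N) (b c : H10 Ω N) :
    ∫⁻ x in Ω, (absHartree a b x * ‖fn c x‖ₑ) ^ 2
      ≤ ofReal (kato b * kato c) * ‖a‖ₑ ^ 2 := by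
  have hak := (aemeasurable_kernel (Ω := Ω) (Lp.aestronglyMeasurable a).enorm)
  have hc := (Lp.aestronglyMeasurable (fn c)).enorm
  calc ∫⁻ x in Ω, (absHartree a b x * ‖fn c x‖ₑ) ^ 2
      ≤ ∫⁻ x in Ω, ofReal (kato b) * ∫⁻ y in Ω,
          (‖a y‖ₑ * sqrtKernel x y) ^ 2 * ‖fn c x‖ₑ ^ 2 := by
        refine lintegral_mono fun x => ?_
        rw [lintegral_mul_const' _ _ (by finiteness), mul_pow, ← mul_assoc]
        refine mul_le_mul_left ((absHartree_sq_le hn a b x).trans_eq (mul_comm _ _)) _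
    _ = ofReal (kato b) * ∫⁻ x in Ω, ∫⁻ y in Ω,
          (‖a y‖ₑ * sqrtKernel x y) ^ 2 * ‖fn c x‖ₑ ^ 2 := by
        rw [lintegral_const_mul' _ _ ENNReal.ofReal_ne_top]
    _ = ofReal (kato b) * ∫⁻ y in Ω, ∫⁻ x in Ω,
          (‖a y‖ₑ * sqrtKernel x y) ^ 2 * ‖fn c x‖ₑ ^ 2 := by
        congr 1
        refine lintegral_lintegral_swap ?_
        exact (hak.pow_const 2).mul (hc.pow_const 2).comp_fst
    _ ≤ ofReal (kato b) * ∫⁻ y in Ω, ‖a y‖ₑ ^ 2 * ofReal (kato c) := by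
        gcongr with y
        have e : ∀ x, (‖a y‖ₑ * sqrtKernel x y) ^ 2 * ‖fn c x‖ₑ ^ 2
            = ‖a y‖ₑ ^ 2 * (‖fn c x‖ₑ * sqrtKernel y x) ^ 2 := fun x => by
          rw [sqrtKernel_comm x y]; ring
        simp only [e]
        rw [lintegral_const_mul' _ _ (by finiteness)]
        gcongr
        exact lintegral_kato hn c y
    _ = ofReal (kato b * kato c) * ‖a‖ₑ ^ 2 := by
        rw [lintegral_mul_const' _ _ ENNReal.ofReal_ne_top, lintegral_sq_enorm,
          ENNReal.ofReal_mul (kato_nonneg b)]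
        ring

/-- The Coulomb potential of the density `Re (a, b)`. -/
def hartreePot (Ω : Set (Sp n)) (a b : Sp n → Orb N) (x : Sp n) : ℝ :=
  coulomb Ω (fun y => (inner ℂ (a y) (b y)).re) x

lemma enorm_integrand_le (a b : Sp n → Orb N) (x y : Sp n) : ‖(inner ℂ (a y) (b y)).re / ‖x - y‖‖ₑ
      ≤ (‖a y‖ₑ * sqrtKernel x y) * (‖b y‖ₑ * sqrtKernel x y) := by
  have e : (‖a y‖ₑ * sqrtKernel x y) * (‖b y‖ₑ * sqrtKernel x y)
      = ofReal (‖a y‖ * ‖b y‖ * ‖x - y‖⁻¹) := by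
    rw [mul_mul_mul_comm, sqrtKernel_mul_self, ← ofReal_norm, ← ofReal_norm,
      ← ENNReal.ofReal_mul (norm_nonneg _), ← ENNReal.ofReal_mul (by positivity)]
  rw [e, ← ofReal_norm]
  refine ENNReal.ofReal_le_ofReal ?_
  rw [norm_div, norm_norm, div_eq_mul_inv]
  exact mul_le_right (abs_re_inner_le _ _)

lemma enorm_hartreePot_le (a : L2 Ω N) (b : H10 Ω N) (x : Sp n) :
    ‖hartreePot Ω a (fn b) x‖ₑ ≤ absHartree a b x :=
  (enorm_integral_le_lintegral_enorm _).trans (lintegral_mono fun y => enorm_integrand_le _ _ x y)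

lemma aestronglyMeasurable_re_inner (f g : L2 Ω N) :
    AEStronglyMeasurable (fun y => (inner ℂ (f y) (g y)).re) (vol Ω) :=
  Complex.continuous_re.comp_aestronglyMeasurable
    ((Lp.aestronglyMeasurable f).inner (Lp.aestronglyMeasurable g))

lemma aestronglyMeasurable_integrand (a : L2 Ω N) (b : H10 Ω N) :
    AEStronglyMeasurable (fun p : Sp n × Sp n => (inner ℂ (a p.2) (fn b p.2)).re / ‖p.1 - p.2‖)
      ((vol Ω).prod (vol Ω)) := by
  have h2 : Measurable fun p : Sp n × Sp n => ‖p.1 - p.2‖⁻¹ := by fun_prop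
  simp only [div_eq_mul_inv]
  exact (aestronglyMeasurable_re_inner a (fn b)).comp_snd.mul h2.aestronglyMeasurable

lemma aestronglyMeasurable_hartreePot (a : L2 Ω N) (b : H10 Ω N) :
    AEStronglyMeasurable (hartreePot Ω a (fn b)) (vol Ω) :=
  (aestronglyMeasurable_integrand a b).integral_prod_right'

lemma integrable_integrand (a : L2 Ω N) (b : H10 Ω N) {x : Sp n} (h : absHartree a b x < ⊤) :
    Integrable (fun y => (inner ℂ (a y) (fn b y)).re / ‖x - y‖) (vol Ω) := by
  refine ⟨?_, (lintegral_mono fun y => enorm_integrand_le a (fn b) x y).trans_lt h⟩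
  simp only [div_eq_mul_inv]
  have h2 : Measurable fun y : Sp n => ‖x - y‖⁻¹ := by fun_prop
  exact (aestronglyMeasurable_re_inner a (fn b)).mul h2.aestronglyMeasurable

lemma ae_absHartree (hn : 2 ≤ n) (a : L2 Ω N) (b c : H10 Ω N) :
    ∀ᵐ x ∂vol Ω, fn c x = 0 ∨ absHartree a b x < ⊤ := by
  have h1 : ∫⁻ x in Ω, (absHartree a b x * ‖fn c x‖ₑ) ^ 2 ≠ ⊤ :=
    ((lintegral_absHartree_le hn a b c).trans_lt (by finiteness)).ne
  have h2 := ae_lt_top' (((aemeasurable_absHartree a b).mul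
    (Lp.aestronglyMeasurable (fn c)).enorm).pow_const 2) h1
  filter_upwards [h2] with x hx
  by_cases h0 : fn c x = 0
  · exact Or.inl h0
  · refine Or.inr (lt_top_iff_ne_top.mpr fun ht => ?_)
    rw [Pi.mul_apply, ht, ENNReal.top_mul (by simpa using h0)] at hx
    simp at hx

lemma eLpNorm_hartree_le (hn : 2 ≤ n) (a : L2 Ω N) (b c : H10 Ω N) :
    eLpNorm (fun x => hartreePot Ω a (fn b) x • fn c x) 2 (vol Ω)
      ≤ ofReal (√(kato b * kato c) * ‖a‖) := by
  rw [eLpNorm_eq_lintegral_rpow_enorm_toReal (by simp) (by simp)]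
  have h1 : ∫⁻ x in Ω, ‖hartreePot Ω a (fn b) x • fn c x‖ₑ ^ (2 : ℝ≥0∞).toReal
      ≤ ofReal (kato b * kato c) * ‖a‖ₑ ^ 2 := by
    refine le_trans (lintegral_mono fun x => ?_) (lintegral_absHartree_le hn a b c)
    rw [enorm_smul, ENNReal.toReal_ofNat, ENNReal.rpow_ofNat]
    gcongr
    exact enorm_hartreePot_le a b x
  refine (ENNReal.rpow_le_rpow h1 (by positivity)).trans_eq ?_
  rw [← ofReal_norm, ← ENNReal.ofReal_pow (norm_nonneg _),
    ← ENNReal.ofReal_mul (mul_nonneg (kato_nonneg b) (kato_nonneg c)),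
    ENNReal.ofReal_rpow_of_nonneg (mul_nonneg (mul_nonneg (kato_nonneg b) (kato_nonneg c))
      (sq_nonneg _)) (by positivity)]
  congr 1
  rw [ENNReal.toReal_ofNat, ← Real.sqrt_eq_rpow, Real.sqrt_mul (mul_nonneg (kato_nonneg b)
    (kato_nonneg c)), Real.sqrt_sq (norm_nonneg _)]

lemma memLp_hartree (hn : 2 ≤ n) (a : L2 Ω N) (b c : H10 Ω N) :
    MemLp (fun x => hartreePot Ω a (fn b) x • fn c x) 2 (vol Ω) :=
  ⟨(aestronglyMeasurable_hartreePot a b).smul (Lp.aestronglyMeasurable (fn c)),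
    (eLpNorm_hartree_le hn a b c).trans_lt ENNReal.ofReal_lt_top⟩

/-- The trilinear Hartree term `(∫_Ω Re (a, b) / |x - y| dy) c`. -/
def hartree (hn : 2 ≤ n) (a : L2 Ω N) (b c : H10 Ω N) : L2 Ω N := (memLp_hartree hn a b c).toLp _

variable (hn : 2 ≤ n)

lemma coeFn_hartree (a : L2 Ω N) (b c : H10 Ω N) :
    hartree hn a b c =ᵐ[vol Ω] fun x => hartreePot Ω a (fn b) x • fn c x :=
  MemLp.coeFn_toLp _

lemma norm_hartree_le (a : L2 Ω N) (b c : H10 Ω N) :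
    ‖hartree hn a b c‖ ≤ √(kato b * kato c) * ‖a‖ := by
  rw [hartree, Lp.norm_toLp]
  exact ENNReal.toReal_le_of_le_ofReal (by positivity) (eLpNorm_hartree_le hn a b c)

lemma hartreePot_comm (Ω : Set (Sp n)) (a b : Sp n → Orb N) :
    hartreePot Ω a b = hartreePot Ω b a := by
  funext x
  simp only [hartreePot, inner_re_symm' ]

lemma isBdd_hartreePot (hn : 2 ≤ n) (a b : H10 Ω N) :
    IsBdd Ω (hartreePot Ω (fn a) (fn b)) (√(kato a * kato b)) where
  meas := aestronglyMeasurable_hartreePot (fn a) b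
  nonneg := Real.sqrt_nonneg _
  bound := by
    refine .of_forall fun x => Real.abs_le_sqrt ?_
    have h1 := (pow_le_pow_left' (enorm_hartreePot_le (fn a) b x) 2).trans
      (absHartree_sq_le_kato hn a b x)
    rw [← ofReal_norm, ← ENNReal.ofReal_pow (norm_nonneg _), ENNReal.ofReal_le_ofReal_iff
      (mul_nonneg (kato_nonneg a) (kato_nonneg b)), norm_eq_abs, sq_abs] at h1
    exact h1

end Hartree

section HartreeAlgebra

open Filter Topology H10
open scoped ENNReal

lemma fn_add (v w : H10 Ω N) : fn (v + w) = fn v + fn w := rfl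

lemma fn_sub (v w : H10 Ω N) : fn (v - w) = fn v - fn w := rfl

lemma kato_le (w : H10 Ω N) : kato w ≤ 2 * n * ‖w‖ ^ 2 := by
  rw [kato, sq, ← mul_assoc]
  gcongr
  exact norm_fn_le w

lemma sqrt_kato_le (b c : H10 Ω N) : √(kato b * kato c) ≤ 2 * n * ‖b‖ * ‖c‖ := by
  refine Real.sqrt_le_iff.mpr ⟨by positivity, ?_⟩
  calc kato b * kato c ≤ (2 * n * ‖b‖ ^ 2) * (2 * n * ‖c‖ ^ 2) :=
        mul_le_mul (kato_le b) (kato_le c) (kato_nonneg c) (by positivity)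
    _ = _ := by ring

variable (hn : 2 ≤ n)

lemma hartree_add_left (a a' : L2 Ω N) (b c : H10 Ω N) :
    hartree hn (a + a') b c = hartree hn a b c + hartree hn a' b c := by
  refine Lp.ext ?_
  filter_upwards [coeFn_hartree hn (a + a') b c, coeFn_hartree hn a b c, coeFn_hartree hn a' b c,
    Lp.coeFn_add (hartree hn a b c) (hartree hn a' b c), ae_absHartree hn a b c,
    ae_absHartree hn a' b c] with x h1 h2 h3 h4 h5 h6
  rw [h1, h4, Pi.add_apply, h2, h3]
  rcases h5 with h5 | h5
  · simp [h5]
  rcases h6 with h6 | h6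
  · simp [h6]
  rw [← add_smul]
  congr 1
  rw [hartreePot, hartreePot, hartreePot, coulomb, coulomb, coulomb,
    ← integral_add (integrable_integrand a b h5) (integrable_integrand a' b h6)]
  refine integral_congr_ae ?_
  filter_upwards [Lp.coeFn_add a a'] with y hy
  rw [hy, Pi.add_apply, inner_add_left, add_re, add_div]

lemma hartree_add_right (a : L2 Ω N) (b c c' : H10 Ω N) :
    hartree hn a b (c + c') = hartree hn a b c + hartree hn a b c' := by
  refine Lp.ext ?_
  filter_upwards [coeFn_hartree hn a b (c + c'), coeFn_hartree hn a b c, coeFn_hartree hn a b c',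
    Lp.coeFn_add (hartree hn a b c) (hartree hn a b c'), Lp.coeFn_add (fn c) (fn c')]
    with x h1 h2 h3 h4 h5
  rw [h1, h4, Pi.add_apply, h2, h3, fn_add, h5, Pi.add_apply, smul_add]

lemma hartree_sub_left (a a' : L2 Ω N) (b c : H10 Ω N) :
    hartree hn (a - a') b c = hartree hn a b c - hartree hn a' b c := by
  rw [eq_sub_iff_add_eq, ← hartree_add_left, sub_add_cancel]

lemma hartree_comm (a b c : H10 Ω N) :
    hartree hn (fn a) b c = hartree hn (fn b) a c := by
  refine Lp.ext ?_
  filter_upwards [coeFn_hartree hn (fn a) b c, coeFn_hartree hn (fn b) a c] with x h1 h2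
  rw [h1, h2, hartreePot_comm]

lemma mulOp_hartreePot (a b c : H10 Ω N) :
    mulOp N (isBdd_hartreePot hn a b) (fn c) = hartree hn (fn a) b c := by
  refine Lp.ext ?_
  filter_upwards [coeFn_hartree hn (fn a) b c, coeFn_mulOp (isBdd_hartreePot hn a b) (fn c)]
    with x h1 h2
  rw [h1, h2]

lemma norm_hartree_le_right (a b c : H10 Ω N) :
    ‖hartree hn (fn a) b c‖ ≤ √(kato a * kato b) * ‖fn c‖ := by
  rw [← mulOp_hartreePot]
  exact norm_mulOp_apply_le _ _

lemma re_inner_L2 (f g : L2 Ω N) : (inner ℂ f g).re = ∫ x in Ω, (inner ℂ (f x) (g x)).re := by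
  rw [L2.inner_def]
  exact (reCLM.integral_comp_comm (L2.integrable_inner f g)).symm

/-- The Hartree term is symmetric with respect to the energy product. -/
lemma hartree_symm (a d : L2 Ω N) (b c : H10 Ω N) :
    (inner ℂ d (hartree hn a b c)).re = (inner ℂ a (hartree hn d c b)).re := by
  have key : ∀ (a d : L2 Ω N) (b c : H10 Ω N), (inner ℂ d (hartree hn a b c)).re
      = ∫ x in Ω, ∫ y in Ω, (inner ℂ (a y) (fn b y)).re / ‖x - y‖
        * (inner ℂ (d x) (fn c x)).re := fun a d b c => by
    rw [re_inner_L2]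
    refine integral_congr_ae ?_
    filter_upwards [coeFn_hartree hn a b c] with x hx
    rw [hx, integral_mul_const, ← coe_smul, inner_smul_right, re_ofReal_mul]
    rfl
  rw [key, key, integral_integral_swap]
  · refine integral_congr_ae (.of_forall fun x => integral_congr_ae (.of_forall fun y => ?_))
    simp only
    rw [norm_sub_rev]
    ring
  · have hm : AEStronglyMeasurable (fun p : Sp n × Sp n =>
        (inner ℂ (a p.2) (fn b p.2)).re / ‖p.1 - p.2‖ * (inner ℂ (d p.1) (fn c p.1)).re)
        ((vol Ω).prod (vol Ω)) :=
      (aestronglyMeasurable_integrand a b).mul (aestronglyMeasurable_re_inner d (fn c)).comp_fst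
    refine ⟨hm, ?_⟩
    rw [HasFiniteIntegral, Function.uncurry_def, lintegral_prod _ hm.enorm]
    have h1 : ∀ x, ∫⁻ y in Ω, ‖(inner ℂ (a y) (fn b y)).re / ‖x - y‖
        * (inner ℂ (d x) (fn c x)).re‖ₑ ≤ (absHartree a b x * ‖fn c x‖ₑ) * ‖d x‖ₑ := fun x => by
      have h2 : ‖(inner ℂ (d x) (fn c x)).re‖ₑ ≤ ‖fn c x‖ₑ * ‖d x‖ₑ := by
        rw [← ofReal_norm, ← ofReal_norm, ← ofReal_norm, ← ENNReal.ofReal_mul (norm_nonneg _)]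
        refine ENNReal.ofReal_le_ofReal ((Complex.abs_re_le_norm _).trans ?_)
        rw [mul_comm]
        exact norm_inner_le_norm _ _
      simp only [enorm_mul]
      rw [lintegral_mul_const' _ _ enorm_ne_top, mul_assoc]
      exact mul_le_mul' (lintegral_mono fun y => enorm_integrand_le a (fn b) x y) h2
    refine (lintegral_mono h1).trans_lt ?_
    have h3 := lintegral_mul_sq_le (((aemeasurable_absHartree a b).mul
      (Lp.aestronglyMeasurable (fn c)).enorm)) (Lp.aestronglyMeasurable d).enorm
    have h4 := h3.trans_lt (ENNReal.mul_lt_top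
      ((lintegral_absHartree_le hn a b c).trans_lt (by finiteness))
      ((lintegral_sq_enorm d).trans_lt (by finiteness)))
    rw [lt_top_iff_ne_top] at h4 ⊢
    intro h0
    refine h4 ?_
    simp only [Pi.mul_apply]
    rw [h0]
    simp

lemma hartree_add_mid (a : L2 Ω N) (b b' c : H10 Ω N) :
    hartree hn a (b + b') c = hartree hn a b c + hartree hn a b' c := by
  have h : ∀ d, (inner ℂ d (hartree hn a (b + b') c - (hartree hn a b c + hartree hn a b' c))).re
      = 0 := fun d => by
    rw [inner_sub_right, inner_add_right, sub_re, add_re,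
      hartree_symm hn a d (b + b'), hartree_symm hn a d b, hartree_symm hn a d b',
      hartree_add_right, inner_add_right, add_re, sub_self]
  rw [← sub_eq_zero, ← re_inner_self_nonpos (𝕜 := ℂ)]
  exact (h _).le

/-- The Hartree nonlinearity `(∫_Ω |p|² / |x - y| dy) p`. -/
def hartreeMap (p : H10 Ω N) : L2 Ω N := hartree hn (fn p) p p

lemma norm_hartreeMap_sub_le (p q : H10 Ω N) : ‖hartreeMap hn p - hartreeMap hn q‖
    ≤ 2 * n * (‖p‖ ^ 2 + ‖p‖ * ‖q‖ + ‖q‖ ^ 2) * ‖fn (p - q)‖ := by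
  have e : hartreeMap hn p - hartreeMap hn q = hartree hn (fn p) p (p - q)
      + hartree hn (fn (p - q)) p q + hartree hn (fn (p - q)) q q := by
    have h1 : hartree hn (fn p) p p = hartree hn (fn p) p (p - q) + hartree hn (fn p) p q := by
      rw [← hartree_add_right, sub_add_cancel]
    have h2 : hartree hn (fn p) p q = hartree hn (fn (p - q)) p q + hartree hn (fn q) p q := by
      rw [← hartree_add_left, ← fn_add, sub_add_cancel]
    have h3 : hartree hn (fn q) p q = hartree hn (fn (p - q)) q q + hartree hn (fn q) q q := by
      rw [hartree_comm hn q p, ← hartree_add_left, ← fn_add, sub_add_cancel]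
    rw [hartreeMap, hartreeMap, h1, h2, h3]
    abel
  rw [e]
  have h1 := (norm_hartree_le_right hn p p (p - q)).trans (mul_le_right (sqrt_kato_le p p))
  have h2 := (norm_hartree_le hn (fn (p - q)) p q).trans (mul_le_right (sqrt_kato_le p q))
  have h3 := (norm_hartree_le hn (fn (p - q)) q q).trans (mul_le_right (sqrt_kato_le q q))
  refine (norm_add₃_le).trans ((add_le_add_three h1 h2 h3).trans_eq ?_)
  ring

/-- The terms of order at least two in the expansion of the Hartree nonlinearity. -/
def hartreeRem (p d : H10 Ω N) : L2 Ω N :=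
  hartree hn (fn d) d p + (2 : ℕ) • hartree hn (fn d) p d + hartree hn (fn d) d d

lemma hartreeMap_taylor (p d : H10 Ω N) : hartreeMap hn (p + d) - hartreeMap hn p
    = hartree hn (fn p) p d + (2 : ℕ) • hartree hn (fn d) p p + hartreeRem hn p d := by
  simp only [hartreeMap, hartreeRem, fn_add, hartree_add_left, hartree_add_mid, hartree_add_right,
    hartree_comm hn p d]
  abel

lemma norm_hartreeRem_le (p d : H10 Ω N) : ‖hartreeRem hn p d‖
    ≤ (3 * √(kato d * kato p) + kato d) * ‖fn d‖ := by
  have h1 := norm_hartree_le hn (fn d) d p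
  have h2 := norm_hartree_le hn (fn d) p d
  have h3 := norm_hartree_le hn (fn d) d d
  rw [Real.sqrt_mul_self (kato_nonneg d)] at h3
  rw [mul_comm (kato p)] at h2
  refine norm_add₃_le.trans ?_
  rw [two_nsmul]
  have := norm_add_le (hartree hn (fn d) p d) (hartree hn (fn d) p d)
  nlinarith

lemma re_inner_hartreeMap_nonneg (p : H10 Ω N) :
    0 ≤ (inner ℂ (fn p) (hartreeMap hn p)).re := by
  rw [re_inner_L2]
  refine integral_nonneg_of_ae ?_
  filter_upwards [coeFn_hartree hn (fn p) p p] with x hx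
  rw [hartreeMap, hx, ← coe_smul, inner_smul_right, re_ofReal_mul]
  have hn0 : ∀ z : Orb N, 0 ≤ (inner ℂ z z).re := fun z => inner_self_nonneg (𝕜 := ℂ)
  exact mul_nonneg (integral_nonneg fun y => div_nonneg (hn0 _) (norm_nonneg _)) (hn0 _)

lemma im_inner_hartreeMap (p : H10 Ω N) :
    (inner ℂ (fn p) (hartreeMap hn p)).im = 0 := by
  rw [hartreeMap, ← mulOp_hartreePot]
  exact im_inner_mulOp _ _

lemma remainder_bound {c P Q D x y : ℝ} (hc : 0 ≤ c) (hP : 0 ≤ P)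
    (hd : D ≤ P + Q) (hx : |x| ≤ 2 * c * (Q ^ 2 + Q * P + P ^ 2) * D ^ 2)
    (hy : |y| ≤ P * ((6 * c * D * P + 2 * c * D ^ 2) * D)) :
    1 / 4 * |x + y| ≤ 8 * c * (P ^ 2 + Q ^ 2) * D ^ 2 := by
  have h4 : P * D ≤ P ^ 2 + P * Q := by nlinarith
  have h6 : 0 ≤ c * D ^ 2 := by positivity
  have h5 := mul_le_left h4 h6
  have h7 : 1 / 2 * (Q ^ 2 + Q * P + P ^ 2 + (4 * P ^ 2 + P * Q)) ≤ 8 * (P ^ 2 + Q ^ 2) := by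
    nlinarith [sq_nonneg (P - Q), sq_nonneg P, sq_nonneg Q]
  have h8 := mul_le_left h7 h6
  have h9 := abs_add_le x y
  linarith

lemma hartree_energy_taylor (p d : H10 Ω N) :
    1 / 4 * (inner ℂ (fn (p + d)) (hartreeMap hn (p + d))).re
      - 1 / 4 * (inner ℂ (fn p) (hartreeMap hn p)).re - (inner ℂ (hartreeMap hn p) (fn d)).re
      = 1 / 4 * ((inner ℂ (fn d) (hartreeMap hn (p + d) - hartreeMap hn p)).re
        + (inner ℂ (fn p) (hartreeRem hn p d)).re) := by
  have h1 := hartreeMap_taylor hn p d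
  have e1 : (inner ℂ (fn p) (hartree hn (fn p) p d)).re
      = (inner ℂ (fn d) (hartreeMap hn p)).re := by
    rw [← mulOp_hartreePot, ← inner_mulOp, mulOp_hartreePot, ← inner_re_symm']; rfl
  have e2 : (inner ℂ (fn p) (hartree hn (fn d) p p)).re
      = (inner ℂ (fn d) (hartreeMap hn p)).re := hartree_symm hn (fn d) (fn p) p p
  have e4 : hartreeMap hn (p + d) = hartreeMap hn p + (hartreeMap hn (p + d) - hartreeMap hn p) := by
    abel
  have e5 : (inner ℂ (fn (p + d)) (hartreeMap hn (p + d))).re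
      = (inner ℂ (fn d) (hartreeMap hn (p + d) - hartreeMap hn p)).re
        + (inner ℂ (fn d) (hartreeMap hn p)).re + (inner ℂ (fn p) (hartreeMap hn p)).re
        + (inner ℂ (fn p) (hartreeMap hn (p + d) - hartreeMap hn p)).re := by
    conv_lhs => rw [e4]
    rw [fn_add, inner_add_left, inner_add_right, inner_add_right]
    simp only [add_re]
    ring
  have e6 : (inner ℂ (fn p) (hartreeMap hn (p + d) - hartreeMap hn p)).re
      = 3 * (inner ℂ (fn d) (hartreeMap hn p)).re + (inner ℂ (fn p) (hartreeRem hn p d)).re := by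
    rw [h1, inner_add_right, inner_add_right, two_nsmul, inner_add_right]
    simp only [add_re]
    rw [e1, e2]
    ring
  rw [e5, e6, inner_re_symm' (hartreeMap hn p)]
  ring

/-- The Hartree energy, `∬ |p(x)|² |p(y)|² / (4 |x - y|)`, is differentiable. -/
lemma hartree_energy_remainder (p d : H10 Ω N) :
    |1 / 4 * (inner ℂ (fn (p + d)) (hartreeMap hn (p + d))).re
      - 1 / 4 * (inner ℂ (fn p) (hartreeMap hn p)).re - (inner ℂ (hartreeMap hn p) (fn d)).re|
      ≤ 8 * n * (‖p‖ ^ 2 + ‖p + d‖ ^ 2) * ‖d‖ ^ 2 := by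
  rw [hartree_energy_taylor, abs_mul]
  have hfd := norm_fn_le d
  have hfp := norm_fn_le p
  have b1 : |(inner ℂ (fn d) (hartreeMap hn (p + d) - hartreeMap hn p)).re|
      ≤ 2 * n * (‖p + d‖ ^ 2 + ‖p + d‖ * ‖p‖ + ‖p‖ ^ 2) * ‖d‖ ^ 2 := by
    refine (abs_re_inner_le _ _).trans ?_
    have h2 := norm_hartreeMap_sub_le hn (p + d) p
    rw [add_sub_cancel_left] at h2
    have h3 : ∀ {a b c e : ℝ}, 0 ≤ a → a ≤ e → 0 ≤ c → b ≤ c * a → a * b ≤ c * e ^ 2 := by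
      intro a b c e ha hae hc hb
      have h4 := mul_le_left hb ha
      have h5 := mul_le_left (pow_le_pow_left₀ ha hae 2) hc
      nlinarith
    have h4 : ∀ {P Q : ℝ}, 0 ≤ P → 0 ≤ Q → 0 ≤ 2 * (n : ℝ) * (Q ^ 2 + Q * P + P ^ 2) :=
      fun hP hQ => by positivity
    exact h3 (norm_nonneg (fn d)) hfd (h4 (norm_nonneg p) (norm_nonneg (p + d))) h2
  have b2 : |(inner ℂ (fn p) (hartreeRem hn p d)).re|
      ≤ ‖p‖ * ((6 * n * ‖d‖ * ‖p‖ + 2 * n * ‖d‖ ^ 2) * ‖d‖) := by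
    refine (abs_re_inner_le _ _).trans ?_
    refine mul_le_mul hfp ((norm_hartreeRem_le hn p d).trans ?_) (norm_nonneg _) (norm_nonneg _)
    refine mul_le_mul (add_le_add ?_ (kato_le d)) hfd (norm_nonneg _) (by positivity)
    have := sqrt_kato_le d p
    linarith
  have hd : ‖d‖ ≤ ‖p‖ + ‖p + d‖ := by
    have := norm_sub_le (p + d) p
    rw [add_sub_cancel_left] at this
    linarith
  rw [abs_of_pos (by norm_num : (0 : ℝ) < 1 / 4)]
  exact remainder_bound (Nat.cast_nonneg n) (norm_nonneg p) hd b1 b2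

end HartreeAlgebra

section Abstract

open Filter Topology

variable {ι : V →L[ℂ] H}

/-- A functional with a first-order expansion has the derivative read off from it. -/
lemma hasDerivAt_of_remainder {F : V → H} {G : V → ℝ} {K : ℝ}
    (hG : ∀ p d, |G (p + d) - G p - (inner ℂ (F p) (ι d)).re|
      ≤ K * (1 + ‖p‖ ^ 2 + ‖p + d‖ ^ 2) * ‖d‖ ^ 2) (p : ℝ → V) (p' : V) (t : ℝ)
    (hp : HasDerivAt p p' t) : HasDerivAt (fun s => G (p s)) (inner ℂ (F (p t)) (ι p')).re t := by
  let L : V →L[ℝ] ℝ := reCLM ∘L ((innerSL ℂ (F (p t))) ∘L ι).restrictScalars ℝ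
  suffices h : HasFDerivAt G L (p t) from h.comp_hasDerivAt t hp
  rw [hasFDerivAt_iff_isLittleO_nhds_zero, Asymptotics.isLittleO_iff]
  intro c hc
  have h1 : Tendsto (fun d : V => |K| * (1 + ‖p t‖ ^ 2 + ‖p t + d‖ ^ 2) * ‖d‖) (𝓝 0) (𝓝 0) := by
    have h2 : Continuous fun d : V => |K| * (1 + ‖p t‖ ^ 2 + ‖p t + d‖ ^ 2) * ‖d‖ := by fun_prop
    simpa using h2.tendsto 0
  filter_upwards [h1.eventually_lt_const hc] with d hd
  refine (hG (p t) d).trans ?_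
  have h3 : K * (1 + ‖p t‖ ^ 2 + ‖p t + d‖ ^ 2) * ‖d‖ ^ 2
      ≤ |K| * (1 + ‖p t‖ ^ 2 + ‖p t + d‖ ^ 2) * ‖d‖ * ‖d‖ := by
    rw [mul_assoc _ ‖d‖, ← sq]
    gcongr
    exact le_abs_self K
  exact h3.trans (mul_le_right hd.le)

end Abstract

namespace Problem

open Filter Topology H10

lemma XcBound.lipschitz (hL : P.XcBound L) : LipschitzWith (Real.toNNReal L) P.xcMap := by
  refine lipschitzWith_of_nnnorm_fderiv_le (𝕜 := ℝ) (hL.contDiff.differentiable one_ne_zero)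
    fun z => ?_
  rw [← NNReal.coe_le_coe, coe_nnnorm, Real.coe_toNNReal _ hL.nonneg]
  exact hL.norm_fderiv_le z

lemma xcMap_zero (P : Problem n N) : P.xcMap 0 = 0 := smul_zero _

/-- The exchange-correlation term as an operator on `L²`. -/
def xcOp (hL : P.XcBound L) (ψ : L2 P.Ω N) : L2 P.Ω N := hL.lipschitz.compLp P.xcMap_zero ψ

lemma coeFn_xcOp (hL : P.XcBound L) (ψ : L2 P.Ω N) :
    xcOp hL ψ =ᵐ[vol P.Ω] fun x => P.Vxc (‖ψ x‖ ^ 2) • ψ x :=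
  hL.lipschitz.coeFn_compLp P.xcMap_zero ψ

lemma norm_xcOp_sub_le (hL : P.XcBound L) (ψ χ : L2 P.Ω N) :
    ‖xcOp hL ψ - xcOp hL χ‖ ≤ L * ‖ψ - χ‖ := by
  have := hL.lipschitz.norm_compLp_sub_le P.xcMap_zero ψ χ
  rwa [Real.coe_toNNReal _ hL.nonneg] at this

/-- The exchange-correlation energy density. -/
def xcDensity (P : Problem n N) (z : Orb N) : ℝ := 1 / 2 * ∫ s in 0..‖z‖ ^ 2, P.Vxc (max 0 s)

lemma XcBound.continuous_max (hL : P.XcBound L) : Continuous fun s => P.Vxc (max 0 s) :=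
  hL.continuousOn.comp_continuous (by fun_prop) fun s => mem_Ici.mpr (le_max_left _ _)

lemma XcBound.hasFDerivAt_xcDensity (hL : P.XcBound L) (z : Orb N) :
    HasFDerivAt P.xcDensity (reInner (P.xcMap z)) z := by
  have h1 : HasDerivAt (fun r : ℝ => ∫ s in 0..r, P.Vxc (max 0 s))
      (P.Vxc (max 0 (‖z‖ ^ 2))) (‖z‖ ^ 2) :=
    hL.continuous_max.integral_hasStrictDerivAt 0 _ |>.hasDerivAt
  have h2 := (h1.comp_hasFDerivAt z (hasFDerivAt_norm_sq z)).const_mul (1 / 2)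
  refine h2.congr_fderiv ?_
  ext1 l
  rw [max_eq_right (sq_nonneg _), xcMap, ← coe_smul]
  simp only [smul_apply, reInner_apply, smul_eq_mul, inner_smul_left, conj_ofReal,
    re_ofReal_mul]
  ring

lemma XcBound.abs_xcDensity_le (hL : P.XcBound L) (z : Orb N) :
    |P.xcDensity z| ≤ L / 2 * ‖z‖ ^ 2 := by
  have h1 : ‖∫ s in 0..‖z‖ ^ 2, P.Vxc (max 0 s)‖ ≤ L * |‖z‖ ^ 2 - 0| :=
    intervalIntegral.norm_integral_le_of_norm_le_const fun s _ => hL.abs_le _ (le_max_left _ _)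
  rw [xcDensity, abs_mul, abs_of_pos (by norm_num : (0 : ℝ) < 1 / 2)]
  rw [sub_zero, abs_of_nonneg (sq_nonneg ‖z‖), norm_eq_abs] at h1
  linarith

lemma XcBound.xcDensity_remainder (hL : P.XcBound L) (z d : Orb N) :
    |P.xcDensity (z + d) - P.xcDensity z - (inner ℂ (P.xcMap z) d).re| ≤ L * ‖d‖ ^ 2 := by
  have h1 : ∀ w ∈ Metric.closedBall z ‖d‖, HasFDerivWithinAt
      (fun w => P.xcDensity w - reInner (P.xcMap z) w) (reInner (P.xcMap w) - reInner (P.xcMap z))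
      (Metric.closedBall z ‖d‖) w := fun w _ =>
    ((hL.hasFDerivAt_xcDensity w).sub (reInner (P.xcMap z)).hasFDerivAt).hasFDerivWithinAt
  have h2 : ∀ w ∈ Metric.closedBall z ‖d‖, ‖reInner (P.xcMap w) - reInner (P.xcMap z)‖
      ≤ L * ‖d‖ := fun w hw => by
    refine ContinuousLinearMap.opNorm_le_bound _ (mul_nonneg hL.nonneg (norm_nonneg _)) fun l => ?_
    have h3 : (reInner (P.xcMap w) - reInner (P.xcMap z)) l = reInner (P.xcMap w - P.xcMap z) l := by
      rw [sub_apply, reInner_apply, reInner_apply, reInner_apply, inner_sub_left, sub_re]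
    rw [h3, norm_eq_abs]
    refine (abs_reInner_le _ _).trans (mul_le_right ?_)
    have h4 := hL.lipschitz.norm_sub_le w z
    rw [Real.coe_toNNReal _ hL.nonneg] at h4
    exact h4.trans (mul_le_left (mem_closedBall_iff_norm.mp hw) hL.nonneg)
  have h3 := (convex_closedBall z ‖d‖).norm_image_sub_le_of_norm_hasFDerivWithin_le h1 h2
    (Metric.mem_closedBall_self (norm_nonneg _)) (y := z + d) (by simp)
  rw [add_sub_cancel_left, map_add, reInner_apply, norm_eq_abs] at h3
  rw [sq, ← mul_assoc]
  refine le_trans (le_of_eq ?_) h3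
  rw [reInner_apply]
  congr 1
  ring

lemma XcBound.integrable_xcDensity (hL : P.XcBound L) (ψ : L2 P.Ω N) :
    Integrable (fun x => P.xcDensity (ψ x)) (vol P.Ω) := by
  have hc : Continuous P.xcDensity :=
    continuous_iff_continuousAt.mpr fun z => (hL.hasFDerivAt_xcDensity z).continuousAt
  refine Integrable.mono' (g := fun x => L / 2 * ‖ψ x‖ ^ 2) ?_
    (hc.comp_aestronglyMeasurable (Lp.aestronglyMeasurable ψ))
    (.of_forall fun x => hL.abs_xcDensity_le (ψ x))
  exact ((Lp.memLp ψ).norm.integrable_sq).const_mul _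

lemma norm_sq_eq_integral (ψ : L2 P.Ω N) : ‖ψ‖ ^ 2 = ∫ x in P.Ω, ‖ψ x‖ ^ 2 := by
  have h1 : ‖ψ‖ ^ 2 = (inner ℂ ψ ψ).re := (inner_self_eq_norm_sq (𝕜 := ℂ) ψ).symm
  rw [h1, re_inner_L2]
  exact integral_congr_ae (.of_forall fun x => inner_self_eq_norm_sq (𝕜 := ℂ) (ψ x))

/-- The exchange-correlation energy. -/
def xcEnergy (P : Problem n N) (ψ : L2 P.Ω N) : ℝ := ∫ x in P.Ω, P.xcDensity (ψ x)

lemma XcBound.abs_xcEnergy_le (hL : P.XcBound L) (ψ : L2 P.Ω N) :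
    |P.xcEnergy ψ| ≤ L / 2 * ‖ψ‖ ^ 2 := by
  rw [norm_sq_eq_integral, ← integral_const_mul, xcEnergy, ← norm_eq_abs]
  exact norm_integral_le_of_norm_le (((Lp.memLp ψ).norm.integrable_sq).const_mul _)
    (.of_forall fun x => hL.abs_xcDensity_le (ψ x))

lemma XcBound.xcEnergy_remainder (hL : P.XcBound L) (ψ d : L2 P.Ω N) :
    |P.xcEnergy (ψ + d) - P.xcEnergy ψ - (inner ℂ (xcOp hL ψ) d).re| ≤ L * ‖d‖ ^ 2 := by
  have hi : Integrable (fun x => (inner ℂ (xcOp hL ψ x) (d x)).re) (vol P.Ω) :=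
    (L2.integrable_inner (𝕜 := ℂ) (xcOp hL ψ) d).re
  have hs : Integrable (fun x => P.xcDensity ((ψ + d) x) - P.xcDensity (ψ x))
      (vol P.Ω) := (hL.integrable_xcDensity _).sub (hL.integrable_xcDensity _)
  rw [re_inner_L2, xcEnergy, xcEnergy, ← integral_sub (hL.integrable_xcDensity _)
    (hL.integrable_xcDensity _), ← integral_sub hs hi, norm_sq_eq_integral, ← integral_const_mul, ← norm_eq_abs]
  refine norm_integral_le_of_norm_le (((Lp.memLp d).norm.integrable_sq).const_mul _) ?_
  filter_upwards [Lp.coeFn_add ψ d, coeFn_xcOp hL ψ] with x h1 h2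
  rw [h1, h2]
  exact hL.xcDensity_remainder (ψ x) (d x)

lemma im_inner_xcOp (hL : P.XcBound L) (ψ : L2 P.Ω N) : (inner ℂ ψ (xcOp hL ψ)).im = 0 := by
  have h1 : inner ℂ (xcOp hL ψ) ψ = inner ℂ ψ (xcOp hL ψ) := by
    rw [L2.inner_def, L2.inner_def]
    refine integral_congr_ae ?_
    filter_upwards [coeFn_xcOp hL ψ] with x h1
    rw [h1, ← coe_smul, inner_smul_left, inner_smul_right, conj_ofReal]
  rw [← Complex.conj_eq_iff_im, inner_conj_symm, h1]

/-- Multiplication by `V₀ - 1`; the generator is shifted to `1 - Δ`. -/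
def U0 (P : Problem n N) : HilbertMap (L2 P.Ω N) (L2 P.Ω N) :=
  mulOp N (isBdd_Lp P.V0) - ContinuousLinearMap.id ℂ (L2 P.Ω N)

/-- Multiplication by `V_u`. -/
def U1 (P : Problem n N) : HilbertMap (L2 P.Ω N) (L2 P.Ω N) := mulOp N (isBdd_Lp P.Vu)

lemma U0_apply (ψ : L2 P.Ω N) : P.U0 ψ = mulOp N (isBdd_Lp P.V0) ψ - ψ := rfl

lemma norm_U0_apply_le (ψ : L2 P.Ω N) : ‖P.U0 ψ‖ ≤ (‖P.V0‖ + 1) * ‖ψ‖ := by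
  rw [U0_apply]
  refine (norm_sub_le _ _).trans ?_
  have := norm_mulOp_apply_le (isBdd_Lp P.V0) ψ
  linarith

lemma inner_U0 (f g : L2 P.Ω N) : inner ℂ (P.U0 f) g = inner ℂ f (P.U0 g) := by
  rw [U0_apply, U0_apply, inner_sub_left, inner_sub_right, inner_mulOp]

lemma inner_U1 (f g : L2 P.Ω N) : inner ℂ (P.U1 f) g = inner ℂ f (P.U1 g) := inner_mulOp _ _ _

lemma im_inner_U0 (f : L2 P.Ω N) : (inner ℂ f (P.U0 f)).im = 0 := by
  rw [← Complex.conj_eq_iff_im, inner_conj_symm, inner_U0]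

lemma abs_re_inner_U0_le (f : L2 P.Ω N) : |(inner ℂ f (P.U0 f)).re| ≤ (‖P.V0‖ + 1) * ‖f‖ ^ 2 := by
  refine (abs_re_inner_le _ _).trans ?_
  have := mul_le_left (norm_U0_apply_le f) (norm_nonneg f)
  linarith

/-- The terms of order zero of the state equation without control, with the shift. -/
def nonlin (hn : 2 ≤ n) (hL : P.XcBound L) (p : H10 P.Ω N) : L2 P.Ω N :=
  P.U0 (fn p) + hartreeMap hn p + xcOp hL (fn p)

/-- The energy whose derivative is `nonlin`. -/
def energy (P : Problem n N) (hn : 2 ≤ n) (p : H10 P.Ω N) : ℝ :=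
  1 / 2 * (inner ℂ (fn p) (P.U0 (fn p))).re + 1 / 4 * (inner ℂ (fn p) (hartreeMap hn p)).re
    + P.xcEnergy (fn p)

lemma re_U0_expand (f d : L2 P.Ω N) : 1 / 2 * (inner ℂ (f + d) (P.U0 (f + d))).re
    - 1 / 2 * (inner ℂ f (P.U0 f)).re - (inner ℂ (P.U0 f) d).re
    = 1 / 2 * (inner ℂ d (P.U0 d)).re := by
  have e1 : (inner ℂ f (P.U0 d)).re = (inner ℂ (P.U0 f) d).re := by rw [inner_U0]
  have e2 : (inner ℂ d (P.U0 f)).re = (inner ℂ (P.U0 f) d).re := inner_re_symm' _ _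
  rw [map_add, inner_add_left, inner_add_right, inner_add_right]
  simp only [add_re]
  rw [e1, e2]
  ring

/-- The constant in the estimates for the nonlinearity. -/
def nonlinConst (P : Problem n N) (L : ℝ) : ℝ := ‖P.V0‖ + 1 + 8 * n + L

lemma hartreeMap_zero (hn : 2 ≤ n) : hartreeMap hn (0 : H10 P.Ω N) = 0 := by
  have h0 : fn (0 : H10 P.Ω N) = 0 := rfl
  have h := norm_hartree_le hn (fn (0 : H10 P.Ω N)) 0 0
  rw [hartreeMap]
  rw [h0, norm_zero, mul_zero] at h
  exact norm_le_zero_iff.mp h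

lemma xcOp_zero (hL : P.XcBound L) : xcOp hL 0 = 0 := by rw [xcOp, LipschitzWith.compLp_zero]

lemma isNonlin (hn : 2 ≤ n) (hL : P.XcBound L) :
    IsNonlin (ι P.Ω N) (nonlin hn hL) (P.energy hn) (P.nonlinConst L) := by
  have hL0 := hL.nonneg
  have hV0 := norm_nonneg P.V0
  have hn0 : (0 : ℝ) ≤ n := Nat.cast_nonneg n
  have hC : P.nonlinConst L = ‖P.V0‖ + 1 + 8 * n + L := rfl
  refine ⟨by rw [hC]; positivity, ?_, fun p q => ?_, fun p => ?_, hasDerivAt_of_remainder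
    (K := P.nonlinConst L) fun p d => ?_, fun p => ?_, fun p => ?_⟩
  · have h0 : fn (0 : H10 P.Ω N) = 0 := rfl
    rw [nonlin, hartreeMap_zero, h0, map_zero, xcOp_zero, add_zero, add_zero]
  · have e : nonlin hn hL p - nonlin hn hL q = P.U0 (fn (p - q))
        + (hartreeMap hn p - hartreeMap hn q) + (xcOp hL (fn p) - xcOp hL (fn q)) := by
      rw [nonlin, nonlin, fn_sub, map_sub]; abel
    have h3 := norm_xcOp_sub_le hL (fn p) (fn q)
    rw [← fn_sub] at h3
    rw [e, ι_apply, hC]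
    refine norm_add₃_le.trans ((add_le_add_three (norm_U0_apply_le _)
      (norm_hartreeMap_sub_le hn p q) h3).trans ?_)
    have key : ∀ {a b v l x : ℝ}, 0 ≤ v → 0 ≤ l → 0 ≤ x → (v + 1) * x
        + 2 * n * (a ^ 2 + a * b + b ^ 2) * x + l * x ≤ (v + 1 + 8 * n + l) * (1 + a ^ 2 + b ^ 2) * x := by
      intro a b v l x hv hl hx
      rw [← add_mul, ← add_mul]
      refine mul_le_right ?_ hx
      nlinarith [mul_nonneg hv (sq_nonneg a), mul_nonneg hv (sq_nonneg b), mul_nonneg hl (sq_nonneg a),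
        mul_nonneg hl (sq_nonneg b), mul_nonneg hn0 (sq_nonneg (a - b)), mul_nonneg hn0 (sq_nonneg a),
        mul_nonneg hn0 (sq_nonneg b)]
    exact key hV0 hL0 (norm_nonneg _)
  · rw [nonlin, ι_apply, inner_add_right, inner_add_right, Complex.add_im, Complex.add_im,
      im_inner_U0, im_inner_hartreeMap, im_inner_xcOp, add_zero, add_zero]
  · have e : P.energy hn (p + d) - P.energy hn p - (inner ℂ (nonlin hn hL p) (ι P.Ω N d)).re
        = 1 / 2 * (inner ℂ (fn d) (P.U0 (fn d))).re
          + (1 / 4 * (inner ℂ (fn (p + d)) (hartreeMap hn (p + d))).re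
            - 1 / 4 * (inner ℂ (fn p) (hartreeMap hn p)).re - (inner ℂ (hartreeMap hn p) (fn d)).re)
          + (P.xcEnergy (fn p + fn d) - P.xcEnergy (fn p) - (inner ℂ (xcOp hL (fn p)) (fn d)).re) := by
      rw [← re_U0_expand, energy, energy, nonlin, ι_apply, inner_add_left, inner_add_left, fn_add]
      simp only [add_re]
      ring
    have h1 := abs_re_inner_U0_le (P := P) (fn d)
    have h2 := hartree_energy_remainder hn p d
    have h3 := hL.xcEnergy_remainder (fn p) (fn d)
    have h4 : |1 / 2 * (inner ℂ (fn d) (P.U0 (fn d))).re| ≤ 1 / 2 * ((‖P.V0‖ + 1) * ‖fn d‖ ^ 2) := by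
      rw [abs_mul, abs_of_pos (by norm_num : (0 : ℝ) < 1 / 2)]
      linarith
    have h5 : ‖fn d‖ ^ 2 ≤ ‖d‖ ^ 2 := pow_le_pow_left₀ (norm_nonneg _) (norm_fn_le d) 2
    rw [e, hC]
    refine (abs_add_three _ _ _).trans ((add_le_add_three h4 h2 h3).trans ?_)
    have key : ∀ {a b v l x y : ℝ}, 0 ≤ v → 0 ≤ l → 0 ≤ y → x ≤ y → 1 / 2 * ((v + 1) * x)
        + 8 * n * (a ^ 2 + b ^ 2) * y + l * x ≤ (v + 1 + 8 * n + l) * (1 + a ^ 2 + b ^ 2) * y := by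
      intro a b v l x y hv hl hy hxy
      have h6 : 1 / 2 * ((v + 1) * x) + l * x ≤ (v + 1 + l) * y := by nlinarith
      have h7 : 0 ≤ (v + 1 + l) * (a ^ 2 + b ^ 2) * y := by positivity
      have h8 : 0 ≤ (n : ℝ) * y := by positivity
      linarith
    exact key hV0 hL0 (sq_nonneg _) h5
  · have h1 := (abs_le.mp (abs_re_inner_U0_le (P := P) (fn p))).1
    have h2 := re_inner_hartreeMap_nonneg hn p
    have h3 := (abs_le.mp (hL.abs_xcEnergy_le (fn p))).1
    have h4 : 0 ≤ (‖P.V0‖ + 1 + L) * ‖fn p‖ ^ 2 := mul_nonneg (by linarith) (sq_nonneg _)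
    have h5 : 0 ≤ (n : ℝ) * ‖fn p‖ ^ 2 := mul_nonneg hn0 (sq_nonneg _)
    rw [energy, hC, ι_apply]
    linarith
  · have h1 := (abs_le.mp (abs_re_inner_U0_le (P := P) (fn p))).2
    have h3 := (abs_le.mp (hL.abs_xcEnergy_le (fn p))).2
    have h2 : (inner ℂ (fn p) (hartreeMap hn p)).re ≤ 2 * n * ‖p‖ ^ 2 * ‖fn p‖ ^ 2 := by
      refine (Complex.re_le_norm _).trans ((norm_inner_le_norm _ _).trans ?_)
      have h6 := (norm_hartree_le hn (fn p) p p).trans (mul_le_right (sqrt_kato_le p p))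
      have h7 := mul_le_left h6 (norm_nonneg (fn p))
      rw [hartreeMap]
      linarith
    have h5 : ‖fn p‖ ^ 2 ≤ ‖p‖ ^ 2 := pow_le_pow_left₀ (norm_nonneg _) (norm_fn_le p) 2
    rw [energy, hC]
    have key : ∀ {a v l x e₁ e₂ e₃ : ℝ}, 0 ≤ v → 0 ≤ l → 0 ≤ x → x ≤ a ^ 2 → e₁ ≤ (v + 1) * x →
        e₂ ≤ 2 * n * a ^ 2 * x → e₃ ≤ l / 2 * x →
        1 / 2 * e₁ + 1 / 4 * e₂ + e₃ ≤ (v + 1 + 8 * n + l) * (a ^ 2 + a ^ 4) := by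
      intro a v l x e₁ e₂ e₃ hv hl hx hxa h1 h2 h3
      have h4 : (v + 1 + l) * x ≤ (v + 1 + l) * a ^ 2 := mul_le_left hxa
      have h5 : (n : ℝ) * a ^ 2 * x ≤ n * a ^ 2 * a ^ 2 := mul_le_left hxa
      have h6 : 0 ≤ (v + 1 + l) * x := by positivity
      have h7 : 0 ≤ (v + 1 + l) * a ^ 4 := by positivity
      have h8 : 0 ≤ (n : ℝ) * a ^ 2 := by positivity
      have h9 : 0 ≤ (n : ℝ) * a ^ 4 := by positivity
      nlinarith [mul_nonneg hl hx]
    exact key hV0 hL0 (sq_nonneg ‖fn p‖) h5 h1 h2 h3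

/-- The terms of order zero of the state equation, as functions on `Ω`. -/
lemma coeFn_nonlin (hn : 2 ≤ n) (hL : P.XcBound L) (a : ℝ) (p : H10 P.Ω N) :
    (fun x => P.Vext a x • fn p x + P.VHxc (fn p) x • fn p x) =ᵐ[vol P.Ω]
      (nonlin hn hL p + (a : ℂ) • P.U1 (fn p) + fn p : L2 P.Ω N) := by
  have e : nonlin hn hL p + (a : ℂ) • P.U1 (fn p) + fn p = mulOp N (isBdd_Lp P.V0) (fn p)
      + hartreeMap hn p + xcOp hL (fn p) + (a : ℂ) • mulOp N (isBdd_Lp P.Vu) (fn p) := by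
    rw [nonlin, U0_apply, U1]; abel
  rw [e]
  filter_upwards [Lp.coeFn_add (mulOp N (isBdd_Lp P.V0) (fn p) + hartreeMap hn p + xcOp hL (fn p))
      ((a : ℂ) • mulOp N (isBdd_Lp P.Vu) (fn p)),
    Lp.coeFn_add (mulOp N (isBdd_Lp P.V0) (fn p) + hartreeMap hn p) (xcOp hL (fn p)),
    Lp.coeFn_add (mulOp N (isBdd_Lp P.V0) (fn p)) (hartreeMap hn p),
    Lp.coeFn_smul (a : ℂ) (mulOp N (isBdd_Lp P.Vu) (fn p)), coeFn_mulOp (isBdd_Lp P.V0) (fn p),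
    coeFn_mulOp (isBdd_Lp P.Vu) (fn p), coeFn_hartree hn (fn p) p p, coeFn_xcOp hL (fn p)]
    with x h1 h2 h3 h4 h5 h6 h7 h8
  rw [h1, Pi.add_apply, h2, Pi.add_apply, h3, Pi.add_apply, h4, Pi.smul_apply, h5, h6, h8, hartreeMap,
    h7, Vext, VHxc, hartreePot]
  have h9 : (fun y => (inner ℂ (fn p y) (fn p y)).re) = fun y => ‖fn p y‖ ^ 2 :=
    funext fun y => inner_self_eq_norm_sq (𝕜 := ℂ) (fn p y)
  rw [h9, coe_smul, add_smul, add_smul, mul_smul]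
  abel

end Problem

/-! ### The Laplacian: `H²` regularity and boundedness -/

namespace H10

open Filter Topology

/-- A coordinate of `ℂᴺ` with respect to a real basis. -/
def coordL (N : ℕ) (k : Fin (Module.finrank ℝ (Orb N))) : Orb N →L[ℝ] ℝ :=
  LinearMap.toContinuousLinearMap ((Module.finBasis ℝ (Orb N)).coord k)

lemma integral_inner_eq_sum {φ : Sp n → Orb N} (hφ : MemLp φ 2 (vol Ω)) (f : L2 Ω N) :
    ∫ x in Ω, inner ℂ (φ x) (f x) = ∑ k, inner ℂ (Module.finBasis ℝ (Orb N) k)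
      (∫ x in Ω, coordL N k (φ x) • f x) := by
  have hi : ∀ k, Integrable (fun x => coordL N k (φ x) • f x) (vol Ω) := fun k =>
    memLp_one_iff_integrable.mp ((Lp.memLp f).smul ((coordL N k).comp_memLp' hφ))
  simp only [← integral_inner (𝕜 := ℂ) (hi _)]
  rw [← integral_finsetSum _ fun k _ => (hi k).const_inner _]
  refine integral_congr_ae (.of_forall fun x => ?_)
  have h1 : φ x = ∑ k, coordL N k (φ x) • Module.finBasis ℝ (Orb N) k :=
    ((Module.finBasis ℝ (Orb N)).sum_repr (φ x)).symm
  simp only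
  conv_lhs => rw [h1]
  rw [sum_inner]
  refine Finset.sum_congr rfl fun k _ => ?_
  rw [inner_smul_left_eq_smul, inner_smul_right_eq_smul]

/-- Functions in `H² ∩ H¹₀` have a Laplacian in `L²`. -/
lemma MemH2.exists_isNegLaplacian {w : H10 Ω N} (hw : MemH2 w) : ∃ g, IsNegLaplacian w g := by
  choose d hd using fun i => hw i i
  refine ⟨-∑ i, d i, fun ξ => ?_⟩
  rw [PiLp.inner_apply, inner_neg_right, inner_sum, ← Finset.sum_neg_distrib]
  refine Finset.sum_congr rfl fun i _ => ?_
  have hg : Continuous fun ξ : H10 Ω N => grad ξ i := (gradI Ω N i).continuous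
  have hf : Continuous fun ξ : H10 Ω N => fn ξ := (ι Ω N).continuous
  refine induction_on (p := fun ξ => inner ℂ (grad ξ i) (grad w i) = -inner ℂ (fn ξ) (d i)) ξ
    (isClosed_eq (hg.inner continuous_const) (hf.inner continuous_const).neg) fun ξ φ hφ => ?_
  have hφ' := hφ.1.fderiv_apply (single i 1)
  have e1 : inner ℂ (grad ξ i) (grad w i)
      = ∫ x in Ω, inner ℂ (fderiv ℝ φ x (single i 1)) (grad w i x) := by
    rw [L2.inner_def]
    refine integral_congr_ae ?_
    filter_upwards [hφ.2.2 i] with x hx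
    rw [hx]
  have e2 : inner ℂ (fn ξ) (d i) = ∫ x in Ω, inner ℂ (φ x) (d i x) := by
    rw [L2.inner_def]
    refine integral_congr_ae ?_
    filter_upwards [hφ.2.1] with x hx
    rw [hx]
  rw [e1, e2, integral_inner_eq_sum (hφ'.memLp 2 _), integral_inner_eq_sum (hφ.1.memLp 2 _),
    ← Finset.sum_neg_distrib]
  refine Finset.sum_congr rfl fun k _ => ?_
  have hk : IsTestFun Ω fun x => coordL N k (φ x) :=
    hφ.1.of_eq_zero ((coordL N k).contDiff.comp hφ.1.1) fun x hx => by rw [hx, map_zero]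
  rw [← inner_neg_right, ← hd i _ hk]
  congr 1
  refine integral_congr_ae (.of_forall fun x => ?_)
  have h1 := ((coordL N k).hasFDerivAt.comp x (hφ.1.1.differentiable (by simp) x).hasFDerivAt).fderiv
  have h2 : fderiv ℝ (fun x => coordL N k (φ x)) x (single i 1)
      = coordL N k (fderiv ℝ φ x (single i 1)) := by
    change fderiv ℝ (⇑(coordL N k) ∘ φ) x _ = _
    rw [h1]; rfl
  simp only
  rw [h2]

/-- The pointwise inequality behind Kato's inequality, for the test function `G φ / η`,
`η = √(|φ|² + δ²)`. -/
lemma kato_pointwise {φ φ' : Orb N} {G G' η δ r : ℝ} (hη : η ^ 2 = ‖φ‖ ^ 2 + δ ^ 2) (hη0 : 0 < η)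
    (hδ : 0 < δ) (hG : 0 ≤ G) (hr : r = (inner ℂ φ φ').re) :
    G' * (r / η) ≤ (inner ℂ ((G * η⁻¹) • φ' + (G' * η⁻¹ + G * (-(r / η) / η ^ 2)) • φ) φ').re ∧
    ‖(G * η⁻¹) • φ' + (G' * η⁻¹ + G * (-(r / η) / η ^ 2)) • φ‖ ≤ |G'| + 2 * (G / δ) * ‖φ'‖ := by
  have hφη : ‖φ‖ ≤ η := le_of_sq_le_sq (by rw [hη]; nlinarith) hη0.le
  have hδη : δ ≤ η := le_of_sq_le_sq (by rw [hη]; nlinarith [sq_nonneg ‖φ‖]) hη0.le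
  have hrb : |r| ≤ ‖φ‖ * ‖φ'‖ := hr ▸ abs_re_inner_le _ _
  constructor
  · rw [inner_add_left, add_re, ← coe_smul, ← coe_smul, inner_smul_left,
      inner_smul_left, conj_ofReal, conj_ofReal, re_ofReal_mul,
      re_ofReal_mul, ← hr]
    have h1 : (inner ℂ φ' φ').re = ‖φ'‖ ^ 2 := inner_self_eq_norm_sq (𝕜 := ℂ) φ'
    rw [h1]
    have h2 : (G * η⁻¹) * ‖φ'‖ ^ 2 + (G' * η⁻¹ + G * (-(r / η) / η ^ 2)) * r
        = G' * (r / η) + G * η⁻¹ * (‖φ'‖ ^ 2 - (r / η) ^ 2) := by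
      field_simp
      ring
    rw [h2]
    have h3 : (r / η) ^ 2 ≤ ‖φ'‖ ^ 2 := by
      rw [← sq_abs (r / η), abs_div, abs_of_pos hη0]
      refine pow_le_pow_left₀ (by positivity) ((div_le_iff₀ hη0).mpr (hrb.trans ?_)) 2
      rw [mul_comm]
      exact mul_le_left hφη
    have h4 : 0 ≤ G * η⁻¹ * (‖φ'‖ ^ 2 - (r / η) ^ 2) := mul_nonneg (by positivity) (by linarith)
    linarith
  · have hGδ : G * η⁻¹ ≤ G / δ := by
      rw [div_eq_mul_inv]
      exact mul_le_left (inv_anti₀ hδ hδη) hG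
    have h1 : ‖(G * η⁻¹) • φ'‖ ≤ G / δ * ‖φ'‖ := by
      rw [norm_smul, norm_of_nonneg (by positivity)]
      exact mul_le_right hGδ
    have h2 : ‖(G' * η⁻¹ + G * (-(r / η) / η ^ 2)) • φ‖ ≤ |G'| + G / δ * ‖φ'‖ := by
      rw [norm_smul, norm_eq_abs]
      have h3 : |G' * η⁻¹ + G * (-(r / η) / η ^ 2)| ≤ |G'| * η⁻¹ + G * η⁻¹ * (‖φ'‖ * η⁻¹) := by
        refine (abs_add_le _ _).trans (add_le_add ?_ ?_)
        · rw [abs_mul, abs_of_pos (inv_pos.mpr hη0)]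
        · rw [abs_mul, abs_of_nonneg hG, abs_div, abs_neg, abs_div, abs_of_pos hη0, mul_assoc,
            abs_of_pos (pow_pos hη0 2)]
          refine mul_le_left ?_ hG
          rw [div_div, div_le_iff₀ (by positivity)]
          have e : η⁻¹ * (‖φ'‖ * η⁻¹) * (η * η ^ 2) = η * ‖φ'‖ := by field_simp
          rw [e]
          exact hrb.trans (mul_le_right hφη)
      refine (mul_le_mul h3 hφη (norm_nonneg _) (by positivity)).trans ?_
      have e : (|G'| * η⁻¹ + G * η⁻¹ * (‖φ'‖ * η⁻¹)) * η = |G'| + G * η⁻¹ * ‖φ'‖ := by field_simp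
      rw [e]
      exact add_le_add_right (mul_le_right hGδ) _
    refine (norm_add_le _ _).trans ((add_le_add h1 h2).trans_eq ?_)
    ring

/-- The bump `nε² / (|y - x|² + ε²)^(n/2+1)`, minus the Laplacian of the regularised fundamental
solution. -/
def bump (x : Sp n) (ε : ℝ) (y : Sp n) : ℝ := n * ε ^ 2 * sqDist x ε y ^ (-(n / 2 : ℝ) - 1)

lemma continuous_bump {x : Sp n} {ε : ℝ} (hε : 0 < ε) : Continuous (bump x ε) :=
  continuous_const.mul (continuous_sqDist_rpow hε _)

lemma bump_nonneg {x : Sp n} {ε : ℝ} (hε : 0 < ε) (y : Sp n) : 0 ≤ bump x ε y :=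
  mul_nonneg (by positivity) (Real.rpow_nonneg (sqDist_pos hε y).le _)

/-- A regularised fundamental solution with pole `x`. -/
structure IsFundamental (Ω : Set (Sp n)) (x : Sp n) (ε : ℝ) (G : Sp n → ℝ) : Prop where
  contDiff : ContDiff ℝ ∞ G
  nonneg : ∀ y ∈ Ω, 0 ≤ G y
  deriv : ∀ i y, HasLineDerivAt ℝ G (-((y i - x i) * sqDist x ε y ^ (-(n / 2 : ℝ)))) y (single i 1)

lemma exists_bound_of_bounded (hb : Bornology.IsBounded Ω) {f : Sp n → ℝ} (hf : Continuous f) :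
    ∃ K, 0 ≤ K ∧ ∀ y ∈ Ω, |f y| ≤ K := by
  obtain ⟨K, hK⟩ := (Metric.isCompact_of_isClosed_isBounded isClosed_closure
    hb.closure).exists_bound_of_continuousOn hf.continuousOn
  exact ⟨max K 0, le_max_right _ _, fun y hy => (hK y (subset_closure hy)).trans (le_max_left _ _)⟩

lemma isFiniteMeasure_of_isBounded (hb : Bornology.IsBounded Ω) : IsFiniteMeasure (vol Ω) :=
  ⟨by rw [Measure.restrict_apply_univ]; exact hb.measure_lt_top⟩

set_option maxHeartbeats 800000 in
/-- The test function `G φ / √(|φ|² + δ²)`. -/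
lemma exists_kato_test (hΩ : IsOpen Ω) (hb : Bornology.IsBounded Ω) {x : Sp n} {ε δ : ℝ}
    (hε : 0 < ε) (hδ : 0 < δ) {G : Sp n → ℝ} (hG : IsFundamental Ω x ε G) :
    ∃ A B : ℝ, 0 ≤ B ∧ ∀ (p : H10 Ω N) (φ : Sp n → Orb N), IsTest p φ → ∃ ξ : H10 Ω N,
      (∀ᵐ y ∂vol Ω, ‖fn ξ y‖ ≤ G y) ∧ (∀ i, ‖grad ξ i‖ ≤ A + B * ‖p‖) ∧
      ∫ y in Ω, bump x ε y * (‖fn p y‖ - δ) ≤ (inner ℂ (grad ξ) (grad p)).re := by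
  have := isFiniteMeasure_of_isBounded hb
  have hcoord : ∀ i, Continuous fun y : Sp n => y i - x i := fun i =>
    (EuclideanSpace.proj (𝕜 := ℝ) i).continuous.sub continuous_const
  obtain ⟨a, ha⟩ : ∃ a : Fin n → Sp n → ℝ, ∀ i, a i = fun y =>
    (y i - x i) * sqDist x ε y ^ (-(n / 2 : ℝ)) := ⟨_, fun i => rfl⟩
  have hac : ∀ i, Continuous (a i) := fun i => by
    rw [ha]; exact (hcoord i).mul (continuous_sqDist_rpow hε _)
  obtain ⟨Γ, hΓ0, hΓ⟩ := exists_bound_of_bounded hb hG.contDiff.continuous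
  choose γ hγ0 hγ using fun i => exists_bound_of_bounded hb (hac i)
  obtain ⟨A₀, hA₀⟩ : ∃ A₀, A₀ = ∑ j, γ j := ⟨_, rfl⟩
  have hA₀0 : 0 ≤ A₀ := hA₀ ▸ Finset.sum_nonneg fun j _ => hγ0 j
  have hcm := memLp_const (μ := vol Ω) (p := 2) A₀
  refine ⟨‖hcm.toLp _‖, 2 * (Γ / δ), by positivity, fun p φ hφ => ?_⟩
  obtain ⟨d, hd⟩ : ∃ d : Fin n → Sp n → Orb N, ∀ i y, d i y = fderiv ℝ φ y (single i 1) :=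
    ⟨_, fun _ _ => rfl⟩
  -- `η` is a smooth substitute for `|φ|`; `r i / η` are its derivatives
  obtain ⟨η, hη⟩ : ∃ η : Sp n → ℝ, ∀ y, η y = √(‖φ y‖ ^ 2 + δ ^ 2) := ⟨_, fun _ => rfl⟩
  have hpos : ∀ y, 0 < ‖φ y‖ ^ 2 + δ ^ 2 := fun y => by positivity
  have hη0 : ∀ y, 0 < η y := fun y => hη y ▸ Real.sqrt_pos.mpr (hpos y)
  have hη2 : ∀ y, η y ^ 2 = ‖φ y‖ ^ 2 + δ ^ 2 := fun y => by rw [hη, Real.sq_sqrt (hpos y).le]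
  have hφη : ∀ y, ‖φ y‖ ≤ η y := fun y => le_of_sq_le_sq (by rw [hη2]; nlinarith) (hη0 y).le
  have hηd : ContDiff ℝ ∞ η := by
    rw [funext hη]
    exact ((hφ.1.1.norm_sq ℂ).add contDiff_const).sqrt fun y => (hpos y).ne'
  have hηc := hηd.continuous
  have hdc : ∀ i, Continuous (d i) := fun i => by
    rw [funext (hd i)]; exact (hφ.1.fderiv_apply _).1.continuous
  have hξt : IsTestFun Ω fun y => (G y * (η y)⁻¹) • φ y :=
    hφ.1.of_eq_zero ((hG.contDiff.mul (hηd.inv fun y => (hη0 y).ne')).smul hφ.1.1)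
      fun y hy => by rw [hy, smul_zero]
  obtain ⟨r, hr⟩ : ∃ r : Fin n → Sp n → ℝ, ∀ i y, r i y = (inner ℂ (φ y) (d i y)).re :=
    ⟨_, fun _ _ => rfl⟩
  have hη' : ∀ i y, HasLineDerivAt ℝ η (r i y / η y) y (single i 1) := fun i y => by
    have h1 := hasLineDerivAt_norm_sq hφ.1 (single i 1) y
    rw [HasLineDerivAt] at h1 ⊢
    have h2 := (h1.add_const (δ ^ 2)).sqrt (by simpa using (hpos y).ne')
    rw [funext hη]
    refine h2.congr_deriv ?_
    rw [zero_smul, add_zero, hr, hd, mul_div_mul_left _ _ two_ne_zero]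
  have hξ' : ∀ i y, fderiv ℝ (fun y => (G y * (η y)⁻¹) • φ y) y (single i 1)
      = (G y * (η y)⁻¹) • d i y
        + (-a i y * (η y)⁻¹ + G y * (-(r i y / η y) / η y ^ 2)) • φ y := fun i y => by
    have h1 := hasLineDerivAt_of_isTestFun hξt (single i 1) y
    have h2 := hG.deriv i y
    have h3 := hη' i y
    have h4 := hasLineDerivAt_of_isTestFun hφ.1 (single i 1) y
    rw [HasLineDerivAt] at h1 h2 h3 h4
    have h5 := (h2.mul (h3.inv (by simpa using (hη0 y).ne'))).smul h4
    refine h1.unique (h5.congr_deriv ?_)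
    simp only [zero_smul, add_zero, ← hd, ha, Pi.mul_apply, Pi.inv_apply]
  have hpt := fun i y (hy : y ∈ Ω) => kato_pointwise (G' := -a i y) (hη2 y) (hη0 y) hδ
    (hG.nonneg y hy) (hr i y)
  obtain ⟨ξ, hξ⟩ := exists_isTest hξt
  have hmem : ∀ᵐ y ∂vol Ω, y ∈ Ω := ae_restrict_mem hΩ.measurableSet
  refine ⟨ξ, ?_, fun i => ?_, ?_⟩
  · filter_upwards [hξ.2.1, hmem] with y hy hyΩ
    rw [hy, norm_smul, norm_mul, norm_inv, norm_of_nonneg (hG.nonneg y hyΩ),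
      norm_of_nonneg (hη0 y).le, mul_assoc]
    refine mul_le_of_le_one_right (hG.nonneg y hyΩ) ?_
    rw [inv_mul_eq_div]
    exact div_le_one_of_le₀ (hφη y) (hη0 y).le
  · have hgm := (Lp.memLp (grad p i)).norm
    have h1 : ‖grad ξ i‖ ≤ ‖hcm.toLp _ + (2 * (Γ / δ)) • hgm.toLp _‖ := by
      refine Lp.norm_le_norm_of_ae_le ?_
      filter_upwards [hξ.2.2 i, hφ.2.2 i, hmem, hcm.coeFn_toLp, hgm.coeFn_toLp,
        Lp.coeFn_add (hcm.toLp _) ((2 * (Γ / δ)) • hgm.toLp _),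
        Lp.coeFn_smul (2 * (Γ / δ)) (hgm.toLp _)] with y h1 h2 h3 h4 h5 h6 h7
      rw [h1, h6, Pi.add_apply, h7, Pi.smul_apply, h4, h5, h2, hξ', ← hd]
      refine ((hpt i y h3).2).trans ((add_le_add ?_ ?_).trans (Real.le_norm_self _))
      · rw [abs_neg, hA₀]; exact (hγ i y h3).trans (Finset.single_le_sum (fun j _ => hγ0 j) (Finset.mem_univ i))
      · refine mul_le_right ?_
        have := (le_abs_self _).trans (hΓ y h3)
        gcongr
    refine h1.trans ((norm_add_le _ _).trans (add_le_add_right ?_ _))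
    rw [norm_smul, norm_of_nonneg (by positivity), Lp.norm_toLp, eLpNorm_norm, ← Lp.norm_def]
    exact mul_le_left (norm_grad_apply_le p i)
  · have hks : HasCompactSupport fun y => η y - δ := hφ.1.2.1.mono fun y hy h0 => hy (by
        change η y - δ = 0
        rw [hη, h0, norm_zero, zero_pow two_ne_zero, zero_add, Real.sqrt_sq hδ.le, sub_self])
    have hk's : ∀ i, HasCompactSupport fun y => r i y / η y := fun i =>
      hφ.1.2.1.mono fun y hy h0 => hy (by
        change r i y / η y = 0
        rw [hr, h0, inner_zero_left, Complex.zero_re, zero_div])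
    have hk'c : ∀ i, Continuous fun y => r i y / η y := fun i => by
      have h1 := Complex.continuous_re.comp (hφ.1.1.continuous.inner (hdc i))
      simp only [hr]
      exact h1.div hηc fun y => (hη0 y).ne'
    -- `b i` is the `i`-th derivative of `a i`, and `∑ b i = -ΔG` is the bump function
    obtain ⟨b, hbdef⟩ : ∃ b : Fin n → Sp n → ℝ, ∀ i, b i = fun y => sqDist x ε y ^ (-(n / 2 : ℝ))
      + 2 * (-(n / 2 : ℝ)) * (y i - x i) ^ 2 * sqDist x ε y ^ (-(n / 2 : ℝ) - 1) := ⟨_, fun i => rfl⟩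
    have hbc : ∀ i, Continuous (b i) := fun i => by
      rw [hbdef]
      exact (continuous_sqDist_rpow hε _).add ((continuous_const.mul ((hcoord i).pow 2)).mul
        (continuous_sqDist_rpow hε _))
    have hint : ∀ i, Integrable fun y => b i y * (η y - δ) := fun i =>
      ((hbc i).mul (hηc.sub continuous_const)).integrable_of_hasCompactSupport hks.mul_left
    have hibp : ∀ i, ∫ y, b i y * (η y - δ) = -∫ y, a i y * (r i y / η y) := fun i => by
      refine integral_mul_lineDeriv (hac i) (hbc i) (hηc.sub continuous_const) (hk'c i) hks
        (hk's i) (v := single i 1) (fun y => ?_) (fun y => ?_)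
      · rw [ha, hbdef]; exact hasLineDerivAt_field hε _ i y
      · have h1 := hη' i y
        rw [HasLineDerivAt] at h1 ⊢
        exact h1.sub_const δ
    have hsum : ∀ y, ∑ i, b i y = bump x ε y := fun y => by
      simp only [hbdef]
      rw [sum_field_deriv hε, bump]; ring
    have h1 : ∫ y in Ω, bump x ε y * (‖fn p y‖ - δ) ≤ ∫ y in Ω, bump x ε y * (η y - δ) := by
      obtain ⟨K, -, hK⟩ := exists_bound_of_bounded hb (continuous_bump (x := x) hε)
      have hbd : ∀ᵐ y ∂vol Ω, ‖bump x ε y‖ ≤ K := by filter_upwards [hmem] with y hy using hK y hy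
      have hbm := (continuous_bump (x := x) hε).aestronglyMeasurable (μ := vol Ω)
      refine integral_mono_ae ?_ ?_ ?_
      · refine Integrable.bdd_mul ?_ hbm hbd
        exact ((Lp.memLp (fn p)).norm.integrable one_le_two).sub (integrable_const δ)
      · refine Integrable.bdd_mul ?_ hbm hbd
        exact ((hηc.sub continuous_const).integrable_of_hasCompactSupport hks).restrict
      · filter_upwards [hφ.2.1] with y hy
        exact hy ▸ mul_le_left (sub_le_sub_right (hφη y) δ) (bump_nonneg hε y)
    have h2 : ∫ y in Ω, bump x ε y * (η y - δ) = ∑ i, ∫ y, b i y * (η y - δ) := by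
      rw [setIntegral_eq_of_zero, ← integral_finsetSum _ fun i _ => hint i]
      · refine integral_congr_ae (.of_forall fun y => ?_)
        simp only
        rw [← Finset.sum_mul, hsum]
      · intro y hy
        rw [hη, hφ.1.eq_zero_of_notMem hy, norm_zero, zero_pow two_ne_zero, zero_add,
          Real.sqrt_sq hδ.le, sub_self, mul_zero]
    rw [h2] at h1
    refine h1.trans ?_
    rw [PiLp.inner_apply, Complex.re_sum]
    refine Finset.sum_le_sum fun i _ => ?_
    rw [hibp, re_inner_L2, ← integral_neg, ← setIntegral_eq_of_zero (Ω := Ω)]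
    · refine integral_mono_ae ?_ (L2.integrable_inner (𝕜 := ℂ) _ _).re ?_
      · have h3 : Integrable fun y => a i y * (r i y / η y) :=
          ((hac i).mul (hk'c i)).integrable_of_hasCompactSupport (hk's i).mul_left
        exact h3.neg.restrict
      · filter_upwards [hξ.2.2 i, hφ.2.2 i, hmem] with y h3 h4 h5
        rw [h3, h4, hξ', ← hd]
        exact neg_mul (a i y) _ ▸ (hpt i y h5).1
    · intro y hy
      rw [hr, hφ.1.eq_zero_of_notMem hy, inner_zero_left, Complex.zero_re, zero_div, mul_zero, neg_zero]

end H10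

namespace H10

open Filter Topology

/-- Kato's inequality, tested with a regularised fundamental solution. -/
lemma integral_bump_le (hΩ : IsOpen Ω) (hb : Bornology.IsBounded Ω) {x : Sp n} {ε : ℝ} (hε : 0 < ε)
    {G : Sp n → ℝ} (hG : IsFundamental Ω x ε G) {w : H10 Ω N} {g : L2 Ω N}
    (hw : IsNegLaplacian w g) :
    ∫ y in Ω, bump x ε y * ‖fn w y‖ ≤ ∫ y in Ω, G y * ‖g y‖ := by
  have := isFiniteMeasure_of_isBounded hb
  have hmem : ∀ᵐ y ∂vol Ω, y ∈ Ω := ae_restrict_mem hΩ.measurableSet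
  obtain ⟨K, hK0, hK⟩ := exists_bound_of_bounded hb (continuous_bump (x := x) hε)
  have hbd : ∀ᵐ y ∂vol Ω, ‖bump x ε y‖ ≤ K := by filter_upwards [hmem] with y hy using hK y hy
  have hbm := (continuous_bump (x := x) hε).aestronglyMeasurable (μ := vol Ω)
  have hbi : ∀ {f : Sp n → ℝ}, Integrable f (vol Ω) →
      Integrable (fun y => bump x ε y * f y) (vol Ω) := fun hf => hf.bdd_mul hbm hbd
  have hn : ∀ v : L2 Ω N, Integrable (fun y => ‖v y‖) (vol Ω) := fun v =>
    (Lp.memLp v).norm.integrable one_le_two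
  obtain ⟨Γ, hΓ0, hΓ⟩ := exists_bound_of_bounded hb hG.contDiff.continuous
  have hGi : Integrable (fun y => G y * ‖g y‖) (vol Ω) := by
    refine (hn g).bdd_mul (c := Γ) hG.contDiff.continuous.aestronglyMeasurable ?_
    filter_upwards [hmem] with y hy using hΓ y hy
  have hcm := memLp_const (μ := vol Ω) (p := 2) K
  obtain ⟨p, φ, hp, hlim⟩ := exists_seq w
  have hlim0 : Tendsto (fun k => ‖p k - w‖) atTop (𝓝 0) := tendsto_iff_norm_sub_tendsto_zero.mp hlim
  refine le_of_forall_pos_le_add fun τ hτ => ?_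
  obtain ⟨δ, hδ, hδτ⟩ : ∃ δ > 0, δ * ∫ y in Ω, bump x ε y ≤ τ := by
    have h1 : 0 ≤ ∫ y in Ω, bump x ε y := integral_nonneg fun y => bump_nonneg hε y
    refine ⟨τ / (1 + ∫ y in Ω, bump x ε y), by positivity, ?_⟩
    rw [div_mul_eq_mul_div, div_le_iff₀ (by positivity)]
    nlinarith
  obtain ⟨A, B, hB, hT⟩ := exists_kato_test (N := N) hΩ hb hε hδ hG
  have key : ∀ k, ∫ y in Ω, bump x ε y * ‖fn w y‖ ≤ (∫ y in Ω, G y * ‖g y‖) + τ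
      + (n * (A + B * ‖p k‖) + ‖hcm.toLp _‖) * ‖p k - w‖ := fun k => by
    obtain ⟨ξ, h1, h2, h3⟩ := hT (p k) (φ k) (hp k)
    have e1 : ∫ y in Ω, bump x ε y * ‖fn w y‖ ≤ (∫ y in Ω, bump x ε y * (‖fn (p k) y‖ - δ))
        + δ * (∫ y in Ω, bump x ε y) + ∫ y in Ω, ‖(hcm.toLp _ : Sp n → ℝ) y‖ * ‖fn (p k - w) y‖ := by
      have hi1 : Integrable (fun y => bump x ε y * (‖fn (p k) y‖ - δ)) (vol Ω) :=
        hbi ((hn _).sub (integrable_const δ))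
      have hi2 : Integrable (fun y => δ * bump x ε y) (vol Ω) := by
        have := (hbi (integrable_const (1 : ℝ))).const_mul δ
        simpa using this
      have hi3 := (integral_mul_norm_le (hcm.toLp _) (fn (p k - w))).1
      have hi12 : Integrable (fun y => bump x ε y * (‖fn (p k) y‖ - δ) + δ * bump x ε y)
        (vol Ω) := hi1.add hi2
      rw [← integral_const_mul, ← integral_add hi1 hi2, ← integral_add hi12 hi3]
      refine integral_mono_ae (hbi (hn _)) (hi12.add hi3) ?_
      filter_upwards [hcm.coeFn_toLp, hmem, Lp.coeFn_sub (fn (p k)) (fn w)] with y h4 h5 h6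
      rw [h4, fn_sub, h6, Pi.sub_apply, norm_of_nonneg hK0]
      have h7 := norm_sub_norm_le (fn w y) (fn (p k) y)
      rw [norm_sub_rev] at h7
      have h8 := mul_le_left h7 (bump_nonneg (x := x) hε y)
      have h9 := mul_le_right ((le_abs_self _).trans (hK y h5)) (norm_nonneg (fn (p k) y - fn w y))
      linarith
    have e2 := (integral_mul_norm_le (hcm.toLp _) (fn (p k - w))).2
    have e3 := mul_le_left (norm_fn_le (p k - w)) (norm_nonneg (hcm.toLp _))
    have e4 : (inner ℂ (grad ξ) (grad (p k))).re = (inner ℂ (fn ξ) g).re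
        + (inner ℂ (grad ξ) (grad (p k - w))).re := by
      have h4 : grad (p k) = grad w + grad (p k - w) := by
        have h5 : grad (p k - w) = grad (p k) - grad w := rfl
        rw [h5]; abel
      rw [h4, inner_add_right, hw ξ, add_re]
    have e5 : (inner ℂ (fn ξ) g).re ≤ ∫ y in Ω, G y * ‖g y‖ := by
      rw [re_inner_L2]
      refine integral_mono_ae (L2.integrable_inner (𝕜 := ℂ) _ _).re hGi ?_
      filter_upwards [h1] with y hy
      exact (Complex.re_le_norm _).trans ((norm_inner_le_norm _ _).trans (mul_le_right hy))
    have e6 : (inner ℂ (grad ξ) (grad (p k - w))).re ≤ n * (A + B * ‖p k‖) * ‖p k - w‖ := by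
      rw [PiLp.inner_apply, Complex.re_sum]
      refine (Finset.sum_le_sum fun i _ => (Complex.re_le_norm _).trans ((norm_inner_le_norm _ _).trans
        (mul_le_mul (h2 i) (norm_grad_apply_le (p k - w) i) (norm_nonneg _)
          ((norm_nonneg _).trans (h2 i))))).trans_eq ?_
      simp
      ring
    linarith
  have hlim1 : Tendsto (fun k => (∫ y in Ω, G y * ‖g y‖) + τ
      + (n * (A + B * ‖p k‖) + ‖hcm.toLp _‖) * ‖p k - w‖) atTop
      (𝓝 ((∫ y in Ω, G y * ‖g y‖) + τ + (n * (A + B * ‖w‖) + ‖hcm.toLp _‖) * 0)) :=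
    ((((hlim.norm.const_mul B).const_add A).const_mul _).add_const _ |>.mul hlim0).const_add _
  rw [mul_zero, add_zero] at hlim1
  exact ge_of_tendsto' hlim1 key

/-- The regularised fundamental solutions are bounded in `L²(Ω)`. -/
lemma exists_isFundamental (hn : n = 2 ∨ n = 3) (hb : Bornology.IsBounded Ω) :
    ∃ C : ℝ, 0 ≤ C ∧ ∀ x ∈ Ω, ∀ ε : ℝ, 0 < ε → ε ≤ 1 → ∃ G, IsFundamental Ω x ε G ∧
      ∀ y ∈ Ω, y ≠ x → G y ^ 2 ≤ C * ‖y - x‖ ^ (-(n - 1 : ℝ)) := by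
  obtain ⟨D, hD0, hD⟩ : ∃ D : ℝ, 0 < D ∧ ∀ x ∈ Ω, ∀ y ∈ Ω, ‖y - x‖ ≤ D := by
    obtain ⟨D, hD⟩ := Metric.isBounded_iff.mp hb
    exact ⟨max D 1, by positivity, fun x hx y hy => by
      rw [← dist_eq_norm]; exact (hD hy hx).trans (le_max_left _ _)⟩
  rcases hn with rfl | rfl
  · refine ⟨4 * (D + 1), by positivity, fun x hx ε hε hε1 => ⟨fun y => Real.log (D + 1)
      - 1 / 2 * Real.log (sqDist x ε y), ⟨?_, fun y hy => ?_, fun i y => ?_⟩, fun y hy hyx => ?_⟩⟩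
    · exact contDiff_const.sub (contDiff_const.mul ((contDiff_sqDist x ε).log
        fun y => (sqDist_pos hε y).ne'))
    · have h1 : sqDist x ε y ≤ (D + 1) ^ 2 := by
        rw [sqDist]
        nlinarith [hD x hx y hy, norm_nonneg (y - x)]
      have h2 := Real.log_le_log (sqDist_pos hε y) h1
      rw [Real.log_pow] at h2
      push_cast at h2
      linarith
    · have h1 := hasLineDerivAt_sqDist x ε i y
      rw [HasLineDerivAt] at h1 ⊢
      have h2 := (((h1.log (by simpa using (sqDist_pos hε y).ne')).const_mul (1 / 2)).const_sub
        (Real.log (D + 1)))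
      refine h2.congr_deriv ?_
      norm_num [Real.rpow_neg_one]
      ring
    · have hpos : 0 < ‖y - x‖ := norm_pos_iff.mpr (sub_ne_zero.mpr hyx)
      have h0 : 0 < √(sqDist x ε y) := Real.sqrt_pos.mpr (sqDist_pos hε y)
      have h1 : ‖y - x‖ ≤ √(sqDist x ε y) := Real.le_sqrt_of_sq_le (by
        rw [sqDist]; nlinarith)
      have h2 : √(sqDist x ε y) ≤ D + 1 := by
        refine Real.sqrt_le_iff.mpr ⟨by positivity, ?_⟩
        rw [sqDist]
        nlinarith [hD x hx y hy, norm_nonneg (y - x)]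
      have h3 : Real.log (D + 1) - 1 / 2 * Real.log (sqDist x ε y)
          = Real.log ((D + 1) / √(sqDist x ε y)) := by
        rw [Real.log_div (by positivity) h0.ne', Real.log_sqrt (sqDist_pos hε y).le]
        ring
      have h4 : 0 ≤ Real.log ((D + 1) / √(sqDist x ε y)) := Real.log_nonneg ((one_le_div h0).mpr h2)
      have h5 := Real.log_le_rpow_div (x := (D + 1) / √(sqDist x ε y)) (by positivity)
        (show (0 : ℝ) < 1 / 2 by norm_num)
      have h6 : (D + 1) / √(sqDist x ε y) ≤ (D + 1) / ‖y - x‖ :=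
        div_le_div_of_nonneg_left (by positivity) hpos h1
      have h7 : ‖y - x‖ ^ (-(((2 : ℕ) : ℝ) - 1)) = ‖y - x‖⁻¹ := by norm_num [Real.rpow_neg_one]
      simp only
      rw [h3, h7, mul_assoc, ← div_eq_mul_inv]
      refine (pow_le_pow_left₀ h4 h5 2).trans ?_
      rw [div_pow, ← Real.sqrt_eq_rpow, Real.sq_sqrt (by positivity),
        show ((1 : ℝ) / 2) ^ 2 = 1 / 4 by norm_num]
      linarith
  · refine ⟨1, zero_le_one, fun x hx ε hε hε1 => ⟨fun y => sqDist x ε y ^ (-1 / 2 : ℝ),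
      ⟨?_, fun y hy => ?_, fun i y => ?_⟩, fun y hy hyx => ?_⟩⟩
    · exact (contDiff_sqDist x ε).rpow_const_of_ne fun y => (sqDist_pos hε y).ne'
    · exact Real.rpow_nonneg (sqDist_pos hε y).le _
    · have h1 := hasLineDerivAt_rpow (x := x) hε (-1 / 2) i y
      rw [HasLineDerivAt] at h1 ⊢
      refine h1.congr_deriv ?_
      rw [show -(((3 : ℕ) : ℝ) / 2) = -1 / 2 - 1 by norm_num]
      ring
    · have hpos : 0 < ‖y - x‖ := norm_pos_iff.mpr (sub_ne_zero.mpr hyx)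
      simp only
      rw [one_mul, ← Real.rpow_natCast, ← Real.rpow_mul (sqDist_pos hε y).le]
      norm_num
      rw [Real.rpow_neg_one]
      refine inv_anti₀ (by positivity) ?_
      rw [sqDist]
      nlinarith

lemma exists_bound_integral_kernel (hn : 2 ≤ n) (hΩ : IsOpen Ω) (hb : Bornology.IsBounded Ω) :
    ∃ I : ℝ, 0 ≤ I ∧ ∀ x ∈ Ω, Integrable (fun y => ‖y - x‖ ^ (-(n - 1 : ℝ))) (vol Ω) ∧
      ∫ y in Ω, ‖y - x‖ ^ (-(n - 1 : ℝ)) ≤ I := by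
  obtain ⟨D, hD⟩ : ∃ D : ℝ, ∀ x ∈ Ω, ∀ y ∈ Ω, ‖y - x‖ < D := by
    obtain ⟨D, hD⟩ := Metric.isBounded_iff.mp hb
    exact ⟨D + 1, fun x hx y hy => by rw [← dist_eq_norm]; exact (hD hy hx).trans_lt (lt_add_one D)⟩
  obtain ⟨f, hf⟩ : ∃ f : Sp n → ℝ, ∀ y, f y = ‖y‖ ^ (-(n - 1 : ℝ)) := ⟨_, fun _ => rfl⟩
  have hf0 : ∀ y, 0 ≤ f y := fun y => by rw [hf]; positivity
  have h1 : IntegrableOn f (Metric.ball 0 D) := by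
    refine integrableOn_ball_of_norm_le_rpow (C := 1) (α := (n - 1 : ℝ)) (by simp; omega) (by simp)
      (.of_forall fun y => ?_) ?_
    · rw [one_mul, norm_of_nonneg (hf0 y), hf]
    · have : Measurable f := by rw [funext hf]; fun_prop
      exact this.aestronglyMeasurable
  refine ⟨∫ y in Metric.ball 0 D, f y, integral_nonneg hf0, fun x hx => ?_⟩
  have h2 := (measurePreserving_sub_right (volume : Measure (Sp n)) x).integrable_comp_emb
    (MeasurableEquiv.subRight x).measurableEmbedding (g := (Metric.ball 0 D).indicator f)
  have h3 : Integrable ((Metric.ball 0 D).indicator f ∘ fun y => y - x) :=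
    h2.mpr ((integrable_indicator_iff Metric.isOpen_ball.measurableSet).mpr h1)
  have h4 : ∀ y ∈ Ω, ((Metric.ball 0 D).indicator f ∘ fun y => y - x) y = ‖y - x‖ ^ (-(n - 1 : ℝ)) :=
    fun y hy => by
      rw [Function.comp_apply, indicator_of_mem (mem_ball_zero_iff.mpr (hD x hx y hy)), hf]
  constructor
  · refine h3.restrict.congr ?_
    filter_upwards [ae_restrict_mem hΩ.measurableSet] with y hy using h4 y hy
  · rw [setIntegral_congr_fun hΩ.measurableSet fun y hy => (h4 y hy).symm]
    refine (setIntegral_le_integral h3 (.of_forall fun y =>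
      indicator_nonneg (fun z _ => hf0 z) _)).trans_eq ?_
    rw [← integral_indicator Metric.isOpen_ball.measurableSet]
    exact integral_sub_right_eq_self (fun y => (Metric.ball 0 D).indicator f y) x

/-- Functions with a Laplacian in `L²` are bounded in dimension at most three. -/
lemma exists_bound_of_isNegLaplacian (hn : n = 2 ∨ n = 3) (hΩ : IsOpen Ω)
    (hb : Bornology.IsBounded Ω) : ∃ C : ℝ, 0 ≤ C ∧ ∀ (w : H10 Ω N) (g : L2 Ω N),
      IsNegLaplacian w g → ∀ᵐ x ∂vol Ω, ‖fn w x‖ ≤ C * ‖g‖ := by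
  have hn2 : 2 ≤ n := by omega
  have hn0 : (0 : ℝ) < n := by positivity
  obtain ⟨C, hC0, hC⟩ := exists_isFundamental hn hb
  obtain ⟨I, hI0, hI⟩ := exists_bound_integral_kernel hn2 hΩ hb
  have hmem : ∀ᵐ y ∂vol Ω, y ∈ Ω := ae_restrict_mem hΩ.measurableSet
  obtain ⟨c, hc⟩ : ∃ c : ℝ, c = 2 ^ (n / 2 + 1 : ℝ) / n := ⟨_, rfl⟩
  have hc0 : 0 < c := by rw [hc]; positivity
  obtain ⟨v₀, hv⟩ : ∃ v₀ : ℝ, v₀ = (volume : Measure (Sp n)).real (Metric.ball 0 1) := ⟨_, rfl⟩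
  have hv0 : 0 < v₀ := by
    rw [hv]
    exact ENNReal.toReal_pos (Metric.measure_ball_pos _ _ one_pos).ne' measure_ball_lt_top.ne
  refine ⟨c / v₀ * √(C * I), by positivity, fun w g hw => ?_⟩
  have := isFiniteMeasure_of_isBounded hb
  have hwi : Integrable (fun y => ‖fn w y‖) (vol Ω) :=
    (Lp.memLp (fn w)).norm.integrable one_le_two
  have hx : ∀ x ∈ Ω, ∀ ε : ℝ, 0 < ε → ε ≤ 1 →
      ⨍ y in Metric.closedBall x ε, Ω.indicator (fun y => ‖fn w y‖) y ≤ c / v₀ * √(C * I) * ‖g‖ := by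
    intro x hx ε hε hε1
    obtain ⟨G, hG, hG2⟩ := hC x hx ε hε hε1
    obtain ⟨hIi, hIb⟩ := hI x hx
    have hGx : ∀ᵐ y ∂vol Ω, G y ^ 2 ≤ C * ‖y - x‖ ^ (-(n - 1 : ℝ)) := by
      have : Nontrivial (Sp n) := by
        have : Nonempty (Fin n) := ⟨⟨0, by omega⟩⟩
        infer_instance
      filter_upwards [hmem, ae_restrict_of_ae (Measure.ae_ne volume x)] with y h1 h2
        using hG2 y h1 h2
    have hGm : AEStronglyMeasurable G (vol Ω) := hG.contDiff.continuous.aestronglyMeasurable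
    have hGL : MemLp G 2 (vol Ω) := by
      refine (memLp_two_iff_integrable_sq hGm).mpr ((hIi.const_mul C).mono' (hGm.pow 2) ?_)
      filter_upwards [hGx] with y hy
      rwa [norm_of_nonneg (sq_nonneg _)]
    have hGn : ‖hGL.toLp G‖ ≤ √(C * I) := by
      refine Real.le_sqrt_of_sq_le ?_
      rw [Lp.real_norm_sq]
      refine le_trans ?_ (mul_le_left hIb hC0)
      rw [← integral_const_mul]
      refine integral_mono_ae (Lp.memLp (hGL.toLp G)).integrable_sq (hIi.const_mul C) ?_
      filter_upwards [hGx, hGL.coeFn_toLp] with y h1 h2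
      rwa [h2]
    have h1 : ∫ y in Ω, G y * ‖g y‖ ≤ √(C * I) * ‖g‖ := by
      refine le_trans (le_of_eq ?_) ((integral_mul_norm_le (hGL.toLp G) g).2.trans
        (mul_le_right hGn))
      refine integral_congr_ae ?_
      filter_upwards [hmem, hGL.coeFn_toLp] with y h1 h2
      rw [h2, norm_of_nonneg (hG.nonneg y h1)]
    have h2 := (integral_bump_le hΩ hb hε hG hw).trans h1
    -- on the ball the bump function is bounded below by a multiple of `ε ^ (-n)`
    have hball : ∀ y ∈ Metric.closedBall x ε, 1 ≤ c * ε ^ n * bump x ε y := fun y hy => by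
      have h3 : sqDist x ε y ≤ 2 * ε ^ 2 := by
        rw [sqDist]
        have := pow_le_pow_left₀ (norm_nonneg _) (mem_closedBall_iff_norm.mp hy) 2
        linarith
      have h4 : (2 * ε ^ 2) ^ (-(n / 2 : ℝ) - 1) ≤ sqDist x ε y ^ (-(n / 2 : ℝ) - 1) :=
        Real.rpow_le_rpow_of_nonpos (sqDist_pos hε y) h3 (by linarith)
      have h5 : (2 * ε ^ 2) ^ (-(n / 2 : ℝ) - 1) = (2 ^ (n / 2 + 1 : ℝ))⁻¹ * (ε ^ n * ε ^ 2)⁻¹ := by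
        rw [Real.mul_rpow (by norm_num) (sq_nonneg _), ← Real.rpow_natCast ε 2, ← Real.rpow_mul hε.le,
          ← Real.rpow_neg (by norm_num), ← Real.rpow_natCast ε n, ← Real.rpow_add hε,
          ← Real.rpow_neg hε.le]
        congr 2 <;> push_cast <;> ring
      have h6 : c * ε ^ n * (n * ε ^ 2 * (2 * ε ^ 2) ^ (-(n / 2 : ℝ) - 1)) = 1 := by
        rw [h5, hc]
        field_simp
      rw [← h6, bump]
      gcongr
    have hbwi : Integrable (fun y => bump x ε y * ‖fn w y‖) (vol Ω) := by
      obtain ⟨K, -, hK⟩ := exists_bound_of_bounded hb (continuous_bump (x := x) hε)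
      refine hwi.bdd_mul (c := K) (continuous_bump hε).aestronglyMeasurable ?_
      filter_upwards [hmem] with y hy using hK y hy
    have h3 : ∫ y in Metric.closedBall x ε, Ω.indicator (fun y => ‖fn w y‖) y
        ≤ c * ε ^ n * ∫ y in Ω, bump x ε y * ‖fn w y‖ := by
      rw [setIntegral_indicator hΩ.measurableSet, ← integral_const_mul]
      refine (setIntegral_mono_on (hwi.mono_measure (Measure.restrict_mono inter_subset_right le_rfl))
        ((hbwi.const_mul _).mono_measure (Measure.restrict_mono inter_subset_right le_rfl))
        (measurableSet_closedBall.inter hΩ.measurableSet) fun y hy => ?_).trans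
        (setIntegral_mono_set (hbwi.const_mul _) (.of_forall fun y => ?_)
          inter_subset_right.eventuallyLE)
      · rw [← mul_assoc]
        exact le_mul_of_one_le_left (norm_nonneg _) (hball y hy.1)
      · exact mul_nonneg (by positivity) (mul_nonneg (bump_nonneg hε y) (norm_nonneg _))
    rw [setAverage_eq, Measure.addHaar_real_closedBall _ _ hε.le, finrank_euclideanSpace_fin, ← hv,
      smul_eq_mul, inv_mul_le_iff₀ (by positivity)]
    refine h3.trans ((mul_le_left h2).trans_eq ?_)
    field_simp
  -- the bound for the averages passes to the Lebesgue points
  have hloc : LocallyIntegrable (Ω.indicator fun y => ‖fn w y‖) (volume : Measure (Sp n)) :=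
    ((integrable_indicator_iff hΩ.measurableSet).mpr hwi).locallyIntegrable
  filter_upwards [hmem, ae_restrict_of_ae
    (IsUnifLocDoublingMeasure.ae_tendsto_average volume hloc 1)] with x hxΩ hL
  have hδ : Tendsto (fun k : ℕ => 1 / ((k : ℝ) + 1)) atTop (𝓝[>] 0) :=
    tendsto_nhdsWithin_iff.mpr ⟨tendsto_one_div_add_atTop_nhds_zero_nat,
      .of_forall fun k => mem_Ioi.mpr (by positivity)⟩
  have h1 := hL (fun _ => x) _ hδ (.of_forall fun k =>
    Metric.mem_closedBall_self (by positivity))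
  rw [indicator_of_mem hxΩ] at h1
  refine le_of_tendsto' h1 fun k => hx x hxΩ _ (by positivity) ?_
  rw [div_le_one (by positivity)]
  linarith [(Nat.cast_nonneg k : (0 : ℝ) ≤ k)]

end H10

/-! ### Controls and the distributional time derivative -/

section Control

variable {T : ℝ}

/-- The norm of the embedding of `H¹(0,T)` into the bounded functions is at most this constant. -/
def supConst (T : ℝ) : ℝ := 1 / √T + √T

lemma supConst_nonneg (T : ℝ) : 0 ≤ supConst T := by unfold supConst; positivity

/-- The continuous representative of a control, extended by constants. -/
def H1.ctrl (hT : 0 < T) (u : H1 T) : ℝ → ℝ :=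
  IccExtend hT.le fun t : Icc 0 T => (H1.exists_primitive hT u).choose t

lemma H1.ctrl_of_mem (hT : 0 < T) (u : H1 T) {t : ℝ} (ht : t ∈ Icc 0 T) :
    H1.ctrl hT u t = (H1.exists_primitive hT u).choose t := IccExtend_of_mem _ _ ht

lemma H1.isControl (hT : 0 < T) (u : H1 T) {r : ℝ} (hr : supConst T * ‖u‖ ≤ r) :
    IsControl T r (H1.ctrl hT u) fun s => (u : TimePair T).snd s := by
  obtain ⟨-, h2, h3, h4, h5⟩ := (H1.exists_primitive hT u).choose_spec
  have hle : √T * ‖u‖ ≤ supConst T * ‖u‖ := mul_le_right (le_add_of_nonneg_left (by positivity))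
  refine ⟨?_, fun t => (h5 _ (projIcc 0 T hT.le t).2).trans hr, h2, fun t ht => ?_,
    h4.trans (hle.trans hr)⟩
  · refine Continuous.Icc_extend' ?_
    refine continuousOn_iff_continuous_domRestrict.mp ?_
    exact (continuousOn_const.add (continuousOn_primitive' hT.le h2)).congr fun t _ => h3 t
  · rw [H1.ctrl_of_mem hT u ht, H1.ctrl_of_mem hT u ⟨le_rfl, hT.le⟩]
    exact h3 t

lemma H1.ev_ae_eq (hT : 0 < T) (u : H1 T) : ∀ᵐ t ∂timeMeasure T, H1.ev u t = H1.ctrl hT u t := by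
  filter_upwards [(H1.exists_primitive hT u).choose_spec.1, ae_restrict_mem measurableSet_Ioo]
    with t h1 h2
  rw [h1, H1.ctrl_of_mem hT u (Ioo_subset_Icc_self h2)]

lemma H1.ev_sub (u v : H1 T) : ∀ᵐ t ∂timeMeasure T, H1.ev (u - v) t = H1.ev u t - H1.ev v t :=
  Lp.coeFn_sub (u : TimePair T).fst (v : TimePair T).fst

lemma H1.continuous_ctrl (hT : 0 < T) (u : H1 T) : Continuous (H1.ctrl hT u) :=
  (H1.isControl hT u le_rfl).cont

lemma H1.abs_ctrl_sub_le (hT : 0 < T) (u v : H1 T) {t : ℝ} (ht : t ∈ Icc 0 T) :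
    |H1.ctrl hT u t - H1.ctrl hT v t| ≤ supConst T * ‖u - v‖ := by
  have h1 : EqOn (fun t => H1.ctrl hT u t - H1.ctrl hT v t) (H1.ctrl hT (u - v)) (Icc 0 T) := by
    refine eqOn_Icc_of_ae_eq hT ((H1.continuous_ctrl hT u).sub (H1.continuous_ctrl hT v)).continuousOn
      (H1.continuous_ctrl hT _).continuousOn ?_
    filter_upwards [H1.ev_ae_eq hT u, H1.ev_ae_eq hT v, H1.ev_ae_eq hT (u - v), H1.ev_sub u v]
      with t h1 h2 h3 h4
    rw [← h1, ← h2, ← h3, h4]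
  refine le_trans (le_of_eq ?_) ((H1.isControl hT (u - v) le_rfl).bound t)
  exact congrArg abs (h1 ht)

lemma intervalIntegrable_iff_Ioo {E : Type*} [NormedAddCommGroup E] (hT : 0 ≤ T) {f : ℝ → E} :
    IntervalIntegrable f volume 0 T ↔ Integrable f (timeMeasure T) := by
  rw [intervalIntegrable_iff_integrableOn_Ioc_of_le hT, integrableOn_Ioc_iff_integrableOn_Ioo]
  rfl

lemma integral_eq_Ioo {E : Type*} [NormedAddCommGroup E] [NormedSpace ℝ E] (hT : 0 ≤ T)
    (f : ℝ → E) : ∫ s in 0..T, f s = ∫ s in Ioo 0 T, f s := by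
  rw [integral_of_le hT, integral_Ioc_eq_integral_Ioo]

lemma ae_Ioc_of_ae_Ioo {p : ℝ → Prop} (h : ∀ᵐ t ∂timeMeasure T, p t) :
    ∀ᵐ t ∂(vol (Ioc 0 T)), p t := by
  rwa [← Measure.restrict_congr_set (Ioo_ae_eq_Ioc (μ := volume) (a := (0 : ℝ)) (b := T))]

end Control

section Abstract

open ContinuousLinearMap

variable {ι : V →L[ℂ] H} {T : ℝ}

/-- Weak solutions, with the time derivative in the sense of distributions, are mild solutions. -/
lemma IsMild.of_weakDeriv (h : IsGelfand ι) (hT : 0 < T) {Ψ : ℝ → V} {G : ℝ → V → ℂ}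
    (hG : ∀ (Φ : V) (φ : ℝ → ℝ), IsTestFun (Ioo 0 T) φ →
      (∫ t in Ioo 0 T, ((deriv φ t : ℝ) : ℂ) * inner ℂ (ι Φ) (ι (Ψ t)))
        = - ∫ t in Ioo 0 T, ((φ t : ℝ) : ℂ) * G t Φ)
    {v f : ℝ → H} (hf : IntervalIntegrable f volume 0 T)
    (hv : ContinuousOn v (Icc 0 T)) (hvΨ : ∀ᵐ s ∂timeMeasure T, v s = ι (Ψ s))
    (hw : ∀ᵐ t ∂timeMeasure T, ∀ Φ : V, I * G t Φ = inner ℂ Φ (Ψ t) + inner ℂ (ι Φ) (f t)) :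
    IsMild ι T v f := by
  have h0T : (0 : ℝ) ∈ Icc 0 T := ⟨le_rfl, hT.le⟩
  refine IsVeryWeak.isMild h (fun t ht => ?_) hT.le hv hf
  refine ext_inner_left ℂ fun x => ?_
  have hi : IntervalIntegrable (fun s => v s + res ι (f s)) volume 0 T :=
    (intervalIntegrable_of_cont hv ⟨hT.le, le_rfl⟩).add (intervalIntegrable_clm _ hf)
  have hg : IntervalIntegrable (fun s => -I * inner ℂ x (v s + res ι (f s)))
      volume 0 T := (intervalIntegrable_clm (innerSL ℂ x) hi).const_mul _
  have hvx : ContinuousOn (fun s => inner ℂ (res ι x) (v s)) (Icc 0 T) :=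
    continuousOn_const.inner hv
  obtain ⟨c, hc⟩ := exists_ae_eq_primitive hT
    ((intervalIntegrable_iff_Ioo hT.le).mp (intervalIntegrable_of_cont hvx ⟨hT.le, le_rfl⟩))
    ((intervalIntegrable_iff_Ioo hT.le).mp hg) fun φ hφ => by
      have h1 := hG (adjoint ι x) φ hφ
      simp only [Complex.real_smul]
      refine Eq.trans (integral_congr_ae ?_) (h1.trans (congrArg _ (integral_congr_ae ?_)))
      · filter_upwards [hvΨ] with s hs
        rw [hs]; rfl
      · filter_upwards [hvΨ, hw] with s hs h2
        have h3 := h2 (adjoint ι x)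
        have h4 : inner ℂ (ι (adjoint ι x)) (f s) = inner ℂ x (res ι (f s)) :=
          inner_res_comm x (f s)
        rw [adjoint_inner_left, ← hs, h4, ← inner_add_right] at h3
        rw [← h3]
        linear_combination ((φ s : ℂ) * G s (adjoint ι x)) * Complex.I_sq
  have h2 := eqOn_Icc_of_ae_eq hT hvx (continuousOn_const.add (continuousOn_primitive' hT.le hg)) hc
  have h3 := h2 h0T
  simp only [Pi.add_apply, integral_same, add_zero] at h3
  have h4 := h2 ht
  simp only [Pi.add_apply, ← h3, intervalIntegral.integral_const_mul] at h4
  have h5 := (innerSL ℂ x).intervalIntegral_comp_comm (intervalIntegrable_sub hi ht)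
  simp only [innerSL_apply_apply] at h5
  rw [h5, ← sub_eq_iff_eq_add'] at h4
  rw [inner_smul_right, ← inner_res_comm, inner_sub_right, h4, ← mul_assoc, mul_neg,
    Complex.I_mul_I, neg_neg, one_mul]

/-- The time derivative of a bounded mild solution. -/
lemma IsMild.exists_weakDeriv (h : IsGelfand ι) (hT : 0 < T) {M K : ℝ} {ψ : ℝ → V} {f : ℝ → H}
    (hv : IsMild ι T (fun t => ι (ψ t)) f) (hψ : ∀ t ∈ Icc 0 T, ‖ψ t‖ ≤ M)
    (hf : ∀ t ∈ Icc 0 T, ‖f t‖ ≤ K) :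
    MemLp ψ 2 (timeMeasure T) ∧ ∃ g : ℝ → V →L⋆[ℂ] ℂ, MemLp g 2 (timeMeasure T) ∧
      (∀ (Φ : V) (φ : ℝ → ℝ), IsTestFun (Ioo 0 T) φ →
        (∫ t in Ioo 0 T, ((deriv φ t : ℝ) : ℂ) * inner ℂ (ι Φ) (ι (ψ t)))
          = - ∫ t in Ioo 0 T, ((φ t : ℝ) : ℂ) * g t Φ) ∧
      ∀ t Φ, I * g t Φ = inner ℂ Φ (ψ t) + inner ℂ (ι Φ) (f t) := by
  have hTT : T ∈ Icc 0 T := ⟨hT.le, le_rfl⟩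
  have hψm : MemLp ψ 2 (timeMeasure T) := by
    refine MemLp.of_bound (aestronglyMeasurable_form h hv.cont) M ?_
    filter_upwards [ae_restrict_mem measurableSet_Ioo] with t ht using hψ t (Ioo_subset_Icc_self ht)
  have hfm : MemLp f 2 (timeMeasure T) := by
    refine MemLp.of_bound ((intervalIntegrable_iff_Ioo hT.le).mp hv.int).aestronglyMeasurable K ?_
    filter_upwards [ae_restrict_mem measurableSet_Ioo] with t ht using hf t (Ioo_subset_Icc_self ht)
  obtain ⟨g, hg⟩ : ∃ g : ℝ → V →L⋆[ℂ] ℂ, ∀ t,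
      g t = innerSLFlip ℂ (-I • (ψ t + adjoint ι (f t))) := ⟨_, fun _ => rfl⟩
  have hge : ∀ t Φ, g t Φ = -I * (inner ℂ Φ (ψ t) + inner ℂ (ι Φ) (f t)) := fun t Φ => by
    rw [hg, innerSLFlip_apply_apply, inner_smul_right, inner_add_right, adjoint_inner_right]
  refine ⟨hψm, g, ?_, fun Φ φ hφ => ?_, fun t Φ => ?_⟩
  · rw [funext hg]
    exact (innerSLFlip ℂ (E := V)).comp_memLp'
      ((hψm.add ((adjoint ι).comp_memLp' hfm)).const_smul (-I))
  · obtain ⟨h1, -⟩ := hv.inner_form_eq h hψ Φ hTT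
    have hφ0 : φ 0 = 0 := hφ.eq_zero_of_notMem (by simp)
    have hφT : φ T = 0 := hφ.eq_zero_of_notMem (by simp)
    have hdc : Continuous (deriv φ) := hφ.1.continuous_deriv (by simp)
    have hpr : ∀ s ∈ Icc 0 T, φ s = φ 0 + ∫ r in 0..s, deriv φ r := fun s _ => by
      rw [intervalIntegral.integral_deriv_eq_sub
        (fun x _ => (hφ.1.differentiable (by simp)).differentiableAt)
        (hdc.intervalIntegrable _ _)]
      ring
    have key := (integral_bilin_primitive (ContinuousLinearMap.lsmul ℝ ℝ (E := ℂ)) hT.le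
      (hdc.intervalIntegrable 0 T) h1 hpr
      (fun s hs => (hv.inner_form_eq h hψ Φ hs).2)).2.2
    simp only [lsmul_apply, hφ0, hφT, zero_smul, zero_add, Complex.real_smul,
      integral_eq_Ioo hT.le] at key
    simp only [hge]
    exact eq_neg_of_add_eq_zero_left key.symm
  · rw [hge, ← mul_assoc, mul_neg, Complex.I_mul_I, neg_neg, one_mul]

end Abstract

/-! ### The control-to-state map -/

section Trace

variable {T : ℝ}

lemma HasTimeTrace.timeTrace_eq (hT : 0 < T) {Ψ : X Ω N T} {v : ℝ → L2 Ω N}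
    (hv : ContinuousOn v (Icc 0 T)) (hvΨ : ∀ᵐ s ∂timeMeasure T, v s = H10.fn (Ψ s)) {t : ℝ}
    (ht : t ∈ Icc 0 T) : timeTrace Ψ t = v t := by
  have hex : ∃ f, HasTimeTrace Ψ t f := ⟨_, v, hv, hvΨ, rfl⟩
  rw [timeTrace, dif_pos hex]
  obtain ⟨w, hw, hwΨ, e⟩ := hex.choose_spec
  rw [← e]
  refine eqOn_Icc_of_ae_eq hT hw hv ?_ ht
  filter_upwards [hvΨ, hwΨ] with s h1 h2
  rw [h1, h2]

end Trace

section Abstract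

variable {ι : V →L[ℂ] H}

/-- A bounded mild solution is unique among the solutions that are merely square integrable in time
with values in the form domain. -/
lemma IsMild.eqOn_of_isNonlin (h : IsGelfand ι) {T M C r : ℝ} (hT : 0 ≤ T) {F : V → H}
    {E : V → ℝ} {U : H →L[ℂ] H} {a : ℝ → ℝ} {v : ℝ → H} {ψ : ℝ → V} (hF : IsNonlin ι F E C)
    (Ψ : ℝ → V) (hv : IsMild ι T v fun s => F (Ψ s) + (a s : ℂ) • U (v s))
    (hvΨ : ∀ᵐ s ∂timeMeasure T, v s = ι (Ψ s))
    (hsq : Integrable (fun s => ‖Ψ s‖ ^ 2) (timeMeasure T))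
    (hm : IsMild ι T (fun s => ι (ψ s)) fun s => F (ψ s) + (a s : ℂ) • U (ι (ψ s)))
    (hM : ∀ t ∈ Icc 0 T, ‖ψ t‖ ≤ M) (ha : ∀ t, |a t| ≤ r) (h0 : v 0 = ι (ψ 0)) :
    EqOn v (fun s => ι (ψ s)) (Icc 0 T) := by
  have hC := hF.nonneg
  have hr := (abs_nonneg _).trans (ha 0)
  intro t ht
  have h3 := hv.norm_sub_le_exp h hm (t := t)
    (c := fun s => C * (1 + ‖Ψ s‖ ^ 2 + M ^ 2) + r * ‖U‖) (b := fun _ => 0) (by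
      rw [intervalIntegrable_iff_Ioo hT]
      exact ((((integrable_const 1).add hsq).add (integrable_const _)).const_mul _).add
        (integrable_const _))
    (by simp) (fun _ _ => by positivity) (fun _ _ => le_rfl) (by
      refine ae_Ioc_of_ae_Ioo ?_
      filter_upwards [hvΨ, ae_restrict_mem measurableSet_Ioo] with s h1 h2
      have e : F (Ψ s) + (a s : ℂ) • U (v s) - (F (ψ s) + (a s : ℂ) • U (ι (ψ s)))
          = (F (Ψ s) - F (ψ s)) + (a s : ℂ) • U (v s - ι (ψ s)) := by
        rw [map_sub, smul_sub]; abel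
      have h3 := hF.lip (Ψ s) (ψ s)
      have h4 : ‖ψ s‖ ^ 2 ≤ M ^ 2 :=
        pow_le_pow_left₀ (norm_nonneg _) (hM s (Ioo_subset_Icc_self h2)) 2
      rw [map_sub, ← h1] at h3
      rw [e, add_zero, add_mul]
      refine (norm_add_le _ _).trans (add_le_add (h3.trans ?_) ?_)
      · exact mul_le_right (mul_le_left (add_le_add_right h4 _) hC)
      · rw [norm_smul, norm_coe, mul_assoc]
        exact mul_le_mul (ha s) (U.le_opNorm _) (norm_nonneg _) hr) ht
  simp only [h0, sub_self, norm_zero, intervalIntegral.integral_zero, add_zero, zero_mul] at h3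
  exact sub_eq_zero.mp (norm_le_zero_iff.mp h3)

end Abstract

namespace Problem

open Filter Topology H10

variable (hn : 2 ≤ n) (hL : P.XcBound L)

/-- The lower-order terms of the state equation along a curve. -/
def rhs (u : H1 P.T) (ψ : ℝ → H10 P.Ω N) (t : ℝ) : L2 P.Ω N :=
  nonlin hn hL (ψ t) + (H1.ctrl P.T_pos u t : ℂ) • P.U1 (fn (ψ t))

/-- `ψ` is the mild solution of the state equation for the control `u`, bounded by `M` in `H¹₀`. -/
structure IsTraj (M : ℝ) (u : H1 P.T) (ψ : ℝ → H10 P.Ω N) : Prop where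
  init : ψ 0 = P.Ψ0
  bound : ∀ t ∈ Icc 0 P.T, ‖ψ t‖ ≤ M
  mild : IsMild (ι P.Ω N) P.T (fun t => ι P.Ω N (ψ t)) (rhs hn hL u ψ)

variable {hn hL} {M : ℝ} {u u' : H1 P.T} {ψ ψ' : ℝ → H10 P.Ω N}

lemma zero_mem (P : Problem n N) : (0 : ℝ) ∈ Icc 0 P.T := ⟨le_rfl, P.T_pos.le⟩

lemma end_mem (P : Problem n N) : P.T ∈ Icc 0 P.T := ⟨P.T_pos.le, le_rfl⟩

lemma nonlinConst_nonneg (hL : P.XcBound L) : 0 ≤ P.nonlinConst L := by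
  have := hL.nonneg
  unfold nonlinConst; positivity

lemma norm_U1_apply_le (f : L2 P.Ω N) : ‖P.U1 f‖ ≤ ‖P.Vu‖ * ‖f‖ :=
  norm_mulOp_apply_le (isBdd_Lp P.Vu) f

lemma norm_coe_smul_U1_le (a : ℝ) (f : L2 P.Ω N) : ‖(a : ℂ) • P.U1 f‖ ≤ |a| * (‖P.Vu‖ * ‖f‖) := by
  rw [norm_smul, norm_coe]
  exact mul_le_left (norm_U1_apply_le f) (abs_nonneg a)

lemma IsTraj.M_nonneg (h : IsTraj hn hL M u ψ) : 0 ≤ M :=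
  (norm_nonneg _).trans (h.bound 0 P.zero_mem)

lemma IsTraj.norm_fn_le (h : IsTraj hn hL M u ψ) {t : ℝ} (ht : t ∈ Icc 0 P.T) :
    ‖fn (ψ t)‖ ≤ M := (H10.norm_fn_le _).trans (h.bound t ht)

lemma IsTraj.continuousOn (h : IsTraj hn hL M u ψ) :
    ContinuousOn (fun t => fn (ψ t)) (Icc 0 P.T) := h.mild.cont

lemma IsTraj.continuousOn_rhs (h : IsTraj hn hL M u ψ) : ContinuousOn (rhs hn hL u ψ) (Icc 0 P.T) :=
  ((isNonlin hn hL).continuousOn_comp h.bound h.mild.cont).add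
    ((Complex.continuous_ofReal.comp (H1.continuous_ctrl P.T_pos u)).continuousOn.smul
      (P.U1.continuous.comp_continuousOn h.continuousOn))

/-- A Lipschitz constant for the nonlinearity on balls of `H¹₀`. -/
def lipConst (P : Problem n N) (L M : ℝ) : ℝ := P.nonlinConst L * (1 + 2 * M ^ 2)

lemma lipConst_nonneg (hL : P.XcBound L) (M : ℝ) : 0 ≤ P.lipConst L M :=
  mul_nonneg (nonlinConst_nonneg hL) (by positivity)

lemma norm_nonlin_sub_le {p q : H10 P.Ω N} (hp : ‖p‖ ≤ M) (hq : ‖q‖ ≤ M) :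
    ‖nonlin hn hL p - nonlin hn hL q‖ ≤ P.lipConst L M * ‖fn p - fn q‖ :=
  (isNonlin hn hL).lip_of_le hp hq

lemma IsTraj.norm_rhs_le (h : IsTraj hn hL M u ψ) {r t : ℝ} (hr : supConst P.T * ‖u‖ ≤ r)
    (ht : t ∈ Icc 0 P.T) : ‖rhs hn hL u ψ t‖ ≤ (P.lipConst L M + r * ‖P.Vu‖) * M := by
  have h0 : nonlin hn hL (0 : H10 P.Ω N) = 0 := (isNonlin hn hL).zero
  have h1 := norm_nonlin_sub_le (hn := hn) (hL := hL) (h.bound t ht)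
    (q := 0) (by rw [norm_zero]; exact h.M_nonneg)
  rw [h0, sub_zero, show fn (0 : H10 P.Ω N) = 0 from rfl, sub_zero] at h1
  have h2 := norm_coe_smul_U1_le (P := P) (H1.ctrl P.T_pos u t) (fn (ψ t))
  have h3 := (H1.isControl P.T_pos u hr).bound t
  have h4 := h.norm_fn_le ht
  have hC := lipConst_nonneg hL M
  have hr0 := (abs_nonneg _).trans h3
  calc ‖rhs hn hL u ψ t‖ ≤ _ := norm_add_le _ _
    _ ≤ P.lipConst L M * M + r * (‖P.Vu‖ * M) := by
      refine add_le_add (h1.trans (mul_le_left h4 hC)) (h2.trans ?_)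
      exact mul_le_mul h3 (mul_le_left h4) (by positivity) hr0
    _ = _ := by ring

/-- The right-hand sides for two solutions and two controls, possibly at different times. -/
lemma norm_rhs_sub_le (h : IsTraj hn hL M u ψ) (h' : IsTraj hn hL M u' ψ') {r s t : ℝ}
    (hr : supConst P.T * ‖u'‖ ≤ r) (hs : s ∈ Icc 0 P.T) (ht : t ∈ Icc 0 P.T) :
    ‖rhs hn hL u' ψ' s - rhs hn hL u ψ t‖ ≤ (P.lipConst L M + r * ‖P.Vu‖) * ‖fn (ψ' s) - fn (ψ t)‖
        + ‖P.Vu‖ * M * |H1.ctrl P.T_pos u' s - H1.ctrl P.T_pos u t| := by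
  have e : rhs hn hL u' ψ' s - rhs hn hL u ψ t = (nonlin hn hL (ψ' s) - nonlin hn hL (ψ t))
      + (H1.ctrl P.T_pos u' s : ℂ) • P.U1 (fn (ψ' s) - fn (ψ t))
      + ((H1.ctrl P.T_pos u' s - H1.ctrl P.T_pos u t : ℝ) : ℂ) • P.U1 (fn (ψ t)) := by
    rw [rhs, rhs, map_sub, smul_sub, Complex.ofReal_sub, sub_smul]; abel
  have h3 := (H1.isControl P.T_pos u' hr).bound s
  rw [e]
  refine norm_add₃_le.trans ((add_le_add_three (norm_nonlin_sub_le (h'.bound s hs) (h.bound t ht))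
    ((norm_coe_smul_U1_le _ _).trans (mul_le_right h3))
    ((norm_coe_smul_U1_le _ _).trans (mul_le_left
      (mul_le_left (h.norm_fn_le ht))))).trans_eq (by ring))

/-- Lipschitz dependence of the solution on the control. -/
lemma IsTraj.norm_sub_le (hΩ : IsOpen P.Ω) (h : IsTraj hn hL M u ψ) (h' : IsTraj hn hL M u' ψ')
    {r t : ℝ} (hr : supConst P.T * ‖u'‖ ≤ r) (ht : t ∈ Icc 0 P.T) :
    ‖fn (ψ' t) - fn (ψ t)‖ ≤ ‖P.Vu‖ * M * supConst P.T * P.T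
      * Real.exp ((P.lipConst L M + r * ‖P.Vu‖) * P.T) * ‖u' - u‖ := by
  have hr0 : 0 ≤ r := (mul_nonneg (supConst_nonneg _) (norm_nonneg _)).trans hr
  have hC := lipConst_nonneg hL M
  have hM := h.M_nonneg
  have hS := supConst_nonneg P.T
  have hT := P.T_pos
  have h1 := h'.mild.norm_sub_le_exp (isGelfand hΩ) h.mild
    (c := fun _ => P.lipConst L M + r * ‖P.Vu‖)
    (b := fun _ => ‖P.Vu‖ * M * (supConst P.T * ‖u' - u‖)) (by simp) (by simp)
    (fun _ _ => by positivity) (fun _ _ => by positivity) (by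
      filter_upwards [ae_restrict_mem measurableSet_Ioc] with s hs
      have hs' := Ioc_subset_Icc_self hs
      refine (norm_rhs_sub_le h h' hr hs' hs').trans (add_le_add_right ?_ _)
      exact mul_le_left (H1.abs_ctrl_sub_le P.T_pos u' u hs')) ht
  simp only [ι_apply, h.init, h'.init, sub_self, norm_zero, zero_add,
    intervalIntegral.integral_const, sub_zero, smul_eq_mul] at h1
  refine h1.trans ?_
  have h2 : Real.exp (t * (P.lipConst L M + r * ‖P.Vu‖))
      ≤ Real.exp ((P.lipConst L M + r * ‖P.Vu‖) * P.T) := by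
    rw [mul_comm]
    exact Real.exp_le_exp.mpr (mul_le_left ht.2)
  refine (mul_le_left h2).trans_eq (by ring)

/-- Solutions exist, with bounds that are uniform on bounded sets of controls. If the initial value
is in `H²`, the solutions are bounded functions. -/
lemma exists_isTraj (hn3 : n = 2 ∨ n = 3) (hΩ : IsOpen P.Ω) (hb : Bornology.IsBounded P.Ω)
    (hL : P.XcBound L) (hΨ0 : P.β ≠ 0 → MemH2 P.Ψ0) (r : ℝ) :
    ∃ M, 0 < M ∧ ∀ u : H1 P.T, ‖u‖ ≤ r → ∃ ψ : ℝ → H10 P.Ω N, IsTraj hn hL M u ψ ∧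
      (P.β ≠ 0 → ∀ t ∈ Icc 0 P.T, ∀ᵐ x ∂vol P.Ω, ‖fn (ψ t) x‖ ≤ M) := by
  obtain ⟨C, hC0, hC⟩ := exists_bound_of_isNegLaplacian (N := N) hn3 hΩ hb
  have hS := supConst_nonneg P.T
  have hG := isGelfand (N := N) hΩ
  obtain ⟨R, hR⟩ : ∃ R, R = supConst P.T * r := ⟨_, rfl⟩
  obtain ⟨M, hMe⟩ : ∃ M, M = √(energyBound (P.nonlinConst L) ‖P.U1‖ ‖P.Ψ0‖ R) + 1 := ⟨_, rfl⟩
  have hM : 0 < M := by rw [hMe]; positivity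
  have hex : ∀ u : H1 P.T, ‖u‖ ≤ r → supConst P.T * ‖u‖ ≤ R ∧
      ∃ ψ : ℝ → H10 P.Ω N, IsTraj hn hL M u ψ := fun u hu => by
    have hur : supConst P.T * ‖u‖ ≤ R := hR ▸ mul_le_left hu hS
    obtain ⟨ψ, h0, h1, h2⟩ := exists_mild_solution hG (isNonlin hn hL) inner_U1 P.T_pos.le
      (H1.isControl P.T_pos u hur) P.Ψ0
    exact ⟨hur, ψ, h0, fun t ht => hMe ▸ (h1 t ht).trans (by linarith), h2⟩
  -- without the tracking term no `L^∞` bound is needed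
  by_cases hβ : P.β = 0
  · exact ⟨M, hM, fun u hu => (hex u hu).2.imp fun ψ h => ⟨h, fun h' => absurd hβ h'⟩⟩
  obtain ⟨g₀, hg₀⟩ := (hΨ0 hβ).exists_isNegLaplacian
  rw [isNegLaplacian_iff] at hg₀
  -- `x₀ = (1 - Δ) Ψ⁰`
  obtain ⟨x₀, hx₀⟩ : ∃ x₀, x₀ = fn P.Ψ0 + g₀ := ⟨_, rfl⟩
  rw [← hx₀] at hg₀
  obtain ⟨K, hK⟩ : ∃ K, K = P.lipConst L M + R * ‖P.Vu‖ := ⟨_, rfl⟩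
  obtain ⟨Λ, hΛ⟩ : ∃ Λ, Λ = (‖x₀‖ + K * M + ‖P.Vu‖ * M * R) * Real.exp (K * P.T) := ⟨_, rfl⟩
  refine ⟨max M (C * (Λ + K * M + M)), lt_max_of_lt_left hM, fun u hu => ?_⟩
  obtain ⟨hur, ψ, hψ⟩ := hex u hu
  have hR0 : 0 ≤ R := (mul_nonneg hS (norm_nonneg _)).trans hur
  have hK0 : 0 ≤ K := by have := lipConst_nonneg hL M; rw [hK]; positivity
  have hΛ0 : 0 ≤ Λ := by rw [hΛ]; positivity
  refine ⟨ψ, ⟨hψ.init, fun t ht => (hψ.bound t ht).trans (le_max_left _ _), hψ.mild⟩,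
    fun _ t ht => ?_⟩
  have hN : ∀ s ∈ Icc 0 P.T, ‖rhs hn hL u ψ s‖ ≤ K * M := fun s hs => hK ▸ hψ.norm_rhs_le hur hs
  have hlip : ∀ t k, 0 ≤ t → 0 ≤ k → t + k ≤ P.T →
      ‖ι P.Ω N (ψ (t + k)) - ι P.Ω N (ψ t)‖ ≤ Λ * k := fun t k ht hk htk => by
    rw [hΛ]
    refine hψ.mild.lipschitz hG (H1.isControl P.T_pos u hur) hK0 (B := ‖P.Vu‖ * M) (by positivity)
      hN (fun s hs t ht => ?_) (by rw [hψ.init]; exact congrArg (ι P.Ω N) hg₀) ht hk htk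
    rw [hK]
    exact norm_rhs_sub_le hψ hψ hur hs ht
  obtain ⟨x, hx, hxb⟩ := hψ.mild.exists_res_eq hG P.T_pos hψ.continuousOn_rhs hN hΛ0 hlip ht
  have e : ψ t = ContinuousLinearMap.adjoint (ι P.Ω N) x := hG.inj hx.symm
  have hneg : IsNegLaplacian (ψ t) (x - fn (ψ t)) := by
    rw [isNegLaplacian_iff, add_sub_cancel]; exact e
  filter_upwards [hC _ _ hneg] with y hy
  refine hy.trans (le_trans (mul_le_left ?_ hC0) (le_max_right _ _))
  exact (norm_sub_le _ _).trans (add_le_add hxb (hψ.norm_fn_le ht))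

lemma pairing_eq_inner {f : Sp n → Orb N} {F : L2 P.Ω N} (h : f =ᵐ[vol P.Ω] F)
    (Φ : L2 P.Ω N) : P.pairing f Φ = inner ℂ Φ F := by
  rw [pairing, L2.inner_def]
  refine integral_congr_ae ?_
  filter_upwards [h] with x hx
  rw [hx]

/-- The potential terms of the state equation as an element of `L²`. -/
lemma pairing_potentials (hn : 2 ≤ n) (hL : P.XcBound L) (a : ℝ) (p : H10 P.Ω N) (Φ : L2 P.Ω N) :
    P.pairing (fun x => P.Vext a x • fn p x) Φ + P.pairing (fun x => P.VHxc (fn p) x • fn p x) Φ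
      = inner ℂ Φ (nonlin hn hL p + (a : ℂ) • P.U1 (fn p)) + inner ℂ Φ (fn p) := by
  have h1 : (fun x => P.Vext a x • fn p x) =ᵐ[vol P.Ω]
      ((a : ℂ) • P.U1 (fn p) + mulOp N (isBdd_Lp P.V0) (fn p) : L2 P.Ω N) := by
    filter_upwards [Lp.coeFn_add ((a : ℂ) • P.U1 (fn p)) (mulOp N (isBdd_Lp P.V0) (fn p)),
      Lp.coeFn_smul (a : ℂ) (P.U1 (fn p)), coeFn_mulOp (isBdd_Lp P.V0) (fn p),
      coeFn_mulOp (isBdd_Lp P.Vu) (fn p)] with x h1 h2 h3 h4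
    rw [h1, Pi.add_apply, h2, Pi.smul_apply, h3, U1, h4, Vext, add_smul, mul_smul,
      ← coe_smul a]
  have h2 : (fun x => P.VHxc (fn p) x • fn p x) =ᵐ[vol P.Ω]
      (nonlin hn hL p + (a : ℂ) • P.U1 (fn p) + fn p
        - ((a : ℂ) • P.U1 (fn p) + mulOp N (isBdd_Lp P.V0) (fn p)) : L2 P.Ω N) := by
    filter_upwards [coeFn_nonlin hn hL a p, h1, Lp.coeFn_sub
      (nonlin hn hL p + (a : ℂ) • P.U1 (fn p) + fn p)
      ((a : ℂ) • P.U1 (fn p) + mulOp N (isBdd_Lp P.V0) (fn p))] with x h3 h4 h5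
    rw [h5, Pi.sub_apply, ← h3, ← h4, add_sub_cancel_left]
  rw [pairing_eq_inner h1, pairing_eq_inner h2, ← inner_add_right, ← inner_add_right,
    add_sub_cancel]

/-- Mild solutions are weak solutions. -/
lemma IsTraj.exists_isState (hΩ : IsOpen P.Ω) (h : IsTraj hn hL M u ψ) :
    ∃ Ψ : X P.Ω N P.T, P.IsState u Ψ ∧ ∀ᵐ t ∂timeMeasure P.T, Ψ t = ψ t := by
  obtain ⟨h1, g, h2, h3, h4⟩ := h.mild.exists_weakDeriv (isGelfand hΩ) P.T_pos h.bound
    fun t ht => h.norm_rhs_le le_rfl ht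
  obtain ⟨G, hG⟩ : ∃ G : XDual P.Ω N P.T, ∀ᵐ t ∂timeMeasure P.T, G t = g t :=
    ⟨MemLp.toLp (E := Hm1 P.Ω N) g h2, MemLp.coeFn_toLp (E := Hm1 P.Ω N) h2⟩
  refine ⟨h1.toLp ψ, ⟨⟨fun t => fn (ψ t), h.continuousOn, ?_, congrArg fn h.init⟩, G,
    fun Φ φ hφ => ?_, ?_⟩, h1.coeFn_toLp⟩
  · filter_upwards [h1.coeFn_toLp] with t ht
    rw [ht]
  · refine Eq.trans (integral_congr_ae ?_) ((h3 Φ φ hφ).trans (congrArg _ (integral_congr_ae ?_)))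
    · filter_upwards [h1.coeFn_toLp] with t ht
      rw [ht]; rfl
    · filter_upwards [hG] with t ht
      rw [ht]
  · filter_upwards [h1.coeFn_toLp, hG, H1.ev_ae_eq P.T_pos u] with t e1 e2 e3 Φ
    have h5 := pairing_potentials hn hL (H1.ctrl P.T_pos u t) (ψ t) (fn Φ)
    rw [e1, e2, e3, h4, H10.inner_eq, add_assoc (inner ℂ (grad Φ) (grad (ψ t))), h5, ι_apply, rhs]
    ring

/-- Weak solutions coincide with the mild solution. -/
lemma IsState.ae_eq (hΩ : IsOpen P.Ω) {Ψ : X P.Ω N P.T} (hΨ : P.IsState u Ψ)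
    (h : IsTraj hn hL M u ψ) : ∀ᵐ t ∂timeMeasure P.T, Ψ t = ψ t := by
  obtain ⟨⟨v, hvc, hvΨ, hv0⟩, G, hG, hw⟩ := hΨ
  have hT := P.T_pos
  have hC := nonlinConst_nonneg hL
  have hN := isNonlin hn hL
  obtain ⟨B, hB⟩ := isCompact_Icc.exists_bound_of_continuousOn hvc
  have hsq : Integrable (fun s => ‖Ψ s‖ ^ 2) (timeMeasure P.T) :=
    (Lp.memLp Ψ).norm.integrable_sq
  have hnl : IntervalIntegrable (fun s => nonlin hn hL (Ψ s)) volume 0 P.T := by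
    rw [intervalIntegrable_iff_Ioo hT.le]
    refine Integrable.mono' (g := fun s => P.nonlinConst L * (1 + ‖Ψ s‖ ^ 2) * B)
      ((((integrable_const 1).add hsq).const_mul _).mul_const _)
      (hN.continuous.comp_aestronglyMeasurable (Lp.aestronglyMeasurable Ψ)) ?_
    filter_upwards [hvΨ, ae_restrict_mem measurableSet_Ioo] with s h1 h2
    refine (hN.norm_le (Ψ s)).trans (mul_le_left ?_)
    rw [ι_apply, ← h1]
    exact hB s (Ioo_subset_Icc_self h2)
  have hlin : IntervalIntegrable (fun s => (H1.ctrl P.T_pos u s : ℂ) • P.U1 (v s)) volume 0 P.T :=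
    intervalIntegrable_of_cont
      ((Complex.continuous_ofReal.comp (H1.continuous_ctrl P.T_pos u)).continuousOn.smul
        (P.U1.continuous.comp_continuousOn hvc)) P.end_mem
  have hm : IsMild (ι P.Ω N) P.T v
      (fun s => nonlin hn hL (Ψ s) + (H1.ctrl P.T_pos u s : ℂ) • P.U1 (v s)) := by
    refine IsMild.of_weakDeriv (isGelfand hΩ) hT (Ψ := fun t => Ψ t) (G := fun t Φ => G t Φ)
      hG (hnl.add hlin) hvc hvΨ ?_
    filter_upwards [hw, hvΨ, H1.ev_ae_eq P.T_pos u] with t h1 h2 h3 Φ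
    have h5 := pairing_potentials hn hL (H1.ctrl P.T_pos u t) (Ψ t) (fn Φ)
    change I * G t Φ = inner ℂ Φ (Ψ t)
      + inner ℂ (fn Φ) (nonlin hn hL (Ψ t) + (H1.ctrl P.T_pos u t : ℂ) • P.U1 (v t))
    have h6 := h1 Φ
    rw [h3, add_assoc, h5] at h6
    rw [h6, h2, H10.inner_eq]
    ring
  have key := hm.eqOn_of_isNonlin (isGelfand hΩ) hT.le hN (fun s => Ψ s) hvΨ hsq h.mild h.bound
    (H1.isControl P.T_pos u le_rfl).bound (by rw [hv0, h.init]; rfl)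
  filter_upwards [hvΨ, ae_restrict_mem measurableSet_Ioo] with t h1 h2
  exact (isGelfand (N := N) hΩ).inj (h1.symm.trans (key (Ioo_subset_Icc_self h2)))

end Problem

/-! ### The linearised equation -/

section HartreeLin

open H10 Filter Topology

/-- The linearisation of the Hartree term at `p`. -/
def hartreeLin (hn : 2 ≤ n) (p : H10 Ω N) (l : L2 Ω N) : L2 Ω N :=
  mulOp N (isBdd_hartreePot hn p p) l + (2 : ℕ) • hartree hn l p p

lemma hartreeLin_sub (hn : 2 ≤ n) (p : H10 Ω N) (l l' : L2 Ω N) :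
    hartreeLin hn p (l - l') = hartreeLin hn p l - hartreeLin hn p l' := by
  rw [hartreeLin, hartreeLin, hartreeLin, map_sub, hartree_sub_left, smul_sub]; abel

lemma norm_add_two_nsmul_le {E : Type*} [NormedAddCommGroup E] {x y : E} {c : ℝ} (hx : ‖x‖ ≤ c)
    (hy : ‖y‖ ≤ c) : ‖x + (2 : ℕ) • y‖ ≤ 3 * c := by
  rw [two_nsmul, ← add_assoc]
  exact (norm_add₃_le).trans (by linarith)

lemma norm_hartreeLin_le (hn : 2 ≤ n) (p : H10 Ω N) (l : L2 Ω N) :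
    ‖hartreeLin hn p l‖ ≤ 3 * (kato p * ‖l‖) := by
  have h1 := norm_hartree_le hn l p p
  have h2 : ‖mulOp N (isBdd_hartreePot hn p p) l‖ ≤ kato p * ‖l‖ :=
    (norm_mulOp_apply_le _ l).trans_eq (by rw [Real.sqrt_mul_self (kato_nonneg p)])
  rw [Real.sqrt_mul_self (kato_nonneg p)] at h1
  exact norm_add_two_nsmul_le h2 h1

lemma norm_hartreeLin_sub_le (hΩ : IsOpen Ω) (hn : 2 ≤ n) (p q : H10 Ω N) (l : L2 Ω N) :
    ‖hartreeLin hn p l - hartreeLin hn q l‖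
      ≤ 3 * ((√(kato (p - q) * kato p) + √(kato (p - q) * kato q)) * ‖l‖) := by
  have h1 : ‖mulOp N (isBdd_hartreePot hn p p) l - mulOp N (isBdd_hartreePot hn q q) l‖
      ≤ (√(kato (p - q) * kato p) + √(kato (p - q) * kato q)) * ‖l‖ := by
    refine (denseRange_ι (N := N) hΩ).induction_on l
      (isClosed_le (by fun_prop) (by fun_prop)) fun c => ?_
    have h2 : hartree hn (fn p) p c = hartree hn (fn (p - q)) p c + hartree hn (fn q) p c := by
      rw [← hartree_add_left, ← fn_add, sub_add_cancel]
    have h3 : hartree hn (fn q) p c = hartree hn (fn (p - q)) q c + hartree hn (fn q) q c := by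
      rw [hartree_comm hn q p, ← hartree_add_left, ← fn_add, sub_add_cancel]
    rw [ι_apply, mulOp_hartreePot hn, mulOp_hartreePot hn, h2, h3, ← add_assoc, add_sub_cancel_right,
      add_mul]
    exact (norm_add_le _ _).trans (add_le_add (norm_hartree_le_right hn _ _ _)
      (norm_hartree_le_right hn _ _ _))
  have h2 : ‖hartree hn l p p - hartree hn l q q‖
      ≤ (√(kato (p - q) * kato p) + √(kato (p - q) * kato q)) * ‖l‖ := by
    have h3 : hartree hn l p p = hartree hn l (p - q) p + hartree hn l q p := by
      rw [← hartree_add_mid, sub_add_cancel]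
    have h4 : hartree hn l q p = hartree hn l q (p - q) + hartree hn l q q := by
      rw [← hartree_add_right, sub_add_cancel]
    rw [h3, h4, ← add_assoc, add_sub_cancel_right, add_mul, mul_comm (kato (p - q)) (kato q)]
    exact (norm_add_le _ _).trans (add_le_add (norm_hartree_le hn _ _ _) (norm_hartree_le hn _ _ _))
  have e : hartreeLin hn p l - hartreeLin hn q l
      = (mulOp N (isBdd_hartreePot hn p p) l - mulOp N (isBdd_hartreePot hn q q) l)
        + (2 : ℕ) • (hartree hn l p p - hartree hn l q q) := by
    rw [hartreeLin, hartreeLin, smul_sub]; abel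
  rw [e]
  exact norm_add_two_nsmul_le h1 h2

lemma re_inner_hartreeLin (hn : 2 ≤ n) (p : H10 Ω N) (d l : L2 Ω N) :
    (inner ℂ d (hartreeLin hn p l)).re = (inner ℂ (hartreeLin hn p d) l).re := by
  have h1 := hartree_symm hn l d p p
  rw [inner_re_symm' l] at h1
  rw [hartreeLin, hartreeLin, inner_add_right, inner_add_left, two_nsmul, two_nsmul,
    inner_add_right, inner_add_left, inner_mulOp]
  simp only [add_re, h1]

lemma kato_le_of_norm_le {p : H10 Ω N} {M : ℝ} (hM : ‖p‖ ≤ M) : kato p ≤ 2 * n * M ^ 2 :=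
  (kato_le p).trans (mul_le_left (pow_le_pow_left₀ (norm_nonneg _) hM 2))

lemma kato_sub_le {p q : H10 Ω N} {M : ℝ} (hp : ‖p‖ ≤ M) (hq : ‖q‖ ≤ M) :
    kato (p - q) ≤ 4 * n * M * ‖fn p - fn q‖ := by
  have h1 : ‖p - q‖ ≤ 2 * M := (norm_sub_le _ _).trans (by linarith)
  rw [kato, fn_sub]
  exact (mul_le_left h1).trans_eq (by ring)

lemma sqrt_kato_sub_le {p q r : H10 Ω N} {M : ℝ} (hp : ‖p‖ ≤ M) (hq : ‖q‖ ≤ M) (hr : ‖r‖ ≤ M) :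
    √(kato (p - q) * kato r) ≤ √(4 * n * M * ‖fn p - fn q‖ * (2 * n * M ^ 2)) :=
  Real.sqrt_le_sqrt (mul_le_mul (kato_sub_le hp hq) (kato_le_of_norm_le hr) (kato_nonneg _)
    ((kato_nonneg _).trans (kato_sub_le hp hq)))

lemma continuousOn_hartreeLin (hΩ : IsOpen Ω) (hn : 2 ≤ n) {S : Set ℝ} {M : ℝ} {ψ : ℝ → H10 Ω N}
    {y : ℝ → L2 Ω N} (hM : ∀ t ∈ S, ‖ψ t‖ ≤ M) (hψ : ContinuousOn (fun t => fn (ψ t)) S)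
    (hy : ContinuousOn y S) : ContinuousOn (fun t => hartreeLin hn (ψ t) (y t)) S := by
  intro t ht
  obtain ⟨g, hg⟩ : ∃ g : ℝ → ℝ, ∀ s, g s = 3 * (2 * n * M ^ 2 * ‖y s - y t‖)
      + 3 * ((√(4 * n * M * ‖fn (ψ s) - fn (ψ t)‖ * (2 * n * M ^ 2))
        + √(4 * n * M * ‖fn (ψ s) - fn (ψ t)‖ * (2 * n * M ^ 2))) * ‖y t‖) := ⟨_, fun _ => rfl⟩
  have hgc : ContinuousWithinAt g S t := by
    rw [funext hg]
    have h1 : ContinuousWithinAt (fun s => ‖fn (ψ s) - fn (ψ t)‖) S t :=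
      ((hψ t ht).sub continuousWithinAt_const).norm
    have h2 : ContinuousWithinAt (fun s => ‖y s - y t‖) S t :=
      ((hy t ht).sub continuousWithinAt_const).norm
    have h3 := ((h1.const_mul (4 * n * M)).mul_const (2 * n * M ^ 2)).sqrt
    exact ((h2.const_mul _).const_mul 3).add (((h3.add h3).mul_const _).const_mul 3)
  have hg0 : g t = 0 := by simp [hg]
  rw [ContinuousWithinAt, hg0] at hgc
  refine tendsto_iff_norm_sub_tendsto_zero.mpr (squeeze_zero' (.of_forall fun _ =>
    norm_nonneg _) (eventually_nhdsWithin_of_forall fun s hs => ?_) hgc)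
  have e : hartreeLin hn (ψ s) (y s) - hartreeLin hn (ψ t) (y t) = hartreeLin hn (ψ s) (y s - y t)
      + (hartreeLin hn (ψ s) (y t) - hartreeLin hn (ψ t) (y t)) := by
    rw [hartreeLin_sub]; abel
  rw [e, hg]
  refine (norm_add_le _ _).trans (add_le_add ((norm_hartreeLin_le hn _ _).trans ?_)
    ((norm_hartreeLin_sub_le hΩ hn _ _ _).trans ?_))
  · exact mul_le_left (mul_le_right (kato_le_of_norm_le (hM s hs))) (by norm_num)
  · refine mul_le_left (mul_le_right (add_le_add ?_ ?_)) (by norm_num)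
    · exact sqrt_kato_sub_le (hM s hs) (hM t ht) (hM s hs)
    · exact sqrt_kato_sub_le (hM s hs) (hM t ht) (hM t ht)

end HartreeLin

lemma Continuous.superpose {Y α E F G : Type*} [TopologicalSpace Y] {mα : MeasurableSpace α}
    {μ : Measure α} [NormedAddCommGroup E] [NormedSpace ℝ E] [NormedAddCommGroup F] [NormedSpace ℝ F]
    [NormedAddCommGroup G] [NormedSpace ℝ G] {A : E → F →L[ℝ] G} {K : ℝ} (hA : IsCoeff A K)
    {f : Y → Lp E 2 μ} {g : Y → Lp F 2 μ} (hf : Continuous f) (hg : Continuous g) :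
    Continuous fun y => TDKS.superpose hA (f y) (g y) :=
  (continuous_superpose hA).comp (hf.prodMk hg)

section Density

open Filter

variable {M : ℝ}

lemma isCoeff_reInner (hM : 0 < M) : IsCoeff (fun z : Orb N => reInner (clip M z)) M where
  cont := continuous_reInner.comp (continuous_clip hM)
  bound z := ContinuousLinearMap.opNorm_le_bound _ hM.le fun _ => (abs_reInner_le _ _).trans
    (mul_le_right (norm_clip_le hM z))

lemma isCoeff_span (hM : 0 < M) :
    IsCoeff (fun z : Orb N => ContinuousLinearMap.toSpanSingleton ℝ (clip M z)) M where
  cont := (ContinuousLinearMap.toSpanSingletonCLE (𝕜 := ℝ) (E := Orb N)).continuous.comp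
    (continuous_clip hM)
  bound z := by
    rw [ContinuousLinearMap.norm_toSpanSingleton]
    exact norm_clip_le hM z

/-- The density `|ψ|²` as an element of `L²`, where `ψ` is bounded by `M`. -/
def dens (hM : 0 < M) (ψ : L2 Ω N) : Lp ℝ 2 (vol Ω) := superpose (isCoeff_reInner hM) ψ ψ

/-- The function `(|ψ|² - r) ψ` as an element of `L²`, where `ψ` is bounded by `M`. -/
def src (hM : 0 < M) (ψ : L2 Ω N) (r : Lp ℝ 2 (vol Ω)) : L2 Ω N :=
  superpose (isCoeff_span hM) ψ (dens hM ψ - r)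

lemma continuous_dens (hM : 0 < M) : Continuous fun ψ : L2 Ω N => dens hM ψ :=
  Continuous.superpose (isCoeff_reInner hM) continuous_id continuous_id

lemma continuous_src (hM : 0 < M) :
    Continuous fun p : L2 Ω N × Lp ℝ 2 (vol Ω) => src hM p.1 p.2 := by
  have h : Continuous fun p : L2 Ω N × Lp ℝ 2 (vol Ω) => dens hM p.1 - p.2 :=
    ((continuous_dens hM).comp continuous_fst).sub continuous_snd
  exact Continuous.superpose (isCoeff_span hM) continuous_fst h

lemma norm_dens_le (hM : 0 < M) (ψ : L2 Ω N) : ‖dens hM ψ‖ ≤ M * ‖ψ‖ := norm_superpose_le _ _ _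

lemma norm_src_le (hM : 0 < M) (ψ : L2 Ω N) (r : Lp ℝ 2 (vol Ω)) :
    ‖src hM ψ r‖ ≤ M * (M * ‖ψ‖ + ‖r‖) :=
  (norm_superpose_le _ _ _).trans (mul_le_left
    ((norm_sub_le _ _).trans (add_le_add_left (norm_dens_le hM ψ) _)) hM.le)

lemma coeFn_dens (hM : 0 < M) {ψ : L2 Ω N} (hψ : ∀ᵐ x ∂vol Ω, ‖ψ x‖ ≤ M) :
    dens hM ψ =ᵐ[vol Ω] fun x => ‖ψ x‖ ^ 2 := by
  filter_upwards [coeFn_superpose (isCoeff_reInner hM) ψ ψ, hψ] with x h1 h2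
  rw [dens, h1, clip_of_norm_le hM h2, reInner_apply]
  exact inner_self_eq_norm_sq (𝕜 := ℂ) (ψ x)

lemma coeFn_src (hM : 0 < M) {ψ : L2 Ω N} (hψ : ∀ᵐ x ∂vol Ω, ‖ψ x‖ ≤ M) (r : Lp ℝ 2 (vol Ω)) :
    src hM ψ r =ᵐ[vol Ω] fun x => (‖ψ x‖ ^ 2 - r x) • ψ x := by
  filter_upwards [coeFn_superpose (isCoeff_span hM) ψ (dens hM ψ - r), hψ, coeFn_dens hM hψ,
    Lp.coeFn_sub (dens hM ψ) r] with x h1 h2 h3 h4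
  rw [src, h1, clip_of_norm_le hM h2, h4, Pi.sub_apply, h3,
    ContinuousLinearMap.toSpanSingleton_apply]

end Density

namespace Problem

open Filter Topology H10

lemma XcBound.isCoeff (hL : P.XcBound L) : IsCoeff (fderiv ℝ P.xcMap) L :=
  ⟨hL.contDiff.continuous_fderiv one_ne_zero, hL.norm_fderiv_le⟩

/-- The linearisation of the lower-order terms of the state equation at `p`, for the control
value `a`. -/
def lin (hn : 2 ≤ n) (hL : P.XcBound L) (a : ℝ) (p : H10 P.Ω N) (l : L2 P.Ω N) : L2 P.Ω N :=
  P.U0 l + (a : ℂ) • P.U1 l + hartreeLin hn p l + superpose hL.isCoeff (fn p) l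

variable (hn : 2 ≤ n) (hL : P.XcBound L)

lemma lin_sub (a : ℝ) (p : H10 P.Ω N) (l l' : L2 P.Ω N) :
    lin hn hL a p (l - l') = lin hn hL a p l - lin hn hL a p l' := by
  simp only [lin, map_sub, smul_sub, hartreeLin_sub, superpose_sub]; abel

/-- The operator norm of the linearisation is at most this constant. -/
def linConst (P : Problem n N) (L M r : ℝ) : ℝ := ‖P.V0‖ + 1 + r * ‖P.Vu‖ + 3 * (2 * n * M ^ 2) + L

lemma linConst_nonneg (hL : P.XcBound L) (M : ℝ) {r : ℝ} (hr : 0 ≤ r) : 0 ≤ P.linConst L M r := by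
  have := hL.nonneg
  unfold linConst; positivity

lemma norm_lin_le {a r M : ℝ} (ha : |a| ≤ r) {p : H10 P.Ω N} (hp : ‖p‖ ≤ M) (l : L2 P.Ω N) :
    ‖lin hn hL a p l‖ ≤ P.linConst L M r * ‖l‖ := by
  have h3 := (norm_hartreeLin_le hn p l).trans (mul_le_left
    (mul_le_right (kato_le_of_norm_le hp) (norm_nonneg l)) (by norm_num))
  have h2 := (norm_coe_smul_U1_le (P := P) a l).trans (mul_le_right ha)
  rw [lin, linConst]
  refine (norm_add_le _ _).trans ((add_le_add (norm_add₃_le.trans (add_le_add_three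
    (norm_U0_apply_le l) h2 h3)) (norm_superpose_le hL.isCoeff (fn p) l)).trans_eq (by ring))

/-- The linearisation is symmetric with respect to the real inner product. -/
lemma re_inner_lin (a : ℝ) (p : H10 P.Ω N) (d l : L2 P.Ω N) :
    (inner ℂ d (lin hn hL a p l)).re = (inner ℂ (lin hn hL a p d) l).re := by
  have h1 : (inner ℂ d (superpose hL.isCoeff (fn p) l)).re
      = (inner ℂ (superpose hL.isCoeff (fn p) d) l).re := by
    rw [re_inner_L2, re_inner_L2]
    refine integral_congr_ae ?_
    filter_upwards [coeFn_superpose hL.isCoeff (fn p) l, coeFn_superpose hL.isCoeff (fn p) d]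
      with x h1 h2
    have h3 := inner_re_symm' (d x) (fn p x)
    rw [h1, h2, hL.fderiv_apply, hL.fderiv_apply]
    simp only [← coe_smul, inner_add_left, inner_add_right, inner_smul_left,
      inner_smul_right, add_re, conj_ofReal, re_ofReal_mul, h3]
    ring
  have h2 := re_inner_hartreeLin hn p d l
  rw [lin, lin]
  simp only [inner_add_left, inner_add_right, inner_smul_left, inner_smul_right,
    conj_ofReal, add_re, inner_U0, inner_U1, h1, h2]

lemma continuousOn_lin (hΩ : IsOpen P.Ω) {S : Set ℝ} {M : ℝ} {ψ : ℝ → H10 P.Ω N} {c : ℝ → ℝ}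
    {y : ℝ → L2 P.Ω N} (hM : ∀ t ∈ S, ‖ψ t‖ ≤ M) (hψ : ContinuousOn (fun t => fn (ψ t)) S)
    (hc : Continuous c) (hy : ContinuousOn y S) :
    ContinuousOn (fun t => lin hn hL (c t) (ψ t) (y t)) S :=
  (((P.U0.continuous.comp_continuousOn hy).add
    ((Complex.continuous_ofReal.comp hc).continuousOn.smul (P.U1.continuous.comp_continuousOn hy))).add
    (continuousOn_hartreeLin hΩ hn hM hψ hy)).add
    ((continuous_superpose hL.isCoeff).comp_continuousOn (hψ.prodMk hy))

end Problem

/-! ### The adjoint equation -/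

lemma integrable_comp_pair {α H E G : Type*} {mα : MeasurableSpace α} {μ : Measure α}
    [IsFiniteMeasure μ] [NormedAddCommGroup H] [NormedAddCommGroup E] [NormedAddCommGroup G]
    {f : α → H} {r : α → E} {F : H × E → G} (hF : Continuous F) (hf : AEStronglyMeasurable f μ)
    (hr : Integrable r μ) {C D : ℝ} (hb : ∀ᵐ t ∂μ, ‖F (f t, r t)‖ ≤ C * (D + ‖r t‖)) :
    Integrable (fun t => F (f t, r t)) μ :=
  Integrable.mono' (((integrable_const D).add hr.norm).const_mul C)
    (hF.comp_aestronglyMeasurable (hf.prodMk hr.aestronglyMeasurable)) hb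

namespace Problem

open Filter Topology H10 ContinuousLinearMap

variable {hn : 2 ≤ n} {hL : P.XcBound L}

/-- The lower-order terms of the adjoint equation along the state `ψ`. -/
def adjRhs (hn : 2 ≤ n) (hL : P.XcBound L) (hM : 0 < M) (u : H1 P.T) (ψ : ℝ → H10 P.Ω N) (t : ℝ)
    (l : L2 P.Ω N) : L2 P.Ω N :=
  lin hn hL (H1.ctrl P.T_pos u t) (ψ t) l - (2 * P.β) • src hM (fn (ψ t)) (P.ρd t)

lemma pairing_adjointTerms (hM : 0 < M) (a : ℝ) {p : H10 P.Ω N}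
    (hb : P.β ≠ 0 → ∀ᵐ x ∂vol P.Ω, ‖fn p x‖ ≤ M) (l Φ : L2 P.Ω N)
    (r : Lp ℝ 2 (vol P.Ω)) : P.pairing (P.adjointTerms a (fn p) l r) Φ
      = inner ℂ Φ (lin hn hL a p l - (2 * P.β) • src hM (fn p) r) + inner ℂ Φ l := by
  have hs : ((2 * P.β) • src hM (fn p) r : L2 P.Ω N) =ᵐ[vol P.Ω]
      fun x => (2 * P.β * (‖fn p x‖ ^ 2 - r x)) • fn p x := by
    by_cases hβ : P.β = 0
    · filter_upwards [Lp.coeFn_zero (Orb N) 2 (vol P.Ω)] with x hx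
      simp only [hβ, mul_zero, zero_smul, zero_mul]
      exact hx
    · filter_upwards [Lp.coeFn_smul (2 * P.β) (src hM (fn p) r), coeFn_src hM (hb hβ) r]
        with x h1 h2
      rw [h1, Pi.smul_apply, h2, smul_smul]
  rw [← inner_add_right]
  refine pairing_eq_inner ?_ Φ
  have e : lin hn hL a p l - (2 * P.β) • src hM (fn p) r + l
      = mulOp N (isBdd_Lp P.V0) l + (a : ℂ) • mulOp N (isBdd_Lp P.Vu) l
        + mulOp N (isBdd_hartreePot hn p p) l + superpose hL.isCoeff (fn p) l
        + (hartree hn l p p + hartree hn l p p) - (2 * P.β) • src hM (fn p) r := by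
    rw [lin, U0_apply, U1, hartreeLin, two_nsmul]; abel
  obtain ⟨s, hse⟩ : ∃ s : L2 P.Ω N, s = (2 * P.β) • src hM (fn p) r := ⟨_, rfl⟩
  rw [← hse] at hs e
  rw [← hse, e]
  have add : ∀ {f g : L2 P.Ω N} {f' g' : Sp n → Orb N}, f =ᵐ[vol P.Ω] f' →
      g =ᵐ[vol P.Ω] g' → (f + g : L2 P.Ω N) =ᵐ[vol P.Ω] f' + g' :=
    fun hf hg => (Lp.coeFn_add _ _).trans (hf.add hg)
  have h1 := add (add (add (add (coeFn_mulOp (isBdd_Lp P.V0) l)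
    ((Lp.coeFn_smul (a : ℂ) (mulOp N (isBdd_Lp P.Vu) l)).trans
      ((coeFn_mulOp (isBdd_Lp P.Vu) l).const_smul (a : ℂ))))
    (coeFn_mulOp (isBdd_hartreePot hn p p) l)) (coeFn_superpose hL.isCoeff (fn p) l))
    (add (coeFn_hartree hn l p p) (coeFn_hartree hn l p p))
  filter_upwards [(Lp.coeFn_sub _ s).trans (h1.sub hs)] with x hx
  rw [hx]
  have h2 : coulomb P.Ω (fun y => 2 * (inner ℂ (fn p y) (l y)).re) x
      = 2 * hartreePot P.Ω l (fn p) x := by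
    simp only [hartreePot, coulomb, mul_div_assoc, integral_const_mul, inner_re_symm' (fn p _)]
  have h3 : hartreePot P.Ω (fn p) (fn p) x = coulomb P.Ω (fun y => ‖fn p y‖ ^ 2) x := by
    rw [hartreePot]
    congr 1
    exact funext fun y => inner_self_eq_norm_sq (𝕜 := ℂ) (fn p y)
  rw [adjointTerms, h2]
  simp only [Pi.add_apply, Pi.sub_apply, Pi.smul_apply, Vext, VHxc, h3,
    hL.fderiv_apply, add_smul, mul_smul, coe_smul, two_mul]
  abel

/-- Multiplication by `η χ_A`. -/
lemma isBdd_final (hA : MeasurableSet P.A) :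
    IsBdd P.Ω (fun x => P.η * P.A.indicator (fun _ => (1 : ℝ)) x) |P.η| where
  meas := ((measurable_const.indicator hA).const_mul P.η).aestronglyMeasurable
  nonneg := abs_nonneg _
  bound := .of_forall fun x => by
    rw [abs_mul]
    refine mul_le_of_le_one_right (abs_nonneg _) ?_
    by_cases hx : x ∈ P.A <;> simp [hx]

lemma isTerminalValue_iff (hA : MeasurableSet P.A) {Ψ : X P.Ω N P.T} (f : L2 P.Ω N) :
    P.IsTerminalValue Ψ f ↔ f = -I • mulOp N (isBdd_final hA) (timeTrace Ψ P.T) := by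
  rw [Lp.ext_iff, IsTerminalValue]
  refine eventually_congr ?_
  filter_upwards [Lp.coeFn_smul (-I) (mulOp N (isBdd_final hA) (timeTrace Ψ P.T)),
    coeFn_mulOp (isBdd_final hA) (timeTrace Ψ P.T)] with x h1 h2
  rw [h1, Pi.smul_apply, h2]
  constructor
  · intro h
    rw [← h, smul_smul, neg_mul, Complex.I_mul_I, neg_neg, one_smul]
  · intro h
    rw [h, smul_smul, mul_neg, Complex.I_mul_I, neg_neg, one_smul]

variable {u : H1 P.T} {ψ : ℝ → H10 P.Ω N}

lemma norm_adjRhs_sub_le (hM : 0 < M) (h : IsTraj hn hL M u ψ) {t : ℝ} (ht : t ∈ Icc 0 P.T)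
    (x y : L2 P.Ω N) : ‖adjRhs hn hL hM u ψ t x - adjRhs hn hL hM u ψ t y‖
      ≤ P.linConst L M (supConst P.T * ‖u‖) * ‖x - y‖ := by
  rw [adjRhs, adjRhs, sub_sub_sub_cancel_right, ← lin_sub]
  exact norm_lin_le hn hL ((H1.isControl P.T_pos u le_rfl).bound t) (h.bound t ht) _

lemma IsTraj.aestronglyMeasurable (h : IsTraj hn hL M u ψ) :
    AEStronglyMeasurable (fun t => fn (ψ t)) (timeMeasure P.T) :=
  (h.continuousOn.mono Ioo_subset_Icc_self).aestronglyMeasurable measurableSet_Ioo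

lemma integrable_src (hM : 0 < M) (h : IsTraj hn hL M u ψ) :
    Integrable (fun t => src hM (fn (ψ t)) (P.ρd t)) (timeMeasure P.T) := by
  refine integrable_comp_pair (F := fun p => src hM p.1 p.2) (continuous_src hM)
    h.aestronglyMeasurable ((Lp.memLp P.ρd).integrable (by norm_num)) (C := M) (D := M * M) ?_
  filter_upwards [ae_restrict_mem measurableSet_Ioo] with t ht
  refine (norm_src_le hM _ _).trans (mul_le_left (add_le_add_left ?_ _) hM.le)
  exact mul_le_left (h.norm_fn_le (Ioo_subset_Icc_self ht)) hM.le

lemma intervalIntegrable_adjRhs (hΩ : IsOpen P.Ω) (hM : 0 < M) (h : IsTraj hn hL M u ψ)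
    {y : ℝ → L2 P.Ω N} (hy : ContinuousOn y (Icc 0 P.T)) :
    IntervalIntegrable (fun s => adjRhs hn hL hM u ψ s (y s)) volume 0 P.T := by
  refine (intervalIntegrable_of_cont (continuousOn_lin hn hL hΩ h.bound h.continuousOn
    (H1.continuous_ctrl P.T_pos u) hy) P.end_mem).sub ?_
  rw [intervalIntegrable_iff_Ioo P.T_pos.le]
  exact (integrable_src hM h).smul (2 * P.β)

lemma continuous_extend (Λ : C(Icc (0 : ℝ) P.T, L2 P.Ω N)) : Continuous (P.extend Λ) :=
  Λ.continuous.Icc_extend'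

/-- The adjoint equation in the sense of transposition is the mild equation. -/
lemma isAdjoint_iff (hΩ : IsOpen P.Ω) (hA : MeasurableSet P.A) (hM : 0 < M) (h : IsTraj hn hL M u ψ)
    (hb : P.β ≠ 0 → ∀ t ∈ Icc 0 P.T, ∀ᵐ x ∂vol P.Ω, ‖fn (ψ t) x‖ ≤ M)
    {Ψ : X P.Ω N P.T} (hΨ : ∀ᵐ t ∂timeMeasure P.T, Ψ t = ψ t)
    (Λ : C(Icc (0 : ℝ) P.T, L2 P.Ω N)) : P.IsAdjoint u Ψ Λ ↔
      P.extend Λ P.T = -I • mulOp N (isBdd_final hA) (timeTrace Ψ P.T) ∧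
      IsMild (ι P.Ω N) P.T (P.extend Λ) fun s => adjRhs hn hL hM u ψ s (P.extend Λ s) := by
  have hc := (continuous_extend Λ).continuousOn (s := Icc 0 P.T)
  have hf := intervalIntegrable_adjRhs hΩ hM h hc
  have key : ∀ (Φ : H10 P.Ω N) (g : L2 P.Ω N), fn Φ = res (ι P.Ω N) (fn Φ + g) →
      ∀ t ∈ Icc 0 P.T, ∫ s in t..P.T, (inner ℂ g (P.extend Λ s) + P.pairing
          (P.adjointTerms (H1.ev u s) (fn (Ψ s)) (P.extend Λ s) (P.ρd s)) (fn Φ))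
        = ∫ s in t..P.T, (inner ℂ (fn Φ + g) (P.extend Λ s)
          + inner ℂ (res (ι P.Ω N) (fn Φ + g)) (adjRhs hn hL hM u ψ s (P.extend Λ s))) := by
    intro Φ g hΦ t ht
    refine intervalIntegral.integral_congr_ae_restrict ?_
    rw [uIoc_of_le ht.2]
    refine ae_restrict_of_ae_restrict_of_subset (Ioc_subset_Ioc_left ht.1) (ae_Ioc_of_ae_Ioo ?_)
    filter_upwards [hΨ, H1.ev_ae_eq P.T_pos u, ae_restrict_mem measurableSet_Ioo] with s h1 h2 hs
    rw [h1, h2, pairing_adjointTerms (hn := hn) (hL := hL) hM _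
      fun hβ => hb hβ s (Ioo_subset_Icc_self hs), ← hΦ, inner_add_left, adjRhs]
    ring
  refine and_congr (isTerminalValue_iff hA _) ?_
  have hiff := isVeryWeak_iff (ι := ι P.Ω N) P.T_pos.le hc hf
  constructor
  · intro hw
    refine IsVeryWeak.isMild (isGelfand hΩ) (hiff.mpr fun x t ht => ?_) P.T_pos.le hc hf
    have e : fn (adjoint (ι P.Ω N) x) = res (ι P.Ω N) x := rfl
    have e2 : fn (adjoint (ι P.Ω N) x) + (x - fn (adjoint (ι P.Ω N) x)) = x := add_sub_cancel _ _
    obtain ⟨Φ, hΦ⟩ : ∃ Φ, Φ = adjoint (ι P.Ω N) x := ⟨_, rfl⟩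
    rw [← hΦ] at e e2
    have h1 := hw Φ (x - fn Φ) ((isNegLaplacian_iff _ _).mpr (by rw [e2, hΦ])) t ht
    have h2 := key Φ (x - fn Φ) (by rw [e2, e]) t ht
    rw [e2, ← e] at h2
    rw [← e]
    exact h1.trans h2
  · intro hm Φ g hg t ht
    have e : fn Φ = res (ι P.Ω N) (fn Φ + g) :=
      congrArg (ι P.Ω N) ((isNegLaplacian_iff _ _).mp hg)
    have h1 := hiff.mp (hm.isVeryWeak (isGelfand hΩ)) (fn Φ + g) t ht
    have h2 := key Φ g e t ht
    rw [← e] at h1 h2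
    exact h1.trans h2.symm

lemma exists_unique_isAdjoint (hΩ : IsOpen P.Ω) (hA : MeasurableSet P.A) (hM : 0 < M)
    (h : IsTraj hn hL M u ψ)
    (hb : P.β ≠ 0 → ∀ t ∈ Icc 0 P.T, ∀ᵐ x ∂vol P.Ω, ‖fn (ψ t) x‖ ≤ M)
    {Ψ : X P.Ω N P.T} (hΨ : ∀ᵐ t ∂timeMeasure P.T, Ψ t = ψ t) :
    ∃! Λ : C(Icc (0 : ℝ) P.T, L2 P.Ω N), P.IsAdjoint u Ψ Λ := by
  have hr := mul_nonneg (supConst_nonneg P.T) (norm_nonneg u)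
  have hK := linConst_nonneg hL M hr
  obtain ⟨v, hvc, hvT, hv⟩ := exists_isMild_final (isGelfand hΩ) P.T_pos.le hK
    (fun y hy => intervalIntegrable_adjRhs hΩ hM h hy.continuousOn)
    (fun s hs x y => norm_adjRhs_sub_le hM h hs x y)
    (-I • mulOp N (isBdd_final hA) (timeTrace Ψ P.T))
  obtain ⟨Λ, hΛ⟩ : ∃ Λ : C(Icc (0 : ℝ) P.T, L2 P.Ω N), ∀ t, Λ t = v t :=
    ⟨⟨fun t => v t, hvc.comp continuous_subtype_val⟩, fun _ => rfl⟩
  have hext : EqOn (P.extend Λ) v (Icc 0 P.T) := fun t ht => by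
    rw [extend, IccExtend_of_mem _ _ ht, hΛ]
  refine ⟨Λ, (isAdjoint_iff hΩ hA hM h hb hΨ Λ).mpr ⟨(hext P.end_mem).trans hvT, ?_⟩,
    fun Λ' hΛ' => ?_⟩
  · refine hv.congr hext P.T_pos.le ?_
    filter_upwards [ae_restrict_mem measurableSet_Ioc] with s hs
    rw [hext (Ioc_subset_Icc_self hs)]
  · obtain ⟨h1, h2⟩ := (isAdjoint_iff hΩ hA hM h hb hΨ Λ').mp hΛ'
    have h3 := h2.eqOn_of_final (isGelfand hΩ) hK hv (h1.trans hvT.symm) (by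
      filter_upwards [ae_restrict_mem measurableSet_Ioc] with s hs
      exact norm_adjRhs_sub_le hM h (Ioc_subset_Icc_self hs) _ _)
    ext1 t
    have h4 := h3 t.2
    rw [extend, IccExtend_of_mem _ _ t.2] at h4
    rw [hΛ]
    exact h4

lemma IsAdjoint.ae_eq_of_isAdjointW (hΩ : IsOpen P.Ω) (hA : MeasurableSet P.A) (hM : 0 < M)
    (h : IsTraj hn hL M u ψ)
    (hb : P.β ≠ 0 → ∀ t ∈ Icc 0 P.T, ∀ᵐ x ∂vol P.Ω, ‖fn (ψ t) x‖ ≤ M)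
    {Ψ : X P.Ω N P.T} (hΨ : ∀ᵐ t ∂timeMeasure P.T, Ψ t = ψ t)
    {Λ : C(Icc (0 : ℝ) P.T, L2 P.Ω N)} (hΛ : P.IsAdjoint u Ψ Λ) {Λ' : X P.Ω N P.T}
    (hΛ' : P.IsAdjointW u Ψ Λ') : ∀ᵐ t ∂timeMeasure P.T, fn (Λ' t) = P.extend Λ t := by
  obtain ⟨⟨f, ⟨v, hvc, hvΛ, hvT⟩, hf⟩, G, hG, hw⟩ := hΛ'
  obtain ⟨h1, h2⟩ := (isAdjoint_iff hΩ hA hM h hb hΨ Λ).mp hΛ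
  have hm : IsMild (ι P.Ω N) P.T v fun s => adjRhs hn hL hM u ψ s (v s) := by
    refine IsMild.of_weakDeriv (isGelfand hΩ) P.T_pos (Ψ := fun t => Λ' t) (G := fun t Φ => G t Φ)
      hG (intervalIntegrable_adjRhs hΩ hM h hvc) hvc hvΛ ?_
    filter_upwards [hw, hvΛ, hΨ, H1.ev_ae_eq P.T_pos u, ae_restrict_mem measurableSet_Ioo]
      with t h3 h4 h5 h6 ht Φ
    change I * G t Φ = inner ℂ Φ (Λ' t) + inner ℂ (fn Φ) (adjRhs hn hL hM u ψ t (v t))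
    have h7 := h3 Φ
    rw [h5, h6, pairing_adjointTerms (hn := hn) (hL := hL) hM _
      fun hβ => hb hβ t (Ioo_subset_Icc_self ht)] at h7
    rw [h7, h4, H10.inner_eq, adjRhs]
    ring
  have hr := mul_nonneg (supConst_nonneg P.T) (norm_nonneg u)
  have h3 := hm.eqOn_of_final (isGelfand hΩ) (linConst_nonneg hL M hr) h2
    (by rw [hvT, h1]; exact (isTerminalValue_iff hA f).mp hf) (by
      filter_upwards [ae_restrict_mem measurableSet_Ioc] with s hs
      exact norm_adjRhs_sub_le hM h (Ioc_subset_Icc_self hs) _ _)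
  filter_upwards [hvΛ, ae_restrict_mem measurableSet_Ioo] with t h4 ht
  rw [← h4]
  exact h3 (Ioo_subset_Icc_self ht)

end Problem

/-! ### Remainders of first-order expansions -/

section Superposition

open Filter Topology

variable {α : Type*} [MeasurableSpace α] {μ : Measure α} {E F : Type*} [NormedAddCommGroup E]
  [NormedSpace ℝ E] [NormedAddCommGroup F] [NormedSpace ℝ F]

/-- Superposition operators are not differentiable on `L²`, but their remainders are of higher
order when they are paired with a fixed function. -/
lemma exists_tendsto_integral_le {ψ : ℕ → Lp E 2 μ} {ψ₀ : Lp E 2 μ}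
    (hψ : Tendsto ψ atTop (𝓝 ψ₀)) {g : α → E → ℝ} {C : ℝ} (hg : ∀ x z, |g x z| ≤ C)
    (hg0 : ∀ᵐ x ∂μ, Tendsto (g x) (𝓝 (ψ₀ x)) (𝓝 0))
    (hm : ∀ k, AEStronglyMeasurable (fun x => g x (ψ k x)) μ) (h : Lp F 2 μ) :
    ∃ δ : ℕ → ℝ, Tendsto δ atTop (𝓝 0) ∧ (∀ k, 0 ≤ δ k ∧ δ k ≤ C * ‖h‖) ∧
      ∀ (K : ℝ) (k : ℕ) (w : α → ℝ), 0 ≤ K →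
      (∀ᵐ x ∂μ, |w x| ≤ (K * ‖ψ k x - ψ₀ x‖ + |g x (ψ k x)| * ‖h x‖) * ‖ψ k x - ψ₀ x‖) →
      |∫ x, w x ∂μ| ≤ (K * ‖ψ k - ψ₀‖ + δ k) * ‖ψ k - ψ₀‖ := by
  have hb : ∀ k x, ‖g x (ψ k x) * ‖h x‖‖ ≤ C * ‖h x‖ := fun k x => by
    rw [norm_mul, norm_norm]
    exact mul_le_right (hg _ _)
  have hq : ∀ k, MemLp (fun x => g x (ψ k x) * ‖h x‖) 2 μ := fun k =>
    MemLp.of_le_mul (Lp.memLp h) ((hm k).mul (Lp.aestronglyMeasurable h).norm) (.of_forall (hb k))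
  refine ⟨fun k => ‖(hq k).toLp‖, tendsto_norm_superposition hψ hg hg0 h fun k =>
    (hq k).coeFn_toLp, fun k => ⟨norm_nonneg _, ?_⟩, fun K k w hK hw => ?_⟩
  · refine Lp.norm_le_mul_norm_of_ae_le_mul ?_
    filter_upwards [(hq k).coeFn_toLp] with x hx
    rw [hx]
    exact hb k x
  · obtain ⟨h1, h2⟩ := integral_mul_norm_le (hq k).toLp (ψ k - ψ₀)
    obtain ⟨h3, h4⟩ := integral_mul_norm_le (ψ k - ψ₀) (ψ k - ψ₀)
    have h5 : ‖∫ x, w x ∂μ‖ ≤ ∫ x, (K * (‖(ψ k - ψ₀) x‖ * ‖(ψ k - ψ₀) x‖)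
        + ‖(hq k).toLp _ x‖ * ‖(ψ k - ψ₀) x‖) ∂μ := by
      refine norm_integral_le_of_norm_le ((h3.const_mul K).add h1) ?_
      filter_upwards [hw, (hq k).coeFn_toLp, Lp.coeFn_sub (ψ k) ψ₀] with x h3 h4 h5
      rw [h4, h5, Pi.sub_apply, norm_mul, norm_norm, norm_eq_abs, norm_eq_abs]
      linarith
    rw [integral_add (h3.const_mul K) h1, integral_const_mul, norm_eq_abs] at h5
    have h6 := mul_le_left h4 hK
    linarith

end Superposition

namespace Problem

open Filter Topology H10

/-- The remainder of the first-order expansion of the nonlinearity. -/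
def nonlinRem (hn : 2 ≤ n) (hL : P.XcBound L) (p q : H10 P.Ω N) : L2 P.Ω N :=
  hartreeRem hn p (q - p)
    + (xcOp hL (fn q) - xcOp hL (fn p) - superpose hL.isCoeff (fn p) (fn q - fn p))

lemma nonlin_sub_eq (hn : 2 ≤ n) (hL : P.XcBound L) (p q : H10 P.Ω N) :
    nonlin hn hL q - nonlin hn hL p = lin hn hL 0 p (fn q - fn p) + nonlinRem hn hL p q := by
  have h1 := hartreeMap_taylor hn p (q - p)
  rw [add_sub_cancel, ← mulOp_hartreePot, fn_sub] at h1
  have h2 : nonlin hn hL q - nonlin hn hL p = P.U0 (fn q - fn p) + (hartreeMap hn q - hartreeMap hn p)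
      + (xcOp hL (fn q) - xcOp hL (fn p)) := by
    rw [nonlin, nonlin, map_sub]; abel
  rw [h2, h1, nonlinRem, lin, hartreeLin, Complex.ofReal_zero, zero_smul]
  abel

lemma exists_xcRem_le (hL : P.XcBound L) {q : ℕ → L2 P.Ω N} {p : L2 P.Ω N}
    (hq : Tendsto q atTop (𝓝 p)) (l : L2 P.Ω N) :
    ∃ δ : ℕ → ℝ, Tendsto δ atTop (𝓝 0) ∧ (∀ k, 0 ≤ δ k ∧ δ k ≤ 2 * L * ‖l‖) ∧ ∀ k,
      |(inner ℂ l (xcOp hL (q k) - xcOp hL p - superpose hL.isCoeff p (q k - p))).re|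
        ≤ δ k * ‖q k - p‖ := by
  obtain ⟨g, hg⟩ : ∃ g : Sp n → Orb N → ℝ, ∀ x z, g x z
      = ‖P.xcMap z - P.xcMap (p x) - fderiv ℝ P.xcMap (p x) (z - p x)‖ / ‖z - p x‖ :=
    ⟨_, fun _ _ => rfl⟩
  have hr : ∀ k, (xcOp hL (q k) - xcOp hL p - superpose hL.isCoeff p (q k - p) : L2 P.Ω N)
      =ᵐ[vol P.Ω] fun x =>
        P.xcMap (q k x) - P.xcMap (p x) - fderiv ℝ P.xcMap (p x) (q k x - p x) := fun k => by
    filter_upwards [Lp.coeFn_sub (xcOp hL (q k) - xcOp hL p) (superpose hL.isCoeff p (q k - p)),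
      Lp.coeFn_sub (xcOp hL (q k)) (xcOp hL p), coeFn_xcOp hL (q k), coeFn_xcOp hL p,
      coeFn_superpose hL.isCoeff p (q k - p), Lp.coeFn_sub (q k) p] with x h1 h2 h3 h4 h5 h6
    rw [h1, Pi.sub_apply, h2, Pi.sub_apply, h3, h4, h5, h6]
    rfl
  obtain ⟨δ, h0, h1, h2⟩ := exists_tendsto_integral_le hq (g := g) (C := 2 * L) (fun x z => by
      have h3 := hL.lipschitz.norm_sub_le z (p x)
      have h4 := hL.isCoeff.norm_apply_le (p x) (z - p x)
      rw [Real.coe_toNNReal _ hL.nonneg] at h3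
      rw [hg, abs_of_nonneg (by positivity)]
      have hL0 := hL.nonneg
      refine div_le_of_le_mul₀ (norm_nonneg _) (by positivity) ((norm_sub_le _ _).trans ?_)
      linarith)
    (.of_forall fun x => by
      have h3 := hasFDerivAt_iff_tendsto.mp
        ((hL.contDiff.differentiable one_ne_zero) (p x)).hasFDerivAt
      refine h3.congr fun z => ?_
      rw [hg, div_eq_inv_mul])
    (fun k => by
      have h3 : AEMeasurable (fun x =>
          ‖(xcOp hL (q k) - xcOp hL p - superpose hL.isCoeff p (q k - p) : L2 P.Ω N) x‖
            / ‖q k x - p x‖) (vol P.Ω) :=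
        (Lp.aestronglyMeasurable _).norm.aemeasurable.div
          ((Lp.aestronglyMeasurable (q k)).sub (Lp.aestronglyMeasurable p)).norm.aemeasurable
      refine h3.aestronglyMeasurable.congr ?_
      filter_upwards [hr k] with x hx
      rw [hx, hg]) l
  refine ⟨δ, h0, h1, fun k => ?_⟩
  have h3 := h2 0 k (fun x => (inner ℂ (l x)
    ((xcOp hL (q k) - xcOp hL p - superpose hL.isCoeff p (q k - p) : L2 P.Ω N) x)).re) le_rfl ?_
  · rwa [zero_mul, zero_add, ← re_inner_L2] at h3
  filter_upwards [hr k] with x hx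
  rw [hx, hg, abs_of_nonneg (div_nonneg (norm_nonneg _) (norm_nonneg _)), zero_mul, zero_add,
    mul_right_comm, mul_comm _ ‖l x‖]
  refine (abs_re_inner_le _ _).trans_eq ?_
  congr 1
  rcases eq_or_ne (q k x - p x) 0 with hz | hz
  · rw [sub_eq_zero.mp hz]; simp
  · exact (div_mul_cancel₀ _ (norm_ne_zero_iff.mpr hz)).symm

lemma norm_hartreeRem_le_of_norm_le (hn : 2 ≤ n) {p q : H10 P.Ω N} (hp : ‖p‖ ≤ M) (hq : ‖q‖ ≤ M) :
    ‖hartreeRem hn p (q - p)‖ ≤ (3 * √(4 * n * M * ‖fn q - fn p‖ * (2 * n * M ^ 2))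
      + 4 * n * M * ‖fn q - fn p‖) * ‖fn q - fn p‖ := by
  refine (norm_hartreeRem_le hn p (q - p)).trans ?_
  rw [fn_sub]
  exact mul_le_right (add_le_add (mul_le_left
    (sqrt_kato_sub_le hq hp hp) (by norm_num)) (kato_sub_le hq hp))

/-- A bound for the remainder of the nonlinearity. -/
def remConst (n : ℕ) (L M : ℝ) : ℝ :=
  3 * √(4 * n * M * (2 * M) * (2 * n * M ^ 2)) + 4 * n * M * (2 * M) + 2 * L

lemma exists_nonlinRem_le (hn : 2 ≤ n) (hL : P.XcBound L) (hM : 0 < M) {q : ℕ → H10 P.Ω N}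
    {p : H10 P.Ω N} (hqM : ∀ k, ‖q k‖ ≤ M) (hpM : ‖p‖ ≤ M)
    (hq : Tendsto (fun k => fn (q k)) atTop (𝓝 (fn p))) (l : L2 P.Ω N) :
    ∃ δ : ℕ → ℝ, Tendsto δ atTop (𝓝 0) ∧ (∀ k, 0 ≤ δ k ∧ δ k ≤ remConst n L M * ‖l‖) ∧ ∀ k,
      |(inner ℂ l (nonlinRem hn hL p (q k))).re| ≤ δ k * ‖fn (q k) - fn p‖ := by
  obtain ⟨δ, h0, h1, h2⟩ := exists_xcRem_le hL hq l
  obtain ⟨θ, hθ⟩ : ∃ θ : ℝ → ℝ, ∀ s, θ s = 3 * √(4 * n * M * s * (2 * n * M ^ 2)) + 4 * n * M * s :=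
    ⟨_, fun _ => rfl⟩
  have hd : ∀ k, ‖fn (q k) - fn p‖ ≤ 2 * M := fun k =>
    (norm_sub_le _ _).trans (by linarith [norm_fn_le (q k), norm_fn_le p, hqM k])
  have hθm : ∀ k, θ ‖fn (q k) - fn p‖ ≤ θ (2 * M) := fun k => by
    have := hd k
    rw [hθ, hθ]
    gcongr
  refine ⟨fun k => θ ‖fn (q k) - fn p‖ * ‖l‖ + δ k, ?_, fun k => ⟨?_, ?_⟩, fun k => ?_⟩
  · have hθc : Continuous θ := by rw [funext hθ]; fun_prop
    have h3 := (hθc.tendsto 0).comp (tendsto_iff_norm_sub_tendsto_zero.mp hq)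
    have h4 : θ 0 = 0 := by simp [hθ]
    rw [h4] at h3
    simpa using (h3.mul_const ‖l‖).add h0
  · have := (h1 k).1
    simp only [hθ]
    positivity
  · rw [remConst, add_mul, ← hθ (2 * M)]
    exact add_le_add (mul_le_right (hθm k)) (h1 k).2
  · have h3 := norm_hartreeRem_le_of_norm_le hn hpM (hqM k)
    rw [← hθ] at h3
    rw [nonlinRem, inner_add_right, add_re, add_mul]
    refine (abs_add_le _ _).trans (add_le_add ?_ (h2 k))
    refine (abs_re_inner_le _ _).trans ?_
    exact (mul_le_left h3).trans_eq (by ring)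

lemma norm_dens_sub_sq (hM : 0 < M) {q : L2 P.Ω N}
    (hqM : ∀ᵐ x ∂vol P.Ω, ‖q x‖ ≤ M) (r : Lp ℝ 2 (vol P.Ω)) :
    ‖dens hM q - r‖ ^ 2 = ∫ x in P.Ω, (‖q x‖ ^ 2 - r x) ^ 2 := by
  rw [Lp.real_norm_sq]
  refine integral_congr_ae ?_
  filter_upwards [Lp.coeFn_sub (dens hM q) r, coeFn_dens hM hqM] with x h1 h2
  rw [h1, Pi.sub_apply, h2]

lemma density_expansion {E : Type*} [NormedAddCommGroup E] [InnerProductSpace ℂ E] {p q : E}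
    (hp : ‖p‖ ≤ M) (hq : ‖q‖ ≤ M) (r : ℝ) :
    |1 / 2 * ((‖q‖ ^ 2 - r) ^ 2 - (‖p‖ ^ 2 - r) ^ 2) - 2 * ((‖p‖ ^ 2 - r) * (inner ℂ p (q - p)).re)|
      ≤ (3 * M ^ 2 * ‖q - p‖ + ‖q - p‖ * |r|) * ‖q - p‖ := by
  have h1 : ‖q‖ ^ 2 = ‖p‖ ^ 2 + 2 * (inner ℂ p (q - p)).re + ‖q - p‖ ^ 2 := by
    have := norm_add_sq (𝕜 := ℂ) p (q - p)
    rwa [add_sub_cancel] at this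
  have e : 1 / 2 * ((‖q‖ ^ 2 - r) ^ 2 - (‖p‖ ^ 2 - r) ^ 2)
      - 2 * ((‖p‖ ^ 2 - r) * (inner ℂ p (q - p)).re)
      = 1 / 2 * (‖q‖ ^ 2 - ‖p‖ ^ 2) ^ 2 + ‖q - p‖ ^ 2 * ‖p‖ ^ 2 - ‖q - p‖ ^ 2 * r := by
    rw [h1]; ring
  have h2 : |‖q‖ - ‖p‖| ≤ ‖q - p‖ := abs_norm_sub_norm_le q p
  have h3 : (‖q‖ ^ 2 - ‖p‖ ^ 2) ^ 2 ≤ ‖q - p‖ ^ 2 * (2 * M) ^ 2 := by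
    rw [sq_sub_sq, mul_pow, mul_comm]
    refine mul_le_mul (sq_le_sq' (abs_le.mp h2).1 (abs_le.mp h2).2)
      (pow_le_pow_left₀ (by positivity) (by linarith) 2) (by positivity) (by positivity)
  have h4 : ‖q - p‖ ^ 2 * ‖p‖ ^ 2 ≤ ‖q - p‖ ^ 2 * M ^ 2 :=
    mul_le_left (pow_le_pow_left₀ (norm_nonneg _) hp 2)
  have h5 : |‖q - p‖ ^ 2 * r| = ‖q - p‖ * |r| * ‖q - p‖ := by
    rw [abs_mul, abs_of_nonneg (by positivity)]; ring
  rw [e, add_mul, ← h5]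
  refine (abs_sub _ _).trans (add_le_add_left ?_ _)
  rw [abs_of_nonneg (by positivity)]
  linarith

/-- The first-order expansion of the tracking term at a fixed time. -/
lemma exists_tracking_le (hM : 0 < M) {q : ℕ → L2 P.Ω N} {p : L2 P.Ω N}
    (hqM : ∀ k, ∀ᵐ x ∂vol P.Ω, ‖q k x‖ ≤ M)
    (hpM : ∀ᵐ x ∂vol P.Ω, ‖p x‖ ≤ M) (hq : Tendsto q atTop (𝓝 p))
    (r : Lp ℝ 2 (vol P.Ω)) :
    ∃ δ : ℕ → ℝ, Tendsto δ atTop (𝓝 0) ∧ (∀ k, 0 ≤ δ k ∧ δ k ≤ 2 * M * ‖r‖) ∧ ∀ k,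
      |1 / 2 * (‖dens hM (q k) - r‖ ^ 2 - ‖dens hM p - r‖ ^ 2)
        - 2 * (inner ℂ (src hM p r) (q k - p)).re|
        ≤ (3 * M ^ 2 * ‖q k - p‖ + δ k) * ‖q k - p‖ := by
  obtain ⟨δ, h0, h1, h2⟩ := exists_tendsto_integral_le hq (C := 2 * M)
    (g := fun x z => min ‖z - p x‖ (2 * M)) (fun x z => by
      rw [abs_of_nonneg (by positivity)]
      exact min_le_right _ _)
    (.of_forall fun x => by
      have h3 : Continuous fun z : Orb N => min ‖z - p x‖ (2 * M) := by fun_prop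
      have h4 := h3.tendsto (p x)
      rwa [sub_self, norm_zero, min_eq_left (by positivity)] at h4)
    (fun k => by
      have h3 : Continuous fun z : Orb N => min ‖z‖ (2 * M) := by fun_prop
      exact h3.comp_aestronglyMeasurable
        ((Lp.aestronglyMeasurable (q k)).sub (Lp.aestronglyMeasurable p))) r
  refine ⟨δ, h0, h1, fun k => ?_⟩
  have hsq : ∀ {f : L2 P.Ω N}, (∀ᵐ x ∂vol P.Ω, ‖f x‖ ≤ M) →
      Integrable (fun x => (‖f x‖ ^ 2 - r x) ^ 2) (vol P.Ω) := fun {f} hf => by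
    have h3 := (memLp_two_iff_integrable_sq (Lp.aestronglyMeasurable (dens hM f - r))).mp
      (Lp.memLp (dens hM f - r))
    refine h3.congr ?_
    filter_upwards [Lp.coeFn_sub (dens hM f) r, coeFn_dens hM hf] with x h4 h5
    rw [h4, Pi.sub_apply, h5]
  have hi : Integrable (fun x => (inner ℂ (src hM p r x) ((q k - p : L2 P.Ω N) x)).re)
      (vol P.Ω) := (L2.integrable_inner (𝕜 := ℂ) _ _).re
  have hs : Integrable (fun x => (‖q k x‖ ^ 2 - r x) ^ 2 - (‖p x‖ ^ 2 - r x) ^ 2)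
      (vol P.Ω) := (hsq (hqM k)).sub (hsq hpM)
  rw [norm_dens_sub_sq hM (hqM k), norm_dens_sub_sq hM hpM, re_inner_L2,
    ← integral_sub (hsq (hqM k)) (hsq hpM), ← integral_const_mul, ← integral_const_mul,
    ← integral_sub (hs.const_mul _) (hi.const_mul _)]
  refine h2 (3 * M ^ 2) k _ (by positivity) ?_
  filter_upwards [hqM k, hpM, coeFn_src hM hpM r, Lp.coeFn_sub (q k) p] with x h3 h4 h5 h6
  have h7 : ‖q k x - p x‖ ≤ 2 * M := (norm_sub_le _ _).trans (by linarith)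
  rw [h5, h6, Pi.sub_apply, min_eq_left h7, abs_of_nonneg (norm_nonneg (q k x - p x)),
    ← coe_smul, inner_smul_left, conj_ofReal, re_ofReal_mul]
  exact density_expansion h4 h3 (r x)

end Problem

/-! ### The derivative of the reduced cost -/

section Abstract

variable {ι : V →L[ℂ] H}

/-- Duality between solutions with vanishing initial value and arbitrary solutions. -/
lemma IsMild.re_inner_I_smul (h : IsGelfand ι) {T : ℝ} (hT : 0 ≤ T) {v f w g : ℝ → H}
    (hv : IsMild ι T v f) (hw : IsMild ι T w g) (h0 : v 0 = 0) :
    Integrable (fun s => (inner ℂ (v s) (g s)).re - (inner ℂ (f s) (w s)).re) (timeMeasure T) ∧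
    (inner ℂ (v T) (I • w T)).re
      = ∫ s in Ioo 0 T, ((inner ℂ (v s) (g s)).re - (inner ℂ (f s) (w s)).re) := by
  obtain ⟨h1, h2, h3⟩ := hv.inner_eq hw h (t := T) ⟨hT, le_rfl⟩
  have h4 : IntervalIntegrable (fun s => (inner ℂ (v s) (g s)).re - (inner ℂ (f s) (w s)).re)
      volume 0 T :=
    (intervalIntegrable_clm reCLM h2).sub (intervalIntegrable_clm reCLM h1)
  refine ⟨(intervalIntegrable_iff_Ioo hT).mp h4, ?_⟩
  have h5 : ∫ s in 0..T, reCLM (inner ℂ (v s) (g s) - inner ℂ (f s) (w s))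
      = reCLM (∫ s in 0..T, (inner ℂ (v s) (g s) - inner ℂ (f s) (w s))) :=
    reCLM.intervalIntegral_comp_comm (h2.sub h1)
  rw [intervalIntegral.integral_sub h2 h1] at h5
  rw [← integral_eq_Ioo hT, inner_smul_right, h3, h0, inner_zero_left, zero_add,
    intervalIntegral.integral_const_mul, intervalIntegral.integral_const_mul]
  simp only [map_sub, Complex.reCLM_apply] at h5
  rw [h5]
  simp [mul_add]
  ring

lemma re_inner_expand {B : H →L[ℂ] H} (hB : ∀ x y, inner ℂ (B x) y = inner ℂ x (B y)) (p q : H) :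
    (inner ℂ q (B q)).re = (inner ℂ p (B p)).re + 2 * (inner ℂ (q - p) (B p)).re
      + (inner ℂ (q - p) (B (q - p))).re := by
  have h1 : (inner ℂ q (B p)).re = (inner ℂ p (B q)).re := by rw [← hB, inner_re_symm']
  simp only [map_sub, inner_sub_right, inner_sub_left, sub_re, h1]
  ring

lemma integral_sub_sub {α : Type*} [MeasurableSpace α] {μ : Measure α} {f g p q : α → ℝ} (c : ℝ)
    (hf : Integrable f μ) (hg : Integrable g μ) (hp : Integrable p μ) (hq : Integrable q μ) :
    Integrable (fun x => c * (g x - f x) - p x - q x) μ ∧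
    ∫ x, (c * (g x - f x) - p x - q x) ∂μ
      = c * ((∫ x, g x ∂μ) - ∫ x, f x ∂μ) - (∫ x, p x ∂μ) - ∫ x, q x ∂μ := by
  have h1 : Integrable (fun x => c * (g x - f x)) μ := (hg.sub hf).const_mul c
  have h2 : Integrable (fun x => c * (g x - f x) - p x) μ := h1.sub hp
  exact ⟨h2.sub hq, by
    rw [integral_sub h2 hq, integral_sub h1 hp, integral_const_mul, integral_sub hg hf]⟩

end Abstract

namespace Problem

open Filter Topology H10

variable {hn : 2 ≤ n} {hL : P.XcBound L}
  {u u' : H1 P.T} {ψ ψ' : ℝ → H10 P.Ω N}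

/-- The remainder of the first-order expansion of the right-hand side of the state equation. -/
def rhsRem (hn : 2 ≤ n) (hL : P.XcBound L) (u u' : H1 P.T) (ψ ψ' : ℝ → H10 P.Ω N) (t : ℝ) :
    L2 P.Ω N :=
  nonlinRem hn hL (ψ t) (ψ' t)
    + ((H1.ctrl P.T_pos u' t - H1.ctrl P.T_pos u t : ℝ) : ℂ) • P.U1 (fn (ψ' t))

lemma rhs_sub_eq (t : ℝ) : rhs hn hL u' ψ' t - rhs hn hL u ψ t
    = lin hn hL (H1.ctrl P.T_pos u t) (ψ t) (fn (ψ' t) - fn (ψ t)) + rhsRem hn hL u u' ψ ψ' t := by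
  have h1 := nonlin_sub_eq hn hL (ψ t) (ψ' t)
  rw [rhs, rhs, add_sub_add_comm, h1, rhsRem, Complex.ofReal_sub, sub_smul]
  simp only [lin, map_sub, smul_sub, Complex.ofReal_zero, zero_smul]
  abel

/-- The adjoint state represents the first variation of the terminal value. -/
lemma IsTraj.duality (hΩ : IsOpen P.Ω) (hM : 0 < M) (h : IsTraj hn hL M u ψ)
    (h' : IsTraj hn hL M u' ψ') {l : ℝ → L2 P.Ω N}
    (hl : IsMild (ι P.Ω N) P.T l fun s => adjRhs hn hL hM u ψ s (l s)) :
    Integrable (fun t => P.β * (2 * (inner ℂ (src hM (fn (ψ t)) (P.ρd t))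
        (fn (ψ' t) - fn (ψ t))).re) + (inner ℂ (l t) (rhsRem hn hL u u' ψ ψ' t)).re)
      (timeMeasure P.T) ∧
    (inner ℂ (fn (ψ' P.T) - fn (ψ P.T)) (I • l P.T)).re
      = -∫ t in Ioo 0 P.T, (P.β * (2 * (inner ℂ (src hM (fn (ψ t)) (P.ρd t))
        (fn (ψ' t) - fn (ψ t))).re) + (inner ℂ (l t) (rhsRem hn hL u u' ψ ψ' t)).re) := by
  have hd := h'.mild.sub h.mild (isGelfand hΩ)
  obtain ⟨h1, h2⟩ := hd.re_inner_I_smul (isGelfand hΩ) P.T_pos.le hl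
    (by rw [h.init, h'.init, sub_self])
  have e : ∀ t, (inner ℂ (ι P.Ω N (ψ' t) - ι P.Ω N (ψ t)) (adjRhs hn hL hM u ψ t (l t))).re
      - (inner ℂ (rhs hn hL u' ψ' t - rhs hn hL u ψ t) (l t)).re
      = -(P.β * (2 * (inner ℂ (src hM (fn (ψ t)) (P.ρd t)) (fn (ψ' t) - fn (ψ t))).re)
        + (inner ℂ (l t) (rhsRem hn hL u u' ψ ψ' t)).re) := fun t => by
    simp only [ι_apply]
    have h3 := re_inner_lin hn hL (H1.ctrl P.T_pos u t) (ψ t) (fn (ψ' t) - fn (ψ t)) (l t)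
    have h4 : ((2 * P.β) • src hM (fn (ψ t)) (P.ρd t) : L2 P.Ω N)
        = ((2 * P.β : ℝ) : ℂ) • src hM (fn (ψ t)) (P.ρd t) := (coe_smul _ _).symm
    rw [rhs_sub_eq, adjRhs, inner_sub_right, inner_add_left, sub_re, add_re, h3,
      inner_re_symm' _ (l t), h4, inner_smul_right, re_ofReal_mul,
      inner_re_symm' (src hM _ _), inner_re_symm' (l t) (rhsRem _ _ _ _ _ _ _),
      inner_re_symm' (l t)]
    ring
  simp only [e] at h1 h2
  rw [integral_neg] at h2
  exact ⟨integrable_neg_iff.mp h1, h2⟩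

lemma IsTraj.memLp_dens_sub (hM : 0 < M) (h : IsTraj hn hL M u ψ) :
    MemLp (fun t => dens hM (fn (ψ t)) - P.ρd t) 2 (timeMeasure P.T) := by
  refine MemLp.sub (MemLp.of_bound ((continuous_dens hM).comp_aestronglyMeasurable
    h.aestronglyMeasurable) (M * M) ?_) (Lp.memLp P.ρd)
  filter_upwards [ae_restrict_mem measurableSet_Ioo] with t ht
  exact (norm_dens_le hM _).trans (mul_le_left (h.norm_fn_le (Ioo_subset_Icc_self ht)) hM.le)

lemma IsTraj.integrable_norm_dens_sub_sq (hM : 0 < M) (h : IsTraj hn hL M u ψ) :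
    Integrable (fun t => ‖dens hM (fn (ψ t)) - P.ρd t‖ ^ 2) (timeMeasure P.T) :=
  (h.memLp_dens_sub hM).norm.integrable_sq

lemma IsTraj.reducedCost_eq (hΩ : IsOpen P.Ω) (hA : MeasurableSet P.A) (hM : 0 < M)
    (h : IsTraj hn hL M u ψ)
    (hb : P.β ≠ 0 → ∀ t ∈ Icc 0 P.T, ∀ᵐ x ∂vol P.Ω, ‖fn (ψ t) x‖ ≤ M) :
    P.reducedCost u = P.β / 2 * (∫ t in Ioo 0 P.T, ‖dens hM (fn (ψ t)) - P.ρd t‖ ^ 2)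
      + 1 / 2 * (inner ℂ (fn (ψ P.T)) (mulOp N (isBdd_final hA) (fn (ψ P.T)))).re
      + P.ν / 2 * ‖u‖ ^ 2 := by
  have hex : ∃ Ψ, P.IsState u Ψ := (h.exists_isState hΩ).imp fun _ h => h.1
  have hΨ : ∀ᵐ t ∂timeMeasure P.T, P.state u t = ψ t := by
    rw [state, dif_pos hex]
    exact hex.choose_spec.ae_eq hΩ h
  have hT : timeTrace (P.state u) P.T = fn (ψ P.T) :=
    HasTimeTrace.timeTrace_eq P.T_pos h.continuousOn (hΨ.mono fun t ht => by rw [ht]) P.end_mem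
  rw [reducedCost, cost, hT]
  congr 2
  · by_cases hβ : P.β = 0
    · rw [hβ]; simp
    · congr 1
      refine integral_congr_ae ?_
      filter_upwards [hΨ, ae_restrict_mem measurableSet_Ioo] with t h1 h2
      rw [h1, norm_dens_sub_sq hM (hb hβ t (Ioo_subset_Icc_self h2))]
  · rw [re_inner_L2, ← integral_const_mul, ← integral_const_mul]
    refine integral_congr_ae ?_
    filter_upwards [coeFn_mulOp (isBdd_final hA) (fn (ψ P.T))] with x hx
    rw [hx, ← coe_smul, inner_smul_right, re_ofReal_mul]
    have h1 : (inner ℂ (fn (ψ P.T) x) (fn (ψ P.T) x)).re = ‖fn (ψ P.T) x‖ ^ 2 :=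
      inner_self_eq_norm_sq (𝕜 := ℂ) _
    rw [h1]
    ring

/-- The second-order terms, at a fixed time, in the expansion of the reduced cost; `l` is the
value of the adjoint state and `a` the increment of the control. -/
def costRem (hn : 2 ≤ n) (hL : P.XcBound L) (hM : 0 < M) (p q : H10 P.Ω N) (l : L2 P.Ω N)
    (r : Lp ℝ 2 (vol P.Ω)) (a : ℝ) : ℝ :=
  P.β * (1 / 2 * (‖dens hM (fn q) - r‖ ^ 2 - ‖dens hM (fn p) - r‖ ^ 2)
      - 2 * (inner ℂ (src hM (fn p) r) (fn q - fn p)).re)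
    - (inner ℂ l (nonlinRem hn hL p q)).re - a * (inner ℂ l (P.U1 (fn q - fn p))).re

lemma IsTraj.continuousOn_density (h : IsTraj hn hL M u ψ) {l : ℝ → L2 P.Ω N}
    (hl : ContinuousOn l (Icc 0 P.T)) :
    ContinuousOn (fun t => (inner ℂ (l t) (P.U1 (fn (ψ t)))).re) (Icc 0 P.T) := by
  have h1 : ContinuousOn (fun t => P.U1 (fn (ψ t))) (Icc 0 P.T) :=
    P.U1.continuous.comp_continuousOn h.continuousOn
  have h2 : ContinuousOn (fun t => (inner ℂ (l t) (P.U1 (fn (ψ t))) : ℂ)) (Icc 0 P.T) := hl.inner h1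
  exact Complex.continuous_re.comp_continuousOn h2

lemma costRem_eq (hM : 0 < M) (l : ℝ → L2 P.Ω N) (t : ℝ) :
    costRem hn hL hM (ψ t) (ψ' t) (l t) (P.ρd t) (H1.ctrl P.T_pos u' t - H1.ctrl P.T_pos u t)
      = P.β / 2 * (‖dens hM (fn (ψ' t)) - P.ρd t‖ ^ 2 - ‖dens hM (fn (ψ t)) - P.ρd t‖ ^ 2)
        - (P.β * (2 * (inner ℂ (src hM (fn (ψ t)) (P.ρd t)) (fn (ψ' t) - fn (ψ t))).re)
          + (inner ℂ (l t) (rhsRem hn hL u u' ψ ψ' t)).re)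
        - -(inner ℂ (l t) (P.U1 (fn (ψ t)))).re * (H1.ctrl P.T_pos u' t - H1.ctrl P.T_pos u t) := by
  have h1 : (inner ℂ (l t) (rhsRem hn hL u u' ψ ψ' t)).re
      = (inner ℂ (l t) (nonlinRem hn hL (ψ t) (ψ' t))).re
        + (H1.ctrl P.T_pos u' t - H1.ctrl P.T_pos u t) * (inner ℂ (l t) (P.U1 (fn (ψ' t)))).re := by
    rw [rhsRem, inner_add_right, inner_smul_right, add_re, re_ofReal_mul]
  have h2 : (inner ℂ (l t) (P.U1 (fn (ψ' t) - fn (ψ t)))).re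
      = (inner ℂ (l t) (P.U1 (fn (ψ' t)))).re - (inner ℂ (l t) (P.U1 (fn (ψ t)))).re := by
    rw [map_sub, inner_sub_right, sub_re]
  rw [costRem, h1, h2]
  ring

lemma IsTraj.reducedCost_sub (hΩ : IsOpen P.Ω) (hA : MeasurableSet P.A) (hM : 0 < M)
    (h : IsTraj hn hL M u ψ)
    (hb : P.β ≠ 0 → ∀ t ∈ Icc 0 P.T, ∀ᵐ x ∂vol P.Ω, ‖fn (ψ t) x‖ ≤ M)
    (h' : IsTraj hn hL M u' ψ')
    (hb' : P.β ≠ 0 → ∀ t ∈ Icc 0 P.T, ∀ᵐ x ∂vol P.Ω, ‖fn (ψ' t) x‖ ≤ M)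
    {l : ℝ → L2 P.Ω N} (hl : IsMild (ι P.Ω N) P.T l fun s => adjRhs hn hL hM u ψ s (l s))
    (hlT : I • l P.T = mulOp N (isBdd_final hA) (fn (ψ P.T))) :
    Integrable (fun t => costRem hn hL hM (ψ t) (ψ' t) (l t) (P.ρd t)
      (H1.ctrl P.T_pos u' t - H1.ctrl P.T_pos u t)) (timeMeasure P.T) ∧
    P.reducedCost u' - P.reducedCost u - (P.ν * inner ℝ u (u' - u)
        + ∫ t in Ioo 0 P.T, -(inner ℂ (l t) (P.U1 (fn (ψ t)))).re
            * (H1.ctrl P.T_pos u' t - H1.ctrl P.T_pos u t))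
      = (∫ t in Ioo 0 P.T, costRem hn hL hM (ψ t) (ψ' t) (l t) (P.ρd t)
          (H1.ctrl P.T_pos u' t - H1.ctrl P.T_pos u t))
        + 1 / 2 * (inner ℂ (fn (ψ' P.T) - fn (ψ P.T))
            (mulOp N (isBdd_final hA) (fn (ψ' P.T) - fn (ψ P.T)))).re
        + P.ν / 2 * ‖u' - u‖ ^ 2 := by
  obtain ⟨i1, e1⟩ := h.duality hΩ hM h' hl
  have i2 : Integrable (fun t => -(inner ℂ (l t) (P.U1 (fn (ψ t)))).re
      * (H1.ctrl P.T_pos u' t - H1.ctrl P.T_pos u t)) (timeMeasure P.T) := by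
    refine (intervalIntegrable_iff_Ioo P.T_pos.le).mp (intervalIntegrable_of_cont ?_ P.end_mem)
    exact (h.continuousOn_density hl.cont).neg.mul
      ((H1.continuous_ctrl P.T_pos u').sub (H1.continuous_ctrl P.T_pos u)).continuousOn
  have i3 := h.integrable_norm_dens_sub_sq hM
  have i4 := h'.integrable_norm_dens_sub_sq hM
  simp only [costRem_eq]
  obtain ⟨i5, e5⟩ := integral_sub_sub (P.β / 2) i3 i4 i1 i2
  refine ⟨i5, ?_⟩
  have e2 := re_inner_expand (inner_mulOp (isBdd_final hA)) (fn (ψ P.T)) (fn (ψ' P.T))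
  have e3 : ‖u'‖ ^ 2 = ‖u‖ ^ 2 + 2 * inner ℝ u (u' - u) + ‖u' - u‖ ^ 2 := by
    rw [← norm_add_sq_real, add_sub_cancel]
  rw [e5, h.reducedCost_eq hΩ hA hM hb, h'.reducedCost_eq hΩ hA hM hb', e3]
  rw [hlT] at e1
  rw [e2, e1]
  ring

end Problem

open Filter Topology H10

/-- Dominated convergence for difference quotients. -/
lemma tendsto_inv_mul_integral {α : Type*} [MeasurableSpace α] {μ : Measure α} {F : ℕ → α → ℝ}
    {ε : ℕ → ℝ} {D : α → ℝ} (hF : ∀ k, Integrable (F k) μ) (hD : Integrable D μ)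
    (hε : ∀ k, 0 ≤ ε k) (h : ∀ᵐ x ∂μ, ∃ δ : ℕ → ℝ, Tendsto δ atTop (𝓝 0) ∧
      ∀ k, 0 ≤ δ k ∧ δ k ≤ D x ∧ |F k x| ≤ δ k * ε k) :
    Tendsto (fun k => (ε k)⁻¹ * ∫ x, F k x ∂μ) atTop (𝓝 0) := by
  have key : ∀ᵐ x ∂μ, ∃ δ : ℕ → ℝ, Tendsto δ atTop (𝓝 0) ∧
      ∀ k, δ k ≤ D x ∧ ‖(ε k)⁻¹ * F k x‖ ≤ δ k := by
    filter_upwards [h] with x ⟨δ, h0, h1⟩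
    refine ⟨δ, h0, fun k => ⟨(h1 k).2.1, ?_⟩⟩
    rw [norm_mul, norm_inv, norm_of_nonneg (hε k), norm_eq_abs]
    rcases (hε k).eq_or_lt with h2 | h2
    · rw [← h2, inv_zero, zero_mul]; exact (h1 k).1
    · rw [inv_mul_le_iff₀ h2, mul_comm]; exact (h1 k).2.2
  simp only [← integral_const_mul]
  have h2 := tendsto_integral_of_dominated_convergence (μ := μ) (f := fun _ => (0 : ℝ)) D
    (fun k => ((hF k).const_mul (ε k)⁻¹).aestronglyMeasurable) hD
    (fun k => key.mono fun x ⟨δ, _, h1⟩ => (h1 k).2.trans (h1 k).1)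
    (key.mono fun x ⟨δ, h0, h1⟩ => squeeze_zero_norm (fun k => (h1 k).2) h0)
  simpa using h2

namespace Problem

variable {hn : 2 ≤ n} {hL : P.XcBound L}

lemma exists_costRem_le (hM : 0 < M) {q : ℕ → H10 P.Ω N} {p : H10 P.Ω N}
    (hqM : ∀ k, ‖q k‖ ≤ M) (hpM : ‖p‖ ≤ M)
    (hqb : P.β ≠ 0 → ∀ k, ∀ᵐ x ∂vol P.Ω, ‖fn (q k) x‖ ≤ M)
    (hpb : P.β ≠ 0 → ∀ᵐ x ∂vol P.Ω, ‖fn p x‖ ≤ M)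
    (hq : Tendsto (fun k => fn (q k)) atTop (𝓝 (fn p))) (l : L2 P.Ω N)
    (r : Lp ℝ 2 (vol P.Ω)) : ∃ δ : ℕ → ℝ, Tendsto δ atTop (𝓝 0) ∧
      (∀ k, 0 ≤ δ k ∧ δ k ≤ |P.β| * (2 * M * ‖r‖) + remConst n L M * ‖l‖) ∧
      ∀ k a, |costRem hn hL hM p (q k) l r a| ≤ (|P.β| * (3 * M ^ 2) * ‖fn (q k) - fn p‖ + δ k
        + |a| * (‖P.Vu‖ * ‖l‖)) * ‖fn (q k) - fn p‖ := by
  obtain ⟨δ₁, h0, h1, h2⟩ : ∃ δ : ℕ → ℝ, Tendsto δ atTop (𝓝 0) ∧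
      (∀ k, 0 ≤ δ k ∧ δ k ≤ 2 * M * ‖r‖) ∧ ∀ k, |P.β * (1 / 2 * (‖dens hM (fn (q k)) - r‖ ^ 2
        - ‖dens hM (fn p) - r‖ ^ 2) - 2 * (inner ℂ (src hM (fn p) r) (fn (q k) - fn p)).re)|
        ≤ |P.β| * ((3 * M ^ 2 * ‖fn (q k) - fn p‖ + δ k) * ‖fn (q k) - fn p‖) := by
    by_cases hβ : P.β = 0
    · exact ⟨fun _ => 0, tendsto_const_nhds, fun k => ⟨le_rfl, by positivity⟩, by simp [hβ]⟩
    · obtain ⟨δ, h0, h1, h2⟩ := exists_tracking_le hM (hqb hβ) (hpb hβ) hq r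
      refine ⟨δ, h0, h1, fun k => ?_⟩
      rw [abs_mul]
      exact mul_le_left (h2 k)
  obtain ⟨δ₂, h3, h4, h5⟩ := exists_nonlinRem_le hn hL hM hqM hpM hq l
  refine ⟨fun k => |P.β| * δ₁ k + δ₂ k, by simpa using (h0.const_mul |P.β|).add h3,
    fun k => ⟨add_nonneg (mul_nonneg (abs_nonneg _) (h1 k).1) (h4 k).1,
      add_le_add (mul_le_left (h1 k).2) (h4 k).2⟩, fun k a => ?_⟩
  have h6 : |a * (inner ℂ l (P.U1 (fn (q k) - fn p))).re|
      ≤ |a| * (‖l‖ * (‖P.Vu‖ * ‖fn (q k) - fn p‖)) := by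
    rw [abs_mul]
    exact mul_le_left ((Complex.abs_re_le_norm _).trans ((norm_inner_le_norm _ _).trans
      (mul_le_left (norm_U1_apply_le _))))
  rw [costRem]
  refine (abs_sub _ _).trans ((add_le_add ((abs_sub _ _).trans
    (add_le_add (h2 k) (h5 k))) h6).trans_eq ?_)
  ring

/-- The expansion of the reduced cost is uniform along convergent sequences of controls. -/
lemma tendsto_reducedCost (hΩ : IsOpen P.Ω) (hA : MeasurableSet P.A) (hM : 0 < M) {u : H1 P.T}
    {ψ : ℝ → H10 P.Ω N} (h : IsTraj hn hL M u ψ)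
    (hb : P.β ≠ 0 → ∀ t ∈ Icc 0 P.T, ∀ᵐ x ∂vol P.Ω, ‖fn (ψ t) x‖ ≤ M)
    {U : ℕ → H1 P.T} (hU : Tendsto U atTop (𝓝 u)) {r : ℝ} (hr : ∀ k, ‖U k‖ ≤ r) (hur : ‖u‖ ≤ r)
    {ψ' : ℕ → ℝ → H10 P.Ω N} (h' : ∀ k, IsTraj hn hL M (U k) (ψ' k))
    (hb' : ∀ k, P.β ≠ 0 → ∀ t ∈ Icc 0 P.T, ∀ᵐ x ∂vol P.Ω, ‖fn (ψ' k t) x‖ ≤ M)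
    {l : ℝ → L2 P.Ω N} (hl : IsMild (ι P.Ω N) P.T l fun s => adjRhs hn hL hM u ψ s (l s))
    (hlT : I • l P.T = mulOp N (isBdd_final hA) (fn (ψ P.T))) :
    Tendsto (fun k => ‖U k - u‖⁻¹ * (P.reducedCost (U k) - P.reducedCost u
      - (P.ν * inner ℝ u (U k - u) + ∫ t in Ioo 0 P.T, -(inner ℂ (l t) (P.U1 (fn (ψ t)))).re
            * (H1.ctrl P.T_pos (U k) t - H1.ctrl P.T_pos u t)))) atTop (𝓝 0) := by
  have hS := supConst_nonneg P.T
  obtain ⟨K, hK0, hK⟩ : ∃ K, 0 ≤ K ∧ ∀ k, ∀ t ∈ Icc 0 P.T,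
      ‖fn (ψ' k t) - fn (ψ t)‖ ≤ K * ‖U k - u‖ := by
    refine ⟨_, ?_, fun k t ht => h.norm_sub_le hΩ (h' k) (mul_le_left (hr k) hS) ht⟩
    have := P.T_pos
    positivity
  obtain ⟨B, hB⟩ := isCompact_Icc.exists_bound_of_continuousOn hl.cont
  obtain ⟨ε, hε⟩ : ∃ ε : ℕ → ℝ, ∀ k, ε k = ‖U k - u‖ := ⟨_, fun _ => rfl⟩
  have hε0 : ∀ k, 0 ≤ ε k := fun k => (hε k).symm ▸ norm_nonneg _
  have hεr : ∀ k, ε k ≤ 2 * r := fun k => by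
    rw [hε]; exact (norm_sub_le _ _).trans (by linarith [hr k])
  have hεt : Tendsto ε atTop (𝓝 0) := by
    rw [funext hε]; exact tendsto_iff_norm_sub_tendsto_zero.mp hU
  have hsub := fun k => h.reducedCost_sub hΩ hA hM hb (h' k) (hb' k) hl hlT
  have hB0 : 0 ≤ B := (norm_nonneg _).trans (hB 0 P.zero_mem)
  have hrc : 0 ≤ remConst n L M := by
    have := hL.nonneg
    unfold remConst; positivity
  have hVB : 0 ≤ ‖P.Vu‖ * B := mul_nonneg (norm_nonneg _) hB0
  -- the integrated remainder, with a majorant that is integrable in time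
  have hint := tendsto_inv_mul_integral (fun k => (hsub k).1)
    (D := fun t => (|P.β| * (3 * M ^ 2) * (K * (2 * r)) + (|P.β| * (2 * M * ‖P.ρd t‖)
      + remConst n L M * B) + supConst P.T * (2 * r) * (‖P.Vu‖ * B)) * K) (by
      have h1 := ((Lp.memLp P.ρd).integrable (by norm_num)).norm
      exact ((((integrable_const _).add (((h1.const_mul _).const_mul _).add
        (integrable_const _))).add (integrable_const _)).mul_const _)) hε0 (by
      filter_upwards [ae_restrict_mem measurableSet_Ioo] with t ht
      replace ht := Ioo_subset_Icc_self ht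
      have hq : Tendsto (fun k => fn (ψ' k t)) atTop (𝓝 (fn (ψ t))) := by
        rw [tendsto_iff_norm_sub_tendsto_zero]
        refine squeeze_zero (fun _ => norm_nonneg _) (fun k => hK k t ht) ?_
        simp only [← hε]
        simpa using hεt.const_mul K
      obtain ⟨δ, h0, h1, h2⟩ := exists_costRem_le (hn := hn) (hL := hL) hM
        (fun k => (h' k).bound t ht) (h.bound t ht) (fun hβ k => hb' k hβ t ht)
        (fun hβ => hb hβ t ht) hq (l t) (P.ρd t)
      have hlB := hB t ht
      refine ⟨fun k => (|P.β| * (3 * M ^ 2) * (K * ε k) + δ k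
        + supConst P.T * ε k * (‖P.Vu‖ * B)) * K, ?_, fun k => ⟨?_, ?_, ?_⟩⟩
      · simpa using ((((hεt.const_mul K).const_mul (|P.β| * (3 * M ^ 2))).add h0).add
          ((hεt.const_mul (supConst P.T)).mul_const (‖P.Vu‖ * B))).mul_const K
      · have := hε0 k
        have := (h1 k).1
        positivity
      · have h3 := (h1 k).2
        have h4 := mul_le_left hlB hrc
        refine mul_le_right (add_le_add_three ?_ (by linarith) ?_) hK0
        · exact mul_le_left (mul_le_left (hεr k) hK0)
        · exact mul_le_right (mul_le_left (hεr k) hS) hVB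
      · have h3 := hK k t ht
        have h4 := H1.abs_ctrl_sub_le P.T_pos (U k) u ht
        rw [← hε] at h3 h4
        refine (h2 k _).trans ?_
        rw [mul_assoc _ K]
        have h5 := hε0 k
        have h6 := (h1 k).1
        refine mul_le_mul (add_le_add_three (mul_le_left h3) le_rfl
          (mul_le_mul h4 (mul_le_left hlB) (by positivity)
            (by positivity))) h3 (norm_nonneg _) (by positivity))
  -- the terms that are quadratic in the increment
  have hquad : Tendsto (fun k => ‖U k - u‖⁻¹ * (1 / 2 * (inner ℂ (fn (ψ' k P.T) - fn (ψ P.T))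
      (mulOp N (isBdd_final hA) (fn (ψ' k P.T) - fn (ψ P.T)))).re + P.ν / 2 * ‖U k - u‖ ^ 2))
      atTop (𝓝 0) := by
    refine squeeze_zero_norm (a := fun k => (1 / 2 * (K * (|P.η| * K)) + |P.ν| / 2) * ε k)
      (fun k => ?_) (by simpa using hεt.const_mul (1 / 2 * (K * (|P.η| * K)) + |P.ν| / 2))
    have h3 := hK k P.T P.end_mem
    have h4 := norm_mulOp_apply_le (isBdd_final hA) (fn (ψ' k P.T) - fn (ψ P.T))
    have h5 := (Complex.abs_re_le_norm _).trans (norm_inner_le_norm (𝕜 := ℂ)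
      (fn (ψ' k P.T) - fn (ψ P.T)) (mulOp N (isBdd_final hA) (fn (ψ' k P.T) - fn (ψ P.T))))
    rw [← hε] at h3 ⊢
    have h6 := hε0 k
    have h7 := h5.trans (mul_le_mul h3 (h4.trans (mul_le_left h3)) (norm_nonneg _) (by positivity))
    rw [norm_mul, norm_inv, norm_of_nonneg h6, norm_eq_abs]
    have h8 : |1 / 2 * (inner ℂ (fn (ψ' k P.T) - fn (ψ P.T))
        (mulOp N (isBdd_final hA) (fn (ψ' k P.T) - fn (ψ P.T)))).re + P.ν / 2 * ε k ^ 2|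
        ≤ ((1 / 2 * (K * (|P.η| * K)) + |P.ν| / 2) * ε k) * ε k := by
      refine (abs_add_le _ _).trans ?_
      simp only [abs_mul, abs_div, abs_of_nonneg (sq_nonneg (ε k)), abs_two, abs_one]
      linarith
    rcases h6.eq_or_lt with h9 | h9
    · rw [← h9]; simp
    · rw [inv_mul_le_iff₀ h9]; exact h8.trans_eq (mul_comm _ _)
  simp only [hε] at hint
  have := hint.add hquad
  simp only [← mul_add, add_zero] at this
  refine this.congr fun k => ?_
  rw [(hsub k).2, add_assoc]

end Problem

open Filter Topology H10

/-- Square integrable densities define continuous functionals on the controls. -/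
lemma H1.exists_dual {T : ℝ} {g : ℝ → ℝ} (hg : MemLp g 2 (timeMeasure T)) :
    ∃ ℓ : StrongDual ℝ (H1 T), ∀ δu : H1 T, ℓ δu = ∫ t in Ioo 0 T, g t * H1.ev δu t := by
  refine ⟨(innerSL ℝ (hg.toLp g)) ∘L (WithLp.fstL 2 ℝ _ _) ∘L (H1 T).subtypeL, fun δu => ?_⟩
  change inner ℝ (hg.toLp g) (δu : TimePair T).fst = _
  rw [L2.inner_def]
  refine integral_congr_ae ?_
  filter_upwards [hg.coeFn_toLp] with t ht
  rw [ht, H1.ev]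
  simp [mul_comm]

namespace Problem

variable {hn : 2 ≤ n} {hL : P.XcBound L} {u : H1 P.T}
  {ψ : ℝ → H10 P.Ω N} {Ψ : X P.Ω N P.T}

lemma gradDensity_ae_eq (hΨ : ∀ᵐ t ∂timeMeasure P.T, Ψ t = ψ t)
    (Λ : C(Icc (0 : ℝ) P.T, L2 P.Ω N)) : P.gradDensity Ψ Λ =ᵐ[timeMeasure P.T]
      fun t => -(inner ℂ (P.extend Λ t) (P.U1 (fn (ψ t)))).re := by
  filter_upwards [hΨ] with t ht
  rw [gradDensity, ht, inner_re_symm', pairing, re_inner_L2, neg_inj]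
  rw [← re_inner_L2, L2.inner_def]
  congr 1
  refine integral_congr_ae ?_
  filter_upwards [coeFn_mulOp (isBdd_Lp P.Vu) (fn (ψ t))] with x hx
  rw [U1, hx]

lemma memLp_gradDensity (h : IsTraj hn hL M u ψ) (hΨ : ∀ᵐ t ∂timeMeasure P.T, Ψ t = ψ t)
    (Λ : C(Icc (0 : ℝ) P.T, L2 P.Ω N)) : MemLp (P.gradDensity Ψ Λ) 2 (timeMeasure P.T) := by
  have hc := (h.continuousOn_density (continuous_extend Λ).continuousOn).neg
  obtain ⟨C, hC⟩ := isCompact_Icc.exists_bound_of_continuousOn hc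
  refine (memLp_congr_ae (gradDensity_ae_eq hΨ Λ)).mpr (MemLp.of_bound
    ((hc.mono Ioo_subset_Icc_self).aestronglyMeasurable measurableSet_Ioo) C ?_)
  filter_upwards [ae_restrict_mem measurableSet_Ioo] with t ht
  exact hC t (Ioo_subset_Icc_self ht)

lemma hasGradientAt_reducedCost (hn : 2 ≤ n) (hn3 : n = 2 ∨ n = 3) (hΩ : IsOpen P.Ω)
    (hb : Bornology.IsBounded P.Ω) (hL : P.XcBound L) (hΨ0 : P.β ≠ 0 → MemH2 P.Ψ0)
    (hA : MeasurableSet P.A) (hΨ : P.IsState u Ψ) {Λ : C(Icc (0 : ℝ) P.T, L2 P.Ω N)}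
    (hΛ : P.IsAdjoint u Ψ Λ) {ℓ : StrongDual ℝ (H1 P.T)}
    (hℓ : ∀ δu : H1 P.T, ℓ δu = ∫ t in Ioo 0 P.T, P.gradDensity Ψ Λ t * H1.ev δu t) :
    HasGradientAt P.reducedCost (P.ν • u + (InnerProductSpace.toDual ℝ (H1 P.T)).symm ℓ) u := by
  rw [hasGradientAt_iff_tendsto]
  refine tendsto_of_seq_tendsto fun U hU => ?_
  obtain ⟨r, hr⟩ := hU.norm.bddAbove_range
  obtain ⟨M, hM, hex⟩ := exists_isTraj (hn := hn) hn3 hΩ hb hL hΨ0 (max r ‖u‖)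
  obtain ⟨ψ, h, hψb⟩ := hex u (le_max_right _ _)
  have hUr : ∀ k, ‖U k‖ ≤ max r ‖u‖ := fun k => (hr (mem_range_self k)).trans (le_max_left _ _)
  choose ψ' h' hb' using fun k => hex (U k) (hUr k)
  have hΨψ := hΨ.ae_eq hΩ h
  obtain ⟨hT, hl⟩ := (isAdjoint_iff hΩ hA hM h hψb hΨψ Λ).mp hΛ
  have htr : timeTrace Ψ P.T = fn (ψ P.T) :=
    HasTimeTrace.timeTrace_eq P.T_pos h.continuousOn (hΨψ.mono fun t ht => by rw [ht]) P.end_mem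
  have hlT : I • P.extend Λ P.T = mulOp N (isBdd_final hA) (fn (ψ P.T)) := by
    rw [hT, htr, smul_smul, mul_neg, Complex.I_mul_I, neg_neg, one_smul]
  have key := (tendsto_reducedCost hΩ hA hM h hψb hU hUr (le_max_right _ _) h' hb' hl hlT).norm
  rw [norm_zero] at key
  refine key.congr fun k => ?_
  have h1 : inner ℝ (P.ν • u + (InnerProductSpace.toDual ℝ (H1 P.T)).symm ℓ) (U k - u)
      = P.ν * inner ℝ u (U k - u) + ∫ t in Ioo 0 P.T, -(inner ℂ (P.extend Λ t) (P.U1 (fn (ψ t)))).re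
            * (H1.ctrl P.T_pos (U k) t - H1.ctrl P.T_pos u t) := by
    have h0 : inner ℝ (P.ν • u) (U k - u) = P.ν * inner ℝ u (U k - u) := by
      have h2 := real_inner_smul_left (F := H1 P.T) u (U k - u) P.ν
      exact h2
    rw [inner_add_left, h0, InnerProductSpace.toDual_symm_apply, hℓ]
    congr 1
    refine integral_congr_ae ?_
    filter_upwards [gradDensity_ae_eq hΨψ Λ, H1.ev_sub (U k) u, H1.ev_ae_eq P.T_pos (U k),
      H1.ev_ae_eq P.T_pos u] with t h2 h3 h4 h5
    rw [h2, h3, h4, h5]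
  rw [Function.comp_apply, h1, norm_mul, norm_inv, norm_norm]

end Problem

end

end TDKS

theorem mainTheorem2 {n N : ℕ} (hn : n = 2 ∨ n = 3) (P : TDKS.Problem n N)
    (hopen : IsOpen P.Ω) (hbdd : Bornology.IsBounded P.Ω)
    (hR : 0 < P.R) (hVc : P.CorrelationAssumption)
    (hA : MeasurableSet P.A)
    (hβ : 0 ≤ P.β) (hη : 0 ≤ P.η) (hβη : 0 < P.β + P.η) (hν : 0 < P.ν)
    (hΨ0 : P.β ≠ 0 → TDKS.H10.MemH2 P.Ψ0) :
    (∀ u : TDKS.H1 P.T, ∃! Ψ : TDKS.X P.Ω N P.T, P.IsState u Ψ) ∧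
    ∀ (u : TDKS.H1 P.T) (Ψ : TDKS.X P.Ω N P.T), P.IsState u Ψ →
      (∃! Λ : C(Set.Icc (0 : ℝ) P.T, TDKS.L2 P.Ω N), P.IsAdjoint u Ψ Λ) ∧
      ∀ Λ : C(Set.Icc (0 : ℝ) P.T, TDKS.L2 P.Ω N), P.IsAdjoint u Ψ Λ →
        (∀ Λ' : TDKS.X P.Ω N P.T, P.IsAdjointW u Ψ Λ' →
          ∀ᵐ t ∂(TDKS.timeMeasure P.T), TDKS.H10.fn (Λ' t) = P.extend Λ t) ∧
        MeasureTheory.MemLp (P.gradDensity Ψ Λ) 2 (TDKS.timeMeasure P.T) ∧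
        ∃ ℓ : StrongDual ℝ (TDKS.H1 P.T),
          (∀ δu : TDKS.H1 P.T,
            ℓ δu = ∫ t in Set.Ioo 0 P.T, P.gradDensity Ψ Λ t * TDKS.H1.ev δu t) ∧
          HasGradientAt P.reducedCost
            (P.ν • u + (InnerProductSpace.toDual ℝ (TDKS.H1 P.T)).symm ℓ) u := by
  have hn2 : 2 ≤ n := by omega
  obtain ⟨L, hL⟩ := P.exists_xcBound (by omega) hR hVc
  have hex : ∀ u : TDKS.H1 P.T, ∃ M, 0 < M ∧ ∃ ψ, TDKS.Problem.IsTraj hn2 hL M u ψ ∧ (P.β ≠ 0 →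
      ∀ t ∈ Set.Icc 0 P.T, ∀ᵐ x ∂(MeasureTheory.volume.restrict P.Ω),
        ‖TDKS.H10.fn (ψ t) x‖ ≤ M) := fun u => by
    obtain ⟨M, hM, hex⟩ :=
      TDKS.Problem.exists_isTraj (hn := hn2) hn hopen hbdd hL hΨ0 ‖u‖
    exact ⟨M, hM, hex u le_rfl⟩
  refine ⟨fun u => ?_, fun u Ψ hΨ => ?_⟩
  · obtain ⟨M, hM, ψ, h, -⟩ := hex u
    obtain ⟨Ψ, hΨ, -⟩ := h.exists_isState hopen
    refine ⟨Ψ, hΨ, fun Ψ' hΨ' => MeasureTheory.Lp.ext ?_⟩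
    filter_upwards [hΨ.ae_eq hopen h, hΨ'.ae_eq hopen h] with t h1 h2
    rw [h1, h2]
  · obtain ⟨M, hM, ψ, h, hb⟩ := hex u
    have hΨψ := hΨ.ae_eq hopen h
    refine ⟨TDKS.Problem.exists_unique_isAdjoint hopen hA hM h hb hΨψ, fun Λ hΛ => ?_⟩
    have hg := TDKS.Problem.memLp_gradDensity h hΨψ Λ
    obtain ⟨ℓ, hℓ⟩ := TDKS.H1.exists_dual hg
    exact ⟨fun Λ' hΛ' => hΛ.ae_eq_of_isAdjointW hopen hA hM h hb hΨψ hΛ', hg, ℓ, hℓ,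
      TDKS.Problem.hasGradientAt_reducedCost hn2 hn hopen hbdd hL hΨ0 hA hΨ hΛ hℓ⟩
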